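/- **Conventions.** Rings are associative and unital, $A$ is a ring, and $M\otimes_A N$ is formed from the right action on $M$ and the left action on $N$. A *left bialgebroid* $(U,A,s,t,\Delta,\varepsilon)$ consists of a ring $U$ with ring maps $s:A\to U$, $t:A^{op}\to U$ with commuting images and an $A$-coring structure $\Delta(u)=u_{(1)}\otimes_A u_{(2)}$, $\varepsilon$ on $U$ with the bimodule structure $a\triangleright u\triangleleft b=s(a)t(b)u$, such that $u_{(1)}t(a)\otimes_A u_{(2)}=u_{(1)}\otimes_A u_{(2)}s(a)$, $\Delta$ is unital and multiplicative, $\varepsilon(1)=1$ and $\varepsilon(uv)=\varepsilon(u\,s(\varepsilon(v)))=\varepsilon(u\,t(\varepsilon(v)))$. A *right bialgebroid* $V$ is a left bialgebroid structure on the opposite ring $V^{op}$, with source and target exchanged; its coproduct is $v\mapsto v^{(1)}\otimes_A v^{(2)}$, for the bimodule structure $a\blacktriangleright v\blacktriangleleft b=v\,t(a)s(b)$. We write $U_\triangleleft$ for $U$ with the right $A$-action $u\triangleleft a=t(a)u$. Left modules $M$ over $U$ (or $V$) are $A$-bimodules by $amb=s(a)t(b)m$, right modules by $amb=m\,t(a)s(b)$.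 A left $U$-comodule has a left $A$-linear coassociative counital coaction $m\mapsto m_{(-1)}\otimes m_{(0)}\in U_\triangleleft\otimes_A M$ and the induced right action $ma=\varepsilon(m_{(-1)}s(a))m_{(0)}$. A right $V$-comodule has a right $A$-linear coassociative counital coaction $m\mapsto m^{(0)}\otimes m^{(1)}\in M\otimes_A{}_\blacktriangleright V$ and the induced left action $am=m^{(0)}\partial(s(a)m^{(1)})$, where $\partial$ is the counit. These categories are monoidal over $A$-bimodules, with diagonal actions and codiagonal coactions. A *right $U$-contramodule* is a right $A$-module $M$ with an additive map $\gamma:\mathrm{Hom}_{A^{op}}(U_\triangleleft,M)\to M$ such that $\gamma(f(s(a)\,\cdot))=\gamma(f)a$, $\gamma(m\,\varepsilon(\cdot))=m$, and $\gamma(u\mapsto\gamma(v\mapsto g(u\otimes v)))=\gamma(u\mapsto g(u_{(1)}\otimes u_{(2)}))$ for all right $A$-linear $g$ on $U_\triangleleft\otimes_A{}_\triangleright U$, where $u\otimes v$ is multiplied from the right by $(u\otimes v)a=u\otimes t(a)v$. It carries the left action $am=\gamma(m\,\varepsilon(\cdot\,s(a)))$. A *(left-left) Yetter–Drinfel'd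 module* over $U$ is a left module and left comodule with the same underlying bimodule and $(u_{(1)}n)_{(-1)}u_{(2)}\otimes(u_{(1)}n)_{(0)}=u_{(1)}n_{(-1)}\otimes u_{(2)}n_{(0)}$; the braiding is $m\otimes n\mapsto m_{(-1)}n\otimes m_{(0)}$. A *(right-right) Yetter–Drinfel'd module* over $V$ is a right module and right comodule with the same underlying bimodule and $(mv^{(2)})^{(0)}\otimes v^{(1)}(mv^{(2)})^{(1)}=m^{(0)}v^{(1)}\otimes m^{(1)}v^{(2)}$; the braiding is $m\otimes n\mapsto n^{(0)}\otimes mn^{(1)}$. (These braidings need not be invertible.) $U$ is a *left Hopf algebroid* if $u\otimes v\mapsto u_{(1)}\otimes u_{(2)}v$, from $U\otimes_{A^{op}}U$ (with $u\,t(a)\otimes v=u\otimes t(a)v$) to $U_\triangleleft\otimes_A{}_\triangleright U$, is bijective; $u_+\otimes u_-$ denotes the preimage of $u\otimes1$. $V$ is a *right Hopf algebroid* if $v'\otimes v\mapsto v'v^{(1)}\otimes v^{(2)}$, from $V\otimes_{A^{op}}V$ (with $v'\,t(a)\otimes v=v'\otimes t(a)v$) to $V_\blacktriangleleft\otimes_A{}_\blacktriangleright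 V$, is bijective; $v^-\otimes v^+$ denotes the preimage of $1\otimes v$. An *anti Yetter–Drinfel'd (aYD) module* over a right Hopf algebroid $V$ is a left module and right comodule with the same underlying bimodule and $(vm)^{(0)}\otimes(vm)^{(1)}=v^{(1)+}m^{(0)}\otimes v^{(2)}m^{(1)}v^{(1)-}$; it is *stable* if $m^{(1)}m^{(0)}=m$. An *aYD contramodule* over a left Hopf algebroid $U$ is a left module and right contramodule with the same underlying bimodule and $u\,\gamma(f)=\gamma\big((u_{(2)}\rightharpoonup f)(\cdot\,u_{(1)})\big)$, where $(u\rightharpoonup f)(w)=u_+f(u_-w)$; it is *stable* if $\gamma(u\mapsto um)=m$. **Lemma 4.3.** Let $(U,A)$ be a left bialgebroid and let $U^*=\mathrm{Hom}_{A^{op}}(U_\triangleleft,A)$ be its dual, a ring by $\langle\phi\psi,u\rangle=\langle\psi,s(\langle\phi,u_{(1)}\rangle)u_{(2)}\rangle$, with source $a\mapsto\varepsilon(\cdot\,s(a))$ and target $a\mapsto a\,\varepsilon(\cdot)$. If $U_\triangleleft$ is finitely generated projective over $A$, it is a right bialgebroid, with coproduct determined by $\langle\phi,uv\rangle=\langle\phi^{(1)},u\,t(\langle\phi^{(2)},v\rangle)\rangle$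 and counit $\phi\mapsto\phi(1)$. All functors below are the identity on underlying bimodules and maps. 1. There is a functor $U\text{-}\mathbf{Comod}\to\mathbf{Mod}\text{-}U^*$, given by $m\phi=\langle\phi,m_{(-1)}\rangle m_{(0)}$. If $U_\triangleleft$ is finitely generated projective, it is a strict monoidal equivalence. 2. If $U_\triangleleft$ is finitely generated projective, there is a strict monoidal equivalence $\mathbf{Comod}\text{-}U^*\to U\text{-}\mathbf{Mod}$, given by $um=m^{(0)}\langle m^{(1)},u\rangle$. 3. If $U_\triangleleft$ is finitely generated projective, there is a braided strict monoidal equivalence from the Yetter–Drinfel'd modules over $U^*$ to those over $U$, under which actions and coactions correspond as in (1) and (2). 4. There is a functor $\mathbf{Contramod}\text{-}U\to U^*\text{-}\mathbf{Mod}$, given by $\phi\cdot m=\gamma(m\langle\phi,\cdot\rangle)$. If $U_\triangleleft$ is finitely generated projective, it is an equivalence. 5. Let $U$ be a left Hopf algebroid with $U_\triangleleft$ finitely generated projective. Then $U^*$ is a right Hopf algebroid. If on an $A$-bimodule a left $U^*$-module and a right $U^*$-comodule structure correspond to a right $U$-contramodule and a left $U$-module structure as in (4) and (2), then the former pair satisfies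 the aYD module condition if and only if the latter pair satisfies the aYD contramodule condition, and the former pair is stable if and only if the latter is. Consequently there is an equivalence, with actions, coactions and contraactions corresponding in this way, from the category of aYD modules over $U^*$ to that of aYD contramodules over $U$, and it restricts to an equivalence between the full subcategories of stable objects. -/

import Mathlib

open CategoryTheory MonoidalCategory MulOpposite
open scoped TensorProduct

universe u

/-! ## Tensor products over a noncommutative ring -/

section Bal

/-- A biadditive map from a function that is additive in each variable. -/
def biHom {M N P : Type*} [AddCommGroup M] [AddCommGroup N] [AddCommGroup P] (f : M → N → P)
    (h₁ : ∀ m n n', f m (n + n') = f m n + f m n') (h₂ : ∀ m m' n, f (m + m') n = f m n + f m' n) :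
    M →+ N →+ P :=
  AddMonoidHom.mk' (fun m => AddMonoidHom.mk' (f m) (h₁ m)) (fun m m' => by ext n; exact h₂ m m' n)

@[simp] lemma biHom_apply {M N P : Type*} [AddCommGroup M] [AddCommGroup N] [AddCommGroup P]
    (f : M → N → P) (h₁ : ∀ m n n', f m (n + n') = f m n + f m n')
    (h₂ : ∀ m m' n, f (m + m') n = f m n + f m' n) (m : M) (n : N) : biHom f h₁ h₂ m n = f m n :=
  rfl

variable {ι : Type*} {M N P M' N' M'' N'' : Type*}
  [AddCommGroup M] [AddCommGroup N] [AddCommGroup P] [AddCommGroup M'] [AddCommGroup N']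
  [AddCommGroup M''] [AddCommGroup N'']

/-- The subgroup of `M ⊗[ℤ] N` generated by all `r a m ⊗ n - m ⊗ l a n`. -/
def balRel (r : ι → AddMonoid.End M) (l : ι → AddMonoid.End N) : AddSubgroup (M ⊗[ℤ] N) :=
  AddSubgroup.closure {x | ∃ a m n, x = r a m ⊗ₜ[ℤ] n - m ⊗ₜ[ℤ] l a n}

/-- The balanced tensor product of `M` and `N`: the quotient of `M ⊗[ℤ] N` in which
`r a m ⊗ n = m ⊗ l a n` for all `a`. -/
def Bal (r : ι → AddMonoid.End M) (l : ι → AddMonoid.End N) : Type _ :=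
  (M ⊗[ℤ] N) ⧸ balRel r l

variable {r : ι → AddMonoid.End M} {l : ι → AddMonoid.End N}
  {r' : ι → AddMonoid.End M'} {l' : ι → AddMonoid.End N'}
  {r'' : ι → AddMonoid.End M''} {l'' : ι → AddMonoid.End N''}

namespace Bal

instance : AddCommGroup (Bal r l) := inferInstanceAs (AddCommGroup ((M ⊗[ℤ] N) ⧸ balRel r l))

/-- The class of a formal tensor in the balanced tensor product. -/
def mk : M ⊗[ℤ] N →+ Bal r l := QuotientAddGroup.mk' (balRel r l)

lemma mk_surjective : Function.Surjective (mk : M ⊗[ℤ] N →+ Bal r l) :=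
  QuotientAddGroup.mk'_surjective _

/-- The class of `m ⊗ n`. -/
def tmul (m : M) (n : N) : Bal r l := mk (m ⊗ₜ[ℤ] n)

@[simp] lemma mk_tmul (m : M) (n : N) : (mk (m ⊗ₜ[ℤ] n) : Bal r l) = tmul m n := rfl

lemma tmul_add (m : M) (n n' : N) : (tmul m (n + n') : Bal r l) = tmul m n + tmul m n' := by
  rw [tmul, TensorProduct.tmul_add, map_add]; rfl

lemma add_tmul (m m' : M) (n : N) : (tmul (m + m') n : Bal r l) = tmul m n + tmul m' n := by
  rw [tmul, TensorProduct.add_tmul, map_add]; rfl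

lemma bal (a : ι) (m : M) (n : N) : (tmul (r a m) n : Bal r l) = tmul m (l a n) := by
  have h : (mk (r a m ⊗ₜ[ℤ] n - m ⊗ₜ[ℤ] l a n) : Bal r l) = 0 :=
    (QuotientAddGroup.eq_zero_iff _).2 (AddSubgroup.subset_closure ⟨a, m, n, rfl⟩)
  rw [map_sub, sub_eq_zero] at h
  exact h

/-- `m ⊗ n` as a biadditive map. -/
def tmulHom : M →+ N →+ Bal r l :=
  biHom tmul tmul_add add_tmul

@[simp] lemma tmulHom_apply (m : M) (n : N) : (tmulHom m n : Bal r l) = tmul m n := rfl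

@[simp] lemma tmul_zero (m : M) : (tmul m 0 : Bal r l) = 0 := (tmulHom m).map_zero

@[simp] lemma zero_tmul (n : N) : (tmul 0 n : Bal r l) = 0 := (tmulHom.flip n).map_zero

lemma tmul_sum {κ : Type*} (s : Finset κ) (m : M) (f : κ → N) :
    (tmul m (∑ i ∈ s, f i) : Bal r l) = ∑ i ∈ s, tmul m (f i) := map_sum (tmulHom m) f s

lemma sum_tmul {κ : Type*} (s : Finset κ) (f : κ → M) (n : N) :
    (tmul (∑ i ∈ s, f i) n : Bal r l) = ∑ i ∈ s, tmul (f i) n := map_sum (tmulHom.flip n) f s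

/-- The biadditive map `f`, as a map on formal tensors. -/
def fLift (f : M →+ N →+ P) : M ⊗[ℤ] N →+ P :=
  TensorProduct.liftAddHom f (fun z m n => by simp)

@[simp] lemma fLift_tmul (f : M →+ N →+ P) (m : M) (n : N) : fLift f (m ⊗ₜ[ℤ] n) = f m n := rfl

/-- The universal property: balanced biadditive maps factor over the balanced tensor product. -/
def lift (f : M →+ N →+ P) (hf : ∀ a m n, f (r a m) n = f m (l a n)) : Bal r l →+ P :=
  QuotientAddGroup.lift (balRel r l) (fLift f) (by
    rw [balRel, AddSubgroup.closure_le]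
    rintro _ ⟨a, m, n, rfl⟩
    simp [hf])

@[simp] lemma lift_tmul (f : M →+ N →+ P) (hf : ∀ a m n, f (r a m) n = f m (l a n)) (m : M)
    (n : N) : lift f hf (tmul m n) = f m n := rfl

lemma lift_mk (f : M →+ N →+ P) (hf : ∀ a m n, f (r a m) n = f m (l a n)) (x : M ⊗[ℤ] N) :
    lift f hf (mk x) = fLift f x := rfl

@[elab_as_elim]
lemma induction {p : Bal r l → Prop} (x : Bal r l) (h0 : p 0) (ht : ∀ m n, p (tmul m n))
    (ha : ∀ x y, p x → p y → p (x + y)) : p x := by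
  obtain ⟨x, rfl⟩ := mk_surjective x
  induction x with
  | zero => simpa using h0
  | tmul m n => exact ht m n
  | add x y hx hy => simpa using ha _ _ hx hy

lemma hom_ext {f g : Bal r l →+ P} (h : ∀ m n, f (tmul m n) = g (tmul m n)) : f = g := by
  ext x
  induction x using Bal.induction with
  | h0 => simp
  | ht m n => exact h m n
  | ha x y hx hy => simp [hx, hy]

lemma hom_eq {f g : Bal r l →+ P} (h : ∀ m n, f (tmul m n) = g (tmul m n)) (x : Bal r l) :
    f x = g x := DFunLike.congr_fun (hom_ext h) x

/-- Functoriality of the balanced tensor product: `m ⊗ n ↦ f m ⊗ g n`. -/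
def map (f : M →+ M') (g : N →+ N') (hf : ∀ a m, f (r a m) = r' a (f m))
    (hg : ∀ a n, g (l a n) = l' a (g n)) : Bal r l →+ Bal r' l' :=
  lift (biHom (fun m n => tmul (f m) (g n)) (fun m n n' => by simp [tmul_add])
    (fun m m' n => by simp [add_tmul])) (fun a m n => by simp [hf, hg, bal])

@[simp] lemma map_tmul (f : M →+ M') (g : N →+ N') (hf : ∀ a m, f (r a m) = r' a (f m))
    (hg : ∀ a n, g (l a n) = l' a (g n)) (m : M) (n : N) :
    (map f g hf hg : Bal r l →+ Bal r' l') (tmul m n) = tmul (f m) (g n) := rfl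

end Bal

end Bal

/-! ## The monoidal category of bimodules -/

/-- The tensor product over `A` of a right module (`r`) and a left module (`l`). -/
abbrev Tens {A M N : Type*} [Ring A] [AddCommGroup M] [AddCommGroup N]
    (r : Aᵐᵒᵖ →+* AddMonoid.End M) (l : A →+* AddMonoid.End N) : Type _ :=
  Bal (fun a : A => r (op a)) (fun a : A => l a)

lemma tens_bal {A M N : Type*} [Ring A] [AddCommGroup M] [AddCommGroup N]
    {r : Aᵐᵒᵖ →+* AddMonoid.End M} {l : A →+* AddMonoid.End N} (a : A) (m : M) (n : N) :
    (Bal.tmul (r (op a) m) n : Tens r l) = Bal.tmul m (l a n) :=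
  Bal.bal (r := fun a : A => r (op a)) (l := fun a : A => l a) a m n

/-- An `A`-bimodule: an additive group with commuting left and right actions of `A`. -/
structure Bim (A : Type u) [Ring A] where
  carrier : Type u
  [grp : AddCommGroup carrier]
  l : A →+* AddMonoid.End carrier
  r : Aᵐᵒᵖ →+* AddMonoid.End carrier
  comm : ∀ a b m, l a (r b m) = r b (l a m)

namespace Bim

variable {A : Type u} [Ring A]

instance : CoeSort (Bim A) (Type u) := ⟨carrier⟩

instance (M : Bim A) : AddCommGroup M := M.grp

/-- A morphism of bimodules. -/
@[ext] structure Hom (M N : Bim A) where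
  add : M →+ N
  map_l : ∀ a m, add (M.l a m) = N.l a (add m)
  map_r : ∀ a m, add (M.r a m) = N.r a (add m)

instance : Category (Bim A) where
  Hom := Hom
  id M := ⟨AddMonoidHom.id M, fun _ _ => rfl, fun _ _ => rfl⟩
  comp f g := ⟨g.add.comp f.add, fun a m => by simp [f.map_l, g.map_l],
    fun a m => by simp [f.map_r, g.map_r]⟩

@[simp] lemma id_add (M : Bim A) (m : M) : Hom.add (𝟙 M) m = m := rfl

@[simp] lemma comp_add {M N P : Bim A} (f : M ⟶ N) (g : N ⟶ P) (m : M) :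
    Hom.add (f ≫ g) m = g.add (f.add m) := rfl

lemma hom_l {M N : Bim A} (f : M ⟶ N) (a : A) (m : M) : f.add (M.l a m) = N.l a (f.add m) :=
  f.map_l a m

lemma hom_r {M N : Bim A} (f : M ⟶ N) (a : Aᵐᵒᵖ) (m : M) : f.add (M.r a m) = N.r a (f.add m) :=
  f.map_r a m

lemma hom_ext {M N : Bim A} {f g : M ⟶ N} (h : ∀ m, f.add m = g.add m) : f = g :=
  Hom.ext (AddMonoidHom.ext h)

lemma l_mul (M : Bim A) (a b : A) (m : M) : M.l (a * b) m = M.l a (M.l b m) := by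
  rw [map_mul]; rfl

lemma r_mul (M : Bim A) (a b : A) (m : M) : M.r (op (a * b)) m = M.r (op b) (M.r (op a) m) := by
  rw [op_mul, map_mul]; rfl

lemma l_one (M : Bim A) (m : M) : M.l 1 m = m := by rw [map_one]; rfl

lemma r_one (M : Bim A) (m : M) : M.r 1 m = m := by rw [map_one]; rfl

lemma l_add (M : Bim A) (a b : A) (m : M) : M.l (a + b) m = M.l a m + M.l b m := by
  rw [map_add]; rfl

lemma r_add (M : Bim A) (a b : Aᵐᵒᵖ) (m : M) : M.r (a + b) m = M.r a m + M.r b m := by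
  rw [map_add]; rfl

lemma r_mul' (M : Bim A) (a b : Aᵐᵒᵖ) (m : M) : M.r (a * b) m = M.r a (M.r b m) := by
  rw [map_mul]; rfl

/-- The left action on `M ⊗_A N`. -/
def tensL (M N : Bim A) : A →+* AddMonoid.End (Tens M.r N.l) :=
  RingHom.mk' ⟨⟨fun a => Bal.map (M.l a) (AddMonoidHom.id N) (fun b m => M.comm a (op b) m)
      (fun _ _ => rfl), Bal.hom_ext (fun m n => congrArg (Bal.tmul · n) (M.l_one m))⟩,
      fun a b => Bal.hom_ext (fun m n => congrArg (Bal.tmul · n) (M.l_mul a b m))⟩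
    (fun a b => Bal.hom_ext (fun m n =>
      (congrArg (Bal.tmul · n) (M.l_add a b m)).trans (Bal.add_tmul _ _ n)))

/-- The right action on `M ⊗_A N`. -/
def tensR (M N : Bim A) : Aᵐᵒᵖ →+* AddMonoid.End (Tens M.r N.l) :=
  RingHom.mk' ⟨⟨fun a => Bal.map (AddMonoidHom.id M) (N.r a) (fun _ _ => rfl)
      (fun b n => (N.comm b a n).symm),
        Bal.hom_ext (fun m n => congrArg (Bal.tmul m) (N.r_one n))⟩,
      fun a b => Bal.hom_ext (fun m n => congrArg (Bal.tmul m) (N.r_mul' a b n))⟩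
    (fun a b => Bal.hom_ext (fun m n =>
      (congrArg (Bal.tmul m) (N.r_add a b n)).trans (Bal.tmul_add m _ _)))

lemma tensL_tmul (M N : Bim A) (a : A) (m : M) (n : N) :
    tensL M N a (Bal.tmul m n) = Bal.tmul (M.l a m) n := rfl

lemma tensR_tmul (M N : Bim A) (a : Aᵐᵒᵖ) (m : M) (n : N) :
    tensR M N a (Bal.tmul m n) = Bal.tmul m (N.r a n) := rfl

/-- The bimodule `M ⊗_A N`. -/
def tens (M N : Bim A) : Bim A where
  carrier := Tens M.r N.l
  l := tensL M N
  r := tensR M N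
  comm a b x := by
    induction x using Bal.induction with
    | h0 => simp
    | ht m n => rw [tensL_tmul, tensR_tmul, tensR_tmul, tensL_tmul]
    | ha x y hx hy => simp only [map_add, hx, hy]

/-- The ring `A` as a bimodule over itself. -/
def one (A : Type u) [Ring A] : Bim A where
  carrier := A
  l := Module.toAddMonoidEnd A A
  r := Module.toAddMonoidEnd Aᵐᵒᵖ A
  comm a b m := (mul_assoc a m b.unop).symm

/-- An element of `A`, as an element of the bimodule `A`. -/
def el : A →+ one A := AddMonoidHom.id A

/-- The element `m ⊗ n` of `M ⊗_A N`. -/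
def t {M N : Bim A} (m : M) (n : N) : tens M N := Bal.tmul m n

lemma t_def {M N : Bim A} (m : M) (n : N) : (Bal.tmul m n : tens M N) = t m n := rfl

lemma t_bal {M N : Bim A} (a : A) (m : M) (n : N) : t (M.r (op a) m) n = t m (N.l a n) :=
  tens_bal a m n

lemma t_add {M N : Bim A} (m : M) (n n' : N) : t m (n + n') = t m n + t m n' := Bal.tmul_add m n n'

lemma add_t {M N : Bim A} (m m' : M) (n : N) : t (m + m') n = t m n + t m' n := Bal.add_tmul m m' n

lemma zero_t {M N : Bim A} (n : N) : t (0 : M) n = 0 := Bal.zero_tmul n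

lemma t_zero {M N : Bim A} (m : M) : t m (0 : N) = 0 := Bal.tmul_zero m

@[simp] lemma tens_l {M N : Bim A} (a : A) (m : M) (n : N) :
    (tens M N).l a (t m n) = t (M.l a m) n := rfl

@[simp] lemma tens_r {M N : Bim A} (a : Aᵐᵒᵖ) (m : M) (n : N) :
    (tens M N).r a (t m n) = t m (N.r a n) := rfl

@[simp] lemma one_l (a b : A) : (one A).l a (el b) = el (a * b) := rfl

@[simp] lemma one_r (a : Aᵐᵒᵖ) (b : A) : (one A).r a (el b) = el (b * a.unop) := rfl

@[elab_as_elim]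
lemma t_induction {M N : Bim A} {p : tens M N → Prop} (x : tens M N) (h0 : p 0)
    (ht : ∀ m n, p (t m n)) (ha : ∀ x y, p x → p y → p (x + y)) : p x :=
  Bal.induction x h0 ht ha

/-- Additive maps out of `M ⊗_A N` agree if they agree on all `m ⊗ n`. -/
lemma t_hom_eq {M N : Bim A} {P : Type*} [AddCommGroup P] {f g : tens M N →+ P}
    (h : ∀ m n, f (t m n) = g (t m n)) (x : tens M N) : f x = g x := Bal.hom_eq h x

/-- The universal property of `M ⊗_A N`. -/
def tlift {M N : Bim A} {P : Type*} [AddCommGroup P] (f : M →+ N →+ P)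
    (hf : ∀ a m n, f (M.r (op a) m) n = f m (N.l a n)) : tens M N →+ P := Bal.lift f hf

@[simp] lemma tlift_t {M N : Bim A} {P : Type*} [AddCommGroup P] (f : M →+ N →+ P)
    (hf : ∀ a m n, f (M.r (op a) m) n = f m (N.l a n)) (m : M) (n : N) :
    tlift f hf (t m n) = f m n := rfl

/-- The additive map `m ⊗ n ↦ f m ⊗ g n`. -/
def addmap {M N M' N' : Bim A} (f : M ⟶ M') (g : N ⟶ N') : tens M N →+ tens M' N' :=
  Bal.map f.add g.add (fun _ _ => f.map_r _ _) (fun _ _ => g.map_l _ _)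

/-- The tensor product of bimodule maps. -/
def tmap {M N M' N' : Bim A} (f : M ⟶ M') (g : N ⟶ N') : tens M N ⟶ tens M' N' where
  add := addmap f g
  map_l a x := t_hom_eq (f := AddMonoidHom.comp (addmap f g) ((tens M N).l a))
    (g := AddMonoidHom.comp ((tens M' N').l a) (addmap f g))
    (fun m _ => congrArg (t · _) (f.map_l a m)) x
  map_r a x := t_hom_eq (f := AddMonoidHom.comp (addmap f g) ((tens M N).r a))
    (g := AddMonoidHom.comp ((tens M' N').r a) (addmap f g))
    (fun _ n => congrArg (t _ ·) (g.map_r a n)) x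

@[simp] lemma tmap_t {M N M' N' : Bim A} (f : M ⟶ M') (g : N ⟶ N') (m : M) (n : N) :
    (tmap f g).add (t m n) = t (f.add m) (g.add n) := rfl

/-- Build a morphism of bimodules out of `M ⊗_A N`. -/
def tdesc {M N P : Bim A} (f : M →+ N →+ P)
    (hf : ∀ a m n, f (M.r (op a) m) n = f m (N.l a n))
    (hl : ∀ a m n, f (M.l a m) n = P.l a (f m n)) (hr : ∀ a m n, f m (N.r a n) = P.r a (f m n)) :
    tens M N ⟶ P where
  add := tlift f hf
  map_l a x := by
    induction x using t_induction with
    | h0 => simp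
    | ht m n => exact hl a m n
    | ha x y hx hy => simp only [map_add, hx, hy]
  map_r a x := by
    induction x using t_induction with
    | h0 => simp
    | ht m n => exact hr a m n
    | ha x y hx hy => simp only [map_add, hx, hy]

lemma tens_ext {M N P : Bim A} {f g : tens M N ⟶ P} (h : ∀ m n, f.add (t m n) = g.add (t m n)) :
    f = g := Hom.ext (Bal.hom_ext h)

lemma tens_ext3 {M N P Q : Bim A} {f g : tens (tens M N) P ⟶ Q}
    (h : ∀ m n p, f.add (t (t m n) p) = g.add (t (t m n) p)) : f = g :=
  tens_ext (fun x p => t_hom_eq (f := (f.add.comp (Bal.tmulHom.flip p)))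
    (g := (g.add.comp (Bal.tmulHom.flip p))) (fun m n => h m n p) x)

lemma tens_ext3' {M N P Q : Bim A} {f g : tens M (tens N P) ⟶ Q}
    (h : ∀ m n p, f.add (t m (t n p)) = g.add (t m (t n p))) : f = g :=
  tens_ext (fun m x => t_hom_eq (f := (f.add.comp (Bal.tmulHom m)))
    (g := (g.add.comp (Bal.tmulHom m))) (fun n p => h m n p) x)

lemma tens_ext4 {M N P Q R : Bim A} {f g : tens (tens (tens M N) P) Q ⟶ R}
    (h : ∀ m n p q, f.add (t (t (t m n) p) q) = g.add (t (t (t m n) p) q)) : f = g :=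
  tens_ext3 (fun x p q => t_hom_eq
    (f := f.add.comp ((Bal.tmulHom.flip q).comp (Bal.tmulHom.flip p)))
    (g := g.add.comp ((Bal.tmulHom.flip q).comp (Bal.tmulHom.flip p))) (fun m n => h m n p q) x)

/-- The associator `(m ⊗ n) ⊗ p ↦ m ⊗ (n ⊗ p)`. -/
def assoc (M N P : Bim A) : tens (tens M N) P ≅ tens M (tens N P) where
  hom := tdesc
    (tlift (P := P →+ tens M (tens N P))
      (biHom (fun m n => (Bal.tmulHom m).comp (Bal.tmulHom n))
        (fun m n n' => by ext p; exact (congrArg (t m) (add_t n n' p)).trans (t_add m _ _))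
        (fun m m' n => by ext p; exact add_t m m' (t n p)))
      (fun a m n => by ext p; exact t_bal a m (t n p)))
    (fun a x p => by
      induction x using t_induction with
      | h0 => simp
      | ht m n => exact congrArg (t m ·) (t_bal a n p)
      | ha x y hx hy => simp only [map_add, AddMonoidHom.add_apply, hx, hy])
    (fun a x p => by
      induction x using t_induction with
      | h0 => simp
      | ht m n => rfl
      | ha x y hx hy => simp only [map_add, AddMonoidHom.add_apply, hx, hy])
    (fun a x p => by
      induction x using t_induction with
      | h0 => simp
      | ht m n => rfl
      | ha x y hx hy => simp only [map_add, AddMonoidHom.add_apply, hx, hy])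
  inv := tdesc
    (AddMonoidHom.flip (tlift (P := M →+ tens (tens M N) P)
      (biHom (fun n p => AddMonoidHom.mk' (fun m => t (t m n) p)
          (fun m m' => by simp [add_t]))
        (fun n p p' => by ext m; simp [t_add])
        (fun n n' p => by ext m; simp [add_t, t_add]))
      (fun a n p => by ext m; exact t_bal a (t m n) p)))
    (fun a m x => by
      induction x using t_induction with
      | h0 => simp
      | ht n p => exact congrArg (t · p) (t_bal a m n)
      | ha x y hx hy => simp only [map_add, hx, hy])
    (fun a m x => by
      induction x using t_induction with
      | h0 => simp
      | ht n p => rfl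
      | ha x y hx hy => simp only [map_add, hx, hy])
    (fun a m x => by
      induction x using t_induction with
      | h0 => simp
      | ht n p => rfl
      | ha x y hx hy => simp only [map_add, hx, hy])
  hom_inv_id := tens_ext3 (fun _ _ _ => rfl)
  inv_hom_id := tens_ext3' (fun _ _ _ => rfl)

@[simp] lemma assoc_hom_t {M N P : Bim A} (m : M) (n : N) (p : P) :
    (assoc M N P).hom.add (t (t m n) p) = t m (t n p) := rfl

@[simp] lemma assoc_inv_t {M N P : Bim A} (m : M) (n : N) (p : P) :
    (assoc M N P).inv.add (t m (t n p)) = t (t m n) p := rfl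

/-- The left unitor `a ⊗ m ↦ a m`. -/
def leftU (M : Bim A) : tens (one A) M ≅ M where
  hom := tdesc (M := one A) (biHom (M := A) (fun a m => M.l a m) (fun a m m' => map_add _ _ _)
      (fun a a' m => l_add M a a' m))
    (fun (a b : A) m => l_mul M b a m) (fun a b m => l_mul M a b m) (fun a b m => M.comm b a m)
  inv := ⟨Bal.tmulHom (el (1 : A)), fun a m => by
      change t (el (1 : A)) (M.l a m) = t ((one A).l a (el 1)) m
      rw [← t_bal, one_r, one_l, mul_one, one_mul, unop_op], fun a m => rfl⟩
  hom_inv_id := tens_ext (fun (a : A) m => by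
    change t (el (1 : A)) (M.l a m) = t (el a) m
    rw [← t_bal, one_r, one_mul, unop_op])
  inv_hom_id := hom_ext (fun m => by
    change M.l 1 m = m
    rw [map_one]; rfl)

@[simp] lemma leftU_hom_t {M : Bim A} (a : A) (m : M) :
    (leftU M).hom.add (t (el a) m) = M.l a m := rfl

@[simp] lemma leftU_inv_apply {M : Bim A} (m : M) :
    (leftU M).inv.add m = t (el 1) m := rfl

/-- The right unitor `m ⊗ a ↦ m a`. -/
def rightU (M : Bim A) : tens M (one A) ≅ M where
  hom := tdesc (N := one A) (biHom (N := A) (fun m a => M.r (op a) m)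
      (fun m a b => r_add M (op a) (op b) m) (fun m m' a => map_add _ _ _))
    (fun (a : A) m (b : A) => (r_mul M a b m).symm)
    (fun (a : A) m (b : A) => (M.comm a (op b) m).symm) (fun a m (b : A) => r_mul M b a.unop m)
  inv := ⟨Bal.tmulHom.flip (el (1 : A)), fun a m => rfl, fun a m => by
      change t (M.r (op a.unop) m) (el (1 : A)) = t m ((one A).r a (el 1))
      rw [t_bal, one_r, one_l, mul_one, one_mul]⟩
  hom_inv_id := tens_ext (fun m (a : A) => by
    change t (M.r (op a) m) (el (1 : A)) = t m (el a)
    rw [t_bal, one_l, mul_one])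
  inv_hom_id := hom_ext (fun m => by
    change M.r (op 1) m = m
    rw [op_one, map_one]; rfl)

@[simp] lemma rightU_hom_t {M : Bim A} (a : A) (m : M) :
    (rightU M).hom.add (t m (el a)) = M.r (op a) m := rfl

@[simp] lemma rightU_inv_apply {M : Bim A} (m : M) :
    (rightU M).inv.add m = t m (el 1) := rfl

instance : MonoidalCategoryStruct (Bim A) where
  tensorObj := tens
  whiskerLeft M _ _ f := tmap (𝟙 M) f
  whiskerRight f N := tmap f (𝟙 N)
  tensorHom := tmap
  tensorUnit := one A
  associator := assoc
  leftUnitor := leftU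
  rightUnitor := rightU

/-- The monoidal category of `A`-bimodules. -/
instance : MonoidalCategory (Bim A) where
  tensorHom_def _ _ := tens_ext (fun _ _ => rfl)
  id_tensorHom_id _ _ := tens_ext (fun _ _ => rfl)
  tensorHom_comp_tensorHom _ _ _ _ := tens_ext (fun _ _ => rfl)
  whiskerLeft_id _ _ := tens_ext (fun _ _ => rfl)
  id_whiskerRight _ _ := tens_ext (fun _ _ => rfl)
  associator_naturality _ _ _ := tens_ext3 (fun _ _ _ => rfl)
  leftUnitor_naturality f := tens_ext (fun (a : A) m => (hom_l f a m).symm)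
  rightUnitor_naturality f := tens_ext (fun m (a : A) => (hom_r f (op a) m).symm)
  pentagon _ _ _ _ := tens_ext4 (fun _ _ _ _ => rfl)
  triangle _ _ := tens_ext3 (fun m (a : A) n => (t_bal a m n).symm)

end Bim

/-! ## Categories of objects with additional structure -/

section Structured

universe v' u' w

variable {C : Type u'} [Category.{v'} C]

/-- A notion of structure on the objects of `C`, together with a condition which says when a
morphism of `C` is compatible with given structures. -/
structure StrOn (C : Type u') [Category.{v'} C] where
  Str : C → Type w
  IsHom : ∀ {X Y : C}, Str X → Str Y → (X ⟶ Y) → Prop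
  id_mem : ∀ {X : C} (s : Str X), IsHom s s (𝟙 X)
  comp_mem : ∀ {X Y Z : C} {s : Str X} {s' : Str Y} {s'' : Str Z} {f : X ⟶ Y} {g : Y ⟶ Z},
    IsHom s s' f → IsHom s' s'' g → IsHom s s'' (f ≫ g)

namespace StrOn

/-- An object of `C` together with a structure on it. -/
structure Obj (D : StrOn.{v', u', w} C) where
  base : C
  str : D.Str base

variable {D : StrOn.{v', u', w} C}

/-- A structure preserving morphism. -/
@[ext] structure Hom (X Y : D.Obj) where
  base : X.base ⟶ Y.base
  mem : D.IsHom X.str Y.str base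

instance : Category D.Obj where
  Hom := Hom
  id X := ⟨𝟙 X.base, D.id_mem X.str⟩
  comp f g := ⟨f.base ≫ g.base, D.comp_mem f.mem g.mem⟩
  id_comp f := Hom.ext (Category.id_comp f.base)
  comp_id f := Hom.ext (Category.comp_id f.base)
  assoc f g h := Hom.ext (Category.assoc f.base g.base h.base)

/-- The functor that forgets the structure. -/
def forget (D : StrOn.{v', u', w} C) : D.Obj ⥤ C where
  obj X := X.base
  map f := f.base

/-- A tensor product of structures, over the tensor product of `C`: the constraint isomorphisms of
`C` are required to preserve structure. -/
structure Mon (D : StrOn.{v', u', w} C) [MonoidalCategory C] where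
  tensor : ∀ {X Y : C}, D.Str X → D.Str Y → D.Str (X ⊗ Y)
  unit : D.Str (𝟙_ C)
  inv_mem : ∀ {X Y : C} {s : D.Str X} {s' : D.Str Y} (f : X ≅ Y), D.IsHom s s' f.hom →
    D.IsHom s' s f.inv
  tensor_mem : ∀ {X Y X' Y' : C} {s : D.Str X} {s' : D.Str Y} {p : D.Str X'} {p' : D.Str Y'}
    {f : X ⟶ Y} {g : X' ⟶ Y'}, D.IsHom s s' f → D.IsHom p p' g →
      D.IsHom (tensor s p) (tensor s' p') (f ⊗ₘ g)
  assoc_mem : ∀ {X Y Z : C} (s : D.Str X) (s' : D.Str Y) (s'' : D.Str Z),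
    D.IsHom (tensor (tensor s s') s'') (tensor s (tensor s' s'')) (α_ X Y Z).hom
  left_mem : ∀ {X : C} (s : D.Str X), D.IsHom (tensor unit s) s (λ_ X).hom
  right_mem : ∀ {X : C} (s : D.Str X), D.IsHom (tensor s unit) s (ρ_ X).hom

variable [MonoidalCategory C]

/-- An isomorphism of structured objects from a structure preserving isomorphism of `C`. -/
def Mon.iso (T : D.Mon) {X Y : D.Obj} (f : X.base ≅ Y.base) (h : D.IsHom X.str Y.str f.hom) :
    X ≅ Y where
  hom := ⟨f.hom, h⟩
  inv := ⟨f.inv, T.inv_mem f h⟩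
  hom_inv_id := Hom.ext f.hom_inv_id
  inv_hom_id := Hom.ext f.inv_hom_id

/-- The monoidal category of structured objects; all operations are those of `C`. -/
@[reducible] def Mon.monoidal (T : D.Mon) : MonoidalCategory D.Obj where
  tensorObj X Y := ⟨X.base ⊗ Y.base, T.tensor X.str Y.str⟩
  whiskerLeft X _ _ f := ⟨X.base ◁ f.base, by
    rw [← id_tensorHom]; exact T.tensor_mem (D.id_mem X.str) f.mem⟩
  whiskerRight f Y := ⟨f.base ▷ Y.base, by
    rw [← tensorHom_id]; exact T.tensor_mem f.mem (D.id_mem Y.str)⟩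
  tensorHom f g := ⟨f.base ⊗ₘ g.base, T.tensor_mem f.mem g.mem⟩
  tensorUnit := ⟨𝟙_ C, T.unit⟩
  associator X Y Z := T.iso (α_ X.base Y.base Z.base) (T.assoc_mem X.str Y.str Z.str)
  leftUnitor X := T.iso (λ_ X.base) (T.left_mem X.str)
  rightUnitor X := T.iso (ρ_ X.base) (T.right_mem X.str)
  tensorHom_def f g := Hom.ext (MonoidalCategory.tensorHom_def f.base g.base)
  id_tensorHom_id X Y := Hom.ext (MonoidalCategory.id_tensorHom_id X.base Y.base)
  tensorHom_comp_tensorHom f₁ f₂ g₁ g₂ :=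
    Hom.ext (MonoidalCategory.tensorHom_comp_tensorHom f₁.base f₂.base g₁.base g₂.base)
  whiskerLeft_id X Y := Hom.ext (MonoidalCategory.whiskerLeft_id X.base Y.base)
  id_whiskerRight X Y := Hom.ext (MonoidalCategory.id_whiskerRight X.base Y.base)
  associator_naturality f g h :=
    Hom.ext (MonoidalCategory.associator_naturality f.base g.base h.base)
  leftUnitor_naturality f := Hom.ext (MonoidalCategory.leftUnitor_naturality f.base)
  rightUnitor_naturality f := Hom.ext (MonoidalCategory.rightUnitor_naturality f.base)
  pentagon W X Y Z := Hom.ext (MonoidalCategory.pentagon W.base X.base Y.base Z.base)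
  triangle X Y := Hom.ext (MonoidalCategory.triangle X.base Y.base)

end StrOn

end Structured

/-! ## Bialgebroids -/

namespace Bim

variable {A : Type u} [Ring A]

/-- `x ⊗ m ↦ f x ⊗ m` for a right `A`-linear map `f`. -/
def fst {X Y : Bim A} (M : Bim A) (f : X →+ Y) (hf : ∀ a x, f (X.r (op a) x) = Y.r (op a) (f x)) :
    tens X M →+ tens Y M := Bal.map f (AddMonoidHom.id M) hf (fun _ _ => rfl)

@[simp] lemma fst_t {X Y M : Bim A} (f : X →+ Y)
    (hf : ∀ a x, f (X.r (op a) x) = Y.r (op a) (f x)) (x : X) (m : M) :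
    fst M f hf (t x m) = t (f x) m := rfl

/-- `m ⊗ x ↦ m ⊗ f x` for a left `A`-linear map `f`. -/
def snd {X Y : Bim A} (M : Bim A) (f : X →+ Y) (hf : ∀ a x, f (X.l a x) = Y.l a (f x)) :
    tens M X →+ tens M Y := Bal.map (AddMonoidHom.id M) f (fun _ _ => rfl) hf

@[simp] lemma snd_t {X Y M : Bim A} (f : X →+ Y) (hf : ∀ a x, f (X.l a x) = Y.l a (f x)) (x : X)
    (m : M) : snd M f hf (t m x) = t m (f x) := rfl

end Bim

/-- Ring maps `s : A → U` and `t : Aᵒᵖ → U` with commuting images, that is, a ring map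
`A ⊗ Aᵒᵖ → U`. -/
structure AeRing (A U : Type u) [Ring A] [Ring U] where
  s : A →+* U
  t : Aᵐᵒᵖ →+* U
  comm : ∀ a b, s a * t b = t b * s a

namespace AeRing

variable {A U : Type u} [Ring A] [Ring U] (R : AeRing A U)

/-- `a ▹ u = s(a) u` -/
def lact : A →+* AddMonoid.End U := (Module.toAddMonoidEnd U U).comp R.s

/-- `u ◃ a = t(a) u` -/
def ract : Aᵐᵒᵖ →+* AddMonoid.End U := (Module.toAddMonoidEnd U U).comp R.t

lemma lact_apply (a : A) (u : U) : R.lact a u = R.s a * u := rfl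
lemma ract_apply (a : Aᵐᵒᵖ) (u : U) : R.ract a u = R.t a * u := rfl

/-- `U` with the bimodule structure `a ▹ u ◃ b = s(a) t(b) u`. -/
abbrev leftBim : Bim A where
  carrier := U
  l := R.lact
  r := R.ract
  comm a b u := by
    simp only [lact_apply, ract_apply]
    rw [← mul_assoc, ← mul_assoc, R.comm]

/-- The map from formal tensors to `U_◃ ⊗_A ▹U`. -/
def mkL : U ⊗[ℤ] U →+ Bim.tens R.leftBim R.leftBim := Bal.mk

/-- The opposite `Uᵒᵖ`, in which source and target exchange their roles: the bimodule
`▹(Uᵒᵖ)◃` is `▸U◂`, that is, `U` with `a ▸ u ◂ b = u t(a) s(b)`. -/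
def opp : AeRing A Uᵐᵒᵖ where
  s := (RingHom.op R.t).comp (RingEquiv.opOp A).toRingHom
  t := RingHom.op R.s
  comm a b := congrArg op (R.comm b.unop (op a))

lemma opp_s (a : A) : R.opp.s a = op (R.t (op a)) := rfl
lemma opp_t (a : Aᵐᵒᵖ) : R.opp.t a = op (R.s a.unop) := rfl

end AeRing

/-- A left bialgebroid `(U, A, s, t, Δ, ε)`: an `A ⊗ Aᵒᵖ`-ring with an `A`-coring structure on the
bimodule `▹U◃`, that is, a comonoid structure in the monoidal category of bimodules, such that the
coproduct takes values in the Takeuchi product and is unital and multiplicative with respect to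
the factorwise product (computed on arbitrary representatives), and such that
`ε (1) = 1` and `ε (u v) = ε (u s(ε v)) = ε (u t(ε v))`. -/
structure LeftBialgebroid (A U : Type u) [Ring A] [Ring U] extends AeRing A U where
  coring : ComonObj toAeRing.leftBim
  takeuchi : ∀ (a : A) (u : U) (x : U ⊗[ℤ] U), toAeRing.mkL x = coring.comul.add u →
    toAeRing.mkL (x * (t (op a) ⊗ₜ 1)) = toAeRing.mkL (x * (1 ⊗ₜ s a))
  comul_one : coring.comul.add (1 : U) = toAeRing.mkL 1
  comul_mul : ∀ (u v : U) (x y : U ⊗[ℤ] U), toAeRing.mkL x = coring.comul.add u →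
    toAeRing.mkL y = coring.comul.add v → coring.comul.add (u * v : U) = toAeRing.mkL (x * y)
  counit_one : coring.counit.add (1 : U) = (1 : A)
  counit_mul_s : ∀ u v : U,
    coring.counit.add (u * v : U) = coring.counit.add (u * s (coring.counit.add v) : U)
  counit_mul_t : ∀ u v : U,
    coring.counit.add (u * v : U) = coring.counit.add (u * t (op (coring.counit.add v)) : U)

/-- A right bialgebroid `(V, A, s, t, Δ, ∂)` is a left bialgebroid structure on the opposite ring
`Vᵒᵖ`, with source and target exchanged. In terms of the multiplication of `V`: there is an
`A`-coring structure on `▸V◂`, where `a ▸ v ◂ b = v t(a) s(b)`, with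
`s(a) v⁽¹⁾ ⊗ v⁽²⁾ = v⁽¹⁾ ⊗ t(a) v⁽²⁾`, a unital multiplicative coproduct, `∂(1) = 1`, and
`∂(v w) = ∂(s(∂ v) w) = ∂(t(∂ v) w)`. -/
abbrev RightBialgebroid (A V : Type u) [Ring A] [Ring V] := LeftBialgebroid A Vᵐᵒᵖ

namespace LeftBialgebroid

variable {A U : Type u} [Ring A] [Ring U] (L : LeftBialgebroid A U)

/-- The coproduct `u ↦ u₍₁₎ ⊗ u₍₂₎`. -/
def Δ : U →+ Bim.tens L.leftBim L.leftBim := L.coring.comul.add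

/-- The counit. -/
def ε : U →+ A := L.coring.counit.add

/-- `u ⊗ x ↦ u z ⊗ x` -/
def mulFst (X : Bim A) (z : U) : Bim.tens L.leftBim X →+ Bim.tens L.leftBim X :=
  Bim.fst X (AddMonoidHom.mulRight z) (fun a u => mul_assoc (L.t (op a)) u z)

/-- `u ⊗ v ↦ u ⊗ v z` -/
def mulSnd (z : U) : Bim.tens L.leftBim L.leftBim →+ Bim.tens L.leftBim L.leftBim :=
  Bim.snd L.leftBim (AddMonoidHom.mulRight z) (fun a u => mul_assoc (L.s a) u z)

/-- `u ⊗ x ↦ ε(u) x` -/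
def counitFst (X : Bim A) : Bim.tens L.leftBim X ⟶ X := L.coring.counit ▷ X ≫ (λ_ X).hom

/-- `x ⊗ u ↦ x ε(u)` -/
def counitSnd (X : Bim A) : Bim.tens X L.leftBim ⟶ X := X ◁ L.coring.counit ≫ (ρ_ X).hom

/-- `u ⊗ x ↦ u₍₁₎ ⊗ (u₍₂₎ ⊗ x)` -/
def comulFst (X : Bim A) : Bim.tens L.leftBim X ⟶ Bim.tens L.leftBim (Bim.tens L.leftBim X) :=
  L.coring.comul ▷ X ≫ (α_ L.leftBim L.leftBim X).hom

@[simp] lemma mulFst_t (X : Bim A) (z u : U) (x : X) :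
    L.mulFst X z (Bim.t (M := L.leftBim) u x) = Bim.t (M := L.leftBim) (u * z) x := rfl

@[simp] lemma mulSnd_t (z u v : U) :
    L.mulSnd z (Bim.t (M := L.leftBim) (N := L.leftBim) u v) =
      Bim.t (M := L.leftBim) (N := L.leftBim) u (v * z) := rfl

@[simp] lemma counitFst_t (X : Bim A) (u : U) (x : X) :
    (L.counitFst X).add (Bim.t (M := L.leftBim) u x) = X.l (L.ε u) x := rfl

@[simp] lemma counitSnd_t (X : Bim A) (u : U) (x : X) :
    (L.counitSnd X).add (Bim.t (N := L.leftBim) x u) = X.r (op (L.ε u)) x := rfl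

lemma comulFst_t (X : Bim A) (u : U) (x : X) :
    (L.comulFst X).add (Bim.t (M := L.leftBim) u x) =
      (α_ L.leftBim L.leftBim X).hom.add (Bim.t (L.Δ u) x) := rfl

lemma Δ_s (a : A) (u : U) : L.Δ (L.s a * u) = (Bim.tens L.leftBim L.leftBim).l a (L.Δ u) :=
  L.coring.comul.map_l a u

lemma Δ_t (a : Aᵐᵒᵖ) (u : U) : L.Δ (L.t a * u) = (Bim.tens L.leftBim L.leftBim).r a (L.Δ u) :=
  L.coring.comul.map_r a u

lemma ε_s (a : A) (u : U) : L.ε (L.s a * u) = a * L.ε u := L.coring.counit.map_l a u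

lemma ε_t (a : Aᵐᵒᵖ) (u : U) : L.ε (L.t a * u) = L.ε u * a.unop := L.coring.counit.map_r a u

lemma ε_one : L.ε 1 = 1 := L.counit_one

lemma ε_mul_s (u v : U) : L.ε (u * L.s (L.ε v)) = L.ε (u * v) := (L.counit_mul_s u v).symm

lemma ε_mul_t (u v : U) : L.ε (u * L.t (op (L.ε v))) = L.ε (u * v) := (L.counit_mul_t u v).symm

lemma ε_of_s (a : A) : L.ε (L.s a) = a := by
  have := L.ε_s a 1
  rwa [mul_one, ε_one, mul_one] at this

lemma ε_of_t (a : Aᵐᵒᵖ) : L.ε (L.t a) = a.unop := by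
  have := L.ε_t a 1
  rwa [mul_one, ε_one, one_mul] at this

lemma Δ_one : L.Δ 1 = Bim.t (M := L.leftBim) (N := L.leftBim) (1 : U) (1 : U) := L.comul_one

lemma Δ_of_s (a : A) :
    L.Δ (L.s a) = Bim.t (M := L.leftBim) (N := L.leftBim) (L.s a) (1 : U) := by
  have := L.Δ_s a 1
  rw [mul_one, Δ_one] at this
  rw [this]
  exact congrArg (Bim.t (M := L.leftBim) (N := L.leftBim) · (1 : U)) (mul_one (L.s a))

lemma Δ_of_t (a : Aᵐᵒᵖ) :
    L.Δ (L.t a) = Bim.t (M := L.leftBim) (N := L.leftBim) (1 : U) (L.t a) := by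
  have := L.Δ_t a 1
  rw [mul_one, Δ_one] at this
  rw [this]
  exact congrArg (Bim.t (M := L.leftBim) (N := L.leftBim) (1 : U)) (mul_one (L.t a))

lemma counitFst_Δ (u : U) : (L.counitFst L.leftBim).add (L.Δ u) = u := by
  have h := L.coring.counit_comul
  have h2 := congrArg (fun f => (λ_ L.leftBim).hom.add (Bim.Hom.add f u)) h
  refine (show _ = (λ_ L.leftBim).hom.add ((λ_ L.leftBim).inv.add u) from h2).trans ?_
  exact congrArg (fun f => Bim.Hom.add f u) (λ_ L.leftBim).inv_hom_id

lemma counitSnd_Δ (u : U) : (L.counitSnd L.leftBim).add (L.Δ u) = u := by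
  have h := L.coring.comul_counit
  have h2 := congrArg (fun f => (ρ_ L.leftBim).hom.add (Bim.Hom.add f u)) h
  refine (show _ = (ρ_ L.leftBim).hom.add ((ρ_ L.leftBim).inv.add u) from h2).trans ?_
  exact congrArg (fun f => Bim.Hom.add f u) (ρ_ L.leftBim).inv_hom_id

lemma coassoc (u : U) : (L.comulFst L.leftBim).add (L.Δ u) =
    Bim.snd L.leftBim L.Δ L.Δ_s (L.Δ u) :=
  (congrArg (fun f => Bim.Hom.add f u) L.coring.comul_assoc).symm

lemma takeuchi_Δ (a : A) (u : U) :
    L.mulFst L.leftBim (L.t (op a)) (L.Δ u) = L.mulSnd (L.s a) (L.Δ u) := by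
  obtain ⟨x, hx⟩ := Bal.mk_surjective (L.Δ u)
  have h := L.takeuchi a u x hx
  have h1 : ∀ x, L.mulFst L.leftBim (L.t (op a)) (L.mkL x) =
      L.mkL (x * (L.t (op a) ⊗ₜ 1)) := fun x => by
    induction x with
    | zero => simp
    | tmul u v => rw [Algebra.TensorProduct.tmul_mul_tmul, mul_one]; rfl
    | add x y hx hy => rw [add_mul, map_add, map_add, map_add, hx, hy]
  have h2 : ∀ x, L.mulSnd (L.s a) (L.mkL x) = L.mkL (x * (1 ⊗ₜ L.s a)) := fun x => by
    induction x with
    | zero => simp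
    | tmul u v => rw [Algebra.TensorProduct.tmul_mul_tmul, mul_one]; rfl
    | add x y hx hy => rw [add_mul, map_add, map_add, map_add, hx, hy]
  rw [← hx]
  exact (h1 x).trans (h.trans (h2 x).symm)

/-- `u ⊗ v ↦ (u ⊗ v) y`, for a formal tensor `y`. -/
def mulForm : U ⊗[ℤ] U →+ Bim.tens L.leftBim L.leftBim →+ Bim.tens L.leftBim L.leftBim :=
  Bal.fLift (biHom (fun z w => (L.mulSnd w).comp (L.mulFst L.leftBim z))
    (fun z w w' => Bal.hom_ext fun u v => by
      change Bim.t (M := L.leftBim) (N := L.leftBim) (u * z) (v * (w + w')) = _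
      rw [mul_add, Bim.t_add]; rfl)
    (fun z z' w => Bal.hom_ext fun u v => by
      change Bim.t (M := L.leftBim) (N := L.leftBim) (u * (z + z')) (v * w) = _
      rw [mul_add, Bim.add_t]; rfl))

lemma mulForm_tmul (z w : U) (ξ) : L.mulForm (z ⊗ₜ w) ξ = L.mulSnd w (L.mulFst _ z ξ) := rfl

lemma Δ_mul (u v : U) (y : U ⊗[ℤ] U) (hy : L.mkL y = L.Δ v) :
    L.Δ (u * v) = L.mulForm y (L.Δ u) := by
  obtain ⟨x, hx⟩ := Bal.mk_surjective (L.Δ u)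
  have h : ∀ x y : U ⊗[ℤ] U, L.mkL (x * y) = L.mulForm y (L.mkL x) := fun x y => by
    induction y with
    | zero => simp
    | tmul z w =>
      induction x with
      | zero => simp
      | tmul u v => rw [Algebra.TensorProduct.tmul_mul_tmul]; rfl
      | add x y hx hy => rw [add_mul, map_add, map_add, map_add, hx, hy]
    | add y y' hy hy' => rw [mul_add, map_add, map_add, hy, hy']; rfl
  rw [← hx]
  exact (L.comul_mul u v x y hx hy).trans (h x y)

end LeftBialgebroid

/-! ## Modules -/

section Modules

variable {A U : Type u} [Ring A] [Ring U]

/-- A left `U`-module structure on `M` whose underlying bimodule structure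
`a ▹ m ◃ b = s(a) t(b) m` is the given one. -/
structure LModStr (R : AeRing A U) (M : Bim A) where
  act : U →+* AddMonoid.End M
  act_s : ∀ a m, act (R.s a) m = M.l a m
  act_t : ∀ a m, act (R.t a) m = M.r a m

lemma LModStr.mul {R : AeRing A U} {M : Bim A} (s : LModStr R M) (u v : U) (m : M) :
    s.act (u * v) m = s.act u (s.act v m) := by rw [map_mul]; rfl

lemma LModStr.one {R : AeRing A U} {M : Bim A} (s : LModStr R M) (m : M) :
    s.act 1 m = m := by rw [map_one]; rfl

lemma LModStr.add {R : AeRing A U} {M : Bim A} (s : LModStr R M) (u v : U) (m : M) :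
    s.act (u + v) m = s.act u m + s.act v m := by rw [map_add]; rfl

/-- Left `U`-modules, with `U`-linear maps. -/
abbrev LMod (R : AeRing A U) : StrOn (Bim A) where
  Str := LModStr R
  IsHom s s' f := ∀ u m, f.add (s.act u m) = s'.act u (f.add m)
  id_mem _ _ _ := rfl
  comp_mem h h' u m := by rw [Bim.comp_add, h, h', Bim.comp_add]

/-- Right `U`-modules, as left modules over `Uᵒᵖ`: `act (op u) m` is `m u`. The underlying
bimodule structure is `a ▸ m ◂ b = m t(a) s(b)`. -/
abbrev RMod (R : AeRing A U) : StrOn (Bim A) := LMod R.opp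

namespace LModStr

variable {R : AeRing A U} {M N : Bim A} (s : LModStr R M) (s' : LModStr R N)

/-- `u ⊗ v ↦ u m ⊗ v n` -/
def diag (m : M) (n : N) : Bim.tens R.leftBim R.leftBim →+ Bim.tens M N :=
  Bim.tlift (M := R.leftBim) (N := R.leftBim)
    (biHom (M := U) (N := U) (fun u v => Bim.t (s.act u m) (s'.act v n))
      (fun u v v' => by rw [s'.add, Bim.t_add]) (fun u u' v => by rw [s.add, Bim.add_t]))
    (fun a u v => by
      change Bim.t (s.act (R.t (op a) * u) m) (s'.act v n) =
        Bim.t (s.act u m) (s'.act (R.s a * v) n)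
      rw [s.mul, s.act_t, s'.mul, s'.act_s, Bim.t_bal])

@[simp] lemma diag_t (m : M) (n : N) (u v : U) :
    diag s s' m n (Bim.t (M := R.leftBim) (N := R.leftBim) u v) =
      Bim.t (s.act u m) (s'.act v n) := rfl

/-- `diag` as a biadditive map. -/
def diagHom : M →+ N →+ Bim.tens R.leftBim R.leftBim →+ Bim.tens M N :=
  biHom (diag s s')
    (fun m n n' => Bal.hom_ext fun u v => by
      change Bim.t (s.act u m) (s'.act v (n + n')) = _
      rw [map_add, Bim.t_add]; rfl)
    (fun m m' n => Bal.hom_ext fun u v => by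
      change Bim.t (s.act u (m + m')) (s'.act v n) = _
      rw [map_add, Bim.add_t]; rfl)

end LModStr

namespace LeftBialgebroid

variable (L : LeftBialgebroid A U) {M N : Bim A} (s : LModStr L.toAeRing M)
  (s' : LModStr L.toAeRing N)

/-- The diagonal action of an element: `m ⊗ n ↦ u₍₁₎ m ⊗ u₍₂₎ n`. -/
def diagAct (u : U) : Bim.tens M N →+ Bim.tens M N :=
  Bim.tlift (biHom (fun m n => s.diag s' m n (L.Δ u))
      (fun m n n' => by
        rw [← AddMonoidHom.add_apply]
        exact DFunLike.congr_fun (map_add (s.diagHom s' m) n n') _)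
      (fun m m' n => by
        rw [← AddMonoidHom.add_apply]
        exact DFunLike.congr_fun (DFunLike.congr_fun (map_add (s.diagHom s') m m') n) _))
    (fun a m n => by
      simp only [biHom_apply]
      have h1 : ∀ ξ, s.diag s' (M.r (op a) m) n ξ =
          s.diag s' m n (L.mulFst L.leftBim (L.t (op a)) ξ) :=
        Bim.t_hom_eq (g := (s.diag s' m n).comp (L.mulFst L.leftBim (L.t (op a)))) fun u v => by
          change Bim.t (s.act u _) _ = Bim.t (s.act (u * L.t (op a)) m) _
          rw [s.mul, s.act_t]; rfl
      have h2 : ∀ ξ, s.diag s' m (N.l a n) ξ = s.diag s' m n (L.mulSnd (L.s a) ξ) :=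
        Bim.t_hom_eq (g := (s.diag s' m n).comp (L.mulSnd (L.s a))) fun u v => by
          change Bim.t _ (s'.act v _) = Bim.t _ (s'.act (v * L.s a) n)
          rw [s'.mul, s'.act_s]; rfl
      rw [h1, h2, L.takeuchi_Δ])

lemma diagAct_t (u : U) (m : M) (n : N) :
    L.diagAct s s' u (Bim.t m n) = s.diag s' m n (L.Δ u) := rfl

lemma diag_mulForm (u : U) (m : M) (n : N) (y : U ⊗[ℤ] U) :
    s.diag s' m n (L.mulForm y (L.Δ u)) = L.diagAct s s' u (s.diag s' m n (L.mkL y)) := by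
  induction y with
  | zero => simp
  | add y y' hy hy' => simp only [map_add, AddMonoidHom.add_apply, hy, hy']
  | tmul z w =>
    change _ = s.diag s' (s.act z m) (s'.act w n) (L.Δ u)
    refine Bim.t_hom_eq (f := (s.diag s' m n).comp (L.mulForm (z ⊗ₜ w))) (fun x y => ?_) _
    change Bim.t (s.act (x * z) m) (s'.act (y * w) n) = _
    rw [s.mul, s'.mul]; rfl

/-- The tensor product of two left modules, with the diagonal action
`u (m ⊗ n) = u₍₁₎ m ⊗ u₍₂₎ n`. -/
def tensorLMod : LModStr L.toAeRing (Bim.tens M N) where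
  act := RingHom.mk' ⟨⟨fun u => L.diagAct s s' u, Bal.hom_ext fun m n => by
        change s.diag s' m n (L.Δ 1) = Bim.t m n
        rw [L.Δ_one]
        change Bim.t (s.act 1 m) (s'.act 1 n) = _
        rw [s.one, s'.one]⟩,
      fun u v => Bal.hom_ext fun m n => by
        change s.diag s' m n (L.Δ (u * v)) = L.diagAct s s' u (s.diag s' m n (L.Δ v))
        obtain ⟨y, hy⟩ := Bal.mk_surjective (L.Δ v)
        rw [L.Δ_mul u v y hy, L.diag_mulForm s s', ← hy]; rfl⟩
    (fun u v => Bal.hom_ext fun m n => by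
      change s.diag s' m n (L.Δ (u + v)) = s.diag s' m n (L.Δ u) + s.diag s' m n (L.Δ v)
      rw [map_add, map_add])
  act_s a x := Bim.t_hom_eq (f := L.diagAct s s' (L.s a)) (g := (Bim.tens M N).l a) (fun m n => by
      rw [diagAct_t, Δ_of_s]
      change Bim.t (s.act _ m) (s'.act 1 n) = Bim.t _ _
      rw [s'.one, s.act_s]; rfl) x
  act_t a x := Bim.t_hom_eq (f := L.diagAct s s' (L.t a)) (g := (Bim.tens M N).r a) (fun m n => by
      rw [diagAct_t, Δ_of_t]
      change Bim.t (s.act 1 m) (s'.act _ n) = Bim.t _ _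
      rw [s.one, s'.act_t]; rfl) x

/-- The unit module `A`, with `u a = ε(u s(a))`. -/
def unitLMod : LModStr L.toAeRing (Bim.one A) where
  act := RingHom.mk' ⟨⟨fun u => (AddMonoidHom.mk' (fun a : A => L.ε (u * L.s a))
        (fun a b => by rw [map_add, mul_add, map_add]) : A →+ A),
        AddMonoidHom.ext fun (a : A) => by
          change L.ε (1 * L.s a) = a
          rw [one_mul, ε_of_s]⟩,
      fun u v => AddMonoidHom.ext fun (a : A) => by
        change L.ε (u * v * L.s a) = L.ε (u * L.s (L.ε (v * L.s a)))
        rw [ε_mul_s, mul_assoc]⟩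
    (fun u v => AddMonoidHom.ext fun (a : A) => by
      change L.ε ((u + v) * L.s a) = L.ε (u * L.s a) + L.ε (v * L.s a)
      rw [add_mul, map_add])
  act_s a (b : A) := by
    change L.ε (L.s a * L.s b) = a * b
    rw [← map_mul, ε_of_s]
  act_t a (b : A) := by
    change L.ε (L.t a * L.s b) = b * a.unop
    rw [ε_t, ε_of_s]

lemma diagAct_map {M' N' : Bim A} {p : LModStr L.toAeRing M'} {p' : LModStr L.toAeRing N'}
    (f : M ⟶ M') (g : N ⟶ N') (hf : ∀ u m, f.add (s.act u m) = p.act u (f.add m))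
    (hg : ∀ u m, g.add (s'.act u m) = p'.act u (g.add m)) (u : U) (x : Bim.tens M N) :
    (Bim.tmap f g).add (L.diagAct s s' u x) = L.diagAct p p' u ((Bim.tmap f g).add x) := by
  refine Bim.t_hom_eq (f := (Bim.tmap f g).add.comp (L.diagAct s s' u))
    (g := (L.diagAct p p' u).comp (Bim.tmap f g).add) (fun m n => ?_) x
  change (Bim.tmap f g).add (s.diag s' m n (L.Δ u)) = p.diag p' (f.add m) (g.add n) (L.Δ u)
  refine Bim.t_hom_eq (f := (Bim.tmap f g).add.comp (s.diag s' m n)) (fun x y => ?_) _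
  change Bim.t (f.add (s.act _ _)) (g.add (s'.act _ _)) = Bim.t (p.act _ _) (p'.act _ _)
  rw [hf, hg]

section

variable {P : Bim A} (s'' : LModStr L.toAeRing P)

/-- `u ⊗ (v ⊗ w) ↦ u m ⊗ (v n ⊗ w p)` -/
def diag3 (m : M) (n : N) (p : P) :
    Bim.tens L.leftBim (Bim.tens L.leftBim L.leftBim) →+ Bim.tens M (Bim.tens N P) :=
  Bim.tlift (M := L.leftBim) (biHom (M := U) (fun u ξ => Bim.t (s.act u m) (s'.diag s'' n p ξ))
      (fun u ξ ξ' => by rw [map_add, Bim.t_add])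
      (fun u u' ξ => by rw [s.add, Bim.add_t]))
    (fun a u ξ => by
      change Bim.t (s.act (L.t (op a) * u) m) (s'.diag s'' n p ξ) =
        Bim.t (s.act u m) (s'.diag s'' n p ((Bim.tens L.leftBim L.leftBim).l a ξ))
      rw [s.mul, s.act_t, Bim.t_bal]
      refine congrArg (Bim.t (s.act u m)) ?_
      refine Bim.t_hom_eq (f := AddMonoidHom.comp ((Bim.tens N P).l a) (s'.diag s'' n p))
        (g := (s'.diag s'' n p).comp ((Bim.tens L.leftBim L.leftBim).l a)) (fun v w => ?_) ξ
      change Bim.t (N.l a (s'.act v n)) _ = Bim.t (s'.act (L.s a * v) n) _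
      rw [s'.mul, s'.act_s]; rfl)

lemma diag3_left (m : M) (n : N) (p : P) (ξ : Bim.tens L.leftBim L.leftBim) :
    (Bim.assoc M N P).hom.add ((L.tensorLMod s s').diag s'' (Bim.t m n) p ξ) =
      L.diag3 s s' s'' m n p ((L.comulFst L.leftBim).add ξ) := by
  refine Bim.t_hom_eq
    (f := (Bim.assoc M N P).hom.add.comp ((L.tensorLMod s s').diag s'' (Bim.t m n) p))
    (g := (L.diag3 s s' s'' m n p).comp (L.comulFst L.leftBim).add) (fun v w => ?_) ξ
  change (Bim.assoc M N P).hom.add (Bim.t (s.diag s' m n (L.Δ v)) (s''.act w p)) =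
    L.diag3 s s' s'' m n p ((Bim.assoc _ _ _).hom.add (Bim.t (N := L.leftBim) (L.Δ v) w))
  generalize L.Δ v = η
  induction η using Bim.t_induction with
  | h0 => 
    rw [map_zero, Bim.zero_t, Bim.zero_t, map_zero, map_zero, map_zero]
  | ha x y hx hy =>
    rw [map_add, Bim.add_t, Bim.add_t, map_add, map_add, map_add, hx, hy]
  | ht x y => rfl

lemma diag3_right (m : M) (n : N) (p : P) (ξ : Bim.tens L.leftBim L.leftBim) :
    s.diag (L.tensorLMod s' s'') m (Bim.t n p) ξ =
      L.diag3 s s' s'' m n p (Bim.snd L.leftBim L.Δ L.Δ_s ξ) := by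
  induction ξ using Bim.t_induction with
  | h0 => simp only [map_zero]
  | ha x y hx hy => simp only [map_add, hx, hy]
  | ht x y => rfl

lemma diagAct_assoc (u : U) (x : Bim.tens (Bim.tens M N) P) :
    (Bim.assoc M N P).hom.add (L.diagAct (L.tensorLMod s s') s'' u x) =
      L.diagAct s (L.tensorLMod s' s'') u ((Bim.assoc M N P).hom.add x) := by
  induction x using Bim.t_induction with
  | h0 => simp only [map_zero]
  | ha x y hx hy => simp only [map_add, hx, hy]
  | ht y p =>
    induction y using Bim.t_induction with
    | h0 => simp only [map_zero, Bim.zero_t]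
    | ha x y hx hy => simp only [map_add, Bim.add_t, hx, hy]
    | ht m n =>
      rw [diagAct_t, Bim.assoc_hom_t, diagAct_t, diag3_left, diag3_right, coassoc]

end

/-- The monoidal structure on left modules over a left bialgebroid. -/
def monLMod : (LMod L.toAeRing).Mon where
  tensor s s' := L.tensorLMod s s'
  unit := L.unitLMod
  inv_mem {X Y s s'} f h u m := by
    have hm : f.hom.add (f.inv.add m) = m := congrArg (fun f => Bim.Hom.add f m) f.inv_hom_id
    have := h u (f.inv.add m)
    rw [hm] at this
    rw [← this]
    exact congrArg (fun f => Bim.Hom.add f _) f.hom_inv_id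
  tensor_mem hf hg u x := L.diagAct_map _ _ _ _ hf hg u x
  assoc_mem s s' s'' u x := L.diagAct_assoc s s' s'' u x
  left_mem {X} s u x := by
    refine Bim.t_hom_eq (M := Bim.one A) (f := (λ_ X).hom.add.comp (L.diagAct L.unitLMod s u))
      (g := AddMonoidHom.comp (s.act u) (λ_ X).hom.add) (fun (a : A) m => ?_) x
    change (λ_ X).hom.add (L.unitLMod.diag s (Bim.el a) m (L.Δ u)) = s.act u (X.l a m)
    rw [← s.act_s, ← s.mul]
    have h : ∀ ξ, (λ_ X).hom.add (L.unitLMod.diag s (Bim.el a) m ξ) =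
        s.act ((L.counitFst L.leftBim).add (L.mulFst L.leftBim (L.s a) ξ)) m := by
      intro ξ
      induction ξ using Bim.t_induction with
      | h0 => simp only [map_zero]; rfl
      | ha x y hx hy => simp only [map_add, hx, hy]; rfl
      | ht v w =>
        change X.l (L.ε (v * L.s a)) (s.act w m) = s.act (L.s (L.ε (v * L.s a)) * w) m
        rw [s.mul, s.act_s]
    rw [h]
    congr 2
    have h3 := L.Δ_mul u (L.s a) (L.s a ⊗ₜ 1) (L.Δ_of_s a).symm
    have h4 : L.Δ (u * L.s a) = L.mulFst L.leftBim (L.s a) (L.Δ u) := by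
      rw [h3, mulForm_tmul]
      refine Bim.t_hom_eq (f := (L.mulSnd 1)) (g := AddMonoidHom.id _) (fun v w => ?_) _
      exact congrArg (Bim.t (M := L.leftBim) (N := L.leftBim) v) (mul_one (w : U))
    rw [← h4, L.counitFst_Δ]
  right_mem {X} s u x := by
    refine Bim.t_hom_eq (N := Bim.one A) (f := (ρ_ X).hom.add.comp (L.diagAct s L.unitLMod u))
      (g := AddMonoidHom.comp (s.act u) (ρ_ X).hom.add) (fun m (a : A) => ?_) x
    change (ρ_ X).hom.add (s.diag L.unitLMod m (Bim.el a) (L.Δ u)) = s.act u (X.r (op a) m)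
    rw [← s.act_t, ← s.mul]
    have h : ∀ ξ, (ρ_ X).hom.add (s.diag L.unitLMod m (Bim.el a) ξ) =
        s.act ((L.counitSnd L.leftBim).add (L.mulSnd (L.s a) ξ)) m := by
      intro ξ
      induction ξ using Bim.t_induction with
      | h0 => simp only [map_zero]; rfl
      | ha x y hx hy => simp only [map_add, hx, hy]; rfl
      | ht v w =>
        change X.r (op (L.ε (w * L.s a))) (s.act v m) = s.act (L.t (op (L.ε (w * L.s a))) * v) m
        rw [s.mul, s.act_t]
    rw [h, ← L.takeuchi_Δ]
    congr 2
    have h5 : ∀ ξ, (L.counitSnd L.leftBim).add (L.mulFst L.leftBim (L.t (op a)) ξ) =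
        ((L.counitSnd L.leftBim).add ξ : U) * L.t (op a) := by
      intro ξ
      induction ξ using Bim.t_induction with
      | h0 => simp only [map_zero]; exact (zero_mul _).symm
      | ha x y hx hy => simp only [map_add, hx, hy]; exact (add_mul _ _ _).symm
      | ht v w => exact (mul_assoc (L.t (op (L.ε w))) v (L.t (op a))).symm
    rw [h5, L.counitSnd_Δ]

end LeftBialgebroid

end Modules

/-! ## Left comodules over a left bialgebroid -/

section LeftComodules

variable {A U : Type u} [Ring A] [Ring U]

/-- A left `U`-comodule structure on `M`: a left `A`-linear, coassociative and counital coaction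
`m ↦ m₍₋₁₎ ⊗ m₍₀₎` in `U_◃ ⊗_A M`. The right `A`-action recorded in `M` is required to be the one
induced by the coaction, `m a = ε(m₍₋₁₎ s(a)) m₍₀₎`. -/
structure LComodStr (L : LeftBialgebroid A U) (M : Bim A) where
  coact : M →+ Bim.tens L.leftBim M
  coact_l : ∀ a m, coact (M.l a m) = (Bim.tens L.leftBim M).l a (coact m)
  coassoc : ∀ m, (L.comulFst M).add (coact m) = Bim.snd L.leftBim coact coact_l (coact m)
  counit : ∀ m, (L.counitFst M).add (coact m) = m
  right_eq : ∀ a m, M.r (op a) m = (L.counitFst M).add (L.mulFst M (L.s a) (coact m))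

namespace LeftBialgebroid

variable (L : LeftBialgebroid A U)

lemma mulFst_Δ_s (a : A) (u : U) : L.Δ (u * L.s a) = L.mulFst L.leftBim (L.s a) (L.Δ u) := by
  rw [L.Δ_mul u (L.s a) (L.s a ⊗ₜ 1) (L.Δ_of_s a).symm, mulForm_tmul]
  refine Bim.t_hom_eq (f := (L.mulSnd 1)) (g := AddMonoidHom.id _) (fun v w => ?_) _
  exact congrArg (Bim.t (M := L.leftBim) (N := L.leftBim) v) (mul_one (w : U))

lemma mulSnd_Δ_t (a : Aᵐᵒᵖ) (u : U) : L.Δ (u * L.t a) = L.mulSnd (L.t a) (L.Δ u) := by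
  rw [L.Δ_mul u (L.t a) (1 ⊗ₜ L.t a) (L.Δ_of_t a).symm, mulForm_tmul]
  refine congrArg (L.mulSnd (L.t a)) ?_
  refine Bim.t_hom_eq (f := (L.mulFst _ 1)) (g := AddMonoidHom.id _) (fun v w => ?_) _
  exact congrArg (Bim.t (M := L.leftBim) (N := L.leftBim) · w) (mul_one (v : U))

lemma counitSnd_mulFst (a : Aᵐᵒᵖ) (ξ : Bim.tens L.leftBim L.leftBim) :
    (L.counitSnd L.leftBim).add (L.mulFst L.leftBim (L.t a) ξ) =
      ((L.counitSnd L.leftBim).add ξ : U) * L.t a := by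
  induction ξ using Bim.t_induction with
  | h0 => simp only [map_zero]; exact (zero_mul _).symm
  | ha x y hx hy => simp only [map_add, hx, hy]; exact (add_mul _ _ _).symm
  | ht v w => exact (mul_assoc (L.t (op (L.ε w))) v (L.t a)).symm

lemma counitFst_mulSnd (a : A) (ξ : Bim.tens L.leftBim L.leftBim) :
    (L.counitFst L.leftBim).add (L.mulSnd (L.s a) ξ) =
      ((L.counitFst L.leftBim).add ξ : U) * L.s a := by
  induction ξ using Bim.t_induction with
  | h0 => simp only [map_zero]; exact (zero_mul _).symm
  | ha x y hx hy => simp only [map_add, hx, hy]; exact (add_mul _ _ _).symm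
  | ht v w => exact (mul_assoc (L.s (L.ε v)) w (L.s a)).symm

/-- `u ⊗ m ↦ u z ⊗ g m`, for a left `A`-linear map `g`. -/
def mulMap {M X : Bim A} (z : U) (g : M →+ X) (hg : ∀ a m, g (M.l a m) = X.l a (g m)) :
    Bim.tens L.leftBim M →+ Bim.tens L.leftBim X :=
  (Bim.snd L.leftBim g hg).comp (L.mulFst M z)

@[simp] lemma mulMap_t {M X : Bim A} (z : U) (g : M →+ X)
    (hg : ∀ a m, g (M.l a m) = X.l a (g m)) (u : U) (m : M) :
    L.mulMap z g hg (Bim.t (M := L.leftBim) u m) = Bim.t (M := L.leftBim) (u * z) (g m) := rfl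

lemma mulFst_add (X : Bim A) (z z' : U) (ξ : Bim.tens L.leftBim X) :
    L.mulFst X (z + z') ξ = L.mulFst X z ξ + L.mulFst X z' ξ := by
  induction ξ using Bim.t_induction with
  | h0 => simp only [map_zero, add_zero]
  | ha x y hx hy => simp only [map_add, hx, hy]; abel
  | ht u x =>
    exact (congrArg (Bim.t (M := L.leftBim) · x) (mul_add u z z')).trans (Bim.add_t _ _ _)

lemma mulFst_one (X : Bim A) (ξ : Bim.tens L.leftBim X) : L.mulFst X 1 ξ = ξ := by
  induction ξ using Bim.t_induction with
  | h0 => simp only [map_zero]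
  | ha x y hx hy => simp only [map_add, hx, hy]
  | ht u x => exact congrArg (Bim.t (M := L.leftBim) · x) (mul_one u)

lemma mulFst_mul (X : Bim A) (z w : U) (ξ : Bim.tens L.leftBim X) :
    L.mulFst X (z * w) ξ = L.mulFst X w (L.mulFst X z ξ) := by
  induction ξ using Bim.t_induction with
  | h0 => simp only [map_zero]
  | ha x y hx hy => simp only [map_add, hx, hy]
  | ht u x => exact congrArg (Bim.t (M := L.leftBim) · x) (mul_assoc u z w).symm

lemma mulMap_add {M X : Bim A} (z z' : U) (g : M →+ X) (hg : ∀ a m, g (M.l a m) = X.l a (g m))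
    (ξ : Bim.tens L.leftBim M) :
    L.mulMap (z + z') g hg ξ = L.mulMap z g hg ξ + L.mulMap z' g hg ξ :=
  (congrArg (Bim.snd L.leftBim g hg) (L.mulFst_add M z z' ξ)).trans (map_add _ _ _)

lemma mulMap_mul {M X : Bim A} (z w : U) (g : M →+ X) (hg : ∀ a m, g (M.l a m) = X.l a (g m))
    (ξ : Bim.tens L.leftBim M) :
    L.mulMap (z * w) g hg ξ = L.mulMap w g hg (L.mulFst M z ξ) :=
  congrArg (Bim.snd L.leftBim g hg) (L.mulFst_mul M z w ξ)

end LeftBialgebroid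

namespace LComodStr

variable {L : LeftBialgebroid A U} {M N P : Bim A} (s : LComodStr L M) (s' : LComodStr L N)

lemma coact_r (a : A) (m : M) : s.coact (M.r (op a) m) = L.mulFst M (L.s a) (s.coact m) := by
  have h1 : ∀ ξ, s.coact ((L.counitFst M).add (L.mulFst M (L.s a) ξ)) =
      (L.counitFst (Bim.tens L.leftBim M)).add (L.mulFst _ (L.s a)
        (Bim.snd L.leftBim s.coact s.coact_l ξ)) := fun ξ => by
    induction ξ using Bim.t_induction with
    | h0 => simp only [map_zero]
    | ha x y hx hy => simp only [map_add, hx, hy]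
    | ht u m => exact s.coact_l (L.ε (u * L.s a)) m
  have h2 : ∀ ξ, (L.counitFst (Bim.tens L.leftBim M)).add (L.mulFst _ (L.s a)
        ((L.comulFst M).add ξ)) = L.mulFst M (L.s a) ξ := fun ξ => by
    induction ξ using Bim.t_induction with
    | h0 => simp only [map_zero]
    | ha x y hx hy => simp only [map_add, hx, hy]
    | ht u m =>
      have h3 : ∀ η : Bim.tens L.leftBim L.leftBim,
          (L.counitFst (Bim.tens L.leftBim M)).add (L.mulFst _ (L.s a)
            ((α_ L.leftBim L.leftBim M).hom.add (Bim.t η m))) =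
          Bim.t (M := L.leftBim) ((L.counitFst L.leftBim).add (L.mulFst _ (L.s a) η)) m :=
        fun η => by
          induction η using Bim.t_induction with
          | h0 => simp only [map_zero, Bim.zero_t]
          | ha x y hx hy => simp only [map_add, Bim.add_t, hx, hy]; exact (Bim.add_t _ _ _).symm
          | ht v w => rfl
      rw [L.comulFst_t, h3, ← L.mulFst_Δ_s, L.counitFst_Δ]; rfl
  rw [s.right_eq, h1, ← s.coassoc, h2]

lemma takeuchi (a : A) (m : M) :
    L.mulFst M (L.t (op a)) (s.coact m) = (Bim.tens L.leftBim M).r (op a) (s.coact m) := by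
  have hg : ∀ b (x : Bim.tens L.leftBim M),
      ((L.counitFst M).add.comp (L.mulFst M (L.s a))) ((Bim.tens L.leftBim M).l b x) =
        M.l b (((L.counitFst M).add.comp (L.mulFst M (L.s a))) x) := fun b x => by
    induction x using Bim.t_induction with
    | h0 => simp only [map_zero]
    | ha x y hx hy => simp only [map_add, hx, hy]
    | ht u m =>
      change M.l (L.ε (L.s b * u * L.s a)) m = M.l b (M.l (L.ε (u * L.s a)) m)
      rw [mul_assoc, L.ε_s, M.l_mul]
  have h1 : ∀ ξ : Bim.tens L.leftBim M, (Bim.tens L.leftBim M).r (op a) ξ =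
      Bim.snd L.leftBim _ hg (Bim.snd L.leftBim s.coact s.coact_l ξ) := fun ξ => by
    induction ξ using Bim.t_induction with
    | h0 => simp only [map_zero]
    | ha x y hx hy => simp only [map_add, hx, hy]
    | ht u m => exact congrArg (Bim.t (M := L.leftBim) u) (s.right_eq a m)
  have h2 : ∀ ξ : Bim.tens L.leftBim M, Bim.snd L.leftBim _ hg ((L.comulFst M).add ξ) =
      L.mulFst M (L.t (op a)) ξ := fun ξ => by
    induction ξ using Bim.t_induction with
    | h0 => simp only [map_zero]
    | ha x y hx hy => simp only [map_add, hx, hy]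
    | ht u m =>
      have h3 : ∀ η : Bim.tens L.leftBim L.leftBim,
          Bim.snd L.leftBim _ hg ((α_ L.leftBim L.leftBim M).hom.add (Bim.t η m)) =
          Bim.t (M := L.leftBim) ((L.counitSnd L.leftBim).add (L.mulSnd (L.s a) η)) m :=
        fun η => by
          induction η using Bim.t_induction with
          | h0 => simp only [map_zero, Bim.zero_t]
          | ha x y hx hy => simp only [map_add, Bim.add_t, hx, hy]; exact (Bim.add_t _ _ _).symm
          | ht v w => exact (Bim.t_bal (M := L.leftBim) _ v m).symm
      rw [L.comulFst_t, h3, ← L.takeuchi_Δ, L.counitSnd_mulFst, L.counitSnd_Δ]; rfl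
  rw [h1, ← s.coassoc, h2]

variable (M) in
/-- `u ⊗ m ↦ u v ⊗ (m ⊗ n)` -/
def shift (L : LeftBialgebroid A U) (v : U) (n : N) :
    Bim.tens L.leftBim M →+ Bim.tens L.leftBim (Bim.tens M N) :=
  L.mulMap v (Bal.tmulHom.flip n) (fun _ _ => rfl)

lemma shift_add (v : U) (n n' : N) (ξ : Bim.tens L.leftBim M) :
    shift M L v (n + n') ξ = shift M L v n ξ + shift M L v n' ξ := by
  induction ξ using Bim.t_induction with
  | h0 => simp only [map_zero, add_zero]
  | ha x y hx hy => simp only [map_add, hx, hy]; abel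
  | ht u x =>
    exact (congrArg (Bim.t (M := L.leftBim) (u * v)) (Bim.t_add x n n')).trans (Bim.t_add _ _ _)

lemma add_shift (v v' : U) (n : N) (ξ : Bim.tens L.leftBim M) :
    shift M L (v + v') n ξ = shift M L v n ξ + shift M L v' n ξ :=
  L.mulMap_add v v' _ _ ξ

lemma shift_mul (v w : U) (n : N) (ξ : Bim.tens L.leftBim M) :
    shift M L (v * w) n ξ = shift M L w n (L.mulFst M v ξ) := L.mulMap_mul v w _ _ ξ

/-- `v ⊗ n ↦ m₍₋₁₎ v ⊗ (m₍₀₎ ⊗ n)` -/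
def mulCoact (m : M) : Bim.tens L.leftBim N →+ Bim.tens L.leftBim (Bim.tens M N) :=
  Bim.tlift (M := L.leftBim) (biHom (M := U) (fun v n => shift M L v n (s.coact m))
      (fun v n n' => shift_add v n n' _) (fun v v' n => add_shift v v' n _))
    (fun a v n => by
      change shift M L (L.t (op a) * v) n (s.coact m) = shift M L v (N.l a n) (s.coact m)
      have h1 : ∀ ξ, shift M L v (N.l a n) ξ =
          shift M L v n ((Bim.tens L.leftBim M).r (op a) ξ) := fun ξ => by
        induction ξ using Bim.t_induction with
        | h0 => simp only [map_zero]
        | ha x y hx hy => simp only [map_add, hx, hy]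
        | ht u x => exact congrArg (Bim.t (M := L.leftBim) (u * v)) (Bim.t_bal a x n).symm
      rw [h1, ← s.takeuchi]
      exact L.mulMap_mul _ _ _ _ _)

@[simp] lemma mulCoact_t (m : M) (v : U) (n : N) :
    s.mulCoact m (Bim.t (M := L.leftBim) v n) = shift M L v n (s.coact m) := rfl

lemma mulCoact_add (m m' : M) (η : Bim.tens L.leftBim N) :
    s.mulCoact (m + m') η = s.mulCoact m η + s.mulCoact m' η := by
  induction η using Bim.t_induction with
  | h0 => simp only [map_zero, add_zero]
  | ha x y hx hy => simp only [map_add, hx, hy]; abel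
  | ht v n => simp only [mulCoact_t, map_add]

lemma mulCoact_r (a : A) (m : M) (η : Bim.tens L.leftBim N) :
    s.mulCoact (M.r (op a) m) η = s.mulCoact m ((Bim.tens L.leftBim N).l a η) := by
  induction η using Bim.t_induction with
  | h0 => simp only [map_zero]
  | ha x y hx hy => simp only [map_add, hx, hy]
  | ht v n =>
    change shift M L v n (s.coact (M.r (op a) m)) = shift M L (L.s a * v) n (s.coact m)
    rw [s.coact_r]
    exact (L.mulMap_mul _ _ _ _ _).symm

lemma mulCoact_l (a : A) (m : M) (η : Bim.tens L.leftBim N) :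
    s.mulCoact (M.l a m) η = (Bim.tens L.leftBim (Bim.tens M N)).l a (s.mulCoact m η) := by
  induction η using Bim.t_induction with
  | h0 => simp only [map_zero]
  | ha x y hx hy => simp only [map_add, hx, hy]
  | ht v n =>
    rw [mulCoact_t, mulCoact_t, s.coact_l]
    generalize s.coact m = ξ
    induction ξ using Bim.t_induction with
    | h0 => simp only [map_zero]
    | ha x y hx hy => simp only [map_add, hx, hy]
    | ht u x => exact congrArg (Bim.t (M := L.leftBim) · _) (mul_assoc (L.s a) u v)

/-- The codiagonal coaction `m ⊗ n ↦ m₍₋₁₎ n₍₋₁₎ ⊗ (m₍₀₎ ⊗ n₍₀₎)`. -/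
def codiag : Bim.tens M N →+ Bim.tens L.leftBim (Bim.tens M N) :=
  Bim.tlift (biHom (fun m n => s.mulCoact m (s'.coact n))
      (fun m n n' => by rw [map_add, map_add])
      (fun m m' n => s.mulCoact_add m m' _))
    (fun a m n => (s.mulCoact_r a m _).trans (congrArg _ (s'.coact_l a n).symm))

@[simp] lemma codiag_t (m : M) (n : N) :
    s.codiag s' (Bim.t m n) = s.mulCoact m (s'.coact n) := rfl

lemma codiag_l (a : A) (x : Bim.tens M N) :
    s.codiag s' ((Bim.tens M N).l a x) = (Bim.tens L.leftBim (Bim.tens M N)).l a (s.codiag s' x) := by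
  induction x using Bim.t_induction with
  | h0 => simp only [map_zero]
  | ha x y hx hy => simp only [map_add, hx, hy]
  | ht m n => exact s.mulCoact_l a m _

lemma counit_mulCoact (z : U) (m : M) (η : Bim.tens L.leftBim N) :
    (L.counitFst (Bim.tens M N)).add (L.mulFst _ z (s.mulCoact m η)) =
      Bim.t m ((L.counitFst N).add (L.mulFst N z η)) := by
  induction η using Bim.t_induction with
  | h0 => simp only [map_zero, Bim.t_zero]
  | ha x y hx hy => simp only [map_add, Bim.t_add, hx, hy]
  | ht v n =>
    have h1 : ∀ ξ, (L.counitFst (Bim.tens M N)).add (L.mulFst _ z (shift M L v n ξ)) =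
        Bim.t ((L.counitFst M).add (L.mulFst M (L.t (op (L.ε (v * z)))) ξ)) n := fun ξ => by
      induction ξ using Bim.t_induction with
      | h0 => simp only [map_zero, Bim.zero_t]
      | ha x y hx hy => simp only [map_add, Bim.add_t, hx, hy]
      | ht u x =>
        change Bim.t (M.l (L.ε (u * v * z)) x) n = Bim.t (M.l (L.ε (u * L.t _)) x) n
        rw [L.ε_mul_t, mul_assoc]
    rw [mulCoact_t, h1, s.takeuchi, Bim.hom_r, s.counit, Bim.t_bal]; rfl

/-- `u ⊗ m ↦ u z ⊗ m ⋆ ζ`, where `m ⋆ (v ⊗ n) = m₍₋₁₎ v ⊗ (m₍₀₎ ⊗ n)` -/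
def dbl (z : U) (ζ : Bim.tens L.leftBim N) :
    Bim.tens L.leftBim M →+ Bim.tens L.leftBim (Bim.tens L.leftBim (Bim.tens M N)) :=
  L.mulMap z (AddMonoidHom.mk' (fun m => s.mulCoact m ζ) (fun m m' => s.mulCoact_add m m' ζ))
    (fun a m => s.mulCoact_l a m ζ)

lemma dbl_add (z : U) (ζ ζ' : Bim.tens L.leftBim N) (ξ : Bim.tens L.leftBim M) :
    s.dbl z (ζ + ζ') ξ = s.dbl z ζ ξ + s.dbl z ζ' ξ := by
  induction ξ using Bim.t_induction with
  | h0 => simp only [map_zero, add_zero]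
  | ha x y hx hy => simp only [map_add, hx, hy]; abel
  | ht u x =>
    exact (congrArg (Bim.t (M := L.leftBim) (u * z)) (map_add (s.mulCoact x) ζ ζ')).trans
      (Bim.t_add _ _ _)

lemma add_dbl (z z' : U) (ζ : Bim.tens L.leftBim N) (ξ : Bim.tens L.leftBim M) :
    s.dbl (z + z') ζ ξ = s.dbl z ζ ξ + s.dbl z' ζ ξ :=
  L.mulMap_add z z' _ _ ξ

/-- `z ⊗ ζ ↦ m₍₋₁₎ z ⊗ m₍₀₎ ⋆ ζ` -/
def dblCoact (m : M) : Bim.tens L.leftBim (Bim.tens L.leftBim N) →+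
    Bim.tens L.leftBim (Bim.tens L.leftBim (Bim.tens M N)) :=
  Bim.tlift (M := L.leftBim) (biHom (M := U) (fun z ζ => s.dbl z ζ (s.coact m))
      (fun z ζ ζ' => s.dbl_add z ζ ζ' _) (fun z z' ζ => s.add_dbl z z' ζ _))
    (fun a z ζ => by
      change s.dbl (L.t (op a) * z) ζ (s.coact m) =
        s.dbl z ((Bim.tens L.leftBim N).l a ζ) (s.coact m)
      have h1 : ∀ ξ, s.dbl z ((Bim.tens L.leftBim N).l a ζ) ξ =
          s.dbl z ζ ((Bim.tens L.leftBim M).r (op a) ξ) := fun ξ => by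
        induction ξ using Bim.t_induction with
        | h0 => simp only [map_zero]
        | ha x y hx hy => simp only [map_add, hx, hy]
        | ht u x => exact congrArg (Bim.t (M := L.leftBim) (u * z)) (s.mulCoact_r a x ζ).symm
      rw [h1, ← s.takeuchi]
      exact L.mulMap_mul _ _ _ _ _)

@[simp] lemma dblCoact_t (m : M) (z : U) (ζ : Bim.tens L.leftBim N) :
    s.dblCoact m (Bim.t (M := L.leftBim) z ζ) = s.dbl z ζ (s.coact m) := rfl

variable (M) in
/-- `u ⊗ (v ⊗ m) ↦ u z ⊗ (v w ⊗ (m ⊗ n))` for a formal tensor `z ⊗ w` -/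
def shift2 (L : LeftBialgebroid A U) (n : N) : U ⊗[ℤ] U →+
    Bim.tens L.leftBim (Bim.tens L.leftBim M) →+
      Bim.tens L.leftBim (Bim.tens L.leftBim (Bim.tens M N)) :=
  Bal.fLift (biHom (fun z w => L.mulMap z (shift M L w n) (fun a ξ => by
        induction ξ using Bim.t_induction with
        | h0 => simp only [map_zero]
        | ha x y hx hy => simp only [map_add, hx, hy]
        | ht u x => exact congrArg (Bim.t (M := L.leftBim) · _) (mul_assoc (L.s a) u w)))
    (fun z w w' => Bal.hom_ext fun u ξ => by
      exact (congrArg (Bim.t (M := L.leftBim) (u * z)) (add_shift w w' n ξ)).trans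
        (Bim.t_add _ _ _))
    (fun z z' w => Bal.hom_ext fun u ξ => by
      exact (congrArg (Bim.t (M := L.leftBim) · _) (mul_add u z z')).trans (Bim.add_t _ _ _)))

lemma comul_shift (v : U) (n : N) (y : U ⊗[ℤ] U) (hy : L.mkL y = L.Δ v)
    (ξ : Bim.tens L.leftBim M) :
    (L.comulFst _).add (shift M L v n ξ) = shift2 M L n y ((L.comulFst M).add ξ) := by
  induction ξ using Bim.t_induction with
  | h0 => simp only [map_zero]
  | ha x z hx hz => simp only [map_add, hx, hz]
  | ht u x =>
    change (α_ L.leftBim L.leftBim (Bim.tens M N)).hom.add (Bim.t (L.Δ (u * v)) (Bim.t x n)) =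
      shift2 M L n y ((α_ L.leftBim L.leftBim M).hom.add (Bim.t (L.Δ u) x))
    rw [L.Δ_mul u v y hy]
    generalize L.Δ u = η
    clear hy
    induction y with
    | zero => simp only [map_zero, AddMonoidHom.zero_apply, Bim.zero_t]
    | add y y' hy hy' => simp only [map_add, AddMonoidHom.add_apply, Bim.add_t, hy, hy']
    | tmul z w =>
      induction η using Bim.t_induction with
      | h0 => simp only [map_zero, Bim.zero_t]
      | ha x y hx hy => simp only [map_add, Bim.add_t, hx, hy]
      | ht a b => rfl

lemma shift2_coact (n : N) (y : U ⊗[ℤ] U) (m : M) :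
    shift2 M L n y (Bim.snd L.leftBim s.coact s.coact_l (s.coact m)) =
      s.dblCoact m ((α_ L.leftBim L.leftBim N).hom.add (Bim.t (L.mkL y) n)) := by
  induction y with
  | zero => simp only [map_zero, AddMonoidHom.zero_apply, Bim.zero_t]
  | add y y' hy hy' => simp only [map_add, AddMonoidHom.add_apply, Bim.add_t, hy, hy']
  | tmul z w =>
    change _ = s.dbl z (Bim.t (M := L.leftBim) w n) (s.coact m)
    generalize s.coact m = ξ
    induction ξ using Bim.t_induction with
    | h0 => simp only [map_zero]
    | ha x y hx hy => simp only [map_add, hx, hy]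
    | ht u x => rfl

lemma comul_mulCoact (m : M) (η : Bim.tens L.leftBim N) :
    (L.comulFst _).add (s.mulCoact m η) = s.dblCoact m ((L.comulFst N).add η) := by
  induction η using Bim.t_induction with
  | h0 => simp only [map_zero]
  | ha x y hx hy => simp only [map_add, hx, hy]
  | ht v n =>
    obtain ⟨y, hy⟩ := Bal.mk_surjective (L.Δ v)
    rw [mulCoact_t, comul_shift v n y hy, s.coassoc, s.shift2_coact, L.comulFst_t]
    exact congrArg (fun η => s.dblCoact m ((α_ L.leftBim L.leftBim N).hom.add (Bim.t η n))) hy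

lemma dblCoact_coact (m : M) (η : Bim.tens L.leftBim N) :
    s.dblCoact m (Bim.snd L.leftBim s'.coact s'.coact_l η) =
      Bim.snd L.leftBim (s.codiag s') (s.codiag_l s') (s.mulCoact m η) := by
  induction η using Bim.t_induction with
  | h0 => simp only [map_zero]
  | ha x y hx hy => simp only [map_add, hx, hy]
  | ht v n =>
    rw [mulCoact_t, Bim.snd_t, dblCoact_t]
    generalize s.coact m = ξ
    induction ξ using Bim.t_induction with
    | h0 => simp only [map_zero]
    | ha x y hx hy => simp only [map_add, hx, hy]
    | ht u x => rfl

/-- The tensor product of comodules, with the codiagonal coaction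
`m ⊗ n ↦ m₍₋₁₎ n₍₋₁₎ ⊗ (m₍₀₎ ⊗ n₍₀₎)`. -/
def tensor : LComodStr L (Bim.tens M N) where
  coact := s.codiag s'
  coact_l := s.codiag_l s'
  coassoc x := by
    induction x using Bim.t_induction with
    | h0 => simp only [map_zero]
    | ha x y hx hy => simp only [map_add, hx, hy]
    | ht m n => rw [codiag_t, comul_mulCoact, s'.coassoc, dblCoact_coact]
  counit x := by
    induction x using Bim.t_induction with
    | h0 => simp only [map_zero]
    | ha x y hx hy => simp only [map_add, hx, hy]
    | ht m n =>
      have := s.counit_mulCoact 1 m (s'.coact n)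
      rwa [L.mulFst_one, L.mulFst_one, s'.counit] at this
  right_eq a x := by
    induction x using Bim.t_induction with
    | h0 => simp only [map_zero]
    | ha x y hx hy => simp only [map_add, hx, hy]
    | ht m n => rw [codiag_t, counit_mulCoact, ← s'.right_eq, Bim.tens_r]

/-- The unit comodule `A`, with coaction `a ↦ s(a) ⊗ 1`. -/
def unit (L : LeftBialgebroid A U) : LComodStr L (Bim.one A) where
  coact := AddMonoidHom.mk' (fun a : A => Bim.t (M := L.leftBim) (L.s a) (Bim.el 1)) (fun (a b : A) =>
    (congrArg (Bim.t (M := L.leftBim) · (Bim.el 1)) (map_add L.s a b)).trans (Bim.add_t _ _ _))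
  coact_l a (b : A) := congrArg (Bim.t (M := L.leftBim) · (Bim.el 1)) (map_mul L.s a b)
  coassoc (a : A) := by
    change (α_ L.leftBim L.leftBim (Bim.one A)).hom.add (Bim.t (L.Δ (L.s a)) (Bim.el 1)) = Bim.t (M := L.leftBim) (L.s a)
      (Bim.t (M := L.leftBim) (L.s 1) (Bim.el 1))
    rw [L.Δ_of_s, map_one L.s]; rfl
  counit (a : A) := by
    change L.ε (L.s a) * 1 = a
    rw [L.ε_of_s, mul_one]
  right_eq a (b : A) := by
    change b * a = L.ε (L.s b * L.s a) * 1
    rw [← map_mul, L.ε_of_s, mul_one]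

end LComodStr

/-- Left comodules, with colinear maps. -/
abbrev LComod (L : LeftBialgebroid A U) : StrOn (Bim A) where
  Str := LComodStr L
  IsHom s s' f := ∀ m, (Bim.snd L.leftBim f.add f.map_l) (s.coact m) = s'.coact (f.add m)
  id_mem {X} s m := by
    refine Bim.t_hom_eq (f := Bim.snd L.leftBim (Bim.Hom.add (𝟙 X)) _)
      (g := AddMonoidHom.id _) (fun _ _ => rfl) _
  comp_mem {X Y Z s s' s'' f g} h h' m := by
    rw [Bim.comp_add, ← h', ← h]
    generalize s.coact m = ξ
    induction ξ using Bim.t_induction with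
    | h0 => simp only [map_zero]
    | ha x y hx hy => simp only [map_add, hx, hy]
    | ht u x => rfl

/-- The monoidal structure on left comodules over a left bialgebroid. -/
def monLComod (L : LeftBialgebroid A U) : (LComod L).Mon where
  tensor s s' := s.tensor s'
  unit := LComodStr.unit L
  inv_mem {X Y s s'} f h m := by
    have hm : f.hom.add (f.inv.add m) = m := congrArg (fun f => Bim.Hom.add f m) f.inv_hom_id
    have h1 := h (f.inv.add m)
    rw [hm] at h1
    rw [← h1]
    generalize s.coact (f.inv.add m) = ξ
    induction ξ using Bim.t_induction with
    | h0 => simp only [map_zero]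
    | ha x y hx hy => simp only [map_add, hx, hy]
    | ht u x =>
      exact congrArg (Bim.t (M := L.leftBim) u) (congrArg (fun f => Bim.Hom.add f x) f.hom_inv_id)
  tensor_mem {X Y X' Y' s s' p p' f g} hf hg x := by
    induction x using Bim.t_induction with
    | h0 => simp only [map_zero]
    | ha x y hx hy => simp only [map_add, hx, hy]
    | ht m n =>
      change Bim.snd L.leftBim (Bim.tmap f g).add (Bim.tmap f g).map_l
        (LComodStr.mulCoact s m (LComodStr.coact p n)) =
        LComodStr.mulCoact s' (f.add m) (LComodStr.coact p' (g.add n))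
      rw [← hg n]
      generalize LComodStr.coact p n = η
      induction η using Bim.t_induction with
      | h0 => simp only [map_zero]
      | ha x y hx hy => simp only [map_add, hx, hy]
      | ht v n =>
        rw [LComodStr.mulCoact_t, Bim.snd_t, LComodStr.mulCoact_t, ← hf m]
        generalize LComodStr.coact s m = ξ
        induction ξ using Bim.t_induction with
        | h0 => simp only [map_zero]
        | ha x y hx hy => simp only [map_add, hx, hy]
        | ht u x => rfl
  assoc_mem {X Y Z} s s' s'' x := by
    induction x using Bim.t_induction with
    | h0 => simp only [map_zero]
    | ha x y hx hy => simp only [map_add, hx, hy]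
    | ht x p =>
      induction x using Bim.t_induction with
      | h0 => simp only [map_zero, Bim.zero_t]
      | ha x y hx hy => simp only [map_add, Bim.add_t, hx, hy]
      | ht m n =>
        change Bim.snd L.leftBim (Bim.assoc X Y Z).hom.add (Bim.assoc X Y Z).hom.map_l
          (LComodStr.mulCoact (LComodStr.tensor s s') (Bim.t m n) (LComodStr.coact s'' p)) =
          LComodStr.mulCoact s m (LComodStr.mulCoact s' n (LComodStr.coact s'' p))
        generalize LComodStr.coact s'' p = ζ
        induction ζ using Bim.t_induction with
        | h0 => simp only [map_zero]
        | ha x y hx hy => simp only [map_add, hx, hy]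
        | ht w p =>
          rw [LComodStr.mulCoact_t, LComodStr.mulCoact_t]
          change Bim.snd L.leftBim _ _ (LComodStr.shift _ L w p
            (LComodStr.mulCoact s m (LComodStr.coact s' n))) = _
          generalize LComodStr.coact s' n = η
          induction η using Bim.t_induction with
          | h0 => simp only [map_zero]
          | ha x y hx hy => simp only [map_add, hx, hy]
          | ht v n =>
            change _ = LComodStr.shift _ L (v * w) (Bim.t n p) (LComodStr.coact s m)
            rw [LComodStr.mulCoact_t]
            generalize LComodStr.coact s m = ξ
            induction ξ using Bim.t_induction with
            | h0 => simp only [map_zero]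
            | ha x y hx hy => simp only [map_add, hx, hy]
            | ht u m => exact congrArg (Bim.t (M := L.leftBim) · _) (mul_assoc u v w)
  left_mem {X} s x := by
    refine Bim.t_hom_eq (M := Bim.one A)
      (f := (Bim.snd L.leftBim (λ_ X).hom.add (λ_ X).hom.map_l).comp
        ((LComodStr.unit L).codiag s)) (g := (LComodStr.coact s).comp (λ_ X).hom.add)
      (fun (a : A) m => ?_) x
    change Bim.snd L.leftBim (λ_ X).hom.add (λ_ X).hom.map_l
      ((LComodStr.unit L).mulCoact a (LComodStr.coact s m)) = LComodStr.coact s (X.l a m)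
    rw [LComodStr.coact_l]
    generalize LComodStr.coact s m = ξ
    induction ξ using Bim.t_induction with
    | h0 => simp only [map_zero]
    | ha x y hx hy => simp only [map_add, hx, hy]
    | ht u x => exact congrArg (Bim.t (M := L.leftBim) (L.s a * u)) (X.l_one x)
  right_mem {X} s x := by
    refine Bim.t_hom_eq (N := Bim.one A)
      (f := (Bim.snd L.leftBim (ρ_ X).hom.add (ρ_ X).hom.map_l).comp
        (LComodStr.codiag s (LComodStr.unit L))) (g := (LComodStr.coact s).comp (ρ_ X).hom.add)
      (fun m (a : A) => ?_) x
    change Bim.snd L.leftBim (ρ_ X).hom.add (ρ_ X).hom.map_l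
      (LComodStr.shift _ L (L.s a) (Bim.el 1) (LComodStr.coact s m)) =
        LComodStr.coact s (X.r (op a) m)
    rw [LComodStr.coact_r]
    generalize LComodStr.coact s m = ξ
    induction ξ using Bim.t_induction with
    | h0 => simp only [map_zero]
    | ha x y hx hy => simp only [map_add, hx, hy]
    | ht u x => exact congrArg (Bim.t (M := L.leftBim) (u * L.s a)) (X.r_one x)

end LeftComodules

/-! ## Right comodules -/

section RightComodules

variable {A U : Type u} [Ring A] [Ring U]

namespace LeftBialgebroid

variable (L : LeftBialgebroid A U)

/-- `x ⊗ u ↦ x ⊗ u z` -/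
def mulLast (X : Bim A) (z : U) : Bim.tens X L.leftBim →+ Bim.tens X L.leftBim :=
  Bim.snd X (AddMonoidHom.mulRight z) (fun a u => mul_assoc (L.s a) u z)

/-- `x ⊗ u ↦ (x ⊗ u₍₁₎) ⊗ u₍₂₎` -/
def comulSnd (X : Bim A) : Bim.tens X L.leftBim ⟶ Bim.tens (Bim.tens X L.leftBim) L.leftBim :=
  X ◁ L.coring.comul ≫ (α_ X L.leftBim L.leftBim).inv

lemma comulSnd_t (X : Bim A) (u : U) (x : X) :
    (L.comulSnd X).add (Bim.t (N := L.leftBim) x u) =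
      (α_ X L.leftBim L.leftBim).inv.add (Bim.t x (L.Δ u)) := rfl

lemma mulLast_add (X : Bim A) (z z' : U) (ξ : Bim.tens X L.leftBim) :
    L.mulLast X (z + z') ξ = L.mulLast X z ξ + L.mulLast X z' ξ := by
  induction ξ using Bim.t_induction with
  | h0 => simp only [map_zero, add_zero]
  | ha x y hx hy => simp only [map_add, hx, hy]; abel
  | ht x u =>
    exact (congrArg (Bim.t (N := L.leftBim) x) (mul_add u z z')).trans (Bim.t_add _ _ _)

lemma mulLast_one (X : Bim A) (ξ : Bim.tens X L.leftBim) : L.mulLast X 1 ξ = ξ := by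
  induction ξ using Bim.t_induction with
  | h0 => simp only [map_zero]
  | ha x y hx hy => simp only [map_add, hx, hy]
  | ht x u => exact congrArg (Bim.t (N := L.leftBim) x) (mul_one u)

lemma mulLast_mul (X : Bim A) (z w : U) (ξ : Bim.tens X L.leftBim) :
    L.mulLast X (z * w) ξ = L.mulLast X w (L.mulLast X z ξ) := by
  induction ξ using Bim.t_induction with
  | h0 => simp only [map_zero]
  | ha x y hx hy => simp only [map_add, hx, hy]
  | ht x u => exact congrArg (Bim.t (N := L.leftBim) x) (mul_assoc u z w).symm

/-- `m ⊗ u ↦ g m ⊗ u z`, for a right `A`-linear map `g`. -/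
def mapMul {M X : Bim A} (z : U) (g : M →+ X) (hg : ∀ a m, g (M.r (op a) m) = X.r (op a) (g m)) :
    Bim.tens M L.leftBim →+ Bim.tens X L.leftBim :=
  (Bim.fst L.leftBim g hg).comp (L.mulLast M z)

@[simp] lemma mapMul_t {M X : Bim A} (z : U) (g : M →+ X)
    (hg : ∀ a m, g (M.r (op a) m) = X.r (op a) (g m)) (u : U) (m : M) :
    L.mapMul z g hg (Bim.t (N := L.leftBim) m u) = Bim.t (N := L.leftBim) (g m) (u * z) := rfl

lemma mapMul_add {M X : Bim A} (z z' : U) (g : M →+ X)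
    (hg : ∀ a m, g (M.r (op a) m) = X.r (op a) (g m)) (ξ : Bim.tens M L.leftBim) :
    L.mapMul (z + z') g hg ξ = L.mapMul z g hg ξ + L.mapMul z' g hg ξ :=
  (congrArg (Bim.fst L.leftBim g hg) (L.mulLast_add M z z' ξ)).trans (map_add _ _ _)

lemma mapMul_mul {M X : Bim A} (z w : U) (g : M →+ X)
    (hg : ∀ a m, g (M.r (op a) m) = X.r (op a) (g m)) (ξ : Bim.tens M L.leftBim) :
    L.mapMul (z * w) g hg ξ = L.mapMul w g hg (L.mulLast M z ξ) :=
  congrArg (Bim.fst L.leftBim g hg) (L.mulLast_mul M z w ξ)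

end LeftBialgebroid

/-- A right comodule structure on `M` over the coring underlying a left bialgebroid `U`: a right
`A`-linear, coassociative and counital coaction `m ↦ m₍₀₎ ⊗ m₍₁₎` in `M ⊗_A ▹U`. The left
`A`-action recorded in `M` is required to be the induced one, `a m = m₍₀₎ ε(m₍₁₎ t(a))`.

For a right bialgebroid `V`, which is by definition a left bialgebroid structure on `Vᵒᵖ`, these
are the right `V`-comodules; in terms of the multiplication of `V`, the coaction takes values in
`M ⊗_A ▸V` and `a m = m⁽⁰⁾ ∂(s(a) m⁽¹⁾)`. -/
structure RComodStr (L : LeftBialgebroid A U) (M : Bim A) where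
  coact : M →+ Bim.tens M L.leftBim
  coact_r : ∀ a m, coact (M.r (op a) m) = (Bim.tens M L.leftBim).r (op a) (coact m)
  coassoc : ∀ m, (L.comulSnd M).add (coact m) = Bim.fst L.leftBim coact coact_r (coact m)
  counit : ∀ m, (L.counitSnd M).add (coact m) = m
  left_eq : ∀ a m, M.l a m = (L.counitSnd M).add (L.mulLast M (L.t (op a)) (coact m))

namespace RComodStr

variable {L : LeftBialgebroid A U} {M N P : Bim A} (s : RComodStr L M) (s' : RComodStr L N)

lemma coact_l (a : A) (m : M) : s.coact (M.l a m) = L.mulLast M (L.t (op a)) (s.coact m) := by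
  have h1 : ∀ ξ, s.coact ((L.counitSnd M).add (L.mulLast M (L.t (op a)) ξ)) =
      (L.counitSnd (Bim.tens M L.leftBim)).add (L.mulLast _ (L.t (op a))
        (Bim.fst L.leftBim s.coact s.coact_r ξ)) := fun ξ => by
    induction ξ using Bim.t_induction with
    | h0 => simp only [map_zero]
    | ha x y hx hy => simp only [map_add, hx, hy]
    | ht m u => exact s.coact_r (L.ε (u * L.t (op a))) m
  have h2 : ∀ ξ, (L.counitSnd (Bim.tens M L.leftBim)).add (L.mulLast _ (L.t (op a))
        ((L.comulSnd M).add ξ)) = L.mulLast M (L.t (op a)) ξ := fun ξ => by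
    induction ξ using Bim.t_induction with
    | h0 => simp only [map_zero]
    | ha x y hx hy => simp only [map_add, hx, hy]
    | ht m u =>
      have h3 : ∀ η : Bim.tens L.leftBim L.leftBim,
          (L.counitSnd (Bim.tens M L.leftBim)).add (L.mulLast _ (L.t (op a))
            ((α_ M L.leftBim L.leftBim).inv.add (Bim.t m η))) =
          Bim.t (N := L.leftBim) m ((L.counitSnd L.leftBim).add (L.mulSnd (L.t (op a)) η)) :=
        fun η => by
          induction η using Bim.t_induction with
          | h0 => simp only [map_zero, Bim.t_zero]
          | ha x y hx hy => simp only [map_add, Bim.t_add, hx, hy]; exact (Bim.t_add _ _ _).symm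
          | ht v w => rfl
      rw [L.comulSnd_t, h3, ← L.mulSnd_Δ_t, L.counitSnd_Δ]; rfl
  rw [s.left_eq, h1, ← s.coassoc, h2]

lemma takeuchi (a : A) (m : M) :
    L.mulLast M (L.s a) (s.coact m) = (Bim.tens M L.leftBim).l a (s.coact m) := by
  have hg : ∀ b (x : Bim.tens M L.leftBim),
      ((L.counitSnd M).add.comp (L.mulLast M (L.t (op a)))) ((Bim.tens M L.leftBim).r (op b) x) =
        M.r (op b) (((L.counitSnd M).add.comp (L.mulLast M (L.t (op a)))) x) := fun b x => by
    induction x using Bim.t_induction with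
    | h0 => simp only [map_zero]
    | ha x y hx hy => simp only [map_add, hx, hy]
    | ht m u =>
      change M.r (op (L.ε (L.t (op b) * u * L.t (op a)))) m =
        M.r (op b) (M.r (op (L.ε (u * L.t (op a)))) m)
      rw [mul_assoc, L.ε_t, M.r_mul]; rfl
  have h1 : ∀ ξ : Bim.tens M L.leftBim, (Bim.tens M L.leftBim).l a ξ =
      Bim.fst L.leftBim _ hg (Bim.fst L.leftBim s.coact s.coact_r ξ) := fun ξ => by
    induction ξ using Bim.t_induction with
    | h0 => simp only [map_zero]
    | ha x y hx hy => simp only [map_add, hx, hy]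
    | ht m u => exact congrArg (Bim.t (N := L.leftBim) · u) (s.left_eq a m)
  have h2 : ∀ ξ : Bim.tens M L.leftBim, Bim.fst L.leftBim _ hg ((L.comulSnd M).add ξ) =
      L.mulLast M (L.s a) ξ := fun ξ => by
    induction ξ using Bim.t_induction with
    | h0 => simp only [map_zero]
    | ha x y hx hy => simp only [map_add, hx, hy]
    | ht m u =>
      have h3 : ∀ η : Bim.tens L.leftBim L.leftBim,
          Bim.fst L.leftBim _ hg ((α_ M L.leftBim L.leftBim).inv.add (Bim.t m η)) =
          Bim.t (N := L.leftBim) m ((L.counitFst L.leftBim).add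
            (L.mulFst L.leftBim (L.t (op a)) η)) :=
        fun η => by
          induction η using Bim.t_induction with
          | h0 => simp only [map_zero, Bim.t_zero]
          | ha x y hx hy => simp only [map_add, Bim.t_add, hx, hy]; exact (Bim.t_add _ _ _).symm
          | ht v w => exact Bim.t_bal (N := L.leftBim) _ m w
      rw [L.comulSnd_t, h3, L.takeuchi_Δ, L.counitFst_mulSnd, L.counitFst_Δ]; rfl
  rw [h1, ← s.coassoc, h2]

variable (N) in
/-- `n ⊗ u ↦ (m ⊗ n) ⊗ u v` -/
def shift (L : LeftBialgebroid A U) (m : M) (v : U) :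
    Bim.tens N L.leftBim →+ Bim.tens (Bim.tens M N) L.leftBim :=
  L.mapMul v (Bal.tmulHom m) (fun _ _ => rfl)

lemma shift_add (m : M) (v v' : U) (ξ : Bim.tens N L.leftBim) :
    shift N L m (v + v') ξ = shift N L m v ξ + shift N L m v' ξ :=
  L.mapMul_add v v' _ _ ξ

lemma add_shift (m m' : M) (v : U) (ξ : Bim.tens N L.leftBim) :
    shift N L (m + m') v ξ = shift N L m v ξ + shift N L m' v ξ := by
  induction ξ using Bim.t_induction with
  | h0 => simp only [map_zero, add_zero]
  | ha x y hx hy => simp only [map_add, hx, hy]; abel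
  | ht x u =>
    exact (congrArg (Bim.t (N := L.leftBim) · (u * v)) (Bim.add_t m m' x)).trans (Bim.add_t _ _ _)

lemma shift_mul (m : M) (v w : U) (ξ : Bim.tens N L.leftBim) :
    shift N L m (v * w) ξ = shift N L m w (L.mulLast N v ξ) := L.mapMul_mul v w _ _ ξ

/-- `m ⊗ v ↦ (m ⊗ n₍₀₎) ⊗ n₍₁₎ v` -/
def mulCoact (n : N) : Bim.tens M L.leftBim →+ Bim.tens (Bim.tens M N) L.leftBim :=
  Bim.tlift (N := L.leftBim) (biHom (N := U) (fun m v => shift N L m v (s'.coact n))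
      (fun m v v' => shift_add m v v' _) (fun m m' v => add_shift m m' v _))
    (fun a m v => by
      change shift N L (M.r (op a) m) v (s'.coact n) = shift N L m (L.s a * v) (s'.coact n)
      have h1 : ∀ ξ, shift N L (M.r (op a) m) v ξ =
          shift N L m v ((Bim.tens N L.leftBim).l a ξ) := fun ξ => by
        induction ξ using Bim.t_induction with
        | h0 => simp only [map_zero]
        | ha x y hx hy => simp only [map_add, hx, hy]
        | ht x u => exact congrArg (Bim.t (N := L.leftBim) · (u * v)) (Bim.t_bal a m x)
      rw [h1, ← s'.takeuchi]
      exact (L.mapMul_mul _ _ _ _ _).symm)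

@[simp] lemma mulCoact_t (n : N) (m : M) (v : U) :
    s'.mulCoact n (Bim.t (N := L.leftBim) m v) = shift N L m v (s'.coact n) := rfl

lemma mulCoact_add (n n' : N) (η : Bim.tens M L.leftBim) :
    s'.mulCoact (n + n') η = s'.mulCoact n η + s'.mulCoact n' η := by
  induction η using Bim.t_induction with
  | h0 => simp only [map_zero, add_zero]
  | ha x y hx hy => simp only [map_add, hx, hy]; abel
  | ht m v => simp only [mulCoact_t, map_add]

lemma mulCoact_l (a : A) (n : N) (η : Bim.tens M L.leftBim) :
    s'.mulCoact (N.l a n) η = s'.mulCoact n ((Bim.tens M L.leftBim).r (op a) η) := by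
  induction η using Bim.t_induction with
  | h0 => simp only [map_zero]
  | ha x y hx hy => simp only [map_add, hx, hy]
  | ht m v =>
    change shift N L m v (s'.coact (N.l a n)) = shift N L m (L.t (op a) * v) (s'.coact n)
    rw [s'.coact_l]
    exact (L.mapMul_mul _ _ _ _ _).symm

lemma mulCoact_r (a : A) (n : N) (η : Bim.tens M L.leftBim) :
    s'.mulCoact (N.r (op a) n) η =
      (Bim.tens (Bim.tens M N) L.leftBim).r (op a) (s'.mulCoact n η) := by
  induction η using Bim.t_induction with
  | h0 => simp only [map_zero]
  | ha x y hx hy => simp only [map_add, hx, hy]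
  | ht m v =>
    rw [mulCoact_t, mulCoact_t, s'.coact_r]
    generalize s'.coact n = ξ
    induction ξ using Bim.t_induction with
    | h0 => simp only [map_zero]
    | ha x y hx hy => simp only [map_add, hx, hy]
    | ht x u => exact congrArg (Bim.t (N := L.leftBim) _) (mul_assoc (L.t (op a)) u v)

/-- The codiagonal coaction `m ⊗ n ↦ (m₍₀₎ ⊗ n₍₀₎) ⊗ n₍₁₎ m₍₁₎`. -/
def codiag : Bim.tens M N →+ Bim.tens (Bim.tens M N) L.leftBim :=
  Bim.tlift (biHom (fun m n => s'.mulCoact n (s.coact m))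
      (fun m n n' => s'.mulCoact_add n n' _)
      (fun m m' n => by rw [map_add, map_add]))
    (fun a m n => (congrArg _ (s.coact_r a m)).trans (s'.mulCoact_l a n _).symm)

@[simp] lemma codiag_t (m : M) (n : N) :
    s.codiag s' (Bim.t m n) = s'.mulCoact n (s.coact m) := rfl

lemma codiag_r (a : A) (x : Bim.tens M N) :
    s.codiag s' ((Bim.tens M N).r (op a) x) =
      (Bim.tens (Bim.tens M N) L.leftBim).r (op a) (s.codiag s' x) := by
  induction x using Bim.t_induction with
  | h0 => simp only [map_zero]
  | ha x y hx hy => simp only [map_add, hx, hy]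
  | ht m n => exact s'.mulCoact_r a n _

lemma counit_mulCoact (z : U) (n : N) (η : Bim.tens M L.leftBim) :
    (L.counitSnd (Bim.tens M N)).add (L.mulLast _ z (s'.mulCoact n η)) =
      Bim.t ((L.counitSnd M).add (L.mulLast M z η)) n := by
  induction η using Bim.t_induction with
  | h0 => simp only [map_zero, Bim.zero_t]
  | ha x y hx hy => simp only [map_add, Bim.add_t, hx, hy]
  | ht m v =>
    have h1 : ∀ ξ, (L.counitSnd (Bim.tens M N)).add (L.mulLast _ z (shift N L m v ξ)) =
        Bim.t m ((L.counitSnd N).add (L.mulLast N (L.s (L.ε (v * z))) ξ)) := fun ξ => by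
      induction ξ using Bim.t_induction with
      | h0 => simp only [map_zero, Bim.t_zero]
      | ha x y hx hy => simp only [map_add, Bim.t_add, hx, hy]
      | ht x u =>
        change Bim.t m (N.r (op (L.ε (u * v * z))) x) = Bim.t m (N.r (op (L.ε (u * L.s _))) x)
        rw [L.ε_mul_s, mul_assoc]
    rw [mulCoact_t, h1, s'.takeuchi, Bim.hom_l, s'.counit, ← Bim.t_bal]; rfl

/-- `n ⊗ u ↦ ζ ⋆ n ⊗ u z`, where `(m ⊗ v) ⋆ n = (m ⊗ n₍₀₎) ⊗ n₍₁₎ v` -/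
def dbl (z : U) (ζ : Bim.tens M L.leftBim) :
    Bim.tens N L.leftBim →+ Bim.tens (Bim.tens (Bim.tens M N) L.leftBim) L.leftBim :=
  L.mapMul z (AddMonoidHom.mk' (fun n => s'.mulCoact n ζ) (fun n n' => s'.mulCoact_add n n' ζ))
    (fun a n => s'.mulCoact_r a n ζ)

lemma dbl_add (z : U) (ζ ζ' : Bim.tens M L.leftBim) (ξ : Bim.tens N L.leftBim) :
    s'.dbl z (ζ + ζ') ξ = s'.dbl z ζ ξ + s'.dbl z ζ' ξ := by
  induction ξ using Bim.t_induction with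
  | h0 => simp only [map_zero, add_zero]
  | ha x y hx hy => simp only [map_add, hx, hy]; abel
  | ht x u =>
    exact (congrArg (Bim.t (N := L.leftBim) · (u * z)) (map_add (s'.mulCoact x) ζ ζ')).trans
      (Bim.add_t _ _ _)

lemma add_dbl (z z' : U) (ζ : Bim.tens M L.leftBim) (ξ : Bim.tens N L.leftBim) :
    s'.dbl (z + z') ζ ξ = s'.dbl z ζ ξ + s'.dbl z' ζ ξ :=
  L.mapMul_add z z' _ _ ξ

/-- `ζ ⊗ z ↦ ζ ⋆ n₍₀₎ ⊗ n₍₁₎ z` -/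
def dblCoact (n : N) : Bim.tens (Bim.tens M L.leftBim) L.leftBim →+
    Bim.tens (Bim.tens (Bim.tens M N) L.leftBim) L.leftBim :=
  Bim.tlift (N := L.leftBim) (biHom (N := U) (fun ζ z => s'.dbl z ζ (s'.coact n))
      (fun ζ z z' => s'.add_dbl z z' ζ _) (fun ζ ζ' z => s'.dbl_add z ζ ζ' _))
    (fun a ζ z => by
      change s'.dbl z ((Bim.tens M L.leftBim).r (op a) ζ) (s'.coact n) =
        s'.dbl (L.s a * z) ζ (s'.coact n)
      have h1 : ∀ ξ, s'.dbl z ((Bim.tens M L.leftBim).r (op a) ζ) ξ =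
          s'.dbl z ζ ((Bim.tens N L.leftBim).l a ξ) := fun ξ => by
        induction ξ using Bim.t_induction with
        | h0 => simp only [map_zero]
        | ha x y hx hy => simp only [map_add, hx, hy]
        | ht x u => exact congrArg (Bim.t (N := L.leftBim) · (u * z)) (s'.mulCoact_l a x ζ).symm
      rw [h1, ← s'.takeuchi]
      exact (L.mapMul_mul _ _ _ _ _).symm)

@[simp] lemma dblCoact_t (n : N) (z : U) (ζ : Bim.tens M L.leftBim) :
    s'.dblCoact n (Bim.t (N := L.leftBim) ζ z) = s'.dbl z ζ (s'.coact n) := rfl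

variable (N) in
/-- `(n ⊗ u) ⊗ v ↦ ((m ⊗ n) ⊗ u z) ⊗ v w` for a formal tensor `z ⊗ w` -/
def shift2 (L : LeftBialgebroid A U) (m : M) : U ⊗[ℤ] U →+
    Bim.tens (Bim.tens N L.leftBim) L.leftBim →+
      Bim.tens (Bim.tens (Bim.tens M N) L.leftBim) L.leftBim :=
  Bal.fLift (biHom (fun z w => L.mapMul w (shift N L m z) (fun a ξ => by
        induction ξ using Bim.t_induction with
        | h0 => simp only [map_zero]
        | ha x y hx hy => simp only [map_add, hx, hy]
        | ht x u => exact congrArg (Bim.t (N := L.leftBim) _) (mul_assoc (L.t (op a)) u z)))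
    (fun z w w' => Bal.hom_ext fun ξ u => by
      exact (congrArg (Bim.t (N := L.leftBim) _) (mul_add u w w')).trans (Bim.t_add _ _ _))
    (fun z z' w => Bal.hom_ext fun ξ u => by
      exact (congrArg (Bim.t (N := L.leftBim) · (u * w)) (shift_add m z z' ξ)).trans
        (Bim.add_t _ _ _)))

lemma comul_shift (v : U) (m : M) (y : U ⊗[ℤ] U) (hy : L.mkL y = L.Δ v)
    (ξ : Bim.tens N L.leftBim) :
    (L.comulSnd _).add (shift N L m v ξ) = shift2 N L m y ((L.comulSnd N).add ξ) := by
  induction ξ using Bim.t_induction with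
  | h0 => simp only [map_zero]
  | ha x z hx hz => simp only [map_add, hx, hz]
  | ht x u =>
    change (α_ (Bim.tens M N) L.leftBim L.leftBim).inv.add (Bim.t (Bim.t m x) (L.Δ (u * v))) =
      shift2 N L m y ((α_ N L.leftBim L.leftBim).inv.add (Bim.t x (L.Δ u)))
    rw [L.Δ_mul u v y hy]
    generalize L.Δ u = η
    clear hy
    induction y with
    | zero => simp only [map_zero, AddMonoidHom.zero_apply, Bim.t_zero]
    | add y y' hy hy' => simp only [map_add, AddMonoidHom.add_apply, Bim.t_add, hy, hy']
    | tmul z w =>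
      induction η using Bim.t_induction with
      | h0 => simp only [map_zero, Bim.t_zero]
      | ha x y hx hy => simp only [map_add, Bim.t_add, hx, hy]
      | ht a b => rfl

lemma shift2_coact (m : M) (y : U ⊗[ℤ] U) (n : N) :
    shift2 N L m y (Bim.fst L.leftBim s'.coact s'.coact_r (s'.coact n)) =
      s'.dblCoact n ((α_ M L.leftBim L.leftBim).inv.add (Bim.t m (L.mkL y))) := by
  induction y with
  | zero => simp only [map_zero, AddMonoidHom.zero_apply, Bim.t_zero]
  | add y y' hy hy' => simp only [map_add, AddMonoidHom.add_apply, Bim.t_add, hy, hy']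
  | tmul z w =>
    change _ = s'.dbl w (Bim.t (N := L.leftBim) m z) (s'.coact n)
    generalize s'.coact n = ξ
    induction ξ using Bim.t_induction with
    | h0 => simp only [map_zero]
    | ha x y hx hy => simp only [map_add, hx, hy]
    | ht x u => rfl

lemma comul_mulCoact (n : N) (η : Bim.tens M L.leftBim) :
    (L.comulSnd _).add (s'.mulCoact n η) = s'.dblCoact n ((L.comulSnd M).add η) := by
  induction η using Bim.t_induction with
  | h0 => simp only [map_zero]
  | ha x y hx hy => simp only [map_add, hx, hy]
  | ht m v =>
    obtain ⟨y, hy⟩ := Bal.mk_surjective (L.Δ v)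
    rw [mulCoact_t, comul_shift v m y hy, s'.coassoc, s'.shift2_coact, L.comulSnd_t]
    exact congrArg (fun η => s'.dblCoact n ((α_ M L.leftBim L.leftBim).inv.add (Bim.t m η))) hy

lemma dblCoact_coact (n : N) (η : Bim.tens M L.leftBim) :
    s'.dblCoact n (Bim.fst L.leftBim s.coact s.coact_r η) =
      Bim.fst L.leftBim (s.codiag s') (s.codiag_r s') (s'.mulCoact n η) := by
  induction η using Bim.t_induction with
  | h0 => simp only [map_zero]
  | ha x y hx hy => simp only [map_add, hx, hy]
  | ht m v =>
    rw [mulCoact_t, Bim.fst_t, dblCoact_t]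
    generalize s'.coact n = ξ
    induction ξ using Bim.t_induction with
    | h0 => simp only [map_zero]
    | ha x y hx hy => simp only [map_add, hx, hy]
    | ht x u => rfl

/-- The tensor product of right comodules, with the codiagonal coaction
`m ⊗ n ↦ (m₍₀₎ ⊗ n₍₀₎) ⊗ n₍₁₎ m₍₁₎`; over a right bialgebroid `V`, in terms of the multiplication
of `V`, this reads `(m⁽⁰⁾ ⊗ n⁽⁰⁾) ⊗ m⁽¹⁾ n⁽¹⁾`. -/
def tensor : RComodStr L (Bim.tens M N) where
  coact := s.codiag s'
  coact_r := s.codiag_r s'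
  coassoc x := by
    induction x using Bim.t_induction with
    | h0 => simp only [map_zero]
    | ha x y hx hy => simp only [map_add, hx, hy]
    | ht m n => rw [codiag_t, comul_mulCoact, s.coassoc, dblCoact_coact]
  counit x := by
    induction x using Bim.t_induction with
    | h0 => simp only [map_zero]
    | ha x y hx hy => simp only [map_add, hx, hy]
    | ht m n =>
      have := s'.counit_mulCoact 1 n (s.coact m)
      rwa [L.mulLast_one, L.mulLast_one, s.counit] at this
  left_eq a x := by
    induction x using Bim.t_induction with
    | h0 => simp only [map_zero]
    | ha x y hx hy => simp only [map_add, hx, hy]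
    | ht m n => rw [codiag_t, counit_mulCoact, ← s.left_eq, Bim.tens_l]

/-- The unit comodule `A`, with coaction `a ↦ 1 ⊗ t(a)`; over a right bialgebroid `V` this is
`a ↦ 1 ⊗ s(a)`. -/
def unit (L : LeftBialgebroid A U) : RComodStr L (Bim.one A) where
  coact := AddMonoidHom.mk' (fun a : A => Bim.t (N := L.leftBim) (Bim.el 1) (L.t (op a)))
    (fun (a b : A) => (congrArg (Bim.t (N := L.leftBim) (Bim.el 1))
      (map_add L.t (op a) (op b))).trans (Bim.t_add _ _ _))
  coact_r a (b : A) := congrArg (Bim.t (N := L.leftBim) (Bim.el 1)) (map_mul L.t (op a) (op b))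
  coassoc (a : A) := by
    change (α_ (Bim.one A) L.leftBim L.leftBim).inv.add (Bim.t (Bim.el 1) (L.Δ (L.t (op a)))) =
      Bim.t (N := L.leftBim) (Bim.t (N := L.leftBim) (Bim.el 1) (L.t (op 1))) (L.t (op a))
    rw [L.Δ_of_t, op_one, map_one L.t]; rfl
  counit (a : A) := by
    change 1 * L.ε (L.t (op a)) = a
    rw [L.ε_of_t, one_mul, unop_op]
  left_eq a (b : A) := by
    change a * b = 1 * L.ε (L.t (op b) * L.t (op a))
    rw [← map_mul, L.ε_of_t, one_mul]; rfl

end RComodStr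

/-- Right comodules, with colinear maps. -/
abbrev RComod (L : LeftBialgebroid A U) : StrOn (Bim A) where
  Str := RComodStr L
  IsHom s s' f := ∀ m, (Bim.fst L.leftBim f.add (fun a m => f.map_r (op a) m)) (s.coact m) =
    s'.coact (f.add m)
  id_mem {X} s m := by
    refine Bim.t_hom_eq (f := Bim.fst L.leftBim (Bim.Hom.add (𝟙 X)) _)
      (g := AddMonoidHom.id _) (fun _ _ => rfl) _
  comp_mem {X Y Z s s' s'' f g} h h' m := by
    rw [Bim.comp_add, ← h', ← h]
    generalize s.coact m = ξ
    induction ξ using Bim.t_induction with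
    | h0 => simp only [map_zero]
    | ha x y hx hy => simp only [map_add, hx, hy]
    | ht x u => rfl

/-- The monoidal structure on right comodules. -/
def monRComod (L : LeftBialgebroid A U) : (RComod L).Mon where
  tensor s s' := s.tensor s'
  unit := RComodStr.unit L
  inv_mem {X Y s s'} f h m := by
    have hm : f.hom.add (f.inv.add m) = m := congrArg (fun f => Bim.Hom.add f m) f.inv_hom_id
    have h1 := h (f.inv.add m)
    rw [hm] at h1
    rw [← h1]
    generalize s.coact (f.inv.add m) = ξ
    induction ξ using Bim.t_induction with
    | h0 => simp only [map_zero]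
    | ha x y hx hy => simp only [map_add, hx, hy]
    | ht x u =>
      exact congrArg (Bim.t (N := L.leftBim) · u)
        (congrArg (fun f => Bim.Hom.add f x) f.hom_inv_id)
  tensor_mem {X Y X' Y' s s' p p' f g} hf hg x := by
    induction x using Bim.t_induction with
    | h0 => simp only [map_zero]
    | ha x y hx hy => simp only [map_add, hx, hy]
    | ht m n =>
      change Bim.fst L.leftBim (Bim.tmap f g).add (fun a m => (Bim.tmap f g).map_r (op a) m)
        (RComodStr.mulCoact p n (RComodStr.coact s m)) =
        RComodStr.mulCoact p' (g.add n) (RComodStr.coact s' (f.add m))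
      rw [← hf m]
      generalize RComodStr.coact s m = η
      induction η using Bim.t_induction with
      | h0 => simp only [map_zero]
      | ha x y hx hy => simp only [map_add, hx, hy]
      | ht m v =>
        rw [RComodStr.mulCoact_t, Bim.fst_t, RComodStr.mulCoact_t, ← hg n]
        generalize RComodStr.coact p n = ξ
        induction ξ using Bim.t_induction with
        | h0 => simp only [map_zero]
        | ha x y hx hy => simp only [map_add, hx, hy]
        | ht x u => rfl
  assoc_mem {X Y Z} s s' s'' x := by
    induction x using Bim.t_induction with
    | h0 => simp only [map_zero]
    | ha x y hx hy => simp only [map_add, hx, hy]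
    | ht x p =>
      induction x using Bim.t_induction with
      | h0 => simp only [map_zero, Bim.zero_t]
      | ha x y hx hy => simp only [map_add, Bim.add_t, hx, hy]
      | ht m n =>
        change Bim.fst L.leftBim (Bim.assoc X Y Z).hom.add
          (fun a m => (Bim.assoc X Y Z).hom.map_r (op a) m)
          (RComodStr.mulCoact s'' p (RComodStr.mulCoact s' n (RComodStr.coact s m))) =
          RComodStr.mulCoact (RComodStr.tensor s' s'') (Bim.t n p) (RComodStr.coact s m)
        generalize RComodStr.coact s m = ζ
        induction ζ using Bim.t_induction with
        | h0 => simp only [map_zero]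
        | ha x y hx hy => simp only [map_add, hx, hy]
        | ht m w =>
          rw [RComodStr.mulCoact_t, RComodStr.mulCoact_t]
          change _ = RComodStr.shift _ L m w (RComodStr.mulCoact s'' p (RComodStr.coact s' n))
          generalize RComodStr.coact s' n = η
          induction η using Bim.t_induction with
          | h0 => simp only [map_zero]
          | ha x y hx hy => simp only [map_add, hx, hy]
          | ht n v =>
            rw [RComodStr.mulCoact_t]
            change Bim.fst L.leftBim _ _ (RComodStr.shift _ L (Bim.t m n) (v * w)
              (RComodStr.coact s'' p)) = _
            generalize RComodStr.coact s'' p = ξ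
            induction ξ using Bim.t_induction with
            | h0 => simp only [map_zero]
            | ha x y hx hy => simp only [map_add, hx, hy]
            | ht p u => exact congrArg (Bim.t (N := L.leftBim) _) (mul_assoc u v w).symm
  left_mem {X} s x := by
    refine Bim.t_hom_eq (M := Bim.one A)
      (f := (Bim.fst L.leftBim (λ_ X).hom.add (fun a m => (λ_ X).hom.map_r (op a) m)).comp
        ((RComodStr.unit L).codiag s)) (g := (RComodStr.coact s).comp (λ_ X).hom.add)
      (fun (a : A) m => ?_) x
    change Bim.fst L.leftBim (λ_ X).hom.add (fun a m => (λ_ X).hom.map_r (op a) m)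
      (RComodStr.shift _ L (Bim.el 1) (L.t (op a)) (RComodStr.coact s m)) =
        RComodStr.coact s (X.l a m)
    rw [RComodStr.coact_l]
    generalize RComodStr.coact s m = ξ
    induction ξ using Bim.t_induction with
    | h0 => simp only [map_zero]
    | ha x y hx hy => simp only [map_add, hx, hy]
    | ht x u => exact congrArg (Bim.t (N := L.leftBim) · (u * L.t (op a))) (X.l_one x)
  right_mem {X} s x := by
    refine Bim.t_hom_eq (N := Bim.one A)
      (f := (Bim.fst L.leftBim (ρ_ X).hom.add (fun a m => (ρ_ X).hom.map_r (op a) m)).comp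
        (RComodStr.codiag s (RComodStr.unit L))) (g := (RComodStr.coact s).comp (ρ_ X).hom.add)
      (fun m (a : A) => ?_) x
    change Bim.fst L.leftBim (ρ_ X).hom.add (fun a m => (ρ_ X).hom.map_r (op a) m)
      ((RComodStr.unit L).mulCoact (N := Bim.one A) a (RComodStr.coact s m)) =
        RComodStr.coact s (X.r (op a) m)
    rw [RComodStr.coact_r]
    generalize RComodStr.coact s m = ξ
    induction ξ using Bim.t_induction with
    | h0 => simp only [map_zero]
    | ha x y hx hy => simp only [map_add, hx, hy]
    | ht x u => exact congrArg (Bim.t (N := L.leftBim) · (L.t (op a) * u)) (X.r_one x)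

end RightComodules

/-! ## Left Yetter-Drinfel'd modules -/

section LeftYD

variable {A U : Type u} [Ring A] [Ring U]

namespace LeftBialgebroid

variable (L : LeftBialgebroid A U)

/-- The left regular module `U`. -/
def reg : LModStr L.toAeRing L.leftBim where
  act := Module.toAddMonoidEnd U U
  act_s _ _ := rfl
  act_t _ _ := rfl

lemma reg_act (u v : U) : L.reg.act u v = u * v := rfl

lemma counitSnd_mulFst' (z : U) (ξ : Bim.tens L.leftBim L.leftBim) :
    (L.counitSnd L.leftBim).add (L.mulFst L.leftBim z ξ) =
      ((L.counitSnd L.leftBim).add ξ : U) * z := by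
  induction ξ using Bim.t_induction with
  | h0 => simp only [map_zero]; exact (zero_mul _).symm
  | ha x y hx hy => simp only [map_add, hx, hy]; exact (add_mul _ _ _).symm
  | ht v w => exact (mul_assoc (L.t (op (L.ε w))) v z).symm

lemma counitFst_mulSnd' (z : U) (ξ : Bim.tens L.leftBim L.leftBim) :
    (L.counitFst L.leftBim).add (L.mulSnd z ξ) = ((L.counitFst L.leftBim).add ξ : U) * z := by
  induction ξ using Bim.t_induction with
  | h0 => simp only [map_zero]; exact (zero_mul _).symm
  | ha x y hx hy => simp only [map_add, hx, hy]; exact (add_mul _ _ _).symm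
  | ht v w => exact (mul_assoc (L.s (L.ε v)) w z).symm

lemma mulFst_l (X : Bim A) (z : U) (a : A) (ξ : Bim.tens L.leftBim X) :
    L.mulFst X z ((Bim.tens L.leftBim X).l a ξ) = (Bim.tens L.leftBim X).l a (L.mulFst X z ξ) := by
  induction ξ using Bim.t_induction with
  | h0 => simp only [map_zero]
  | ha x y hx hy => simp only [map_add, hx, hy]
  | ht u x => exact congrArg (Bim.t (M := L.leftBim) · x) (mul_assoc (L.s a) u z)

lemma mulFst_r (X : Bim A) (z : U) (a : Aᵐᵒᵖ) (ξ : Bim.tens L.leftBim X) :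
    L.mulFst X z ((Bim.tens L.leftBim X).r a ξ) = (Bim.tens L.leftBim X).r a (L.mulFst X z ξ) := by
  induction ξ using Bim.t_induction with
  | h0 => simp only [map_zero]
  | ha x y hx hy => simp only [map_add, hx, hy]
  | ht u x => rfl

/-- The coproduct on the first factor: `u ⊗ v ↦ (u₍₁₎ ⊗ u₍₂₎) ⊗ v`. -/
def comulL : Bim.tens L.leftBim L.leftBim →+ Bim.tens (Bim.tens L.leftBim L.leftBim) L.leftBim :=
  (L.coring.comul ▷ L.leftBim).add

lemma comulL_t (u v : U) :
    L.comulL (Bim.t (M := L.leftBim) (N := L.leftBim) u v) = Bim.t (N := L.leftBim) (L.Δ u) v := rfl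

lemma coassoc' (u : U) : (α_ L.leftBim L.leftBim L.leftBim).inv.add
    (Bim.snd L.leftBim L.Δ L.Δ_s (L.Δ u)) = L.comulL (L.Δ u) := by
  rw [← L.coassoc]
  exact congrArg (fun f => Bim.Hom.add f (L.comulL (L.Δ u)))
    (α_ L.leftBim L.leftBim L.leftBim).hom_inv_id

end LeftBialgebroid

variable {L : LeftBialgebroid A U} {M N : Bim A}

/-- `u ⊗ v ↦ (u n)₍₋₁₎ v ⊗ (u n)₍₀₎` -/
def ydL (s : LModStr L.toAeRing N) (c : LComodStr L N) (n : N) :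
    Bim.tens L.leftBim L.leftBim →+ Bim.tens L.leftBim N :=
  Bim.tlift (M := L.leftBim) (N := L.leftBim)
    (biHom (M := U) (N := U) (fun u v => L.mulFst N v (c.coact (s.act u n)))
      (fun u v v' => L.mulFst_add N v v' _) (fun u u' v => by rw [s.add, map_add, map_add]))
    (fun a u v => by
      change L.mulFst N v (c.coact (s.act (L.t (op a) * u) n)) =
        L.mulFst N (L.s a * v) (c.coact (s.act u n))
      rw [s.mul, s.act_t, c.coact_r, L.mulFst_mul])

/-- A left Yetter-Drinfel'd module: a left module and left comodule with the same underlying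
bimodule, such that `(u₍₁₎ n)₍₋₁₎ u₍₂₎ ⊗ (u₍₁₎ n)₍₀₎ = u₍₁₎ n₍₋₁₎ ⊗ u₍₂₎ n₍₀₎`. -/
structure LYDStr (L : LeftBialgebroid A U) (N : Bim A) where
  mod : LModStr L.toAeRing N
  comod : LComodStr L N
  yd : ∀ u n, ydL mod comod n (L.Δ u) = L.diagAct L.reg mod u (comod.coact n)

section

variable (s : LModStr L.toAeRing M) (c : LComodStr L M) (s' : LModStr L.toAeRing N)
  (c' : LComodStr L N)

@[simp] lemma ydL_t (n : N) (u v : U) :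
    ydL s' c' n (Bim.t (M := L.leftBim) (N := L.leftBim) u v) =
      L.mulFst N v (c'.coact (s'.act u n)) := rfl

lemma ydL_l (n : N) (a : A) (ζ : Bim.tens L.leftBim L.leftBim) :
    ydL s' c' n ((Bim.tens L.leftBim L.leftBim).l a ζ) =
      (Bim.tens L.leftBim N).l a (ydL s' c' n ζ) := by
  induction ζ using Bim.t_induction with
  | h0 => simp only [map_zero]
  | ha x y hx hy => simp only [map_add, hx, hy]
  | ht u v =>
    change L.mulFst N v (c'.coact (s'.act (L.s a * u) n)) = _
    rw [s'.mul, s'.act_s, c'.coact_l, L.mulFst_l]; rfl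

lemma ydL_r (n : N) (a : A) (ζ : Bim.tens L.leftBim L.leftBim) :
    ydL s' c' n ((Bim.tens L.leftBim L.leftBim).r (op a) ζ) =
      (Bim.tens L.leftBim N).r (op a) (ydL s' c' n ζ) := by
  induction ζ using Bim.t_induction with
  | h0 => simp only [map_zero]
  | ha x y hx hy => simp only [map_add, hx, hy]
  | ht u v =>
    change L.mulFst N (L.t (op a) * v) (c'.coact (s'.act u n)) = _
    rw [L.mulFst_mul, c'.takeuchi, L.mulFst_r]; rfl

lemma mulFst_mulCoact (z : U) (m : M) (η : Bim.tens L.leftBim N) :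
    L.mulFst _ z (c.mulCoact m η) = c.mulCoact m (L.mulFst N z η) := by
  induction η using Bim.t_induction with
  | h0 => simp only [map_zero]
  | ha x y hx hy => simp only [map_add, hx, hy]
  | ht v n =>
    rw [LComodStr.mulCoact_t, LeftBialgebroid.mulFst_t, LComodStr.mulCoact_t]
    generalize c.coact m = ξ
    induction ξ using Bim.t_induction with
    | h0 => simp only [map_zero]
    | ha x y hx hy => simp only [map_add, hx, hy]
    | ht u x => exact congrArg (Bim.t (M := L.leftBim) · _) (mul_assoc u v z)

/-- `x ⊗ ζ ↦ (x m) ⋆ (ydL n ζ)` -/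
def ydE (m : M) (n : N) : Bim.tens L.leftBim (Bim.tens L.leftBim L.leftBim) →+
    Bim.tens L.leftBim (Bim.tens M N) :=
  Bim.tlift (M := L.leftBim) (biHom (M := U)
      (fun x ζ => c.mulCoact (s.act x m) (ydL s' c' n ζ))
      (fun x ζ ζ' => by rw [map_add, map_add])
      (fun x x' ζ => by rw [s.add, c.mulCoact_add]))
    (fun a x ζ => by
      change c.mulCoact (s.act (L.t (op a) * x) m) (ydL s' c' n ζ) =
        c.mulCoact (s.act x m) (ydL s' c' n ((Bim.tens L.leftBim L.leftBim).l a ζ))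
      rw [s.mul, s.act_t, c.mulCoact_r, ydL_l])

lemma ydE_comul (m : M) (n : N) (ξ : Bim.tens L.leftBim L.leftBim) :
    ydL (L.tensorLMod s s') (c.tensor c') (Bim.t m n) ξ =
      ydE s c s' c' m n ((L.comulFst L.leftBim).add ξ) := by
  induction ξ using Bim.t_induction with
  | h0 => simp only [map_zero]
  | ha x y hx hy => simp only [map_add, hx, hy]
  | ht x y =>
    change L.mulFst _ y (c.codiag c' (s.diag s' m n (L.Δ x))) =
      ydE s c s' c' m n ((α_ L.leftBim L.leftBim L.leftBim).hom.add (Bim.t (N := L.leftBim) (L.Δ x) y))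
    generalize L.Δ x = η
    induction η using Bim.t_induction with
    | h0 => simp only [map_zero, Bim.zero_t]
    | ha x y hx hy => simp only [map_add, Bim.add_t, hx, hy]
    | ht v w => exact mulFst_mulCoact c y (s.act v m) _

/-- `x ⊗ y ↦ (x m) ⋆ (y η)` -/
def ydF (m : M) (η : Bim.tens L.leftBim N) : Bim.tens L.leftBim L.leftBim →+
    Bim.tens L.leftBim (Bim.tens M N) :=
  Bim.tlift (M := L.leftBim) (N := L.leftBim) (biHom (M := U) (N := U)
      (fun x y => c.mulCoact (s.act x m) ((L.tensorLMod L.reg s').act y η))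
      (fun x y y' => by rw [LModStr.add, map_add])
      (fun x x' y => by rw [s.add, c.mulCoact_add]))
    (fun a x y => by
      change c.mulCoact (s.act (L.t (op a) * x) m) ((L.tensorLMod L.reg s').act y η) =
        c.mulCoact (s.act x m) ((L.tensorLMod L.reg s').act (L.s a * y) η)
      rw [s.mul, s.act_t, c.mulCoact_r, LModStr.mul, LModStr.act_s])

lemma ydE_yd (h : ∀ u n, ydL s' c' n (L.Δ u) = L.diagAct L.reg s' u (c'.coact n))
    (m : M) (n : N) (ξ : Bim.tens L.leftBim L.leftBim) :
    ydE s c s' c' m n (Bim.snd L.leftBim L.Δ L.Δ_s ξ) = ydF s c s' m (c'.coact n) ξ := by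
  induction ξ using Bim.t_induction with
  | h0 => simp only [map_zero]
  | ha x y hx hy => simp only [map_add, hx, hy]
  | ht x y => exact congrArg (c.mulCoact (s.act x m)) (h y n)

/-- `ζ ⊗ y ↦ ydL m ζ`, multiplied by `v` and tensored with `y n` -/
def ydH (m : M) (v : U) (n : N) : Bim.tens (Bim.tens L.leftBim L.leftBim) L.leftBim →+
    Bim.tens L.leftBim (Bim.tens M N) :=
  Bim.tlift (N := L.leftBim) (biHom (N := U)
      (fun ζ y => LComodStr.shift M L v (s'.act y n) (ydL s c m ζ))
      (fun ζ y y' => by rw [s'.add, LComodStr.shift_add])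
      (fun ζ ζ' y => by rw [map_add, map_add]))
    (fun a ζ y => by
      change LComodStr.shift M L v (s'.act y n)
          (ydL s c m ((Bim.tens L.leftBim L.leftBim).r (op a) ζ)) =
        LComodStr.shift M L v (s'.act (L.s a * y) n) (ydL s c m ζ)
      rw [s'.mul, s'.act_s, ydL_r]
      generalize ydL s c m ζ = ξ
      induction ξ using Bim.t_induction with
      | h0 => simp only [map_zero]
      | ha x y hx hy => simp only [map_add, hx, hy]
      | ht u x => exact congrArg (Bim.t (M := L.leftBim) (u * v)) (Bim.t_bal a x _))

lemma ydF_eq (m : M) (v : U) (n : N) (ξ : Bim.tens L.leftBim L.leftBim) :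
    ydF s c s' m (Bim.t (M := L.leftBim) v n) ξ = ydH s c s' m v n
      ((α_ L.leftBim L.leftBim L.leftBim).inv.add (Bim.snd L.leftBim L.Δ L.Δ_s ξ)) := by
  induction ξ using Bim.t_induction with
  | h0 => simp only [map_zero]
  | ha x y hx hy => simp only [map_add, hx, hy]
  | ht x y =>
    change c.mulCoact (s.act x m) (L.reg.diag s' v n (L.Δ y)) = ydH s c s' m v n
      ((α_ L.leftBim L.leftBim L.leftBim).inv.add (Bim.t (M := L.leftBim) x (L.Δ y)))
    generalize L.Δ y = η
    induction η using Bim.t_induction with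
    | h0 => simp only [map_zero, Bim.t_zero]
    | ha x y hx hy => simp only [map_add, Bim.t_add, hx, hy]
    | ht y z =>
      rw [LModStr.diag_t, LComodStr.mulCoact_t, L.reg_act, LComodStr.shift_mul]
      rfl

lemma ydH_yd (h : ∀ u m, ydL s c m (L.Δ u) = L.diagAct L.reg s u (c.coact m))
    (m : M) (v : U) (n : N) (ξ : Bim.tens L.leftBim L.leftBim) :
    ydH s c s' m v n (L.comulL ξ) = L.mulFst _ v ((Bim.assoc L.leftBim M N).hom.add
      ((L.tensorLMod L.reg s).diag s' (c.coact m) n ξ)) := by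
  induction ξ using Bim.t_induction with
  | h0 => simp only [map_zero]
  | ha x y hx hy => simp only [map_add, hx, hy]
  | ht x y =>
    rw [L.comulL_t]
    change LComodStr.shift M L v (s'.act y n) (ydL s c m (L.Δ x)) =
      L.mulFst _ v ((Bim.assoc L.leftBim M N).hom.add
        (Bim.t (L.diagAct L.reg s x (c.coact m)) (s'.act y n)))
    rw [h]
    generalize L.diagAct L.reg s x (c.coact m) = η
    induction η using Bim.t_induction with
    | h0 => simp only [map_zero, Bim.zero_t]
    | ha x y hx hy => simp only [map_add, Bim.add_t, hx, hy]
    | ht y z => rfl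

lemma diagAct_mulFst (X : Bim A) (p : LModStr L.toAeRing X) (u v : U) (ξ : Bim.tens L.leftBim X) :
    L.mulFst X v (L.diagAct L.reg p u ξ) = L.diagAct L.reg p u (L.mulFst X v ξ) := by
  induction ξ using Bim.t_induction with
  | h0 => simp only [map_zero]
  | ha x y hx hy => simp only [map_add, hx, hy]
  | ht w x =>
    rw [LeftBialgebroid.mulFst_t, LeftBialgebroid.diagAct_t, LeftBialgebroid.diagAct_t]
    generalize L.Δ u = η
    induction η using Bim.t_induction with
    | h0 => simp only [map_zero]
    | ha x y hx hy => simp only [map_add, hx, hy]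
    | ht y z => exact congrArg (Bim.t (M := L.leftBim) · _) (mul_assoc y w v)

lemma ydF_Δ (h : ∀ u m, ydL s c m (L.Δ u) = L.diagAct L.reg s u (c.coact m))
    (m : M) (u : U) (η : Bim.tens L.leftBim N) :
    ydF s c s' m η (L.Δ u) = L.diagAct L.reg (L.tensorLMod s s') u (c.mulCoact m η) := by
  have hadd : ∀ η η' (ξ : Bim.tens L.leftBim L.leftBim), ydF s c s' m (η + η') ξ =
      ydF s c s' m η ξ + ydF s c s' m η' ξ := fun η η' ξ => by
    induction ξ using Bim.t_induction with
    | h0 => simp only [map_zero, add_zero]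
    | ha x y hx hy => simp only [map_add, hx, hy]; abel
    | ht x y =>
      change c.mulCoact (s.act x m) ((L.tensorLMod L.reg s').act y (η + η')) = _
      rw [map_add, map_add]; rfl
  have hzero : ∀ ξ : Bim.tens L.leftBim L.leftBim, ydF s c s' m 0 ξ = 0 := fun ξ => by
    have := hadd 0 0 ξ
    rwa [add_zero, left_eq_add] at this
  induction η using Bim.t_induction with
  | h0 => rw [hzero, map_zero, map_zero]
  | ha x y hx hy => rw [hadd, hx, hy, map_add, map_add]
  | ht v n =>
    rw [ydF_eq, L.coassoc', ydH_yd s c s' h]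
    have h1 := L.diagAct_assoc L.reg s s' u (Bim.t (c.coact m) n)
    rw [LeftBialgebroid.diagAct_t] at h1
    rw [h1, diagAct_mulFst, LComodStr.mulCoact_t]
    refine congrArg (L.diagAct L.reg (L.tensorLMod s s') u) ?_
    generalize c.coact m = ξ
    induction ξ using Bim.t_induction with
    | h0 => simp only [map_zero, Bim.zero_t]
    | ha x y hx hy => simp only [map_add, Bim.add_t, hx, hy]
    | ht y z => rfl

end

namespace LYDStr

/-- The tensor product of Yetter-Drinfel'd modules. -/
def tensor (p : LYDStr L M) (q : LYDStr L N) : LYDStr L (Bim.tens M N) where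
  mod := L.tensorLMod p.mod q.mod
  comod := p.comod.tensor q.comod
  yd u x := by
    have hadd : ∀ x y ξ, ydL (L.tensorLMod p.mod q.mod) (p.comod.tensor q.comod) (x + y) ξ =
        ydL (L.tensorLMod p.mod q.mod) (p.comod.tensor q.comod) x ξ +
        ydL (L.tensorLMod p.mod q.mod) (p.comod.tensor q.comod) y ξ := fun x y ξ => by
      induction ξ using Bim.t_induction with
      | h0 => simp only [map_zero, add_zero]
      | ha x y hx hy => simp only [map_add, hx, hy]; abel
      | ht u v => simp only [ydL_t, map_add]
    have hzero : ∀ ξ, ydL (L.tensorLMod p.mod q.mod) (p.comod.tensor q.comod) 0 ξ = 0 := fun ξ => by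
      have := hadd 0 0 ξ
      rwa [add_zero, left_eq_add] at this
    induction x using Bim.t_induction with
    | h0 => rw [hzero, map_zero, map_zero]
    | ha x y hx hy => rw [hadd, hx, hy, map_add, map_add]
    | ht m n =>
      rw [ydE_comul, L.coassoc, ydE_yd _ _ _ _ q.yd, ydF_Δ _ _ _ p.yd]; rfl

/-- The unit Yetter-Drinfel'd module `A`. -/
def unit (L : LeftBialgebroid A U) : LYDStr L (Bim.one A) where
  mod := L.unitLMod
  comod := LComodStr.unit L
  yd u (a : A) := by
    have h1 : ∀ ξ, ydL L.unitLMod (LComodStr.unit L) a ξ = Bim.t (M := L.leftBim)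
        ((L.counitFst L.leftBim).add (L.mulFst _ (L.s a) ξ)) (Bim.el 1) := fun ξ => by
      induction ξ using Bim.t_induction with
      | h0 => simp only [map_zero, Bim.zero_t]
      | ha x y hx hy => simp only [map_add, hx, hy]; exact (Bim.add_t _ _ _).symm
      | ht u v => rfl
    have h2 : ∀ ξ, L.reg.diag L.unitLMod (L.s a) (Bim.el 1) ξ = Bim.t (M := L.leftBim)
        ((L.counitSnd L.leftBim).add (L.mulFst _ (L.s a) ξ)) (Bim.el 1) := fun ξ => by
      induction ξ using Bim.t_induction with
      | h0 => simp only [map_zero, Bim.zero_t]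
      | ha x y hx hy => simp only [map_add, hx, hy]; exact (Bim.add_t _ _ _).symm
      | ht u v =>
        change Bim.t (M := L.leftBim) (u * L.s a) (Bim.el (L.ε (v * L.s 1))) =
          Bim.t (M := L.leftBim) (L.leftBim.r (op (L.ε v)) (u * L.s a)) (Bim.el 1)
        rw [Bim.t_bal, map_one L.s, mul_one, Bim.one_l, mul_one]
    rw [h1]
    change _ = L.reg.diag L.unitLMod (L.s a) (Bim.el 1) (L.Δ u)
    rw [h2, ← L.mulFst_Δ_s, L.counitFst_Δ, L.mulFst_Δ_s, L.counitSnd_mulFst', L.counitSnd_Δ]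

end LYDStr

/-- Left Yetter-Drinfel'd modules, with linear and colinear maps. -/
abbrev LYD (L : LeftBialgebroid A U) : StrOn (Bim A) where
  Str := LYDStr L
  IsHom p q f := (LMod L.toAeRing).IsHom p.mod q.mod f ∧ (LComod L).IsHom p.comod q.comod f
  id_mem p := ⟨(LMod L.toAeRing).id_mem p.mod, (LComod L).id_mem p.comod⟩
  comp_mem h h' := ⟨(LMod L.toAeRing).comp_mem h.1 h'.1, (LComod L).comp_mem h.2 h'.2⟩

/-- The monoidal structure on left Yetter-Drinfel'd modules. -/
def monLYD (L : LeftBialgebroid A U) : (LYD L).Mon where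
  tensor p q := p.tensor q
  unit := LYDStr.unit L
  inv_mem f h := ⟨L.monLMod.inv_mem f h.1, (monLComod L).inv_mem f h.2⟩
  tensor_mem h h' := ⟨L.monLMod.tensor_mem h.1 h'.1, (monLComod L).tensor_mem h.2 h'.2⟩
  assoc_mem p p' p'' := ⟨L.monLMod.assoc_mem p.mod p'.mod p''.mod,
    (monLComod L).assoc_mem p.comod p'.comod p''.comod⟩
  left_mem p := ⟨L.monLMod.left_mem p.mod, (monLComod L).left_mem p.comod⟩
  right_mem p := ⟨L.monLMod.right_mem p.mod, (monLComod L).right_mem p.comod⟩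

namespace LYDStr

variable (p : LYDStr L M) (q : LYDStr L N)

/-- `u ⊗ m ↦ u n ⊗ m` -/
def ev (s' : LModStr L.toAeRing N) (M : Bim A) (n : N) :
    Bim.tens L.leftBim M →+ Bim.tens N M :=
  Bim.fst M (AddMonoidHom.mk' (fun u : U => s'.act u n) (fun u v => s'.add u v n))
    (fun a u => by
      change s'.act (L.t (op a) * u) n = _
      rw [s'.mul, s'.act_t]; rfl)

@[simp] lemma ev_t (s' : LModStr L.toAeRing N) (n : N) (u : U) (m : M) :
    ev s' M n (Bim.t (M := L.leftBim) u m) = Bim.t (s'.act u n) m := rfl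

lemma ev_add (s' : LModStr L.toAeRing N) (n n' : N) (ξ : Bim.tens L.leftBim M) :
    ev s' M (n + n') ξ = ev s' M n ξ + ev s' M n' ξ := by
  induction ξ using Bim.t_induction with
  | h0 => simp only [map_zero, add_zero]
  | ha x y hx hy => simp only [map_add, hx, hy]; abel
  | ht u m => simp only [ev_t, map_add, Bim.add_t]

lemma ev_act (s' : LModStr L.toAeRing N) (v : U) (n : N) (ξ : Bim.tens L.leftBim M) :
    ev s' M (s'.act v n) ξ = ev s' M n (L.mulFst M v ξ) := by
  induction ξ using Bim.t_induction with
  | h0 => simp only [map_zero]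
  | ha x y hx hy => simp only [map_add, hx, hy]
  | ht u m => exact congrArg (Bim.t · m) (s'.mul u v n).symm

/-- The braiding `m ⊗ n ↦ m₍₋₁₎ n ⊗ m₍₀₎`, as a map of bimodules. -/
def braidBim : Bim.tens M N ⟶ Bim.tens N M :=
  Bim.tdesc (biHom (fun m n => ev q.mod M n (p.comod.coact m)) (fun m n n' => ev_add _ n n' _)
      (fun m m' n => by rw [map_add, map_add]))
    (fun a m n => by
      change ev q.mod M n (p.comod.coact (M.r (op a) m)) = ev q.mod M (N.l a n) (p.comod.coact m)
      rw [p.comod.coact_r, ← q.mod.act_s, ev_act])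
    (fun a m n => by
      change ev q.mod M n (p.comod.coact (M.l a m)) = (Bim.tens N M).l a (ev q.mod M n _)
      rw [p.comod.coact_l]
      generalize p.comod.coact m = ξ
      induction ξ using Bim.t_induction with
      | h0 => simp only [map_zero]
      | ha x y hx hy => simp only [map_add, hx, hy]
      | ht u m =>
        refine congrArg (Bim.t · m) ?_
        change q.mod.act (L.s a * u) n = _
        rw [q.mod.mul, q.mod.act_s]; rfl)
    (fun a m n => by
      obtain ⟨a⟩ := a
      change ev q.mod M (N.r (op a) n) (p.comod.coact m) =
        (Bim.tens N M).r (op a) (ev q.mod M n (p.comod.coact m))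
      rw [← q.mod.act_t, ev_act, p.comod.takeuchi]
      generalize p.comod.coact m = ξ
      induction ξ using Bim.t_induction with
      | h0 => simp only [map_zero]
      | ha x y hx hy => simp only [map_add, hx, hy]
      | ht u m => rfl)

lemma braidBim_t (m : M) (n : N) :
    (p.braidBim q).add (Bim.t m n) = ev q.mod M n (p.comod.coact m) := rfl

lemma ev_diagAct (u : U) (n : N) (ξ : Bim.tens L.leftBim M) :
    ev q.mod M n (L.diagAct L.reg p.mod u ξ) = L.diagAct q.mod p.mod u (ev q.mod M n ξ) := by
  induction ξ using Bim.t_induction with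
  | h0 => simp only [map_zero]
  | ha x y hx hy => simp only [map_add, hx, hy]
  | ht v m =>
    rw [ev_t, LeftBialgebroid.diagAct_t, LeftBialgebroid.diagAct_t]
    generalize L.Δ u = η
    induction η using Bim.t_induction with
    | h0 => simp only [map_zero]
    | ha x y hx hy => simp only [map_add, hx, hy]
    | ht y z => exact congrArg (Bim.t · _) (q.mod.mul y v n)

lemma braid_linear : (LMod L.toAeRing).IsHom (p.tensor q).mod (q.tensor p).mod (p.braidBim q) := by
  intro u x
  induction x using Bim.t_induction with
  | h0 => simp only [map_zero]
  | ha x y hx hy => simp only [map_add, hx, hy]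
  | ht m n =>
    change (p.braidBim q).add (p.mod.diag q.mod m n (L.Δ u)) =
      L.diagAct q.mod p.mod u (ev q.mod M n (p.comod.coact m))
    rw [← ev_diagAct, ← p.yd]
    generalize L.Δ u = η
    induction η using Bim.t_induction with
    | h0 => simp only [map_zero]
    | ha x y hx hy => simp only [map_add, hx, hy]
    | ht y z => exact ev_act q.mod z n _

/-- `u ⊗ ζ ↦ (u n) ⋆ ζ` -/
def evCoact (n : N) : Bim.tens L.leftBim (Bim.tens L.leftBim M) →+
    Bim.tens L.leftBim (Bim.tens N M) :=
  Bim.tlift (M := L.leftBim) (biHom (M := U) (fun u ζ => q.comod.mulCoact (q.mod.act u n) ζ)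
      (fun u ζ ζ' => map_add _ ζ ζ') (fun u u' ζ => by rw [q.mod.add, q.comod.mulCoact_add]))
    (fun a u ζ => by
      change q.comod.mulCoact (q.mod.act (L.t (op a) * u) n) ζ =
        q.comod.mulCoact (q.mod.act u n) ((Bim.tens L.leftBim M).l a ζ)
      rw [q.mod.mul, q.mod.act_t, q.comod.mulCoact_r])

/-- `u ⊗ m ↦ (u η) ⊗ m` -/
def actTens (M : Bim A) (η : Bim.tens L.leftBim N) :
    Bim.tens L.leftBim M →+ Bim.tens L.leftBim (Bim.tens N M) :=
  Bim.tlift (M := L.leftBim) (biHom (M := U)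
      (fun u m => (Bim.assoc L.leftBim N M).hom.add (Bim.t (L.diagAct L.reg q.mod u η) m))
      (fun u m m' => by rw [Bim.t_add, map_add])
      (fun u u' m => by
        have : L.diagAct L.reg q.mod (u + u') η = L.diagAct L.reg q.mod u η +
          L.diagAct L.reg q.mod u' η := (L.tensorLMod L.reg q.mod).add u u' η
        rw [this, Bim.add_t, map_add]))
    (fun a u m => by
      change (Bim.assoc L.leftBim N M).hom.add
          (Bim.t ((L.tensorLMod L.reg q.mod).act (L.t (op a) * u) η) m) =
        (Bim.assoc L.leftBim N M).hom.add
          (Bim.t ((L.tensorLMod L.reg q.mod).act u η) (M.l a m))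
      rw [LModStr.mul, LModStr.act_t, Bim.t_bal])

lemma actTens_add (η η' : Bim.tens L.leftBim N) (ξ : Bim.tens L.leftBim M) :
    q.actTens M (η + η') ξ = q.actTens M η ξ + q.actTens M η' ξ := by
  induction ξ using Bim.t_induction with
  | h0 => simp only [map_zero, add_zero]
  | ha x y hx hy => simp only [map_add, hx, hy]; abel
  | ht u m =>
    change (Bim.assoc L.leftBim N M).hom.add (Bim.t (L.diagAct L.reg q.mod u (η + η')) m) = _
    rw [map_add, Bim.add_t, map_add]; rfl

lemma evCoact_comul (n : N) (ξ : Bim.tens L.leftBim M) :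
    q.evCoact n ((L.comulFst M).add ξ) = q.actTens M (q.comod.coact n) ξ := by
  induction ξ using Bim.t_induction with
  | h0 => simp only [map_zero]
  | ha x y hx hy => simp only [map_add, hx, hy]
  | ht u m =>
    change q.evCoact n ((α_ L.leftBim L.leftBim M).hom.add (Bim.t (L.Δ u) m)) =
      (Bim.assoc L.leftBim N M).hom.add (Bim.t (L.diagAct L.reg q.mod u (q.comod.coact n)) m)
    rw [← q.yd]
    generalize L.Δ u = η
    induction η using Bim.t_induction with
    | h0 => simp only [map_zero, Bim.zero_t]
    | ha x y hx hy => simp only [map_add, Bim.add_t, hx, hy]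
    | ht x y =>
      change LComodStr.shift N L y m (q.comod.coact (q.mod.act x n)) =
        (Bim.assoc L.leftBim N M).hom.add (Bim.t (L.mulFst N y (q.comod.coact (q.mod.act x n))) m)
      generalize q.comod.coact (q.mod.act x n) = ζ
      induction ζ using Bim.t_induction with
      | h0 => simp only [map_zero, Bim.zero_t]
      | ha x y hx hy => simp only [map_add, Bim.add_t, hx, hy]
      | ht x y => rfl

lemma braid_colinear : (LComod L).IsHom (p.tensor q).comod (q.tensor p).comod (p.braidBim q) := by
  intro x
  induction x using Bim.t_induction with
  | h0 => simp only [map_zero]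
  | ha x y hx hy => simp only [map_add, hx, hy]
  | ht m n =>
    have h1 : ∀ ξ, q.comod.codiag p.comod (ev q.mod M n ξ) =
        q.evCoact n (Bim.snd L.leftBim p.comod.coact p.comod.coact_l ξ) := fun ξ => by
      induction ξ using Bim.t_induction with
      | h0 => simp only [map_zero]
      | ha x y hx hy => simp only [map_add, hx, hy]
      | ht x y => rfl
    change Bim.snd L.leftBim (p.braidBim q).add (p.braidBim q).map_l
      (p.comod.mulCoact m (q.comod.coact n)) =
      q.comod.codiag p.comod (ev q.mod M n (p.comod.coact m))
    rw [h1, ← p.comod.coassoc, evCoact_comul]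
    generalize q.comod.coact n = η
    induction η using Bim.t_induction with
    | h0 =>
      have := q.actTens_add (M := M) 0 0 (p.comod.coact m)
      rw [add_zero, left_eq_add] at this
      rw [this, map_zero, map_zero]
    | ha x y hx hy => rw [map_add, map_add, hx, hy, actTens_add]
    | ht v n =>
      rw [LComodStr.mulCoact_t]
      have h2 : ∀ ξ, Bim.snd L.leftBim (p.braidBim q).add (p.braidBim q).map_l
          (LComodStr.shift M L v n ξ) = L.mulMap v (ev q.mod M n) (fun a ξ => by
              induction ξ using Bim.t_induction with
              | h0 => simp only [map_zero]
              | ha x y hx hy => simp only [map_add, hx, hy]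
              | ht u m =>
                refine congrArg (Bim.t · m) ?_
                change q.mod.act (L.s a * u) n = _
                rw [q.mod.mul, q.mod.act_s]; rfl)
            (Bim.snd L.leftBim p.comod.coact p.comod.coact_l ξ) := fun ξ => by
        induction ξ using Bim.t_induction with
        | h0 => simp only [map_zero]
        | ha x y hx hy => simp only [map_add, hx, hy]
        | ht x y => rfl
      rw [h2, ← p.comod.coassoc]
      generalize p.comod.coact m = ξ
      induction ξ using Bim.t_induction with
      | h0 => simp only [map_zero]
      | ha x y hx hy => simp only [map_add, hx, hy]
      | ht u x =>
        rw [L.comulFst_t]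
        change _ = (Bim.assoc L.leftBim N M).hom.add (Bim.t (L.reg.diag q.mod v n (L.Δ u)) x)
        generalize L.Δ u = η
        induction η using Bim.t_induction with
        | h0 => simp only [map_zero, Bim.zero_t]
        | ha x y hx hy => simp only [map_add, Bim.add_t, hx, hy]
        | ht y z => rfl

end LYDStr

/-- The braiding `m ⊗ n ↦ m₍₋₁₎ n ⊗ m₍₀₎` of left Yetter-Drinfel'd modules. -/
def braidLYD (X Y : (LYD L).Obj) :
    (⟨X.base ⊗ Y.base, X.str.tensor Y.str⟩ : (LYD L).Obj) ⟶ ⟨Y.base ⊗ X.base, Y.str.tensor X.str⟩ :=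
  ⟨X.str.braidBim Y.str, X.str.braid_linear Y.str, X.str.braid_colinear Y.str⟩

end LeftYD

/-! ## Right Yetter-Drinfel'd modules -/

section RightYD

variable {A U : Type u} [Ring A] [Ring U]

namespace LeftBialgebroid

variable (L : LeftBialgebroid A U)

lemma mulLast_l (X : Bim A) (z : U) (a : A) (ξ : Bim.tens X L.leftBim) :
    L.mulLast X z ((Bim.tens X L.leftBim).l a ξ) = (Bim.tens X L.leftBim).l a (L.mulLast X z ξ) := by
  induction ξ using Bim.t_induction with
  | h0 => simp only [map_zero]
  | ha x y hx hy => simp only [map_add, hx, hy]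
  | ht u x => rfl

lemma mulLast_r (X : Bim A) (z : U) (a : Aᵐᵒᵖ) (ξ : Bim.tens X L.leftBim) :
    L.mulLast X z ((Bim.tens X L.leftBim).r a ξ) = (Bim.tens X L.leftBim).r a (L.mulLast X z ξ) := by
  induction ξ using Bim.t_induction with
  | h0 => simp only [map_zero]
  | ha x y hx hy => simp only [map_add, hx, hy]
  | ht x u => exact congrArg (Bim.t (N := L.leftBim) x) (mul_assoc (L.t a) u z)

end LeftBialgebroid

variable {L : LeftBialgebroid A U} {M N : Bim A}

/-- `u ⊗ v ↦ (v n)₍₀₎ ⊗ (v n)₍₁₎ u` -/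
def ydR (s : LModStr L.toAeRing N) (c : RComodStr L N) (n : N) :
    Bim.tens L.leftBim L.leftBim →+ Bim.tens N L.leftBim :=
  Bim.tlift (M := L.leftBim) (N := L.leftBim)
    (biHom (M := U) (N := U) (fun u v => L.mulLast N u (c.coact (s.act v n)))
      (fun u v v' => by rw [s.add, map_add, map_add]) (fun u u' v => L.mulLast_add N u u' _))
    (fun a u v => by
      change L.mulLast N (L.t (op a) * u) (c.coact (s.act v n)) =
        L.mulLast N u (c.coact (s.act (L.s a * v) n))
      rw [s.mul, s.act_s, c.coact_l, L.mulLast_mul])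

/-- A left module and right comodule with the same underlying bimodule, such that
`(u₍₂₎ n)₍₀₎ ⊗ (u₍₂₎ n)₍₁₎ u₍₁₎ = u₍₁₎ n₍₀₎ ⊗ u₍₂₎ n₍₁₎`. For a right bialgebroid `V`, which is a
left bialgebroid structure on `Vᵒᵖ`, these are the right Yetter-Drinfel'd modules over `V`: right
modules and right comodules with `(n v⁽²⁾)⁽⁰⁾ ⊗ v⁽¹⁾ (n v⁽²⁾)⁽¹⁾ = n⁽⁰⁾ v⁽¹⁾ ⊗ n⁽¹⁾ v⁽²⁾`. -/
structure RYDStr (L : LeftBialgebroid A U) (N : Bim A) where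
  mod : LModStr L.toAeRing N
  comod : RComodStr L N
  yd : ∀ u n, ydR mod comod n (L.Δ u) = L.diagAct mod L.reg u (comod.coact n)

section

variable (s : LModStr L.toAeRing M) (c : RComodStr L M) (s' : LModStr L.toAeRing N)
  (c' : RComodStr L N)

@[simp] lemma ydR_t (n : N) (u v : U) :
    ydR s' c' n (Bim.t (M := L.leftBim) (N := L.leftBim) u v) =
      L.mulLast N u (c'.coact (s'.act v n)) := rfl

lemma ydR_l (n : N) (a : A) (ζ : Bim.tens L.leftBim L.leftBim) :
    ydR s' c' n ((Bim.tens L.leftBim L.leftBim).l a ζ) =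
      (Bim.tens N L.leftBim).l a (ydR s' c' n ζ) := by
  induction ζ using Bim.t_induction with
  | h0 => simp only [map_zero]
  | ha x y hx hy => simp only [map_add, hx, hy]
  | ht u v =>
    change L.mulLast N (L.s a * u) (c'.coact (s'.act v n)) = _
    rw [L.mulLast_mul, c'.takeuchi, L.mulLast_l]; rfl

lemma ydR_r (n : N) (a : A) (ζ : Bim.tens L.leftBim L.leftBim) :
    ydR s' c' n ((Bim.tens L.leftBim L.leftBim).r (op a) ζ) =
      (Bim.tens N L.leftBim).r (op a) (ydR s' c' n ζ) := by
  induction ζ using Bim.t_induction with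
  | h0 => simp only [map_zero]
  | ha x y hx hy => simp only [map_add, hx, hy]
  | ht u v =>
    change L.mulLast N u (c'.coact (s'.act (L.t (op a) * v) n)) = _
    rw [s'.mul, s'.act_t, c'.coact_r, L.mulLast_r]; rfl

lemma mulLast_mulCoact (z : U) (n : N) (η : Bim.tens M L.leftBim) :
    L.mulLast _ z (c'.mulCoact n η) = c'.mulCoact n (L.mulLast M z η) := by
  induction η using Bim.t_induction with
  | h0 => simp only [map_zero]
  | ha x y hx hy => simp only [map_add, hx, hy]
  | ht m v =>
    change L.mulLast _ z (RComodStr.shift N L m v (c'.coact n)) =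
      RComodStr.shift N L m (v * z) (c'.coact n)
    generalize c'.coact n = ξ
    induction ξ using Bim.t_induction with
    | h0 => simp only [map_zero]
    | ha x y hx hy => simp only [map_add, hx, hy]
    | ht x u => exact congrArg (Bim.t (N := L.leftBim) _) (mul_assoc u v z)

/-- `ζ ⊗ y ↦ (ydR m ζ) ⋆ (y n)` -/
def ydRE (m : M) (n : N) : Bim.tens (Bim.tens L.leftBim L.leftBim) L.leftBim →+
    Bim.tens (Bim.tens M N) L.leftBim :=
  Bim.tlift (N := L.leftBim) (biHom (N := U)
      (fun ζ y => c'.mulCoact (s'.act y n) (ydR s c m ζ))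
      (fun ζ y y' => by rw [s'.add, c'.mulCoact_add])
      (fun ζ ζ' y => by rw [map_add, map_add]))
    (fun a ζ y => by
      change c'.mulCoact (s'.act y n) (ydR s c m ((Bim.tens L.leftBim L.leftBim).r (op a) ζ)) =
        c'.mulCoact (s'.act (L.s a * y) n) (ydR s c m ζ)
      rw [s'.mul, s'.act_s, c'.mulCoact_l, ydR_r])

lemma ydRE_comul (m : M) (n : N) (ξ : Bim.tens L.leftBim L.leftBim) :
    ydR (L.tensorLMod s s') (c.tensor c') (Bim.t m n) ξ =
      ydRE s c s' c' m n ((L.comulSnd L.leftBim).add ξ) := by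
  induction ξ using Bim.t_induction with
  | h0 => simp only [map_zero]
  | ha x y hx hy => simp only [map_add, hx, hy]
  | ht x y =>
    change L.mulLast _ x (c.codiag c' (s.diag s' m n (L.Δ y))) =
      ydRE s c s' c' m n
        ((α_ L.leftBim L.leftBim L.leftBim).inv.add (Bim.t (M := L.leftBim) x (L.Δ y)))
    generalize L.Δ y = η
    induction η using Bim.t_induction with
    | h0 => simp only [map_zero, Bim.t_zero]
    | ha x y hx hy => simp only [map_add, Bim.t_add, hx, hy]
    | ht v w => exact mulLast_mulCoact c' x (s'.act w n) _

/-- `x ⊗ y ↦ (x η) ⋆ (y n)` -/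
def ydRF (n : N) (η : Bim.tens M L.leftBim) : Bim.tens L.leftBim L.leftBim →+
    Bim.tens (Bim.tens M N) L.leftBim :=
  Bim.tlift (M := L.leftBim) (N := L.leftBim) (biHom (M := U) (N := U)
      (fun x y => c'.mulCoact (s'.act y n) ((L.tensorLMod s L.reg).act x η))
      (fun x y y' => by rw [s'.add, c'.mulCoact_add])
      (fun x x' y => by rw [LModStr.add, map_add]))
    (fun a x y => by
      change c'.mulCoact (s'.act y n) ((L.tensorLMod s L.reg).act (L.t (op a) * x) η) =
        c'.mulCoact (s'.act (L.s a * y) n) ((L.tensorLMod s L.reg).act x η)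
      rw [s'.mul, s'.act_s, c'.mulCoact_l, LModStr.mul, LModStr.act_t])

lemma ydRE_yd (h : ∀ u m, ydR s c m (L.Δ u) = L.diagAct s L.reg u (c.coact m))
    (m : M) (n : N) (ξ : Bim.tens L.leftBim L.leftBim) :
    ydRE s c s' c' m n (L.comulL ξ) = ydRF s s' c' n (c.coact m) ξ := by
  induction ξ using Bim.t_induction with
  | h0 => simp only [map_zero]
  | ha x y hx hy => simp only [map_add, hx, hy]
  | ht x y => exact congrArg (c'.mulCoact (s'.act y n)) (h x m)

/-- `x ⊗ ζ ↦ ydR n ζ`, multiplied by `v` and tensored with `x m` -/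
def ydRH (m : M) (v : U) (n : N) : Bim.tens L.leftBim (Bim.tens L.leftBim L.leftBim) →+
    Bim.tens (Bim.tens M N) L.leftBim :=
  Bim.tlift (M := L.leftBim) (biHom (M := U)
      (fun x ζ => RComodStr.shift N L (s.act x m) v (ydR s' c' n ζ))
      (fun x ζ ζ' => by rw [map_add, map_add])
      (fun x x' ζ => by rw [s.add, RComodStr.add_shift]))
    (fun a x ζ => by
      change RComodStr.shift N L (s.act (L.t (op a) * x) m) v (ydR s' c' n ζ) =
        RComodStr.shift N L (s.act x m) v
          (ydR s' c' n ((Bim.tens L.leftBim L.leftBim).l a ζ))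
      rw [s.mul, s.act_t, ydR_l]
      generalize ydR s' c' n ζ = ξ
      induction ξ using Bim.t_induction with
      | h0 => simp only [map_zero]
      | ha x y hx hy => simp only [map_add, hx, hy]
      | ht x u => exact congrArg (Bim.t (N := L.leftBim) · (u * v)) (Bim.t_bal a _ x))

lemma ydRF_eq (m : M) (v : U) (n : N) (ξ : Bim.tens L.leftBim L.leftBim) :
    ydRF s s' c' n (Bim.t (N := L.leftBim) m v) ξ =
      ydRH s s' c' m v n ((L.comulFst L.leftBim).add ξ) := by
  induction ξ using Bim.t_induction with
  | h0 => simp only [map_zero]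
  | ha x y hx hy => simp only [map_add, hx, hy]
  | ht x y =>
    change c'.mulCoact (s'.act y n) (s.diag L.reg m v (L.Δ x)) = ydRH s s' c' m v n
      ((α_ L.leftBim L.leftBim L.leftBim).hom.add (Bim.t (N := L.leftBim) (L.Δ x) y))
    generalize L.Δ x = η
    induction η using Bim.t_induction with
    | h0 => simp only [map_zero, Bim.zero_t]
    | ha x y hx hy => simp only [map_add, Bim.add_t, hx, hy]
    | ht x z =>
      rw [LModStr.diag_t, RComodStr.mulCoact_t, L.reg_act, RComodStr.shift_mul]
      rfl

lemma ydRH_yd (h : ∀ u n, ydR s' c' n (L.Δ u) = L.diagAct s' L.reg u (c'.coact n))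
    (m : M) (v : U) (n : N) (ξ : Bim.tens L.leftBim L.leftBim) :
    ydRH s s' c' m v n (Bim.snd L.leftBim L.Δ L.Δ_s ξ) =
      L.mulLast _ v ((Bim.assoc M N L.leftBim).inv.add
        (s.diag (L.tensorLMod s' L.reg) m (c'.coact n) ξ)) := by
  induction ξ using Bim.t_induction with
  | h0 => simp only [map_zero]
  | ha x y hx hy => simp only [map_add, hx, hy]
  | ht x y =>
    change RComodStr.shift N L (s.act x m) v (ydR s' c' n (L.Δ y)) =
      L.mulLast _ v ((Bim.assoc M N L.leftBim).inv.add
        (Bim.t (s.act x m) (L.diagAct s' L.reg y (c'.coact n))))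
    rw [h]
    generalize L.diagAct s' L.reg y (c'.coact n) = η
    induction η using Bim.t_induction with
    | h0 => simp only [map_zero, Bim.t_zero]
    | ha x y hx hy => simp only [map_add, Bim.t_add, hx, hy]
    | ht y z => rfl

lemma diagAct_mulLast (X : Bim A) (p : LModStr L.toAeRing X) (u v : U)
    (ξ : Bim.tens X L.leftBim) :
    L.mulLast X v (L.diagAct p L.reg u ξ) = L.diagAct p L.reg u (L.mulLast X v ξ) := by
  induction ξ using Bim.t_induction with
  | h0 => simp only [map_zero]
  | ha x y hx hy => simp only [map_add, hx, hy]
  | ht x w =>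
    change L.mulLast X v (p.diag L.reg x w (L.Δ u)) = p.diag L.reg x (w * v) (L.Δ u)
    generalize L.Δ u = η
    induction η using Bim.t_induction with
    | h0 => simp only [map_zero]
    | ha x y hx hy => simp only [map_add, hx, hy]
    | ht y z => exact congrArg (Bim.t (N := L.leftBim) _) (mul_assoc z w v)

lemma diagAct_assoc_inv {P : Bim A} (s'' : LModStr L.toAeRing P) (u : U)
    (x : Bim.tens M (Bim.tens N P)) :
    (Bim.assoc M N P).inv.add (L.diagAct s (L.tensorLMod s' s'') u x) =
      L.diagAct (L.tensorLMod s s') s'' u ((Bim.assoc M N P).inv.add x) := by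
  have h := L.diagAct_assoc s s' s'' u ((Bim.assoc M N P).inv.add x)
  have h1 : (Bim.assoc M N P).hom.add ((Bim.assoc M N P).inv.add x) = x :=
    congrArg (fun f => Bim.Hom.add f x) (Bim.assoc M N P).inv_hom_id
  rw [h1] at h
  rw [← h]
  exact congrArg (fun f => Bim.Hom.add f _) (Bim.assoc M N P).hom_inv_id

lemma ydRF_Δ (h : ∀ u n, ydR s' c' n (L.Δ u) = L.diagAct s' L.reg u (c'.coact n))
    (n : N) (u : U) (η : Bim.tens M L.leftBim) :
    ydRF s s' c' n η (L.Δ u) = L.diagAct (L.tensorLMod s s') L.reg u (c'.mulCoact n η) := by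
  have hadd : ∀ η η' (ξ : Bim.tens L.leftBim L.leftBim), ydRF s s' c' n (η + η') ξ =
      ydRF s s' c' n η ξ + ydRF s s' c' n η' ξ := fun η η' ξ => by
    induction ξ using Bim.t_induction with
    | h0 => simp only [map_zero, add_zero]
    | ha x y hx hy => simp only [map_add, hx, hy]; abel
    | ht x y =>
      change c'.mulCoact (s'.act y n) ((L.tensorLMod s L.reg).act x (η + η')) = _
      rw [map_add, map_add]; rfl
  have hzero : ∀ ξ : Bim.tens L.leftBim L.leftBim, ydRF s s' c' n 0 ξ = 0 := fun ξ => by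
    have := hadd 0 0 ξ
    rwa [add_zero, left_eq_add] at this
  induction η using Bim.t_induction with
  | h0 => rw [hzero, map_zero, map_zero]
  | ha x y hx hy => rw [hadd, hx, hy, map_add, map_add]
  | ht m v =>
    rw [ydRF_eq, L.coassoc, ydRH_yd s s' c' h]
    have h1 := diagAct_assoc_inv s s' L.reg u (Bim.t m (c'.coact n))
    rw [LeftBialgebroid.diagAct_t] at h1
    rw [h1, diagAct_mulLast, RComodStr.mulCoact_t]
    refine congrArg (L.diagAct (L.tensorLMod s s') L.reg u) ?_
    generalize c'.coact n = ξ
    induction ξ using Bim.t_induction with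
    | h0 => simp only [map_zero, Bim.t_zero]
    | ha x y hx hy => simp only [map_add, Bim.t_add, hx, hy]
    | ht y z => rfl

end

namespace RYDStr

/-- The tensor product of Yetter-Drinfel'd modules. -/
def tensor (p : RYDStr L M) (q : RYDStr L N) : RYDStr L (Bim.tens M N) where
  mod := L.tensorLMod p.mod q.mod
  comod := p.comod.tensor q.comod
  yd u x := by
    have hadd : ∀ x y ξ, ydR (L.tensorLMod p.mod q.mod) (p.comod.tensor q.comod) (x + y) ξ =
        ydR (L.tensorLMod p.mod q.mod) (p.comod.tensor q.comod) x ξ +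
        ydR (L.tensorLMod p.mod q.mod) (p.comod.tensor q.comod) y ξ := fun x y ξ => by
      induction ξ using Bim.t_induction with
      | h0 => simp only [map_zero, add_zero]
      | ha x y hx hy => simp only [map_add, hx, hy]; abel
      | ht u v => simp only [ydR_t, map_add]
    have hzero : ∀ ξ, ydR (L.tensorLMod p.mod q.mod) (p.comod.tensor q.comod) 0 ξ = 0 := fun ξ => by
      have := hadd 0 0 ξ
      rwa [add_zero, left_eq_add] at this
    induction x using Bim.t_induction with
    | h0 => rw [hzero, map_zero, map_zero]
    | ha x y hx hy => rw [hadd, hx, hy, map_add, map_add]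
    | ht m n =>
      have h1 : (L.comulSnd L.leftBim).add (L.Δ u) = L.comulL (L.Δ u) := L.coassoc' u
      rw [ydRE_comul, h1, ydRE_yd _ _ _ _ p.yd, ydRF_Δ _ _ _ q.yd]; rfl

/-- The unit Yetter-Drinfel'd module `A`. -/
def unit (L : LeftBialgebroid A U) : RYDStr L (Bim.one A) where
  mod := L.unitLMod
  comod := RComodStr.unit L
  yd u (a : A) := by
    have h1 : ∀ ξ, ydR L.unitLMod (RComodStr.unit L) a ξ = Bim.t (N := L.leftBim) (Bim.el 1)
        ((L.counitSnd L.leftBim).add (L.mulSnd (L.t (op a)) ξ)) := fun ξ => by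
      induction ξ using Bim.t_induction with
      | h0 => simp only [map_zero, Bim.t_zero]
      | ha x y hx hy => simp only [map_add, hx, hy]; exact (Bim.t_add _ _ _).symm
      | ht u v =>
        change Bim.t (N := L.leftBim) (Bim.el 1) (L.t (op (L.ε (v * L.s a))) * u) =
          Bim.t (N := L.leftBim) (Bim.el 1) (L.t (op (L.ε (v * L.t (op a)))) * u)
        have h3 := L.ε_mul_t v (L.s a)
        rw [L.ε_of_s] at h3
        rw [h3]
    have h2 : ∀ ξ, L.unitLMod.diag L.reg (Bim.el 1) (L.t (op a)) ξ = Bim.t (N := L.leftBim)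
        (Bim.el 1) ((L.counitFst L.leftBim).add (L.mulSnd (L.t (op a)) ξ)) := fun ξ => by
      induction ξ using Bim.t_induction with
      | h0 => simp only [map_zero, Bim.t_zero]
      | ha x y hx hy => simp only [map_add, hx, hy]; exact (Bim.t_add _ _ _).symm
      | ht u v =>
        change Bim.t (N := L.leftBim) (Bim.el (L.ε (u * L.s 1))) (v * L.t (op a)) =
          Bim.t (N := L.leftBim) (Bim.el 1) (L.leftBim.l (L.ε u) (v * L.t (op a)))
        rw [← Bim.t_bal, map_one L.s, mul_one, Bim.one_r, one_mul, unop_op]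
    rw [h1]
    change _ = L.unitLMod.diag L.reg (Bim.el 1) (L.t (op a)) (L.Δ u)
    rw [h2, ← L.mulSnd_Δ_t, L.counitSnd_Δ, L.mulSnd_Δ_t, L.counitFst_mulSnd', L.counitFst_Δ]

end RYDStr

/-- Right Yetter-Drinfel'd modules, with linear and colinear maps. -/
abbrev RYD (L : LeftBialgebroid A U) : StrOn (Bim A) where
  Str := RYDStr L
  IsHom p q f := (LMod L.toAeRing).IsHom p.mod q.mod f ∧ (RComod L).IsHom p.comod q.comod f
  id_mem p := ⟨(LMod L.toAeRing).id_mem p.mod, (RComod L).id_mem p.comod⟩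
  comp_mem h h' := ⟨(LMod L.toAeRing).comp_mem h.1 h'.1, (RComod L).comp_mem h.2 h'.2⟩

/-- The monoidal structure on right Yetter-Drinfel'd modules. -/
def monRYD (L : LeftBialgebroid A U) : (RYD L).Mon where
  tensor p q := p.tensor q
  unit := RYDStr.unit L
  inv_mem f h := ⟨L.monLMod.inv_mem f h.1, (monRComod L).inv_mem f h.2⟩
  tensor_mem h h' := ⟨L.monLMod.tensor_mem h.1 h'.1, (monRComod L).tensor_mem h.2 h'.2⟩
  assoc_mem p p' p'' := ⟨L.monLMod.assoc_mem p.mod p'.mod p''.mod,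
    (monRComod L).assoc_mem p.comod p'.comod p''.comod⟩
  left_mem p := ⟨L.monLMod.left_mem p.mod, (monRComod L).left_mem p.comod⟩
  right_mem p := ⟨L.monLMod.right_mem p.mod, (monRComod L).right_mem p.comod⟩

namespace RYDStr

variable (p : RYDStr L M) (q : RYDStr L N)

/-- `n ⊗ u ↦ n ⊗ u m` -/
def ev (s : LModStr L.toAeRing M) (N : Bim A) (m : M) :
    Bim.tens N L.leftBim →+ Bim.tens N M :=
  Bim.snd N (AddMonoidHom.mk' (fun u : U => s.act u m) (fun u v => s.add u v m))
    (fun a u => by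
      change s.act (L.s a * u) m = _
      rw [s.mul, s.act_s]; rfl)

@[simp] lemma ev_t (s : LModStr L.toAeRing M) (m : M) (u : U) (n : N) :
    ev s N m (Bim.t (N := L.leftBim) n u) = Bim.t n (s.act u m) := rfl

lemma ev_add (s : LModStr L.toAeRing M) (m m' : M) (ξ : Bim.tens N L.leftBim) :
    ev s N (m + m') ξ = ev s N m ξ + ev s N m' ξ := by
  induction ξ using Bim.t_induction with
  | h0 => simp only [map_zero, add_zero]
  | ha x y hx hy => simp only [map_add, hx, hy]; abel
  | ht u m => simp only [ev_t, map_add, Bim.t_add]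

lemma ev_act (s : LModStr L.toAeRing M) (v : U) (m : M) (ξ : Bim.tens N L.leftBim) :
    ev s N (s.act v m) ξ = ev s N m (L.mulLast N v ξ) := by
  induction ξ using Bim.t_induction with
  | h0 => simp only [map_zero]
  | ha x y hx hy => simp only [map_add, hx, hy]
  | ht n u => exact congrArg (Bim.t n) (s.mul u v m).symm

/-- The braiding `m ⊗ n ↦ n₍₀₎ ⊗ n₍₁₎ m`, as a map of bimodules. -/
def braidBim : Bim.tens M N ⟶ Bim.tens N M :=
  Bim.tdesc (biHom (fun m n => ev p.mod N m (q.comod.coact n))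
      (fun m n n' => by rw [map_add, map_add]) (fun m m' n => ev_add _ m m' _))
    (fun a m n => by
      change ev p.mod N (M.r (op a) m) (q.comod.coact n) = ev p.mod N m (q.comod.coact (N.l a n))
      rw [q.comod.coact_l, ← p.mod.act_t, ev_act])
    (fun a m n => by
      change ev p.mod N (M.l a m) (q.comod.coact n) = (Bim.tens N M).l a (ev p.mod N m _)
      rw [← p.mod.act_s, ev_act, q.comod.takeuchi]
      generalize q.comod.coact n = ξ
      induction ξ using Bim.t_induction with
      | h0 => simp only [map_zero]
      | ha x y hx hy => simp only [map_add, hx, hy]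
      | ht n u => rfl)
    (fun a m n => by
      obtain ⟨a⟩ := a
      change ev p.mod N m (q.comod.coact (N.r (op a) n)) =
        (Bim.tens N M).r (op a) (ev p.mod N m (q.comod.coact n))
      rw [q.comod.coact_r]
      generalize q.comod.coact n = ξ
      induction ξ using Bim.t_induction with
      | h0 => simp only [map_zero]
      | ha x y hx hy => simp only [map_add, hx, hy]
      | ht n u =>
        refine congrArg (Bim.t n) ?_
        change p.mod.act (L.t (op a) * u) m = _
        rw [p.mod.mul, p.mod.act_t]; rfl)

lemma braidBim_t (m : M) (n : N) :
    (p.braidBim q).add (Bim.t m n) = ev p.mod N m (q.comod.coact n) := rfl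

lemma ev_diagAct (u : U) (m : M) (ξ : Bim.tens N L.leftBim) :
    ev p.mod N m (L.diagAct q.mod L.reg u ξ) = L.diagAct q.mod p.mod u (ev p.mod N m ξ) := by
  induction ξ using Bim.t_induction with
  | h0 => simp only [map_zero]
  | ha x y hx hy => simp only [map_add, hx, hy]
  | ht n v =>
    rw [ev_t, LeftBialgebroid.diagAct_t, LeftBialgebroid.diagAct_t]
    generalize L.Δ u = η
    induction η using Bim.t_induction with
    | h0 => simp only [map_zero]
    | ha x y hx hy => simp only [map_add, hx, hy]
    | ht y z => exact congrArg (Bim.t _) (p.mod.mul z v m)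

lemma braid_linear : (LMod L.toAeRing).IsHom (p.tensor q).mod (q.tensor p).mod (p.braidBim q) := by
  intro u x
  induction x using Bim.t_induction with
  | h0 => simp only [map_zero]
  | ha x y hx hy => simp only [map_add, hx, hy]
  | ht m n =>
    change (p.braidBim q).add (p.mod.diag q.mod m n (L.Δ u)) =
      L.diagAct q.mod p.mod u (ev p.mod N m (q.comod.coact n))
    rw [← ev_diagAct, ← q.yd]
    generalize L.Δ u = η
    induction η using Bim.t_induction with
    | h0 => simp only [map_zero]
    | ha x y hx hy => simp only [map_add, hx, hy]
    | ht y z => exact ev_act p.mod y m _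

/-- `ζ ⊗ u ↦ ζ ⋆ (u m)` -/
def evCoact (m : M) : Bim.tens (Bim.tens N L.leftBim) L.leftBim →+
    Bim.tens (Bim.tens N M) L.leftBim :=
  Bim.tlift (N := L.leftBim) (biHom (N := U) (fun ζ u => p.comod.mulCoact (p.mod.act u m) ζ)
      (fun ζ u u' => by rw [p.mod.add, p.comod.mulCoact_add]) (fun ζ ζ' u => map_add _ ζ ζ'))
    (fun a ζ u => by
      change p.comod.mulCoact (p.mod.act u m) ((Bim.tens N L.leftBim).r (op a) ζ) =
        p.comod.mulCoact (p.mod.act (L.s a * u) m) ζ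
      rw [p.mod.mul, p.mod.act_s, p.comod.mulCoact_l])

/-- `n ⊗ u ↦ n ⊗ (u η)` -/
def actTens (N : Bim A) (η : Bim.tens M L.leftBim) :
    Bim.tens N L.leftBim →+ Bim.tens (Bim.tens N M) L.leftBim :=
  Bim.tlift (N := L.leftBim) (biHom (N := U)
      (fun n u => (Bim.assoc N M L.leftBim).inv.add (Bim.t n (L.diagAct p.mod L.reg u η)))
      (fun n u u' => by
        have : L.diagAct p.mod L.reg (u + u') η = L.diagAct p.mod L.reg u η +
          L.diagAct p.mod L.reg u' η := (L.tensorLMod p.mod L.reg).add u u' η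
        rw [this, Bim.t_add, map_add])
      (fun n n' u => by rw [Bim.add_t, map_add]))
    (fun a n u => by
      change (Bim.assoc N M L.leftBim).inv.add
          (Bim.t (N.r (op a) n) ((L.tensorLMod p.mod L.reg).act u η)) =
        (Bim.assoc N M L.leftBim).inv.add
          (Bim.t n ((L.tensorLMod p.mod L.reg).act (L.s a * u) η))
      rw [LModStr.mul, LModStr.act_s, Bim.t_bal])

lemma actTens_add (η η' : Bim.tens M L.leftBim) (ξ : Bim.tens N L.leftBim) :
    p.actTens N (η + η') ξ = p.actTens N η ξ + p.actTens N η' ξ := by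
  induction ξ using Bim.t_induction with
  | h0 => simp only [map_zero, add_zero]
  | ha x y hx hy => simp only [map_add, hx, hy]; abel
  | ht n u =>
    change (Bim.assoc N M L.leftBim).inv.add (Bim.t n (L.diagAct p.mod L.reg u (η + η'))) = _
    rw [map_add, Bim.t_add, map_add]; rfl

lemma evCoact_comul (m : M) (ξ : Bim.tens N L.leftBim) :
    p.evCoact m ((L.comulSnd N).add ξ) = p.actTens N (p.comod.coact m) ξ := by
  induction ξ using Bim.t_induction with
  | h0 => simp only [map_zero]
  | ha x y hx hy => simp only [map_add, hx, hy]
  | ht n u =>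
    change p.evCoact m ((α_ N L.leftBim L.leftBim).inv.add (Bim.t n (L.Δ u))) =
      (Bim.assoc N M L.leftBim).inv.add (Bim.t n (L.diagAct p.mod L.reg u (p.comod.coact m)))
    rw [← p.yd]
    generalize L.Δ u = η
    induction η using Bim.t_induction with
    | h0 => simp only [map_zero, Bim.t_zero]
    | ha x y hx hy => simp only [map_add, Bim.t_add, hx, hy]
    | ht x y =>
      change RComodStr.shift M L n x (p.comod.coact (p.mod.act y m)) =
        (Bim.assoc N M L.leftBim).inv.add (Bim.t n (L.mulLast M x (p.comod.coact (p.mod.act y m))))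
      generalize p.comod.coact (p.mod.act y m) = ζ
      induction ζ using Bim.t_induction with
      | h0 => simp only [map_zero, Bim.t_zero]
      | ha x y hx hy => simp only [map_add, Bim.t_add, hx, hy]
      | ht x y => rfl

lemma braid_colinear : (RComod L).IsHom (p.tensor q).comod (q.tensor p).comod (p.braidBim q) := by
  intro x
  induction x using Bim.t_induction with
  | h0 => simp only [map_zero]
  | ha x y hx hy => simp only [map_add, hx, hy]
  | ht m n =>
    have h1 : ∀ ξ, q.comod.codiag p.comod (ev p.mod N m ξ) =
        p.evCoact m (Bim.fst L.leftBim q.comod.coact q.comod.coact_r ξ) := fun ξ => by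
      induction ξ using Bim.t_induction with
      | h0 => simp only [map_zero]
      | ha x y hx hy => simp only [map_add, hx, hy]
      | ht x y => rfl
    change Bim.fst L.leftBim (p.braidBim q).add (fun a m => (p.braidBim q).map_r (op a) m)
      (q.comod.mulCoact n (p.comod.coact m)) =
      q.comod.codiag p.comod (ev p.mod N m (q.comod.coact n))
    rw [h1, ← q.comod.coassoc, evCoact_comul]
    generalize p.comod.coact m = η
    induction η using Bim.t_induction with
    | h0 =>
      have := p.actTens_add (N := N) 0 0 (q.comod.coact n)
      rw [add_zero, left_eq_add] at this
      rw [this, map_zero, map_zero]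
    | ha x y hx hy => rw [map_add, map_add, hx, hy, actTens_add]
    | ht m v =>
      rw [RComodStr.mulCoact_t]
      have h2 : ∀ ξ, Bim.fst L.leftBim (p.braidBim q).add
          (fun a m => (p.braidBim q).map_r (op a) m) (RComodStr.shift N L m v ξ) =
          L.mapMul v (ev p.mod N m) (fun a ξ => by
              induction ξ using Bim.t_induction with
              | h0 => simp only [map_zero]
              | ha x y hx hy => simp only [map_add, hx, hy]
              | ht n u =>
                refine congrArg (Bim.t n) ?_
                change p.mod.act (L.t (op a) * u) m = _
                rw [p.mod.mul, p.mod.act_t]; rfl)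
            (Bim.fst L.leftBim q.comod.coact q.comod.coact_r ξ) := fun ξ => by
        induction ξ using Bim.t_induction with
        | h0 => simp only [map_zero]
        | ha x y hx hy => simp only [map_add, hx, hy]
        | ht x y => rfl
      rw [h2, ← q.comod.coassoc]
      generalize q.comod.coact n = ξ
      induction ξ using Bim.t_induction with
      | h0 => simp only [map_zero]
      | ha x y hx hy => simp only [map_add, hx, hy]
      | ht x u =>
        rw [L.comulSnd_t]
        change _ = (Bim.assoc N M L.leftBim).inv.add (Bim.t x (p.mod.diag L.reg m v (L.Δ u)))
        generalize L.Δ u = η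
        induction η using Bim.t_induction with
        | h0 => simp only [map_zero, Bim.t_zero]
        | ha x y hx hy => simp only [map_add, Bim.t_add, hx, hy]
        | ht y z => rfl

end RYDStr

/-- The braiding `m ⊗ n ↦ n₍₀₎ ⊗ n₍₁₎ m` of right Yetter-Drinfel'd modules; over a right bialgebroid
`V`, in terms of right modules, it reads `m ⊗ n ↦ n⁽⁰⁾ ⊗ m n⁽¹⁾`. -/
def braidRYD (X Y : (RYD L).Obj) :
    (⟨X.base ⊗ Y.base, X.str.tensor Y.str⟩ : (RYD L).Obj) ⟶ ⟨Y.base ⊗ X.base, Y.str.tensor X.str⟩ :=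
  ⟨X.str.braidBim Y.str, X.str.braid_linear Y.str, X.str.braid_colinear Y.str⟩

end RightYD

/-! ## The dual of a left bialgebroid -/

section Dual

variable {A U : Type u} [Ring A] [Ring U]

namespace LeftBialgebroid

variable (L : LeftBialgebroid A U)

/-- The additive maps `φ : U → A` with `φ(t(a) u) = φ(u) a`. -/
def dualSub : AddSubgroup (U →+ A) where
  carrier := {φ | ∀ a u, φ (L.t (op a) * u) = φ u * a}
  zero_mem' _ _ := (zero_mul _).symm
  add_mem' {φ ψ} h h' a u := by
    change φ _ + ψ _ = (φ u + ψ u) * a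
    rw [h, h', add_mul]
  neg_mem' {φ} h a u := by
    change -φ _ = (-φ u) * a
    rw [h, neg_mul]

/-- The dual `U* = Hom_{Aᵒᵖ}(U_◃, A)` of right `A`-linear maps. -/
def Dual : Type u := L.dualSub

instance : AddCommGroup L.Dual := inferInstanceAs (AddCommGroup L.dualSub)

/-- The pairing `⟨φ, u⟩ = φ(u)`. -/
def ev : L.Dual →+ U →+ A := L.dualSub.subtype

variable {L} in
lemma dual_ext {φ ψ : L.Dual} (h : ∀ u, L.ev φ u = L.ev ψ u) : φ = ψ :=
  Subtype.ext (AddMonoidHom.ext h)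

lemma ev_t (φ : L.Dual) (a : A) (u : U) : L.ev φ (L.t (op a) * u) = L.ev φ u * a := φ.2 a u

/-- An element of the dual, from a function. -/
def mkDual (f : U →+ A) (h : ∀ a u, f (L.t (op a) * u) = f u * a) : L.Dual := ⟨f, h⟩

@[simp] lemma ev_mk (f : U →+ A) (h : ∀ a u, f (L.t (op a) * u) = f u * a) (u : U) :
    L.ev (L.mkDual f h) u = f u := rfl

/-- `u ⊗ x ↦ φ(u) x` -/
def contr (X : Bim A) (φ : L.Dual) : Bim.tens L.leftBim X →+ X :=
  Bim.tlift (M := L.leftBim) (biHom (M := U) (fun u x => X.l (L.ev φ u) x)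
      (fun u x x' => map_add _ _ _) (fun u u' x => by rw [map_add, X.l_add]))
    (fun a u x => by
      change X.l (L.ev φ (L.t (op a) * u)) x = X.l (L.ev φ u) (X.l a x)
      rw [ev_t, X.l_mul])

@[simp] lemma contr_t (X : Bim A) (φ : L.Dual) (u : U) (x : X) :
    L.contr X φ (Bim.t (M := L.leftBim) u x) = X.l (L.ev φ u) x := rfl

lemma contr_r (X : Bim A) (φ : L.Dual) (a : Aᵐᵒᵖ) (ξ : Bim.tens L.leftBim X) :
    L.contr X φ ((Bim.tens L.leftBim X).r a ξ) = X.r a (L.contr X φ ξ) := by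
  induction ξ using Bim.t_induction with
  | h0 => simp only [map_zero]
  | ha x y hx hy => simp only [map_add, hx, hy]
  | ht u x => exact X.comm _ _ _

lemma contr_add (X : Bim A) (φ ψ : L.Dual) (ξ : Bim.tens L.leftBim X) :
    L.contr X (φ + ψ) ξ = L.contr X φ ξ + L.contr X ψ ξ := by
  induction ξ using Bim.t_induction with
  | h0 => simp only [map_zero, add_zero]
  | ha x y hx hy => simp only [map_add, hx, hy]; abel
  | ht u x => rw [contr_t, map_add, AddMonoidHom.add_apply, X.l_add]; rfl

/-- `φ(u₍₁₎) u₍₂₎` -/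
def conv (φ : L.Dual) : U →+ U := (L.contr L.leftBim φ).comp L.Δ

lemma conv_apply (φ : L.Dual) (u : U) : L.conv φ u = L.contr L.leftBim φ (L.Δ u) := rfl

lemma conv_t (φ : L.Dual) (a : Aᵐᵒᵖ) (u : U) : L.conv φ (L.t a * u) = L.t a * L.conv φ u := by
  rw [conv_apply, Δ_t, contr_r]; rfl

lemma conv_add (φ ψ : L.Dual) (u : U) : L.conv (φ + ψ) u = L.conv φ u + L.conv ψ u :=
  L.contr_add L.leftBim φ ψ (L.Δ u)

/-- The product `⟨φ ψ, u⟩ = ⟨ψ, s(⟨φ, u₍₁₎⟩) u₍₂₎⟩`. -/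
def dualMul (φ ψ : L.Dual) : L.Dual :=
  L.mkDual ((L.ev ψ).comp (L.conv φ)) (fun a u => by
    change L.ev ψ (L.conv φ _) = L.ev ψ (L.conv φ u) * a
    rw [conv_t, ev_t])

/-- The unit element is the counit. -/
def dualOne : L.Dual := L.mkDual L.ε (fun a u => L.ε_t (op a) u)

lemma ev_dualMul (φ ψ : L.Dual) (u : U) : L.ev (L.dualMul φ ψ) u = L.ev ψ (L.conv φ u) := rfl

lemma conv_mul (φ ψ : L.Dual) (u : U) : L.conv (L.dualMul φ ψ) u = L.conv ψ (L.conv φ u) := by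
  have h1 : ∀ ξ : Bim.tens L.leftBim L.leftBim, L.contr L.leftBim (L.dualMul φ ψ) ξ =
      L.contr L.leftBim ψ (L.contr (Bim.tens L.leftBim L.leftBim) φ
        ((L.comulFst L.leftBim).add ξ)) := fun ξ => by
    induction ξ using Bim.t_induction with
    | h0 => simp only [map_zero]
    | ha x y hx hy => simp only [map_add, hx, hy]
    | ht x y =>
      rw [L.comulFst_t, contr_t, ev_dualMul, conv_apply]
      generalize L.Δ x = η
      induction η using Bim.t_induction with
      | h0 => simp only [map_zero, Bim.zero_t]; rfl
      | ha x y hx hy =>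
        rw [map_add, map_add, Bim.l_add, Bim.add_t, map_add, map_add, map_add, hx, hy]
      | ht x z => rfl
  have h2 : ∀ ξ : Bim.tens L.leftBim L.leftBim, L.contr (Bim.tens L.leftBim L.leftBim) φ
      (Bim.snd L.leftBim L.Δ L.Δ_s ξ) = L.Δ (L.contr L.leftBim φ ξ) := fun ξ => by
    induction ξ using Bim.t_induction with
    | h0 => simp only [map_zero]
    | ha x y hx hy => simp only [map_add, hx, hy]
    | ht x y => exact (L.Δ_s _ _).symm
  rw [conv_apply, h1, L.coassoc, h2]; rfl

lemma conv_one (u : U) : L.conv L.dualOne u = u := by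
  have h : ∀ ξ : Bim.tens L.leftBim L.leftBim, L.contr L.leftBim L.dualOne ξ =
      (L.counitFst L.leftBim).add ξ := fun ξ => by
    induction ξ using Bim.t_induction with
    | h0 => simp only [map_zero]
    | ha x y hx hy => simp only [map_add, hx, hy]
    | ht x y => rfl
  rw [conv_apply, h, L.counitFst_Δ]

lemma ε_contr (φ : L.Dual) (ξ : Bim.tens L.leftBim L.leftBim) :
    L.ε (L.contr L.leftBim φ ξ) = L.ev φ ((L.counitSnd L.leftBim).add ξ) := by
  induction ξ using Bim.t_induction with
  | h0 => simp only [map_zero]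
  | ha x y hx hy => simp only [map_add, hx, hy]
  | ht x y => exact (L.ε_s _ _).trans (L.ev_t φ _ _).symm

lemma ε_conv (φ : L.Dual) (u : U) : L.ε (L.conv φ u) = L.ev φ u := by
  rw [conv_apply, ε_contr, counitSnd_Δ]

/-- The ring structure on the dual, with product `⟨φ ψ, u⟩ = ⟨ψ, s(⟨φ, u₍₁₎⟩) u₍₂₎⟩` and unit `ε`. -/
instance : Ring L.Dual where
  __ := (inferInstance : AddCommGroup L.Dual)
  mul := L.dualMul
  one := L.dualOne
  left_distrib φ ψ χ := L.dual_ext fun _ => rfl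
  right_distrib φ ψ χ := dual_ext fun u => by
    change L.ev χ (L.conv (φ + ψ) u) = L.ev χ (L.conv φ u) + L.ev χ (L.conv ψ u)
    rw [conv_add, map_add]
  zero_mul φ := dual_ext fun u => by
    change L.ev φ (L.conv 0 u) = 0
    have := L.conv_add 0 0 u
    rw [add_zero, left_eq_add] at this
    rw [this, map_zero]
  mul_zero φ := dual_ext fun _ => rfl
  mul_assoc φ ψ χ := dual_ext fun u => congrArg (L.ev χ) (L.conv_mul φ ψ u)
  one_mul φ := dual_ext fun u => congrArg (L.ev φ) (L.conv_one u)
  mul_one φ := dual_ext fun u => L.ε_conv φ u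

lemma ev_mul (φ ψ : L.Dual) (u : U) : L.ev (φ * ψ) u = L.ev ψ (L.conv φ u) := rfl

lemma ev_one (u : U) : L.ev 1 u = L.ε u := rfl

/-- `sʳ(a) = ε(- s(a))` -/
def dualS : A →+* L.Dual where
  toFun a := L.mkDual (L.ε.comp (AddMonoidHom.mulRight (L.s a))) (fun b u => by
    change L.ε (L.t (op b) * u * L.s a) = L.ε (u * L.s a) * b
    rw [mul_assoc, ε_t]; rfl)
  map_one' := dual_ext fun u => by
    change L.ε (u * L.s 1) = L.ε u
    rw [map_one, mul_one]
  map_mul' a b := dual_ext fun u => by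
    have h : ∀ ξ : Bim.tens L.leftBim L.leftBim, L.contr L.leftBim (L.mkDual
        (L.ε.comp (AddMonoidHom.mulRight (L.s a))) (fun b u => by
          change L.ε (L.t (op b) * u * L.s a) = L.ε (u * L.s a) * b
          rw [mul_assoc, ε_t]; rfl)) ξ =
        (L.counitFst L.leftBim).add (L.mulFst L.leftBim (L.s a) ξ) := fun ξ => by
      induction ξ using Bim.t_induction with
      | h0 => simp only [map_zero]
      | ha x y hx hy => simp only [map_add, hx, hy]
      | ht x y => rfl
    change L.ε (u * L.s (a * b)) = L.ε (L.contr L.leftBim _ (L.Δ u) * L.s b)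
    rw [h, ← L.mulFst_Δ_s, L.counitFst_Δ, map_mul L.s, mul_assoc]
  map_zero' := dual_ext fun u => by
    change L.ε (u * L.s 0) = 0
    rw [map_zero, mul_zero, map_zero]
  map_add' a b := dual_ext fun u => by
    change L.ε (u * L.s (a + b)) = L.ε (u * L.s a) + L.ε (u * L.s b)
    rw [map_add, mul_add, map_add]

/-- `tʳ(a) = a ε(-)` -/
def dualT : Aᵐᵒᵖ →+* L.Dual where
  toFun a := L.mkDual ((AddMonoidHom.mulLeft a.unop).comp L.ε) (fun b u => by
    change a.unop * L.ε (L.t (op b) * u) = a.unop * L.ε u * b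
    rw [ε_t, mul_assoc]; rfl)
  map_one' := dual_ext fun u => one_mul (L.ε u)
  map_mul' a b := dual_ext fun u => by
    have h : ∀ ξ : Bim.tens L.leftBim L.leftBim, L.contr L.leftBim (L.mkDual
        ((AddMonoidHom.mulLeft a.unop).comp L.ε) (fun b u => by
          change a.unop * L.ε (L.t (op b) * u) = a.unop * L.ε u * b
          rw [ε_t, mul_assoc]; rfl)) ξ =
        L.s a.unop * ((L.counitFst L.leftBim).add ξ : U) := fun ξ => by
      induction ξ using Bim.t_induction with
      | h0 => simp only [map_zero]; exact (mul_zero _).symm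
      | ha x y hx hy => simp only [map_add, hx, hy]; exact (mul_add _ _ _).symm
      | ht x y =>
        change L.s (a.unop * L.ε x) * y = L.s a.unop * (L.s (L.ε x) * y)
        rw [map_mul, mul_assoc]
    change b.unop * a.unop * L.ε u = b.unop * L.ε (L.contr L.leftBim _ (L.Δ u))
    rw [h, L.counitFst_Δ, ε_s, mul_assoc]
  map_zero' := dual_ext fun u => zero_mul (L.ε u)
  map_add' a b := dual_ext fun u => add_mul a.unop b.unop (L.ε u)

lemma conv_dualS (a : A) (u : U) : L.conv (L.dualS a) u = u * L.s a := by
  have h : ∀ ξ : Bim.tens L.leftBim L.leftBim, L.contr L.leftBim (L.dualS a) ξ =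
      (L.counitFst L.leftBim).add (L.mulFst L.leftBim (L.s a) ξ) := fun ξ => by
    induction ξ using Bim.t_induction with
    | h0 => simp only [map_zero]
    | ha x y hx hy => simp only [map_add, hx, hy]
    | ht x y => rfl
  rw [conv_apply, h, ← L.mulFst_Δ_s, L.counitFst_Δ]

lemma conv_dualT (a : Aᵐᵒᵖ) (u : U) : L.conv (L.dualT a) u = L.s a.unop * u := by
  have h : ∀ ξ : Bim.tens L.leftBim L.leftBim, L.contr L.leftBim (L.dualT a) ξ =
      L.s a.unop * ((L.counitFst L.leftBim).add ξ : U) := fun ξ => by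
    induction ξ using Bim.t_induction with
    | h0 => simp only [map_zero]; exact (mul_zero _).symm
    | ha x y hx hy => simp only [map_add, hx, hy]; exact (mul_add _ _ _).symm
    | ht x y =>
      change L.s (a.unop * L.ε x) * y = L.s a.unop * (L.s (L.ε x) * y)
      rw [map_mul, mul_assoc]
  rw [conv_apply, h, L.counitFst_Δ]

/-- `⟨sʳ(a) φ, u⟩ = ⟨φ, u s(a)⟩` -/
lemma ev_s_mul (a : A) (φ : L.Dual) (u : U) : L.ev (L.dualS a * φ) u = L.ev φ (u * L.s a) := by
  rw [ev_mul, conv_dualS]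

/-- `⟨tʳ(a) φ, u⟩ = ⟨φ, s(a) u⟩` -/
lemma ev_t_mul (a : Aᵐᵒᵖ) (φ : L.Dual) (u : U) :
    L.ev (L.dualT a * φ) u = L.ev φ (L.s a.unop * u) := by
  rw [ev_mul, conv_dualT]

/-- `⟨φ tʳ(a), u⟩ = a ⟨φ, u⟩` -/
lemma ev_mul_t (a : Aᵐᵒᵖ) (φ : L.Dual) (u : U) : L.ev (φ * L.dualT a) u = a.unop * L.ev φ u := by
  rw [ev_mul, ← ε_conv L φ]; rfl

/-- `⟨φ sʳ(a), u⟩ = ⟨φ, u t(a)⟩` -/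
lemma ev_mul_s (a : A) (φ : L.Dual) (u : U) :
    L.ev (φ * L.dualS a) u = L.ev φ (u * L.t (op a)) := by
  have h : ∀ ξ : Bim.tens L.leftBim L.leftBim, L.ε (L.contr L.leftBim φ ξ * L.s a) =
      L.ev φ ((L.counitSnd L.leftBim).add (L.mulSnd (L.s a) ξ)) := fun ξ => by
    induction ξ using Bim.t_induction with
    | h0 =>
      simp only [map_zero]
      exact (congrArg L.ε (zero_mul _)).trans (map_zero L.ε)
    | ha x y hx hy =>
      simp only [map_add]
      refine (congrArg L.ε (add_mul _ _ _)).trans ((map_add L.ε _ _).trans ?_)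
      rw [hx, hy]
    | ht x y =>
      change L.ε (L.s (L.ev φ x) * y * L.s a) = L.ev φ (L.t (op (L.ε (y * L.s a))) * x)
      rw [mul_assoc, ε_s, ev_t]
  change L.ε (L.contr L.leftBim φ (L.Δ u) * L.s a) = _
  rw [h, ← L.takeuchi_Δ, counitSnd_mulFst', counitSnd_Δ]

/-- The dual as a ring over `A ⊗ Aᵒᵖ`, with source `sʳ(a) = ε(- s(a))` and target
`tʳ(a) = a ε(-)`. -/
def dualRing : AeRing A L.Dual where
  s := L.dualS
  t := L.dualT
  comm a b := dual_ext fun u => by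
    rw [ev_s_mul, ev_mul_s]
    change b.unop * L.ε (u * L.s a) = b.unop * L.ε (u * L.t (op a))
    rw [← ε_mul_t, ε_of_s]

/-- `U_◃` is finitely generated and projective as a right `A`-module. -/
def FGProj : Prop :=
  letI : Module Aᵐᵒᵖ U := Module.compHom U L.t
  Module.Finite Aᵐᵒᵖ U ∧ Module.Projective Aᵐᵒᵖ U

variable {L} in
lemma FGProj.exists_basis (h : L.FGProj) : ∃ (n : ℕ) (e : Fin n → U) (e' : Fin n → L.Dual),
    ∀ u, u = ∑ i, L.t (op (L.ev (e' i) u)) * e i := by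
  let _ : Module Aᵐᵒᵖ U := Module.compHom U L.t
  obtain ⟨h1, h2⟩ := h
  obtain ⟨n, f, g, hf, hg, hfg⟩ := Module.Finite.exists_comp_eq_id_of_projective Aᵐᵒᵖ U
  refine ⟨n, fun i => f (Pi.single i 1), fun i => L.mkDual
    ⟨⟨fun u => (g u i).unop, by simp⟩, fun u v => by simp⟩ (fun a u => ?_), fun u => ?_⟩
  · have : g (L.t (op a) * u) = op a • g u := g.map_smul (op a) u
    change (g (L.t (op a) * u) i).unop = (g u i).unop * a
    rw [this]; rfl
  · have h3 : f (g u) = u := DFunLike.congr_fun hfg u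
    conv_lhs => rw [← h3, ← Finset.univ_sum_single (g u), map_sum]
    refine Finset.sum_congr rfl fun i _ => ?_
    have h4 : (Pi.single i (g u i) : Fin n → Aᵐᵒᵖ) = g u i • Pi.single i 1 := by
      rw [← Pi.single_smul, smul_eq_mul, mul_one]
    rw [h4, map_smul]; rfl

/-- `⟨v ⇀ φ, u⟩ = ⟨φ, u v⟩` -/
def harp (v : U) : L.Dual →+ L.Dual :=
  AddMonoidHom.mk' (fun φ => L.mkDual ((L.ev φ).comp (AddMonoidHom.mulRight v)) (fun a u => by
    change L.ev φ (L.t (op a) * u * v) = L.ev φ (u * v) * a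
    rw [mul_assoc, ev_t])) (fun φ ψ => dual_ext fun _ => rfl)

@[simp] lemma ev_harp (v : U) (φ : L.Dual) (u : U) : L.ev (L.harp v φ) u = L.ev φ (u * v) := rfl

/-- `U*` with the bimodule structure `⟨a ▸ φ ◂ b, u⟩ = a ⟨φ, u t(b)⟩`. -/
abbrev dualBim : Bim A := L.dualRing.opp.leftBim

lemma dualBim_l (a : A) (φ : L.Dual) (u : U) :
    L.ev (L.dualBim.l a (op φ) : L.Dualᵐᵒᵖ).unop u = a * L.ev φ u := L.ev_mul_t (op a) φ u

lemma dualBim_r (a : Aᵐᵒᵖ) (φ : L.Dual) (u : U) :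
    L.ev (L.dualBim.r a (op φ) : L.Dualᵐᵒᵖ).unop u = L.ev φ (u * L.t a) := L.ev_mul_s a.unop φ u

/-- `x ⊗ ψ ↦ x ⟨ψ, u⟩` -/
def pair (X : Bim A) (u : U) : Bim.tens X L.dualBim →+ X :=
  Bim.tlift (N := L.dualBim) (biHom (N := L.Dualᵐᵒᵖ) (fun x ψ => X.r (op (L.ev ψ.unop u)) x)
      (fun x (ψ ψ' : L.Dualᵐᵒᵖ) => by
        rw [MulOpposite.unop_add, map_add, AddMonoidHom.add_apply, MulOpposite.op_add, X.r_add])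
      (fun x x' ψ => map_add _ _ _))
    (fun a x ψ => by
      change X.r (op (L.ev ψ.unop u)) (X.r (op a) x) =
        X.r (op (L.ev (L.dualBim.l a (op ψ.unop) : L.Dualᵐᵒᵖ).unop u)) x
      rw [dualBim_l, X.r_mul])

@[simp] lemma pair_t (X : Bim A) (u : U) (x : X) (ψ : L.Dualᵐᵒᵖ) :
    L.pair X u (Bim.t (N := L.dualBim) x ψ) = X.r (op (L.ev ψ.unop u)) x := rfl

end LeftBialgebroid

end Dual

section DualBialgebroid

variable {A U : Type u} [Ring A] [Ring U]

namespace LeftBialgebroid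

variable (L : LeftBialgebroid A U)

lemma ev_sum {n : ℕ} (f : Fin n → L.Dualᵐᵒᵖ) (u : U) :
    L.ev (∑ i, f i).unop u = ∑ i, L.ev (f i).unop u := by
  rw [Finset.unop_sum, map_sum, AddMonoidHom.finsetSum_apply]

lemma dual_expand {n : ℕ} {e : Fin n → U} {e' : Fin n → L.Dual}
    (he : ∀ u, u = ∑ i, L.t (op (L.ev (e' i) u)) * e i) (ψ : L.Dual) :
    op ψ = ∑ i, L.dualBim.l (L.ev ψ (e i)) (op (e' i)) := by
  refine unop_injective (dual_ext fun u => ?_)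
  refine Eq.trans ?_ (L.ev_sum _ _).symm
  conv_lhs => rw [unop_op, he u, map_sum]
  refine Finset.sum_congr rfl fun i _ => ?_
  rw [dualBim_l, ev_t]

/-- When `U_◃` is finitely generated projective, elements of `X ⊗_A U*` are separated by the pairing
with all elements of `U`. -/
lemma pair_ext (h : L.FGProj) {X : Bim A} {y y' : Bim.tens X L.dualBim}
    (hy : ∀ u, L.pair X u y = L.pair X u y') : y = y' := by
  obtain ⟨n, e, e', he⟩ := h.exists_basis
  have key : ∀ y : Bim.tens X L.dualBim,
      y = ∑ i, Bim.t (N := L.dualBim) (L.pair X (e i) y) (op (e' i)) := fun y => by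
    induction y using Bim.t_induction with
    | h0 => simp only [map_zero, Bim.zero_t, Finset.sum_const_zero]
    | ha x y hx hy => simp only [map_add, Bim.add_t, Finset.sum_add_distrib, ← hx, ← hy]
    | ht x ψ =>
      obtain ⟨ψ, rfl⟩ := op_surjective (α := L.Dual) ψ
      have h1 := L.dual_expand he ψ
      refine (congrArg (Bim.t (N := L.dualBim) x) h1).trans ?_
      refine (Bal.tmul_sum _ _ _).trans (Finset.sum_congr rfl fun i _ => ?_)
      exact (Bim.t_bal (N := L.dualBim) _ x _).symm
  rw [key y, key y']
  exact Finset.sum_congr rfl fun i _ => by rw [hy]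

/-- The sum `∑ (eᵢ ⇀ φ) ⊗ eⁱ` for a dual basis. -/
noncomputable def dualComulAdd (h : L.FGProj) : L.Dualᵐᵒᵖ →+ Bim.tens L.dualBim L.dualBim :=
  AddMonoidHom.mk' (fun φ => ∑ i, Bim.t (M := L.dualBim) (N := L.dualBim)
      (op (L.harp (h.exists_basis.choose_spec.choose i) φ.unop))
      (op (h.exists_basis.choose_spec.choose_spec.choose i)))
    (fun φ ψ => by
      rw [← Finset.sum_add_distrib]
      refine Finset.sum_congr rfl fun i _ => ?_
      rw [← Bim.add_t, MulOpposite.unop_add, map_add]; rfl)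

lemma pair_dualComul (h : L.FGProj) (φ : L.Dual) (v : U) :
    L.pair L.dualBim v (L.dualComulAdd h (op φ)) = op (L.harp v φ) := by
  have he := h.exists_basis.choose_spec.choose_spec.choose_spec
  set e := h.exists_basis.choose_spec.choose
  set e' := h.exists_basis.choose_spec.choose_spec.choose
  change L.pair L.dualBim v (∑ i, Bim.t (M := L.dualBim) (N := L.dualBim)
    (op (L.harp (e i) φ)) (op (e' i))) = _
  rw [map_sum]
  refine unop_injective (dual_ext fun u => ?_)
  refine (L.ev_sum _ _).trans ?_
  rw [unop_op, ev_harp]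
  conv_rhs => rw [he v, Finset.mul_sum, map_sum]
  refine Finset.sum_congr rfl fun i _ => ?_
  rw [pair_t, dualBim_r, ev_harp, mul_assoc]; rfl

lemma pair_l (X : Bim A) (u : U) (a : A) (ξ : Bim.tens X L.dualBim) :
    L.pair X u ((Bim.tens X L.dualBim).l a ξ) = X.l a (L.pair X u ξ) := by
  induction ξ using Bim.t_induction with
  | h0 => simp only [map_zero]
  | ha x y hx hy => simp only [map_add, hx, hy]
  | ht x ψ => exact (X.comm _ _ _).symm

lemma pair_r (X : Bim A) (u : U) (a : Aᵐᵒᵖ) (ξ : Bim.tens X L.dualBim) :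
    L.pair X u ((Bim.tens X L.dualBim).r a ξ) = L.pair X (u * L.t a) ξ := by
  induction ξ using Bim.t_induction with
  | h0 => simp only [map_zero]
  | ha x y hx hy => simp only [map_add, hx, hy]
  | ht x ψ =>
    obtain ⟨ψ, rfl⟩ := op_surjective (α := L.Dual) ψ
    rw [Bim.tens_r, pair_t, dualBim_r]; rfl

/-- The coproduct of the dual, with values in `U*_◂ ⊗_A ▸U*`; it is determined by
`⟨φ⁽¹⁾, u t(⟨φ⁽²⁾, v⟩)⟩ = ⟨φ, u v⟩`. -/
noncomputable def dualComul (h : L.FGProj) : L.dualBim ⟶ Bim.tens L.dualBim L.dualBim where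
  add := L.dualComulAdd h
  map_l a φ := by
    obtain ⟨φ, rfl⟩ := op_surjective (α := L.Dual) φ
    refine L.pair_ext h fun u => ?_
    rw [pair_l]
    have h1 := L.pair_dualComul h (L.dualBim.l a (op φ) : L.Dualᵐᵒᵖ).unop u
    refine h1.trans ?_
    refine (unop_injective (dual_ext fun v => ?_)).trans
      (congrArg (L.dualBim.l a) (L.pair_dualComul h φ u)).symm
    rw [unop_op, ev_harp, dualBim_l, dualBim_l, ev_harp]
  map_r a φ := by
    obtain ⟨φ, rfl⟩ := op_surjective (α := L.Dual) φ
    refine L.pair_ext h fun u => ?_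
    rw [pair_r]
    have h1 := L.pair_dualComul h (L.dualBim.r a (op φ) : L.Dualᵐᵒᵖ).unop u
    refine h1.trans ?_
    refine (unop_injective (dual_ext fun v => ?_)).trans (L.pair_dualComul h φ (u * L.t a)).symm
    rw [unop_op, ev_harp, dualBim_r, unop_op, ev_harp, mul_assoc]

lemma pair_comul (h : L.FGProj) (φ : L.Dual) (v : U) :
    L.pair L.dualBim v ((L.dualComul h).add (op φ)) = op (L.harp v φ) := L.pair_dualComul h φ v

/-- The counit `∂ φ = φ(1)` of the dual. -/
def dualCounit : L.dualBim ⟶ Bim.one A where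
  add := AddMonoidHom.mk' (fun φ : L.Dualᵐᵒᵖ => L.ev φ.unop 1) (fun φ ψ => by
    rw [MulOpposite.unop_add, map_add]; rfl)
  map_l a φ := L.dualBim_l a φ.unop 1
  map_r a φ := by
    refine (L.dualBim_r a φ.unop 1).trans ?_
    have := L.ev_t φ.unop a.unop 1
    rw [mul_one] at this
    rw [one_mul]
    exact this

lemma pair_whiskerLeft (h : L.FGProj) (X : Bim A) (u v : U) (ξ : Bim.tens X L.dualBim) :
    L.pair X v (L.pair (Bim.tens X L.dualBim) u ((α_ X L.dualBim L.dualBim).inv.add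
      ((X ◁ L.dualComul h).add ξ))) = L.pair X (v * u) ξ := by
  have h1 : ∀ (x : X) (η : Bim.tens L.dualBim L.dualBim),
      L.pair (Bim.tens X L.dualBim) u ((α_ X L.dualBim L.dualBim).inv.add (Bim.t x η)) =
        Bim.t x (L.pair L.dualBim u η) := fun x η => by
    induction η using Bim.t_induction with
    | h0 => simp only [map_zero, Bim.t_zero]
    | ha x y hx hy => simp only [map_add, Bim.t_add, hx, hy]; exact (Bim.t_add _ _ _).symm
    | ht ψ χ => rfl
  induction ξ using Bim.t_induction with
  | h0 => simp only [map_zero]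
  | ha x y hx hy => simp only [map_add, hx, hy]
  | ht x ψ =>
    obtain ⟨ψ, rfl⟩ := op_surjective (α := L.Dual) ψ
    change L.pair X v (L.pair (Bim.tens X L.dualBim) u ((α_ X L.dualBim L.dualBim).inv.add
      (Bim.t x ((L.dualComul h).add (op ψ))))) = _
    rw [h1, pair_comul]; rfl

lemma pair_whiskerRight (h : L.FGProj) (u : U) (ξ : Bim.tens L.dualBim L.dualBim) :
    L.pair (Bim.tens L.dualBim L.dualBim) u ((L.dualComul h ▷ L.dualBim).add ξ) =
      (L.dualComul h).add (L.pair L.dualBim u ξ) := by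
  induction ξ using Bim.t_induction with
  | h0 => simp only [map_zero]
  | ha x y hx hy => simp only [map_add, hx, hy]
  | ht x ψ => exact (Bim.hom_r (L.dualComul h) _ x).symm

/-- The coring structure on `▸U*◂`. -/
@[reducible] noncomputable def dualCoring (h : L.FGProj) : ComonObj L.dualBim where
  counit := L.dualCounit
  comul := L.dualComul h
  counit_comul := by
    have h1 : L.dualComul h ≫ L.dualCounit ▷ L.dualBim ≫ (λ_ L.dualBim).hom = 𝟙 _ := by
      refine Bim.hom_ext fun φ => ?_
      obtain ⟨φ, rfl⟩ := op_surjective (α := L.Dual) φ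
      have he := h.exists_basis.choose_spec.choose_spec.choose_spec
      refine Eq.trans ?_ (L.dual_expand he φ).symm
      change ((λ_ L.dualBim).hom.add.comp ((L.dualCounit ▷ L.dualBim).add)) (∑ i : Fin h.exists_basis.choose, _) = _
      rw [map_sum]
      refine Finset.sum_congr rfl fun i _ => ?_
      refine congrArg (fun a => L.dualBim.l a _) ?_
      change L.ev φ (1 * _) = _
      rw [one_mul]
    rw [← Category.assoc, Iso.comp_hom_eq_id] at h1
    exact h1
  comul_counit := by
    have h1 : L.dualComul h ≫ L.dualBim ◁ L.dualCounit ≫ (ρ_ L.dualBim).hom = 𝟙 _ := by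
      refine Bim.hom_ext fun φ => ?_
      obtain ⟨φ, rfl⟩ := op_surjective (α := L.Dual) φ
      have h2 : ∀ ξ, (L.dualBim ◁ L.dualCounit ≫ (ρ_ L.dualBim).hom).add ξ =
          L.pair L.dualBim 1 ξ := fun ξ => by
        induction ξ using Bim.t_induction with
        | h0 => simp only [map_zero]
        | ha x y hx hy => simp only [map_add, hx, hy]
        | ht x ψ => rfl
      refine (h2 _).trans ((L.pair_comul h φ 1).trans ?_)
      exact unop_injective (dual_ext fun v => congrArg (L.ev φ) (mul_one v))
    rw [← Category.assoc, Iso.comp_hom_eq_id] at h1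
    exact h1
  comul_assoc := by
    rw [← Category.assoc, ← Iso.comp_inv_eq]
    refine Bim.hom_ext fun φ => ?_
    obtain ⟨φ, rfl⟩ := op_surjective (α := L.Dual) φ
    refine L.pair_ext h fun u => L.pair_ext h fun v => ?_
    refine (L.pair_whiskerLeft h L.dualBim u v _).trans ?_
    refine Eq.trans ?_ (congrArg (L.pair L.dualBim v) (L.pair_whiskerRight h u _)).symm
    rw [pair_comul, pair_comul, pair_comul]
    exact unop_injective (dual_ext fun w => congrArg (L.ev φ) (mul_assoc w v u).symm)

lemma pair_add (X : Bim A) (u v : U) (ξ : Bim.tens X L.dualBim) :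
    L.pair X (u + v) ξ = L.pair X u ξ + L.pair X v ξ := by
  induction ξ using Bim.t_induction with
  | h0 => simp only [map_zero, add_zero]
  | ha x y hx hy => simp only [map_add, hx, hy]; abel
  | ht x ψ => rw [pair_t, map_add, MulOpposite.op_add, X.r_add]; rfl

/-- `φ ↦ φ(u₍₁₎) u₍₂₎` as an additive map. -/
def convHom (u : U) : L.Dualᵐᵒᵖ →+ U :=
  AddMonoidHom.mk' (fun φ => L.conv φ.unop u) (fun φ ψ => L.conv_add φ.unop ψ.unop u)

/-- `φ ↦ φ(x) y` as an additive map, for a formal tensor `x ⊗ y`. -/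
def contrHom (z : U ⊗[ℤ] U) : L.Dualᵐᵒᵖ →+ U :=
  AddMonoidHom.mk' (fun φ => L.contr L.leftBim φ.unop (L.mkL z))
    (fun φ ψ => L.contr_add L.leftBim φ.unop ψ.unop (L.mkL z))

lemma contrHom_add (z z' : U ⊗[ℤ] U) (φ : L.Dualᵐᵒᵖ) :
    L.contrHom (z + z') φ = L.contrHom z φ + L.contrHom z' φ :=
  (congrArg (L.contr L.leftBim φ.unop) (map_add L.mkL z z')).trans (map_add _ _ _)

lemma contrHom_zero (φ : L.Dualᵐᵒᵖ) : L.contrHom 0 φ = 0 :=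
  (congrArg (L.contr L.leftBim φ.unop) (map_zero L.mkL)).trans (map_zero _)

/-- The map from formal tensors to `U*_◂ ⊗_A ▸U*`. -/
def mkD : L.Dualᵐᵒᵖ ⊗[ℤ] L.Dualᵐᵒᵖ →+ Bim.tens L.dualBim L.dualBim := L.dualRing.opp.mkL

lemma mkD_tmul (ψ χ : L.Dualᵐᵒᵖ) :
    L.mkD (ψ ⊗ₜ χ) = Bim.t (M := L.dualBim) (N := L.dualBim) ψ χ := rfl

/-- `(ψ(w₍₁₎)) w₍₂₎ · χ(x) y` for formal tensors `ψ ⊗ χ` and `x ⊗ y` -/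
def convContr (w : U) (z : U ⊗[ℤ] U) : L.Dualᵐᵒᵖ ⊗[ℤ] L.Dualᵐᵒᵖ →+ U :=
  Bal.fLift (biHom (fun ψ χ => L.convHom w ψ * L.contrHom z χ)
    (fun ψ χ χ' => by rw [map_add, mul_add]) (fun ψ ψ' χ => by rw [map_add, add_mul]))

/-- The map `pair v`, for the bimodule `U*`, as a map to `U*`. -/
def pairD (v : U) : Bim.tens L.dualBim L.dualBim →+ L.Dualᵐᵒᵖ := L.pair L.dualBim v

lemma convHom_r (w : U) (b : A) (ψ : L.Dualᵐᵒᵖ) :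
    L.convHom w (L.dualBim.r (op b) ψ) = L.convHom w ψ * L.s b := by
  have h : ∀ η : Bim.tens L.leftBim L.leftBim,
      L.contr L.leftBim (L.dualBim.r (op b) ψ : L.Dualᵐᵒᵖ).unop η =
        L.contr L.leftBim ψ.unop (L.mulFst L.leftBim (L.t (op b)) η) := fun η => by
    induction η using Bim.t_induction with
    | h0 => simp only [map_zero]
    | ha x y hx hy => simp only [map_add, hx, hy]
    | ht x y => exact congrArg (fun a => L.leftBim.l a y) (L.dualBim_r (op b) ψ.unop x)
  have h1 : ∀ η : Bim.tens L.leftBim L.leftBim,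
      L.contr L.leftBim ψ.unop (L.mulSnd (L.s b) η) = L.contr L.leftBim ψ.unop η * L.s b :=
    fun η => by
      induction η using Bim.t_induction with
      | h0 => simp only [map_zero]; exact (zero_mul _).symm
      | ha x y hx hy => simp only [map_add, hx, hy]; exact (add_mul _ _ _).symm
      | ht x y => exact (mul_assoc _ _ _).symm
  refine (h (L.Δ w)).trans ?_
  rw [L.takeuchi_Δ, h1]; rfl

lemma convContr_add (w : U) (z z' : U ⊗[ℤ] U) (y : L.Dualᵐᵒᵖ ⊗[ℤ] L.Dualᵐᵒᵖ) :
    L.convContr w (z + z') y = L.convContr w z y + L.convContr w z' y := by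
  induction y with
  | zero => simp only [map_zero, add_zero]
  | add y y' hy hy' => simp only [map_add, hy, hy']; abel
  | tmul ψ χ =>
    change L.convHom w ψ * L.contrHom (z + z') χ = L.convHom w ψ * L.contrHom z χ +
      L.convHom w ψ * L.contrHom z' χ
    rw [contrHom_add, mul_add]

lemma convContr_zero (w : U) (y : L.Dualᵐᵒᵖ ⊗[ℤ] L.Dualᵐᵒᵖ) : L.convContr w 0 y = 0 := by
  have := L.convContr_add w 0 0 y
  rwa [add_zero, left_eq_add] at this

lemma convContr_tmul (w v x : U) (y : L.Dualᵐᵒᵖ ⊗[ℤ] L.Dualᵐᵒᵖ) :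
    L.convContr w (v ⊗ₜ x) y = L.convHom w (L.pairD v (L.mkD y)) * x := by
  induction y with
  | zero => rw [map_zero, map_zero, map_zero, map_zero, zero_mul]
  | add y y' hy hy' => rw [map_add, map_add, map_add, map_add, add_mul, hy, hy']
  | tmul ψ χ =>
    change L.convHom w ψ * (L.s (L.ev χ.unop v) * x) =
      L.convHom w (L.dualBim.r (op (L.ev χ.unop v)) ψ) * x
    rw [convHom_r, mul_assoc]

lemma conv_mul_eq (ψ : L.Dual) (y : L.Dualᵐᵒᵖ ⊗[ℤ] L.Dualᵐᵒᵖ)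
    (hy : ∀ u, L.pairD u (L.mkD y) = op (L.harp u ψ)) (w u : U) (z : U ⊗[ℤ] U)
    (hz : L.mkL z = L.Δ u) : L.conv ψ (w * u) = L.convContr w z y := by
  rw [conv_apply, L.Δ_mul w u z hz]
  clear hz
  induction z with
  | zero => rw [map_zero, AddMonoidHom.zero_apply, map_zero, convContr_zero]
  | add z z' hz hz' =>
    rw [map_add, AddMonoidHom.add_apply, map_add, hz, hz', convContr_add]
  | tmul v x =>
    rw [convContr_tmul, hy, mulForm_tmul]
    change _ = L.contr L.leftBim (L.harp v ψ) (L.Δ w) * x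
    generalize L.Δ w = η
    induction η using Bim.t_induction with
    | h0 => simp only [map_zero]; exact (zero_mul _).symm
    | ha x y hx hy => simp only [map_add, hx, hy]; exact (add_mul _ _ _).symm
    | ht x y => exact (mul_assoc _ _ _).symm

/-- The right bialgebroid `U*`, for `U_◃` finitely generated projective over `A`. The source, the
target, the product and the unit are those of `dualRing`, the coproduct is determined by
`⟨φ⁽¹⁾, u t(⟨φ⁽²⁾, v⟩)⟩ = ⟨φ, u v⟩`, and the counit is `∂ φ = φ(1)`. -/
noncomputable abbrev dual (h : L.FGProj) : RightBialgebroid A L.Dual where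
  toAeRing := L.dualRing.opp
  coring := L.dualCoring h
  takeuchi a w x hx := by
    obtain ⟨φ, rfl⟩ := op_surjective (α := L.Dual) w
    refine L.pair_ext h fun u => ?_
    have h1 : ∀ x : L.Dualᵐᵒᵖ ⊗[ℤ] L.Dualᵐᵒᵖ,
        L.pairD u (L.mkD (x * (L.dualRing.opp.t (op a) ⊗ₜ 1))) =
        L.pairD u (L.mkD x) * op (L.dualS a) := fun x => by
      induction x with
      | zero => rw [zero_mul, map_zero, map_zero, zero_mul]
      | add x y hx hy => rw [add_mul, map_add, map_add, map_add, map_add, hx, hy, add_mul]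
      | tmul ψ χ =>
        rw [Algebra.TensorProduct.tmul_mul_tmul, mul_one]
        exact (mul_assoc (L.dualRing.opp.t _) ψ (op (L.dualS a))).symm
    have h2 : ∀ x : L.Dualᵐᵒᵖ ⊗[ℤ] L.Dualᵐᵒᵖ,
        L.pairD u (L.mkD (x * (1 ⊗ₜ L.dualRing.opp.s a))) =
        L.pairD (L.s a * u) (L.mkD x) := fun x => by
      induction x with
      | zero => rw [zero_mul, map_zero, map_zero, map_zero]
      | add x y hx hy => rw [add_mul, map_add, map_add, map_add, map_add, hx, hy]
      | tmul ψ χ =>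
        rw [Algebra.TensorProduct.tmul_mul_tmul, mul_one]
        refine congrArg (fun b => L.dualBim.r (op b) ψ) ?_
        exact L.ev_t_mul (op a) χ.unop u
    refine (h1 x).trans (Eq.trans ?_ (h2 x).symm)
    have h3 : ∀ v, L.pairD v (L.mkD x) = op (L.harp v φ) := fun v =>
      (congrArg (L.pairD v) hx).trans (L.pair_comul h φ v)
    rw [h3, h3]
    refine unop_injective (dual_ext fun v => ?_)
    change L.ev (L.dualS a * L.harp u φ) v = _
    rw [ev_s_mul, unop_op, ev_harp, ev_harp, mul_assoc]
  comul_one := by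
    refine L.pair_ext h fun u => (L.pair_comul h 1 u).trans ?_
    refine unop_injective (dual_ext fun v => ?_)
    change L.ε (v * u) = L.ev (L.dualBim.r (op (L.ε u)) (op 1) : L.Dualᵐᵒᵖ).unop v
    rw [dualBim_r, ev_one, ε_mul_t]
  comul_mul v w x y hx hy := by
    obtain ⟨φ, rfl⟩ := op_surjective (α := L.Dual) v
    obtain ⟨ψ, rfl⟩ := op_surjective (α := L.Dual) w
    have hx' : ∀ u, L.pairD u (L.mkD x) = op (L.harp u φ) := fun u =>
      (congrArg (L.pairD u) hx).trans (L.pair_comul h φ u)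
    have hy' : ∀ u, L.pairD u (L.mkD y) = op (L.harp u ψ) := fun u =>
      (congrArg (L.pairD u) hy).trans (L.pair_comul h ψ u)
    refine L.pair_ext h fun u => (L.pair_comul h (ψ * φ) u).trans ?_
    refine unop_injective (dual_ext fun w => ?_)
    obtain ⟨z, hz⟩ := Bal.mk_surjective (L.Δ u)
    rw [unop_op, ev_harp, ev_mul, L.conv_mul_eq ψ y hy' w u z hz]
    change _ = L.ev (L.pairD u (L.mkD (x * y))).unop w
    clear hy hy'
    induction y with
    | zero =>
      rw [mul_zero, map_zero, map_zero, map_zero, map_zero, unop_zero, map_zero]; rfl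
    | add y y' hy hy' =>
      rw [mul_add, map_add, map_add, map_add, map_add, hy, hy', MulOpposite.unop_add, map_add]; rfl
    | tmul χ ω =>
      have h1 : ∀ x : L.Dualᵐᵒᵖ ⊗[ℤ] L.Dualᵐᵒᵖ, L.pairD u (L.mkD (x * (χ ⊗ₜ ω))) =
          L.pairD (L.conv ω.unop u) (L.mkD x) * χ := fun x => by
        induction x with
        | zero => rw [zero_mul, map_zero, map_zero, map_zero, zero_mul]
        | add x y hx hy => rw [add_mul, map_add, map_add, map_add, map_add, hx, hy, add_mul]
        | tmul α β =>
          rw [Algebra.TensorProduct.tmul_mul_tmul]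
          exact (mul_assoc (L.dualRing.opp.t _) α χ).symm
      rw [h1, hx']
      change L.ev φ (L.convHom w χ * L.contr L.leftBim ω.unop (L.mkL z)) =
        L.ev φ (L.convHom w χ * L.contr L.leftBim ω.unop (L.Δ u))
      rw [← hz]; rfl
  counit_one := L.ε_one
  counit_mul_s v w := by
    obtain ⟨φ, rfl⟩ := op_surjective (α := L.Dual) v
    obtain ⟨ψ, rfl⟩ := op_surjective (α := L.Dual) w
    change L.ev (ψ * φ) 1 = L.ev (L.dualT (op (L.ev ψ 1)) * φ) 1
    rw [L.ev_t_mul, ev_mul, conv_apply, Δ_one]; rfl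
  counit_mul_t v w := by
    obtain ⟨φ, rfl⟩ := op_surjective (α := L.Dual) v
    obtain ⟨ψ, rfl⟩ := op_surjective (α := L.Dual) w
    change L.ev (ψ * φ) 1 = L.ev (L.dualS (L.ev ψ 1) * φ) 1
    rw [L.ev_s_mul, one_mul, ev_mul, conv_apply, Δ_one]
    exact congrArg (L.ev φ) (mul_one (L.s (L.ev ψ 1)))

end LeftBialgebroid

end DualBialgebroid

/-! ## Contramodules -/

section Contramodules

variable {A U : Type u} [Ring A] [Ring U]

namespace LeftBialgebroid

variable (L : LeftBialgebroid A U)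

/-- The group `Hom_{Aᵒᵖ}(U_◃, M)` of additive maps `f : U → M` with `f(t(a) u) = f(u) a`. -/
def RHom (M : Bim A) : AddSubgroup (U →+ M) where
  carrier := {f | ∀ a u, f (L.t a * u) = M.r a (f u)}
  zero_mem' a _ := (map_zero (M.r a)).symm
  add_mem' {f g} h h' a u := by
    change f _ + g _ = M.r a (f u + g u)
    rw [h, h', map_add]
  neg_mem' {f} h a u := by
    change -f _ = M.r a (-f u)
    rw [h, map_neg]

namespace RHom

variable {L} {M N : Bim A}

lemma map_t (f : L.RHom M) (a : Aᵐᵒᵖ) (u : U) : f.1 (L.t a * u) = M.r a (f.1 u) := f.2 a u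

/-- `f a = f(s(a) -)` -/
def shift (a : A) (f : L.RHom M) : L.RHom M :=
  ⟨f.1.comp (AddMonoidHom.mulLeft (L.s a)), fun b u => by
    change f.1 (L.s a * (L.t b * u)) = M.r b (f.1 (L.s a * u))
    rw [← mul_assoc, L.comm, mul_assoc, map_t f]⟩

/-- The map `g ∘ f` for a bimodule map `g`. -/
def postcomp (g : M ⟶ N) (f : L.RHom M) : L.RHom N :=
  ⟨g.add.comp f.1, fun a u => by
    change g.add (f.1 _) = N.r a (g.add (f.1 u))
    rw [map_t f, g.map_r]⟩

/-- The map `m φ(-)` for an element `φ` of the dual. -/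
def ofDual (m : M) (φ : L.Dual) : L.RHom M :=
  ⟨AddMonoidHom.mk' (fun u => M.r (op (L.ev φ u)) m) (fun u v => by
      rw [map_add, MulOpposite.op_add, M.r_add]), fun a u => by
    change M.r (op (L.ev φ (L.t (op a.unop) * u))) m = M.r (op a.unop) (M.r (op (L.ev φ u)) m)
    rw [L.ev_t, M.r_mul]⟩

/-- The map `(-) m` for a left `U`-module `M`. -/
def orbit (s : LModStr L.toAeRing M) (m : M) : L.RHom M :=
  ⟨AddMonoidHom.mk' (fun u => s.act u m) (fun u v => s.add u v m), fun a u => by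
    change s.act (L.t a * u) m = M.r a (s.act u m)
    rw [s.mul, s.act_t]⟩

/-- The map `g(u ⊗ -)` for a right `A`-linear map `g` on `U_◃ ⊗_A ▹U`. -/
def slice (g : Bim.tens L.leftBim L.leftBim →+ M)
    (hg : ∀ a ξ, g ((Bim.tens L.leftBim L.leftBim).r a ξ) = M.r a (g ξ)) (u : U) : L.RHom M :=
  ⟨AddMonoidHom.mk' (fun v => g (Bim.t (M := L.leftBim) (N := L.leftBim) u v)) (fun v w => by
      rw [← map_add]
      exact congrArg g (Bim.t_add (M := L.leftBim) (N := L.leftBim) u v w)), fun a v =>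
    hg a (Bim.t (M := L.leftBim) (N := L.leftBim) u v)⟩

/-- The map `g ∘ Δ` for a right `A`-linear map `g` on `U_◃ ⊗_A ▹U`. -/
def compΔ (g : Bim.tens L.leftBim L.leftBim →+ M)
    (hg : ∀ a ξ, g ((Bim.tens L.leftBim L.leftBim).r a ξ) = M.r a (g ξ)) : L.RHom M :=
  ⟨g.comp L.Δ, fun a u => by
    change g (L.Δ _) = M.r a (g (L.Δ u))
    rw [L.Δ_t, hg]⟩

/-- The map `u ↦ γ(g(u ⊗ -))`. -/
def iterate (γ : L.RHom M →+ M) (hγ : ∀ a f, γ (shift a f) = M.r (op a) (γ f))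
    (g : Bim.tens L.leftBim L.leftBim →+ M)
    (hg : ∀ a ξ, g ((Bim.tens L.leftBim L.leftBim).r a ξ) = M.r a (g ξ)) : L.RHom M :=
  ⟨AddMonoidHom.mk' (fun u => γ (slice g hg u)) (fun u v => by
      rw [← map_add]
      refine congrArg γ (Subtype.ext (AddMonoidHom.ext fun w => ?_))
      refine Eq.trans ?_ (map_add g _ _)
      exact congrArg g (Bim.add_t (M := L.leftBim) (N := L.leftBim) u v w)), fun a u => by
    refine Eq.trans (congrArg γ (Subtype.ext (AddMonoidHom.ext fun w => ?_)))
      (hγ a.unop (slice g hg u))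
    exact congrArg g (Bim.t_bal (M := L.leftBim) (N := L.leftBim) a.unop u w)⟩

end RHom

end LeftBialgebroid

open LeftBialgebroid

/-- A right `U`-contramodule structure on `M`: a right `A`-linear contraaction
`γ : Hom_{Aᵒᵖ}(U_◃, M) → M`, where `(f a)(u) = f(s(a) u)`, with
`γ(u ↦ γ(v ↦ g(u ⊗ v))) = γ(u ↦ g(u₍₁₎ ⊗ u₍₂₎))` and `γ(m ε(-)) = m`, such that the left `A`-action
`a m = γ(m ε(- s(a)))` induced by the contraaction is the given one. -/
structure ContraStr (L : LeftBialgebroid A U) (M : Bim A) where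
  contra : L.RHom M →+ M
  contra_r : ∀ a f, contra (RHom.shift a f) = M.r (op a) (contra f)
  contra_assoc : ∀ (g : Bim.tens L.leftBim L.leftBim →+ M)
    (hg : ∀ a ξ, g ((Bim.tens L.leftBim L.leftBim).r a ξ) = M.r a (g ξ)),
    contra (RHom.iterate contra contra_r g hg) = contra (RHom.compΔ g hg)
  contra_unit : ∀ m, contra (RHom.ofDual m L.dualOne) = m
  left_eq : ∀ a m, contra (RHom.ofDual m (L.dualS a)) = M.l a m

/-- Right `U`-contramodules; the morphisms are the maps `f` with `f(γ(h)) = γ(f ∘ h)`. -/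
abbrev Contra (L : LeftBialgebroid A U) : StrOn (Bim A) where
  Str := ContraStr L
  IsHom s s' f := ∀ h, f.add (s.contra h) = s'.contra (RHom.postcomp f h)
  id_mem _ _ := rfl
  comp_mem {_ _ _ _ _ _ f g} h h' x := by
    rw [Bim.comp_add, h, h']; rfl

end Contramodules

/-! ## Hopf algebroids and anti Yetter-Drinfel'd objects -/

section AntiYD

variable {A U V : Type u} [Ring A] [Ring U] [Ring V]

/-- The ring `V` over `A ⊗ Aᵒᵖ`, if `Vᵒᵖ` is one; source and target exchange their roles. -/
def AeRing.unop (R : AeRing A Vᵐᵒᵖ) : AeRing A V where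
  s := RingHom.unop (R.t : Aᵐᵒᵖ →+* Vᵐᵒᵖ)
  t := (RingHom.op.symm ((R.s).comp (RingEquiv.opOp A).symm.toRingHom))
  comm a b := congrArg MulOpposite.unop (R.comm b.unop (op a))

namespace LeftBialgebroid

variable (L : LeftBialgebroid A U)

/-- Left multiplication by `z`. -/
def lm (z : U) : AddMonoid.End U := AddMonoidHom.mulLeft z

/-- Right multiplication by `z`. -/
def rm (z : U) : AddMonoid.End U := AddMonoidHom.mulRight z

/-- The domain of the Hopf-Galois map: `▸U ⊗_{Aᵒᵖ} U_◃`, in which `u t(a) ⊗ v = u ⊗ t(a) v`. -/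
abbrev HopfDom : Type u := Bal (fun a : A => rm (L.t (op a))) (fun a : A => lm (L.t (op a)))

/-- The Hopf-Galois map `u ⊗ v ↦ u₍₁₎ ⊗ u₍₂₎ v`. -/
def galois : L.HopfDom →+ Bim.tens L.leftBim L.leftBim :=
  Bal.lift (biHom (fun u v => L.mulLast L.leftBim v (L.Δ u))
      (fun u v w => L.mulLast_add L.leftBim v w (L.Δ u))
      (fun u v w => by rw [map_add, map_add]))
    (fun a u v => by
      change L.mulLast L.leftBim v (L.Δ (u * L.t (op a))) =
        L.mulLast L.leftBim (L.t (op a) * v) (L.Δ u)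
      rw [L.mulSnd_Δ_t, L.mulLast_mul]; rfl)

lemma galois_tmul (u v : U) :
    L.galois (Bal.tmul u v) = L.mulLast L.leftBim v (L.Δ u) := by
  unfold galois
  rw [Bal.lift_tmul, biHom_apply]

/-- `U` is a left Hopf algebroid: the Hopf-Galois map is bijective. -/
def IsLeftHopf : Prop := Function.Bijective L.galois

variable {L}

/-- The translation map `u ↦ u₊ ⊗ u₋`, the preimage of `u ⊗ 1` under the Hopf-Galois map. -/
noncomputable def IsLeftHopf.trans (h : L.IsLeftHopf) : U →+ L.HopfDom :=
  (AddEquiv.ofBijective L.galois h).symm.toAddMonoidHom.comp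
    (Bal.tmulHom.flip (1 : U) : U →+ Bim.tens L.leftBim L.leftBim)

lemma IsLeftHopf.galois_trans (h : L.IsLeftHopf) (u : U) :
    L.galois (h.trans u) = Bim.t (M := L.leftBim) (N := L.leftBim) u (1 : U) :=
  (AddEquiv.ofBijective L.galois h).apply_symm_apply _

variable (L) in
/-- `u ⊗ v ↦ t(a) u ⊗ v` -/
def hopfL (a : Aᵐᵒᵖ) : L.HopfDom →+ L.HopfDom :=
  Bal.map (lm (L.t a)) (AddMonoidHom.id U) (fun _ x => (mul_assoc (L.t a) x _).symm)
    (fun _ _ => rfl)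

variable (L) in
/-- `u ⊗ v ↦ u ⊗ v t(a)` -/
def hopfR (a : Aᵐᵒᵖ) : L.HopfDom →+ L.HopfDom :=
  Bal.map (AddMonoidHom.id U) (rm (L.t a)) (fun _ _ => rfl) (fun _ x => mul_assoc _ x (L.t a))

lemma hopfL_tmul (a : Aᵐᵒᵖ) (u v : U) :
    L.hopfL a (Bal.tmul u v) = Bal.tmul (L.t a * u) v := rfl

lemma hopfR_tmul (a : Aᵐᵒᵖ) (u v : U) :
    L.hopfR a (Bal.tmul u v) = Bal.tmul u (v * L.t a) := rfl

lemma galois_hopfL (a : Aᵐᵒᵖ) (ξ : L.HopfDom) :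
    L.galois (L.hopfL a ξ) = (Bim.tens L.leftBim L.leftBim).r a (L.galois ξ) := by
  induction ξ using Bal.induction with
  | h0 => simp only [map_zero]
  | ha x y hx hy => simp only [map_add, hx, hy]
  | ht x y => rw [hopfL_tmul, galois_tmul, galois_tmul, L.Δ_t, L.mulLast_r]

lemma galois_hopfR (a : Aᵐᵒᵖ) (ξ : L.HopfDom) :
    L.galois (L.hopfR a ξ) = L.mulLast L.leftBim (L.t a) (L.galois ξ) := by
  induction ξ using Bal.induction with
  | h0 => simp only [map_zero]
  | ha x y hx hy => simp only [map_add, hx, hy]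
  | ht x y => rw [hopfR_tmul, galois_tmul, galois_tmul, L.mulLast_mul]

/-- `t(a) u₊ ⊗ u₋ = u₊ ⊗ u₋ t(a)` -/
lemma IsLeftHopf.takeuchi (h : L.IsLeftHopf) (u : U) (a : Aᵐᵒᵖ) :
    L.hopfL a (h.trans u) = L.hopfR a (h.trans u) := by
  refine h.1 ?_
  rw [galois_hopfL, galois_hopfR, h.galois_trans, Bim.tens_r]
  change _ = Bim.t (M := L.leftBim) (N := L.leftBim) u (1 * L.t a)
  rw [one_mul]
  exact congrArg (Bim.t (M := L.leftBim) (N := L.leftBim) u) (mul_one (L.t a))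

variable {M : Bim A}

/-- `x ⊗ y ↦ x f(y w)` -/
def RHom.conj (s : LModStr L.toAeRing M) (f : L.RHom M) (w : U) : L.HopfDom →+ M :=
  Bal.lift (biHom (fun x y => s.act x (f.1 (y * w)))
      (fun x y y' => by rw [add_mul, map_add, map_add]) (fun x x' y => s.add _ _ _))
    (fun a x y => by
      change s.act (x * L.t (op a)) (f.1 (y * w)) = s.act x (f.1 (L.t (op a) * y * w))
      rw [s.mul, s.act_t, mul_assoc, RHom.map_t f])

/-- The action `(y ⇀ f)(w) = y₊ f(y₋ w)` on `Hom_{Aᵒᵖ}(U_◃, M)`, for a left Hopf algebroid `U`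
and a left `U`-module `M`. -/
noncomputable def RHom.act (h : L.IsLeftHopf) (s : LModStr L.toAeRing M) (y : U) (f : L.RHom M) :
    L.RHom M :=
  ⟨AddMonoidHom.mk' (fun w => RHom.conj s f w (h.trans y)) (fun w w' => by
      generalize h.trans y = ξ
      induction ξ using Bal.induction with
      | h0 => simp only [map_zero, add_zero]
      | ha x y hx hy => simp only [map_add, hx, hy]; abel
      | ht x y =>
        change s.act x (f.1 (y * (w + w'))) = s.act x (f.1 (y * w)) + s.act x (f.1 (y * w'))
        rw [mul_add, map_add, map_add]), fun a w => by
    have h1 : ∀ ξ : L.HopfDom, RHom.conj s f (L.t a * w) ξ = RHom.conj s f w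
        (L.hopfR a ξ) := fun ξ => by
      induction ξ using Bal.induction with
      | h0 => simp only [map_zero]
      | ha x y hx hy => simp only [map_add, hx, hy]
      | ht x y => exact congrArg (fun z => s.act x (f.1 z)) (mul_assoc y (L.t a) w).symm
    have h2 : ∀ ξ : L.HopfDom, RHom.conj s f w (L.hopfL a ξ) =
        M.r a (RHom.conj s f w ξ) := fun ξ => by
      induction ξ using Bal.induction with
      | h0 => simp only [map_zero]
      | ha x y hx hy => simp only [map_add, hx, hy]
      | ht x y =>
        change s.act (L.t a * x) _ = M.r a (s.act x _)
        rw [s.mul, s.act_t]; rfl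
    exact (h1 _).trans ((congrArg _ (h.takeuchi y a).symm).trans (h2 _))⟩

/-- `f(- x)` -/
def RHom.rshift (x : U) : L.RHom M →+ L.RHom M :=
  AddMonoidHom.mk' (fun f => ⟨f.1.comp (AddMonoidHom.mulRight x), fun a u => by
    change f.1 (L.t a * u * x) = M.r a (f.1 (u * x))
    rw [mul_assoc, RHom.map_t f]⟩) (fun _ _ => rfl)

/-- The map `x ⊗ y ↦ (y ⇀ f)(- x)` on formal tensors. -/
noncomputable def RHom.adj (h : L.IsLeftHopf) (s : LModStr L.toAeRing M) (f : L.RHom M) :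
    U ⊗[ℤ] U →+ L.RHom M :=
  Bal.fLift (biHom (fun x y => RHom.rshift x (RHom.act h s y f))
    (fun x y y' => by
      rw [← map_add]
      refine congrArg (RHom.rshift x) (Subtype.ext (AddMonoidHom.ext fun w => ?_))
      exact (congrArg (RHom.conj s f w) (map_add h.trans y y')).trans (map_add _ _ _))
    (fun x x' y => Subtype.ext (AddMonoidHom.ext fun w => by
      change (RHom.act h s y f).1 (w * (x + x')) =
        (RHom.act h s y f).1 (w * x) + (RHom.act h s y f).1 (w * x')
      rw [mul_add, map_add])))

end LeftBialgebroid

open LeftBialgebroid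

/-- The compatibility of a left `U`-module and a right `U`-contramodule structure on the same bimodule
that defines anti Yetter-Drinfel'd contramodules: `u γ(f) = γ((u₍₂₎ ⇀ f)(- u₍₁₎))`, that is,
`u γ(f) = γ(w ↦ u₍₂₎₊ f(u₍₂₎₋ w u₍₁₎))`, where the right side is computed on arbitrary
representatives of the coproduct. -/
def IsAYDContra {L : LeftBialgebroid A U} (h : L.IsLeftHopf) {M : Bim A} (s : LModStr L.toAeRing M)
    (c : ContraStr L M) : Prop :=
  ∀ (u : U) (f : L.RHom M) (z : U ⊗[ℤ] U), L.mkL z = L.Δ u →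
    s.act u (c.contra f) = c.contra (RHom.adj h s f z)

/-- Stability of a module and contramodule: `γ(u ↦ u m) = m`. -/
def IsStableContra {L : LeftBialgebroid A U} {M : Bim A} (s : LModStr L.toAeRing M)
    (c : ContraStr L M) : Prop := ∀ m, c.contra (RHom.orbit s m) = m

/-- An anti Yetter-Drinfel'd contramodule over a left Hopf algebroid `U`: a compatible left `U`-module
and right `U`-contramodule with the same underlying bimodule. -/
structure AYDContraStr {L : LeftBialgebroid A U} (h : L.IsLeftHopf) (M : Bim A) where
  mod : LModStr L.toAeRing M
  contramod : ContraStr L M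
  ayd : IsAYDContra h mod contramod

/-- Anti Yetter-Drinfel'd contramodules. -/
abbrev AYDContra {L : LeftBialgebroid A U} (h : L.IsLeftHopf) : StrOn (Bim A) where
  Str := AYDContraStr h
  IsHom p q f := (LMod L.toAeRing).IsHom p.mod q.mod f ∧
    (Contra L).IsHom p.contramod q.contramod f
  id_mem p := ⟨(LMod L.toAeRing).id_mem p.mod, (Contra L).id_mem p.contramod⟩
  comp_mem h h' := ⟨(LMod L.toAeRing).comp_mem h.1 h'.1, (Contra L).comp_mem h.2 h'.2⟩

/-- Stable anti Yetter-Drinfel'd contramodules, as a full subcategory. -/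
abbrev SAYDContra {L : LeftBialgebroid A U} (h : L.IsLeftHopf) : StrOn (Bim A) where
  Str M := {p : AYDContraStr h M // IsStableContra p.mod p.contramod}
  IsHom p q f := (AYDContra h).IsHom p.1 q.1 f
  id_mem p := (AYDContra h).id_mem p.1
  comp_mem h' h'' := (AYDContra h).comp_mem h' h''

namespace LeftBialgebroid

variable (L : LeftBialgebroid A U)

/-- The domain of the map `w' ⊗ w ↦ w₍₁₎ w' ⊗ w₍₂₎`, in which `s(a) w' ⊗ w = w' ⊗ w s(a)`. -/
abbrev CoHopfDom : Type u := Bal (fun a : A => lm (L.s a)) (fun a : A => rm (L.s a))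

/-- The Hopf-Galois map `w' ⊗ w ↦ w₍₁₎ w' ⊗ w₍₂₎`. For a right bialgebroid `V`, with product written
in `V`, this is the map `▸V ⊗_{Aᵒᵖ} V_◃ → V_◂ ⊗_A ▸V`, `v' ⊗ v ↦ v' v⁽¹⁾ ⊗ v⁽²⁾`. -/
def cogalois : L.CoHopfDom →+ Bim.tens L.leftBim L.leftBim :=
  Bal.lift (biHom (fun w' w => L.mulFst L.leftBim w' (L.Δ w))
      (fun u v w => by rw [map_add, map_add])
      (fun v w u => L.mulFst_add L.leftBim v w (L.Δ u)))
    (fun a w' w => by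
      change L.mulFst L.leftBim (L.s a * w') (L.Δ w) = L.mulFst L.leftBim w' (L.Δ (w * L.s a))
      rw [L.mulFst_Δ_s, L.mulFst_mul])

lemma cogalois_tmul (u v : U) :
    L.cogalois (Bal.tmul u v) = L.mulFst L.leftBim u (L.Δ v) := by
  unfold cogalois
  rw [Bal.lift_tmul, biHom_apply]

end LeftBialgebroid

namespace RightBialgebroid

/-- The right bialgebroid `V` is a right Hopf algebroid: the Hopf-Galois map
`v' ⊗ v ↦ v' v⁽¹⁾ ⊗ v⁽²⁾` is bijective. -/
def IsRightHopf (R : RightBialgebroid A V) : Prop := Function.Bijective R.cogalois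

variable {R : RightBialgebroid A V}

/-- The translation map `v ↦ v⁻ ⊗ v⁺`, the preimage of `1 ⊗ v` under the Hopf-Galois map. -/
noncomputable def IsRightHopf.trans (h : IsRightHopf R) : Vᵐᵒᵖ →+ R.CoHopfDom :=
  (AddEquiv.ofBijective R.cogalois h).symm.toAddMonoidHom.comp
    (Bal.tmulHom (1 : Vᵐᵒᵖ) : Vᵐᵒᵖ →+ Bim.tens R.leftBim R.leftBim)

lemma IsRightHopf.cogalois_trans (h : IsRightHopf R) (v : Vᵐᵒᵖ) :
    R.cogalois (h.trans v) = Bim.t (M := R.leftBim) (N := R.leftBim) (1 : Vᵐᵒᵖ) v :=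
  (AddEquiv.ofBijective R.cogalois h).apply_symm_apply _

variable {M : Bim A}

/-- `x ⊗ y ↦ y m ⊗ w v x`, the product `w v x` being that of `V`. -/
def conj (s : LModStr R.toAeRing.unop M) (m : M) (v w : Vᵐᵒᵖ) :
    R.CoHopfDom →+ Bim.tens M R.leftBim :=
  Bal.lift (biHom (fun x y => Bim.t (N := R.leftBim) (s.act y.unop m) (x * v * w))
      (fun x y y' => by
        rw [MulOpposite.unop_add, s.add, Bim.add_t])
      (fun x x' y => by
        rw [add_mul, add_mul]; exact Bim.t_add (N := R.leftBim) _ _ _))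
    (fun a x y => by
      change Bim.t (N := R.leftBim) (s.act y.unop m) (R.s a * x * v * w) =
        Bim.t (N := R.leftBim) (s.act (R.toAeRing.unop.t (op a) * y.unop) m) (x * v * w)
      rw [s.mul, s.act_t, Bim.t_bal, mul_assoc, mul_assoc, ← mul_assoc x]; rfl)

/-- `(v ⊗ w) ⊗ (m ⊗ x) ↦ v⁺ m ⊗ w x v⁻` on formal tensors, with products in `V`. -/
noncomputable def adj (h : IsRightHopf R) (s : LModStr R.toAeRing.unop M) :
    Vᵐᵒᵖ ⊗[ℤ] Vᵐᵒᵖ →+ M ⊗[ℤ] Vᵐᵒᵖ →+ Bim.tens M R.leftBim :=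
  Bal.fLift (biHom (fun v w => Bal.fLift (biHom (fun m x => conj s m x w (h.trans v))
    (fun m x x' => by
      generalize h.trans v = ξ
      induction ξ using Bal.induction with
      | h0 => simp only [map_zero, add_zero]
      | ha x y hx hy => simp only [map_add, hx, hy]; abel
      | ht y z =>
        change Bim.t (N := R.leftBim) _ (y * (x + x') * w) = _
        rw [mul_add, add_mul]; exact Bim.t_add (N := R.leftBim) _ _ _)
    (fun m m' x => by
      generalize h.trans v = ξ
      induction ξ using Bal.induction with
      | h0 => simp only [map_zero, add_zero]
      | ha x y hx hy => simp only [map_add, hx, hy]; abel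
      | ht y z =>
        change Bim.t (N := R.leftBim) (s.act z.unop (m + m')) _ = _
        rw [map_add]; exact Bim.add_t (N := R.leftBim) _ _ _)))
    (fun v w w' => by
      ext ζ
      induction ζ with
      | zero => simp only [map_zero]
      | add x y hx hy => simp only [map_add, hx, hy]
      | tmul m x =>
        change conj s m x (w + w') (h.trans v) =
          conj s m x w (h.trans v) + conj s m x w' (h.trans v)
        generalize h.trans v = ξ
        induction ξ using Bal.induction with
        | h0 => simp only [map_zero, add_zero]
        | ha x y hx hy => simp only [map_add, hx, hy]; abel
        | ht y z =>
          change Bim.t (N := R.leftBim) _ (y * x * (w + w')) = _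
          rw [mul_add]; exact Bim.t_add (N := R.leftBim) _ _ _)
    (fun v v' w => by
      ext ζ
      induction ζ with
      | zero => simp only [map_zero]
      | add x y hx hy =>
        exact (map_add _ x y).trans ((congrArg₂ (· + ·) hx hy).trans (map_add _ x y).symm)
      | tmul m x =>
        change conj s m x w (h.trans (v + v')) =
          conj s m x w (h.trans v) + conj s m x w (h.trans v')
        rw [map_add, map_add]))

lemma adj_tmul (h : IsRightHopf R) (s : LModStr R.toAeRing.unop M) (v w x : Vᵐᵒᵖ) (m : M) :
    adj h s (v ⊗ₜ w) (m ⊗ₜ x) = conj s m x w (h.trans v) := rfl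

end RightBialgebroid

/-- `m ⊗ v ↦ v m` -/
def LModStr.evR {R : RightBialgebroid A V} {M : Bim A} (s : LModStr R.toAeRing.unop M) :
    Bim.tens M R.leftBim →+ M :=
  Bim.tlift (N := R.leftBim) (biHom (N := Vᵐᵒᵖ) (fun m v => s.act v.unop m)
      (fun m v v' => by rw [MulOpposite.unop_add, s.add]) (fun m m' v => map_add _ _ _))
    (fun a m v => by
      change s.act v.unop (M.r (op a) m) = s.act (v.unop * R.toAeRing.unop.t (op a)) m
      rw [s.mul, s.act_t])

/-- The compatibility of a left `V`-module and a right `V`-comodule structure on the same bimodule that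
defines anti Yetter-Drinfel'd modules: `(v m)⁽⁰⁾ ⊗ (v m)⁽¹⁾ = v⁽¹⁾⁺ m⁽⁰⁾ ⊗ v⁽²⁾ m⁽¹⁾ v⁽¹⁾⁻`, where the
right side is computed on arbitrary representatives of the coproduct of `v` and the coaction
on `m`. -/
def IsAYD {R : RightBialgebroid A V} (h : RightBialgebroid.IsRightHopf R) {M : Bim A}
    (s : LModStr R.toAeRing.unop M) (c : RComodStr R M) : Prop :=
  ∀ (v : V) (m : M) (z : Vᵐᵒᵖ ⊗[ℤ] Vᵐᵒᵖ) (ζ : M ⊗[ℤ] Vᵐᵒᵖ), R.mkL z = R.Δ (op v) →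
    (Bal.mk ζ : Bim.tens M R.leftBim) = c.coact m →
    c.coact (s.act v m) = RightBialgebroid.adj h s z ζ

/-- Stability of a module and comodule: `m⁽¹⁾ m⁽⁰⁾ = m`. -/
def IsStable {R : RightBialgebroid A V} {M : Bim A} (s : LModStr R.toAeRing.unop M)
    (c : RComodStr R M) : Prop := ∀ m, s.evR (c.coact m) = m

/-- An anti Yetter-Drinfel'd module over a right Hopf algebroid `V`: a compatible left `V`-module and
right `V`-comodule with the same underlying bimodule. -/
structure AYDStr {R : RightBialgebroid A V} (h : RightBialgebroid.IsRightHopf R) (M : Bim A) where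
  mod : LModStr R.toAeRing.unop M
  comod : RComodStr R M
  ayd : IsAYD h mod comod

/-- Anti Yetter-Drinfel'd modules. -/
abbrev AYD {R : RightBialgebroid A V} (h : RightBialgebroid.IsRightHopf R) : StrOn (Bim A) where
  Str := AYDStr h
  IsHom p q f := (LMod R.toAeRing.unop).IsHom p.mod q.mod f ∧ (RComod R).IsHom p.comod q.comod f
  id_mem p := ⟨(LMod R.toAeRing.unop).id_mem p.mod, (RComod R).id_mem p.comod⟩
  comp_mem h h' := ⟨(LMod R.toAeRing.unop).comp_mem h.1 h'.1, (RComod R).comp_mem h.2 h'.2⟩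

/-- Stable anti Yetter-Drinfel'd modules, as a full subcategory. -/
abbrev SAYD {R : RightBialgebroid A V} (h : RightBialgebroid.IsRightHopf R) : StrOn (Bim A) where
  Str M := {p : AYDStr h M // IsStable p.mod p.comod}
  IsHom p q f := (AYD h).IsHom p.1 q.1 f
  id_mem p := (AYD h).id_mem p.1
  comp_mem h' h'' := (AYD h).comp_mem h' h''

end AntiYD

/-! ## Functors that are the identity on underlying objects -/

section Functors

universe v' u' w w'

variable {C : Type u'} [Category.{v'} C]

namespace StrOn

/-- A functorial way to turn one kind of structure into another one on the same object. -/
structure Fun (D : StrOn.{v', u', w} C) (E : StrOn.{v', u', w'} C) where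
  str : ∀ {X : C}, D.Str X → E.Str X
  mem : ∀ {X Y : C} {s : D.Str X} {s' : D.Str Y} {f : X ⟶ Y},
    D.IsHom s s' f → E.IsHom (str s) (str s') f

variable {D : StrOn.{v', u', w} C} {E : StrOn.{v', u', w'} C}

/-- The functor between categories of structured objects; it is the identity on underlying objects
and morphisms. -/
def Fun.functor (F : Fun D E) : D.Obj ⥤ E.Obj where
  obj X := ⟨X.base, F.str X.str⟩
  map f := ⟨f.base, F.mem f.mem⟩

variable [MonoidalCategory C]

/-- `F` is a strict monoidal functor: it takes the unit object to the unit object and tensor products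
to tensor products, on the nose. -/
structure Fun.IsStrictMonoidal (F : Fun D E) (S : D.Mon) (T : E.Mon) : Prop where
  unit : F.str S.unit = T.unit
  tensor : ∀ {X Y : C} (s : D.Str X) (s' : D.Str Y),
    F.str (S.tensor s s') = T.tensor (F.str s) (F.str s')

/-- The monoidal functor given by a strict monoidal functor; its structure morphisms are identities
on underlying objects. -/
@[reducible] def Fun.IsStrictMonoidal.monoidal {F : Fun D E} {S : D.Mon} {T : E.Mon}
    (h : F.IsStrictMonoidal S T) :
    letI := S.monoidal; letI := T.monoidal; F.functor.Monoidal :=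
  letI := S.monoidal
  letI := T.monoidal
  Functor.CoreMonoidal.toMonoidal
    { εIso := T.iso (X := ⟨𝟙_ C, T.unit⟩) (Y := ⟨𝟙_ C, F.str S.unit⟩) (Iso.refl (𝟙_ C)) (by
        rw [h.unit]; exact E.id_mem T.unit)
      μIso := fun X Y => T.iso (X := ⟨X.base ⊗ Y.base, T.tensor (F.str X.str) (F.str Y.str)⟩)
        (Y := ⟨X.base ⊗ Y.base, F.str (S.tensor X.str Y.str)⟩) (Iso.refl (X.base ⊗ Y.base)) (by
          dsimp only
          rw [h.tensor]; exact E.id_mem _)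
      μIso_hom_natural_left := fun f X => Hom.ext ((Category.comp_id _).trans (Category.id_comp _).symm)
      μIso_hom_natural_right := fun X f => Hom.ext ((Category.comp_id _).trans (Category.id_comp _).symm)
      associativity := fun X Y Z => Hom.ext (by
        change ((𝟙 (X.base ⊗ Y.base)) ▷ Z.base) ≫ 𝟙 _ ≫ (α_ X.base Y.base Z.base).hom =
          (α_ X.base Y.base Z.base).hom ≫ (X.base ◁ 𝟙 (Y.base ⊗ Z.base)) ≫ 𝟙 _
        simp)
      left_unitality := fun X => Hom.ext (by
        change (λ_ X.base).hom = ((𝟙 (𝟙_ C)) ▷ X.base) ≫ 𝟙 _ ≫ (λ_ X.base).hom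
        simp)
      right_unitality := fun X => Hom.ext (by
        change (ρ_ X.base).hom = (X.base ◁ (𝟙 (𝟙_ C))) ≫ 𝟙 _ ≫ (ρ_ X.base).hom
        simp) }

end StrOn

end Functors

/-! ## The correspondences between structures over `U` and over its dual -/

section Correspondence

variable {A U : Type u} [Ring A] [Ring U] {L : LeftBialgebroid A U} {M : Bim A}

open LeftBialgebroid

/-- The right `U*`-action is `m φ = ⟨φ, m₍₋₁₎⟩ m₍₀₎`. -/
def ComodToMod (c : LComodStr L M) (s : LModStr L.dualRing.opp M) : Prop :=
  ∀ (φ : L.Dual) (m : M), s.act (op φ) m = L.contr M φ (c.coact m)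

/-- The left `U`-action is `u m = m⁽⁰⁾ ⟨m⁽¹⁾, u⟩`. -/
def DualComodToMod {h : L.FGProj} (c : RComodStr (L.dual h) M) (s : LModStr L.toAeRing M) : Prop :=
  ∀ (u : U) (m : M), s.act u m = L.pair M u (c.coact m)

/-- The left `U*`-action is `φ m = γ(m ⟨φ, -⟩)`. -/
def ContraToMod (c : ContraStr L M) (s : LModStr L.dualRing M) : Prop :=
  ∀ (φ : L.Dual) (m : M), s.act φ m = c.contra (RHom.ofDual m φ)

end Correspondence

/-! ## Equivalences that are the identity on underlying objects -/

section Functors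

universe v' u' w w'

variable {C : Type u'} [Category.{v'} C]
  {D : StrOn.{v', u', w} C} {E : StrOn.{v', u', w'} C}

/-! The engine is a finite dual basis: elements eᵢ of U and eⁱ of U* with u = Σ t(⟨eⁱ, u⟩) eᵢ, which
exists when U_◃ is finitely generated projective. Moving scalars across tensor signs gives three
expansions: ξ = Σ eᵢ ⊗ ⟨eⁱ, ξ⟩ in U_◃ ⊗ X (`tens_expand`), y = Σ ⟨y, eᵢ⟩ ⊗ eⁱ in X ⊗ ▸U*
(`tens_dual_expand`), and f = Σ f(eᵢ)⟨eⁱ, -⟩ in Hom(U_◃, M) (`rhom_expand`). Hence an identity in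
U_◃ ⊗ X may be checked after contracting with every φ (`contr_ext`), one in X ⊗ U* after pairing
with every u (`pair_ext`), and an equality of additive maps on Hom(U_◃, M) on the maps m⟨φ, -⟩
(`RHom.hom_eq`).

Contracting a coaction, or applying a contraaction to m⟨φ, -⟩, produces an action. The product,
unit, source and target of U* are such that coassociativity, counit and the induced A-action become
the module axioms; for coactions of U* the same happens with the multiplication of U, because the
coproduct of U* is the transpose of that multiplication. Conversely, an action gives Σ eᵢ ⊗ m eⁱ, Σ
eᵢ m ⊗ eⁱ or Σ eⁱ f(eᵢ), and the separation principles turn the axioms back. All functors fix the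
underlying bimodules and maps, so an equivalence amounts to hitting every structure and reflecting
morphisms (`StrOn.Fun.isEquivalence`). Strict monoidality follows from Δφ = Σ (eᵢ ⇀ φ) ⊗ eⁱ and Δu =
Σ eᵢ ⊗ ⟨eⁱ, u₍₁₎⟩u₍₂₎.

For Yetter–Drinfel'd modules, pairing one side of the condition over U* with u gives the opposite
side of the condition over U contracted with φ (`pair_ydR`, `pair_diagAct`). Both braidings become m
⊗ n ↦ Σ eᵢ n ⊗ m eⁱ.

For Hopf algebroids, the domain of the Hopf–Galois map of U* is identified with the right A-linear
functionals on U_◃ ⊗ U (`coHopfPair_injective`, `exists_coHopfPair_eq`). Under this identification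
the map is the transpose of the Hopf–Galois map of U (`hopfPair_cogalois`), so bijectivity passes to
the dual.

For anti Yetter–Drinfel'd objects the link is the functional θ : w ↦ ψ(y₊ t(φ(y₋ w))). It can be
written with the translation map of U or with that of U* (`ev_theta`). The right-hand sides of both
compatibility conditions are sums of elements θ m⁽⁰⁾ with ψ = m⁽¹⁾ (`pair_adj_tmul`,
`contra_adj_ofDual`), and they match after expanding Δu and Δφ (`pair_adj`). The left-hand sides are
both u(φ m). The stability conditions both say Σ eⁱ(eᵢ m) = m. -/

/-- A functor that is the identity on underlying objects is an equivalence if every target structure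
is hit and every morphism of target structures comes from a morphism of source structures. -/
lemma StrOn.Fun.isEquivalence (F : StrOn.Fun D E)
    (hs : ∀ {X : C} (t : E.Str X), ∃ s : D.Str X, F.str s = t)
    (hf : ∀ {X Y : C} {s : D.Str X} {s' : D.Str Y} {f : X ⟶ Y},
      E.IsHom (F.str s) (F.str s') f → D.IsHom s s' f) : F.functor.IsEquivalence where
  faithful := ⟨fun {X Y f g} h =>
    StrOn.Hom.ext (congrArg (fun k : F.functor.obj X ⟶ F.functor.obj Y => StrOn.Hom.base k) h)⟩
  full := ⟨fun {X Y} g =>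
    ⟨⟨StrOn.Hom.base (X := F.functor.obj X) (Y := F.functor.obj Y) g,
      hf (StrOn.Hom.mem (X := F.functor.obj X) (Y := F.functor.obj Y) g)⟩, rfl⟩⟩
  -- The preimage has the same underlying object and its image equals t on the nose, so the identity
  -- serves as the isomorphism.
  essSurj := ⟨fun ⟨X, t⟩ => by
    obtain ⟨s, rfl⟩ := hs t
    exact ⟨⟨X, s⟩, ⟨Iso.refl _⟩⟩⟩

end Functors

/-! ## Dual bases -/

section DualBases

variable {A U : Type u} [Ring A] [Ring U]

/-- The action is the only field that carries data; the others are propositions about it. Structures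
obtained by different routes can therefore be compared on elements. -/
lemma LModStr.ext_act {R : AeRing A U} {M : Bim A} {s s' : LModStr R M}
    (h : ∀ u m, s.act u m = s'.act u m) : s = s' := by
  have : s.act = s'.act := RingHom.ext fun u => AddMonoidHom.ext fun m => h u m
  cases s; cases s'; cases this; rfl

lemma LModStr.act_sum {R : AeRing A U} {M : Bim A} (s : LModStr R M) {n : ℕ} (f : Fin n → U)
    (m : M) : s.act (∑ i, f i) m = ∑ i, s.act (f i) m := by
  rw [map_sum]
  exact AddMonoidHom.finsetSum_apply _ _ _

lemma LComodStr.ext_coact {L : LeftBialgebroid A U} {M : Bim A} {s s' : LComodStr L M}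
    (h : ∀ m, s.coact m = s'.coact m) : s = s' := by
  have : s.coact = s'.coact := AddMonoidHom.ext h
  cases s; cases s'; cases this; rfl

lemma ContraStr.ext_contra {L : LeftBialgebroid A U} {M : Bim A} {s s' : ContraStr L M}
    (h : ∀ f, s.contra f = s'.contra f) : s = s' := by
  have : s.contra = s'.contra := AddMonoidHom.ext h
  cases s; cases s'; cases this; rfl

namespace LeftBialgebroid

variable (L : LeftBialgebroid A U)

/-- Elements `eᵢ` of `U` and `eⁱ` of its dual form a dual basis of `U_◃`. -/
def IsDualBasis {n : ℕ} (e : Fin n → U) (e' : Fin n → L.Dual) : Prop :=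
  ∀ u, u = ∑ i, L.t (op (L.ev (e' i) u)) * e i

/-! ### Expansions along a dual basis -/

variable {L} {n : ℕ} {e : Fin n → U} {e' : Fin n → L.Dual} {X Y M N : Bim A}

/-- Replace u by Σ t(⟨eⁱ, u⟩) eᵢ in the first leg; the coefficient acts there from the right, so it
crosses the tensor sign and becomes ⟨eⁱ, u⟩ x. -/
lemma IsDualBasis.tens_expand (he : L.IsDualBasis e e') (ξ : Bim.tens L.leftBim X) :
    ξ = ∑ i, Bim.t (M := L.leftBim) (e i) (L.contr X (e' i) ξ) := by
  induction ξ using Bim.t_induction with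
  | h0 => simp only [map_zero, Bim.t_zero, Finset.sum_const_zero]
  | ha x y hx hy => simp only [map_add, Bim.t_add, Finset.sum_add_distrib, ← hx, ← hy]
  | ht u x =>
    refine (congrArg (Bim.t (M := L.leftBim) · x) (he u)).trans ?_
    refine (Bal.sum_tmul _ _ _).trans (Finset.sum_congr rfl fun i _ => ?_)
    exact Bim.t_bal (M := L.leftBim) _ (e i) x

/-- The expansion mentions ξ only through its contractions. This is the separation principle by
which every identity with values in U_◃ ⊗ X is checked. -/
lemma IsDualBasis.contr_ext (he : L.IsDualBasis e e') {ξ ξ' : Bim.tens L.leftBim X}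
    (h : ∀ φ, L.contr X φ ξ = L.contr X φ ξ') : ξ = ξ' := by
  rw [he.tens_expand ξ, he.tens_expand ξ']
  exact Finset.sum_congr rfl fun i _ => by rw [h]

/-- Here the second leg is expanded, ψ = Σ ⟨ψ, eᵢ⟩ ▸ eⁱ, and the coefficient moves to the first leg.
Any dual basis is allowed, not only the one chosen in the construction of the coproduct. -/
lemma IsDualBasis.tens_dual_expand (he : L.IsDualBasis e e') (y : Bim.tens X L.dualBim) :
    y = ∑ i, Bim.t (N := L.dualBim) (L.pair X (e i) y) (op (e' i)) := by
  induction y using Bim.t_induction with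
  | h0 => simp only [map_zero, Bim.zero_t, Finset.sum_const_zero]
  | ha x y hx hy => simp only [map_add, Bim.add_t, Finset.sum_add_distrib, ← hx, ← hy]
  | ht x ψ =>
    obtain ⟨ψ, rfl⟩ := op_surjective (α := L.Dual) ψ
    refine (congrArg (Bim.t (N := L.dualBim) x) (L.dual_expand he ψ)).trans ?_
    refine (Bal.tmul_sum _ _ _).trans (Finset.sum_congr rfl fun i _ => ?_)
    exact (Bim.t_bal (N := L.dualBim) _ x _).symm

/-- The coefficients are values of `conv` because ⟨φ, u₍₁₎⟩u₍₂₎ is by definition the contraction of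
Δu with φ. -/
lemma IsDualBasis.comul_expand (he : L.IsDualBasis e e') (u : U) :
    L.Δ u = ∑ i, Bim.t (M := L.leftBim) (N := L.leftBim) (e i) (L.conv (e' i) u) :=
  he.tens_expand (L.Δ u)

/-- Pairing the second leg of Δφ with v gives v ⇀ φ, and these pairings are the coefficients of the
expansion. So the coproduct of the dual has the same form in every dual basis. -/
lemma IsDualBasis.dual_comul_expand (he : L.IsDualBasis e e') (h : L.FGProj) (φ : L.Dual) :
    (L.dual h).Δ (op φ) =
      ∑ i, Bim.t (M := L.dualBim) (N := L.dualBim) (op (L.harp (e i) φ)) (op (e' i)) := by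
  refine (he.tens_dual_expand _).trans (Finset.sum_congr rfl fun i _ => ?_)
  exact congrArg (Bim.t (M := L.dualBim) (N := L.dualBim) · (op (e' i))) (L.pair_comul h φ (e i))

/-- `φ = ∑ φ(eᵢ) eⁱ` -/
lemma IsDualBasis.dual_expand (he : L.IsDualBasis e e') (φ : L.Dual) :
    φ = ∑ i, e' i * L.dualT (op (L.ev φ (e i))) := by
  have h := congrArg unop (L.dual_expand he φ)
  rw [Finset.unop_sum] at h
  exact h

/-! ### Rules for contraction with the dual -/

/-- Since ⟨φψ, u⟩ = ⟨ψ, ⟨φ, u₍₁₎⟩u₍₂₎⟩, contracting with a product means splitting the first leg and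
contracting with φ, then with ψ. This converts coassociativity of coactions into associativity of
actions. -/
lemma contr_mul (φ ψ : L.Dual) (ξ : Bim.tens L.leftBim X) :
    L.contr X (φ * ψ) ξ =
      L.contr X ψ (L.contr (Bim.tens L.leftBim X) φ ((L.comulFst X).add ξ)) := by
  induction ξ using Bim.t_induction with
  | h0 => simp only [map_zero]
  | ha x y hx hy => simp only [map_add, hx, hy]
  | ht x y =>
    rw [L.comulFst_t, contr_t, ev_mul, conv_apply]
    -- Both sides are additive in the coproduct of x, so it may be replaced by an arbitrary tensor
    -- and tested on pure ones.
    generalize L.Δ x = η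
    induction η using Bim.t_induction with
    | h0 => simp only [map_zero, Bim.zero_t]; rfl
    | ha x y hx hy =>
      rw [map_add, map_add, Bim.l_add, Bim.add_t, map_add, map_add, map_add, hx, hy]
    | ht x z => rfl

/-- The value of φ acts on the second leg from the left, which f respects. Applied to f a coaction
it lets the coaction be pulled out; applied to f a morphism it relates colinear and linear maps. -/
lemma contr_snd (φ : L.Dual) (f : X →+ Y) (hf : ∀ a x, f (X.l a x) = Y.l a (f x))
    (ξ : Bim.tens L.leftBim X) :
    L.contr Y φ (Bim.snd L.leftBim f hf ξ) = f (L.contr X φ ξ) := by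
  induction ξ using Bim.t_induction with
  | h0 => simp only [map_zero]
  | ha x y hx hy => simp only [map_add, hx, hy]
  | ht u x => exact (hf _ _).symm

/-- Left multiplication by s(a) under φ is left multiplication of φ by the target element of a in
the dual. -/
lemma contr_l (φ : L.Dual) (a : A) (ξ : Bim.tens L.leftBim X) :
    L.contr X φ ((Bim.tens L.leftBim X).l a ξ) = L.contr X (L.dualT (op a) * φ) ξ := by
  induction ξ using Bim.t_induction with
  | h0 => simp only [map_zero]
  | ha x y hx hy => simp only [map_add, hx, hy]
  | ht u x => exact congrArg (fun b => X.l b x) (L.ev_t_mul (op a) φ u).symm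

/-- The unit of the dual is ε; this makes the counit axiom and unitality of the action the same
statement. -/
lemma contr_one (ξ : Bim.tens L.leftBim X) :
    L.contr X 1 ξ = (L.counitFst X).add ξ := by
  induction ξ using Bim.t_induction with
  | h0 => simp only [map_zero]
  | ha x y hx hy => simp only [map_add, hx, hy]
  | ht u x => rfl

/-- The target element of a is a ε(-). Passing to the opposite ring makes the target of the dual the
source, so this yields the left A-action of a right module over the dual. -/
lemma contr_dualT (a : A) (ξ : Bim.tens L.leftBim X) :
    L.contr X (L.dualT (op a)) ξ = X.l a ((L.counitFst X).add ξ) := by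
  induction ξ using Bim.t_induction with
  | h0 => simp only [map_zero]
  | ha x y hx hy => simp only [map_add, hx, hy]
  | ht u x => exact X.l_mul a (L.ε u) x

/-- The source element of a is ε(- s(a)), which is exactly the expression by which a coaction
induces the right A-action. -/
lemma contr_dualS (a : A) (ξ : Bim.tens L.leftBim X) :
    L.contr X (L.dualS a) ξ = (L.counitFst X).add (L.mulFst X (L.s a) ξ) := by
  induction ξ using Bim.t_induction with
  | h0 => simp only [map_zero]
  | ha x y hx hy => simp only [map_add, hx, hy]
  | ht u x => rfl

lemma contr_mulFst (φ : L.Dual) (z : U) (ξ : Bim.tens L.leftBim X) :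
    L.contr X φ (L.mulFst X z ξ) = L.contr X (L.harp z φ) ξ := by
  induction ξ using Bim.t_induction with
  | h0 => simp only [map_zero]
  | ha x y hx hy => simp only [map_add, hx, hy]
  | ht u x => rfl

end LeftBialgebroid

end DualBases

/-! ## Left comodules over `U` and right modules over its dual -/

section ComodulesModules

open LeftBialgebroid

variable {A U : Type u} [Ring A] [Ring U] {L : LeftBialgebroid A U} {M N : Bim A}

/-- The right module over the dual given by a left comodule, `m φ = ⟨φ, m₍₋₁₎⟩ m₍₀₎`. -/
def LComodStr.dualMod (c : LComodStr L M) : LModStr L.dualRing.opp M where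
  act := RingHom.mk' ⟨⟨fun φ => (L.contr M φ.unop).comp c.coact, AddMonoidHom.ext fun m =>
        (contr_one (c.coact m)).trans (c.counit m)⟩,
      fun φ ψ => AddMonoidHom.ext fun m => by
        -- The action is over the opposite ring, so the factors appear reversed: ψ is contracted
        -- first, coassociativity replaces the split first leg by a second coaction, and that
        -- coaction is pulled out of the contraction.
        change L.contr M (ψ.unop * φ.unop) (c.coact m) =
          L.contr M φ.unop (c.coact (L.contr M ψ.unop (c.coact m)))
        rw [contr_mul, c.coassoc, contr_snd]⟩
    (fun φ ψ => AddMonoidHom.ext fun m => L.contr_add M φ.unop ψ.unop (c.coact m))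
  act_s a m := (contr_dualT a (c.coact m)).trans (congrArg (M.l a) (c.counit m))
  act_t a m := (contr_dualS a.unop (c.coact m)).trans (c.right_eq a.unop m).symm

lemma LComodStr.dualMod_act (c : LComodStr L M) (φ : L.Dual) (m : M) :
    c.dualMod.act (op φ) m = L.contr M φ (c.coact m) := rfl

variable (L) in
/-- The functor from left comodules to right modules over the dual. -/
def comodToModFun : StrOn.Fun (LComod L) (RMod L.dualRing) where
  str c := c.dualMod
  mem {X Y c c' f} h φ m := by
    obtain ⟨φ, rfl⟩ := op_surjective (α := L.Dual) φ
    rw [c.dualMod_act, c'.dualMod_act, ← h]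
    exact (contr_snd φ f.add f.map_l _).symm

variable {n : ℕ} {e : Fin n → U} {e' : Fin n → L.Dual}

/-- The coaction `m ↦ ∑ eᵢ ⊗ m eⁱ`. -/
def LModStr.basisCoact (s : LModStr L.dualRing.opp M) (e : Fin n → U) (e' : Fin n → L.Dual) :
    M →+ Bim.tens L.leftBim M :=
  AddMonoidHom.mk' (fun m => ∑ i, Bim.t (M := L.leftBim) (e i) (s.act (op (e' i)) m))
    (fun m m' => by simp only [map_add, Bim.t_add, Finset.sum_add_distrib])

/-- Contraction yields Σ ⟨φ, eᵢ⟩ (m eⁱ). The scalars act through the target of the dual, and φ is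
the sum of the products of eⁱ with the target element of ⟨φ, eᵢ⟩. Thus the dual basis coaction has
the prescribed contractions, and the comodule axioms can be read off from those of the module. -/
lemma LModStr.contr_basisCoact (s : LModStr L.dualRing.opp M) (he : L.IsDualBasis e e')
    (φ : L.Dual) (m : M) : L.contr M φ (s.basisCoact e e' m) = s.act (op φ) m := by
  have h1 : op φ = ∑ i, L.dualRing.opp.s (L.ev φ (e i)) * op (e' i) := L.dual_expand he φ
  change L.contr M φ (∑ i, Bim.t (M := L.leftBim) (e i) (s.act (op (e' i)) m)) = _
  rw [map_sum, h1, s.act_sum]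
  refine Finset.sum_congr rfl fun i _ => ?_
  rw [s.mul, s.act_s]; rfl

/-- The left comodule given by a right module over the dual, for a dual basis. -/
def LModStr.basisComod (s : LModStr L.dualRing.opp M) (he : L.IsDualBasis e e') :
    LComodStr L M where
  coact := s.basisCoact e e'
  -- After contraction both sides are actions of elements of the dual, related by multiplicativity
  -- and the target.
  coact_l a m := he.contr_ext fun φ => by
    rw [contr_l, s.contr_basisCoact he, s.contr_basisCoact he, ← s.act_s, ← s.mul]; rfl
  -- The values lie in U ⊗ (U ⊗ M), so two contractions are needed, φ on the outer leg and ψ on the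
  -- inner one; both sides become m(φψ).
  coassoc m := he.contr_ext fun φ => he.contr_ext fun ψ => by
    rw [← contr_mul, contr_snd, s.contr_basisCoact he, s.contr_basisCoact he,
      s.contr_basisCoact he, ← s.mul]; rfl
  counit m := by
    rw [← contr_one, s.contr_basisCoact he]; exact s.one m
  right_eq a m := by
    rw [← contr_dualS, s.contr_basisCoact he]; exact (s.act_t (op a) m).symm

lemma LModStr.dualMod_basisComod (s : LModStr L.dualRing.opp M) (he : L.IsDualBasis e e') :
    (s.basisComod he).dualMod = s :=
  LModStr.ext_act fun φ m => s.contr_basisCoact he φ.unop m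

/-- The action records all contractions of the coaction, and these separate elements of U_◃ ⊗ M. -/
lemma LComodStr.dualMod_injective (h : L.FGProj) {c c' : LComodStr L M}
    (hc : c.dualMod = c'.dualMod) : c = c' := by
  obtain ⟨n, e, e', he⟩ := h.exists_basis
  exact LComodStr.ext_coact fun m => IsDualBasis.contr_ext he fun φ =>
    congrArg (fun s : LModStr L.dualRing.opp M => s.act (op φ) m) hc

/-- Contracted with φ, the colinearity identity is linearity with respect to φ, and contractions
separate. -/
lemma comodToModFun_reflects (h : L.FGProj) {c : LComodStr L M} {c' : LComodStr L N} {f : M ⟶ N}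
    (hf : (RMod L.dualRing).IsHom c.dualMod c'.dualMod f) : (LComod L).IsHom c c' f := by
  obtain ⟨n, e, e', he⟩ := h.exists_basis
  exact fun m => IsDualBasis.contr_ext he fun φ => (contr_snd φ f.add f.map_l _).trans (hf (op φ) m)

lemma comodToModFun_isEquivalence (h : L.FGProj) : (comodToModFun L).functor.IsEquivalence := by
  refine StrOn.Fun.isEquivalence _ (fun {X} s => ?_) (comodToModFun_reflects h)
  obtain ⟨n, e, e', he⟩ := h.exists_basis
  exact ⟨LModStr.basisComod s he, LModStr.dualMod_basisComod s he⟩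

/-! ### Left comodules and right modules: tensor products -/

lemma contr_shift (φ : L.Dual) (v : U) (n : N) (ξ : Bim.tens L.leftBim M) :
    L.contr (Bim.tens M N) φ (LComodStr.shift M L v n ξ) =
      Bim.t (L.contr M (L.harp v φ) ξ) n := by
  induction ξ using Bim.t_induction with
  | h0 => simp only [map_zero, Bim.zero_t]
  | ha x y hx hy => simp only [map_add, Bim.add_t, hx, hy]
  | ht u x => rfl

/-- Contracting the codiagonal coaction produces ⟨φ, m₍₋₁₎n₍₋₁₎⟩. Writing n₍₋₁₎ ⊗ n₍₀₎ = Σ eᵢ ⊗ n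
eⁱ, the pairing becomes ⟨eᵢ ⇀ φ, m₍₋₁₎⟩, so the result is Σ m(eᵢ ⇀ φ) ⊗ n eⁱ. This is the diagonal
action, as Δφ = Σ (eᵢ ⇀ φ) ⊗ eⁱ. -/
lemma LComodStr.dualMod_tensor (h : L.FGProj) (c : LComodStr L M) (c' : LComodStr L N) :
    (c.tensor c').dualMod = (L.dual h).tensorLMod c.dualMod c'.dualMod := by
  obtain ⟨k, e, e', he⟩ := h.exists_basis
  refine LModStr.ext_act fun φ x => ?_
  obtain ⟨φ, rfl⟩ := op_surjective (α := L.Dual) φ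
  refine Bim.t_hom_eq (f := (c.tensor c').dualMod.act (op φ))
    (g := ((L.dual h).tensorLMod c.dualMod c'.dualMod).act (op φ)) (fun m n => ?_) x
  change L.contr (Bim.tens M N) φ (c.mulCoact m (c'.coact n)) =
    c.dualMod.diag c'.dualMod m n ((L.dual h).Δ (op φ))
  rw [IsDualBasis.dual_comul_expand he h φ]
  conv_lhs => rw [IsDualBasis.tens_expand he (c'.coact n)]
  rw [map_sum, map_sum]
  refine Eq.trans (Finset.sum_congr rfl fun i _ => ?_)
    (map_sum (c.dualMod.diag c'.dualMod m n) _ _).symm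
  exact contr_shift φ (e i) _ (c.coact m)

/-- Both actions send a to ⟨φ, s(a)⟩: on one side from the coaction a ↦ s(a) ⊗ 1, on the other by
evaluating at 1 the product of the target element of a with φ. -/
lemma LComodStr.dualMod_unit (h : L.FGProj) :
    (LComodStr.unit L).dualMod = (L.dual h).unitLMod := by
  refine LModStr.ext_act fun φ (a : A) => ?_
  obtain ⟨φ, rfl⟩ := op_surjective (α := L.Dual) φ
  change L.ev φ (L.s a) * 1 = L.ev (L.dualT (op a) * φ) 1
  rw [L.ev_t_mul, mul_one, mul_one]; rfl

lemma comodToModFun_isStrictMonoidal (h : L.FGProj) :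
    (comodToModFun L).IsStrictMonoidal (monLComod L) (L.dual h).monLMod where
  unit := LComodStr.dualMod_unit h
  tensor c c' := c.dualMod_tensor h c'

end ComodulesModules

/-! ## Right comodules over the dual and left modules over `U` -/

section DualComodules

open LeftBialgebroid

variable {A U : Type u} [Ring A] [Ring U] {L : LeftBialgebroid A U} {X Y M N : Bim A}
  {n : ℕ} {e : Fin n → U} {e' : Fin n → L.Dual}

/-- Pairing leaves a scalar acting from the right on the first leg, which f respects. -/
lemma pair_fst (u : U) (f : X →+ Y) (hf : ∀ a x, f (X.r (op a) x) = Y.r (op a) (f x))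
    (ξ : Bim.tens X L.dualBim) :
    L.pair Y u (Bim.fst L.dualBim f hf ξ) = f (L.pair X u ξ) := by
  induction ξ using Bim.t_induction with
  | h0 => simp only [map_zero]
  | ha x y hx hy => simp only [map_add, hx, hy]
  | ht x ψ => exact (hf _ _).symm

/-- The counit of the dual is evaluation at 1, so counitality of a coaction becomes unitality of the
action. -/
lemma pair_one (h : L.FGProj) (ξ : Bim.tens X L.dualBim) :
    L.pair X 1 ξ = ((L.dual h).counitSnd X).add ξ := by
  induction ξ using Bim.t_induction with
  | h0 => simp only [map_zero]
  | ha x y hx hy => simp only [map_add, hx, hy]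
  | ht x ψ => rfl

/-- Evaluating at s(a) is multiplying by the source element of a and evaluating at 1. This matches
the induced left action of a comodule over the dual with the action of s(a). -/
lemma pair_s (h : L.FGProj) (a : A) (ξ : Bim.tens X L.dualBim) :
    L.pair X (L.s a) ξ = ((L.dual h).counitSnd X).add
      ((L.dual h).mulLast X ((L.dual h).t (op a)) ξ) := by
  induction ξ using Bim.t_induction with
  | h0 => simp only [map_zero]
  | ha x y hx hy => simp only [map_add, hx, hy]
  | ht x ψ =>
    obtain ⟨ψ, rfl⟩ := op_surjective (α := L.Dual) ψ
    change X.r (op (L.ev ψ (L.s a))) x = X.r (op (L.ev (L.dualS a * ψ) 1)) x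
    rw [L.ev_s_mul, one_mul]

/-- The coproduct of the dual is dual to the product of U: pairing the last leg with u and the one
before with v evaluates at vu. This converts coassociativity over the dual into associativity over
U. -/
lemma pair_mul (h : L.FGProj) (u v : U) (ξ : Bim.tens X L.dualBim) :
    L.pair X v (L.pair (Bim.tens X L.dualBim) u (((L.dual h).comulSnd X).add ξ)) =
      L.pair X (v * u) ξ := L.pair_whiskerLeft h X u v ξ

/-- The left module given by a right comodule over the dual, `u m = m⁽⁰⁾ ⟨m⁽¹⁾, u⟩`. -/
def RComodStr.predualMod {h : L.FGProj} (c : RComodStr (L.dual h) M) : LModStr L.toAeRing M where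
  act := RingHom.mk' ⟨⟨fun u => (L.pair M u).comp c.coact, AddMonoidHom.ext fun m =>
        (pair_one h (c.coact m)).trans (c.counit m)⟩,
      fun u v => AddMonoidHom.ext fun m => by
        change L.pair M (u * v) (c.coact m) = L.pair M u (c.coact (L.pair M v (c.coact m)))
        -- The product is split into two pairings of the coproduct, coassociativity turns the
        -- coproduct into an iterated coaction, and the inner pairing passes through the outer
        -- coaction.
        rw [← pair_mul h v u, c.coassoc]
        exact congrArg (L.pair M u) (pair_fst v c.coact c.coact_r (c.coact m))⟩
    (fun u v => AddMonoidHom.ext fun m => L.pair_add M u v (c.coact m))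
  act_s a m := (pair_s h a (c.coact m)).trans (c.left_eq a m).symm
  act_t a m := by
    -- Pairing with 1·t(a) is pairing the right translate by a with 1. Right linearity of the
    -- coaction and the counit axiom then give m a.
    have h1 := (L.pair_r M 1 a (c.coact m)).symm.trans
      ((congrArg (L.pair M 1) (c.coact_r a.unop m)).symm.trans
        ((pair_one h _).trans (c.counit (M.r a m))))
    rw [one_mul] at h1
    exact h1

lemma RComodStr.predualMod_act {h : L.FGProj} (c : RComodStr (L.dual h) M) (u : U) (m : M) :
    c.predualMod.act u m = L.pair M u (c.coact m) := rfl

/-- The functor from right comodules over the dual to left modules. -/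
def dualComodToModFun (h : L.FGProj) : StrOn.Fun (RComod (L.dual h)) (LMod L.toAeRing) where
  str c := c.predualMod
  mem {X Y c c' f} hf u m := by
    rw [c.predualMod_act, c'.predualMod_act, ← hf]
    exact (pair_fst u f.add (fun a m => f.map_r (op a) m) _).symm

/-- The coaction `m ↦ ∑ eᵢ m ⊗ eⁱ`. -/
def LModStr.basisDualCoact (s : LModStr L.toAeRing M) (e : Fin n → U) (e' : Fin n → L.Dual) :
    M →+ Bim.tens M L.dualBim :=
  AddMonoidHom.mk' (fun m => ∑ i, Bim.t (N := L.dualBim) (s.act (e i) m) (op (e' i)))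
    (fun m m' => by simp only [map_add, Bim.add_t, Finset.sum_add_distrib])

/-- Right scalars act through t, so Σ (eᵢ m)⟨eⁱ, u⟩ = Σ t(⟨eⁱ, u⟩) eᵢ m, and the dual basis identity
sums this to u m. -/
lemma LModStr.pair_basisDualCoact (s : LModStr L.toAeRing M) (he : L.IsDualBasis e e')
    (u : U) (m : M) : L.pair M u (s.basisDualCoact e e' m) = s.act u m := by
  change L.pair M u (∑ i, Bim.t (N := L.dualBim) (s.act (e i) m) (op (e' i))) = _
  conv_rhs => rw [he u, s.act_sum]
  rw [map_sum]
  refine Finset.sum_congr rfl fun i _ => ?_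
  rw [s.mul, s.act_t]; rfl

/-- The right comodule over the dual given by a left module, for a dual basis. -/
def LModStr.basisDualComod (h : L.FGProj) (s : LModStr L.toAeRing M) (he : L.IsDualBasis e e') :
    RComodStr (L.dual h) M where
  coact := s.basisDualCoact e e'
  coact_r a m := L.pair_ext h fun u => by
    refine (s.pair_basisDualCoact he u _).trans (Eq.trans ?_ (L.pair_r M u (op a) _).symm)
    rw [s.pair_basisDualCoact he, s.mul, s.act_t]
  -- Pairing the last leg with u and then the remaining one with v turns both sides into v u m.
  coassoc m := L.pair_ext h fun u => L.pair_ext h fun v => by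
    refine (pair_mul h u v _).trans ?_
    refine Eq.trans ?_ (congrArg (L.pair M v) (pair_fst u _ _ _)).symm
    rw [s.pair_basisDualCoact he, s.pair_basisDualCoact he, s.pair_basisDualCoact he, s.mul]
  counit m := by
    refine (pair_one h _).symm.trans ((s.pair_basisDualCoact he 1 m).trans (s.one m))
  left_eq a m := by
    refine ((pair_s h a _).symm.trans ((s.pair_basisDualCoact he (L.s a) m).trans ?_)).symm
    exact s.act_s a m

lemma LModStr.predualMod_basisDualComod (h : L.FGProj) (s : LModStr L.toAeRing M)
    (he : L.IsDualBasis e e') : (s.basisDualComod h he).predualMod = s :=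
  LModStr.ext_act fun u m => s.pair_basisDualCoact he u m

/-- The pairing with u turns the colinearity identity into linearity with respect to u, and pairings
separate elements of N ⊗ U*. -/
lemma dualComodToModFun_reflects (h : L.FGProj) {c : RComodStr (L.dual h) M}
    {c' : RComodStr (L.dual h) N} {f : M ⟶ N}
    (hf : (LMod L.toAeRing).IsHom c.predualMod c'.predualMod f) :
    (RComod (L.dual h)).IsHom c c' f := fun m =>
  L.pair_ext h fun u => (pair_fst u f.add (fun a m => f.map_r (op a) m) _).trans (hf u m)

lemma dualComodToModFun_isEquivalence (h : L.FGProj) :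
    (dualComodToModFun h).functor.IsEquivalence := by
  refine StrOn.Fun.isEquivalence _ (fun {X} s => ?_) (dualComodToModFun_reflects h)
  obtain ⟨n, e, e', he⟩ := h.exists_basis
  exact ⟨LModStr.basisDualComod h s he, LModStr.predualMod_basisDualComod h s he⟩

lemma RComodStr.coact_expand {h : L.FGProj} (c : RComodStr (L.dual h) M)
    (he : L.IsDualBasis e e') (m : M) : c.coact m =
      ∑ i, Bim.t (N := L.dualBim) (c.predualMod.act (e i) m) (op (e' i)) :=
  he.tens_dual_expand (c.coact m)

/-! ### Right comodules over the dual: tensor products -/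

/-- The factor φ is multiplied in front of the last leg, and ⟨φψ, u⟩ is ψ evaluated at ⟨φ,
u₍₁₎⟩u₍₂₎; hence the argument u is replaced by `conv φ u`. -/
lemma pair_shift (h : L.FGProj) (u : U) (m : M) (φ : L.Dual) (ξ : Bim.tens N L.dualBim) :
    L.pair (Bim.tens M N) u (RComodStr.shift N (L.dual h) m (op φ) ξ) =
      Bim.t m (L.pair N (L.conv φ u) ξ) := by
  induction ξ using Bim.t_induction with
  | h0 => simp only [map_zero, Bim.t_zero]
  | ha x y hx hy => simp only [map_add, Bim.t_add, hx, hy]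
  | ht x ψ => rfl

/-- With m⁽⁰⁾ ⊗ m⁽¹⁾ = Σ eᵢ m ⊗ eⁱ, pairing the codiagonal coaction with u gives Σ eᵢ m ⊗ (⟨eⁱ,
u₍₁₎⟩u₍₂₎) n. The elements acting here are the legs of the expansion of Δu. -/
lemma RComodStr.predualMod_tensor {h : L.FGProj} (c : RComodStr (L.dual h) M)
    (c' : RComodStr (L.dual h) N) :
    (c.tensor c').predualMod = L.tensorLMod c.predualMod c'.predualMod := by
  obtain ⟨k, e, e', he⟩ := h.exists_basis
  refine LModStr.ext_act fun u x => ?_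
  refine Bim.t_hom_eq (f := (c.tensor c').predualMod.act u)
    (g := (L.tensorLMod c.predualMod c'.predualMod).act u) (fun m n => ?_) x
  change L.pair (Bim.tens M N) u (c'.mulCoact n (c.coact m)) =
    c.predualMod.diag c'.predualMod m n (L.Δ u)
  rw [IsDualBasis.comul_expand he u, c.coact_expand he]
  refine (congrArg (L.pair (Bim.tens M N) u) (map_sum (c'.mulCoact n) _ _)).trans ?_
  rw [map_sum]
  refine Eq.trans (Finset.sum_congr rfl fun i _ => ?_)
    (map_sum (c.predualMod.diag c'.predualMod m n) _ _).symm
  exact pair_shift h u _ (e' i) (c'.coact n)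

/-- The unit coaction over the dual uses the functional ε(- s(a)), whose value at u is the action of
u on a. -/
lemma RComodStr.predualMod_unit (h : L.FGProj) :
    (RComodStr.unit (L.dual h)).predualMod = L.unitLMod := by
  refine LModStr.ext_act fun u (a : A) => ?_
  change 1 * L.ε (u * L.s a) = L.ε (u * L.s a)
  rw [one_mul]

lemma dualComodToModFun_isStrictMonoidal (h : L.FGProj) :
    (dualComodToModFun h).IsStrictMonoidal (monRComod (L.dual h)) L.monLMod where
  unit := RComodStr.predualMod_unit h
  tensor c c' := c.predualMod_tensor c'

end DualComodules

/-! ## Contramodules over `U` and left modules over the dual -/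

section ContramodulesModules

open LeftBialgebroid

variable {A U : Type u} [Ring A] [Ring U] {L : LeftBialgebroid A U} {M N : Bim A}
  {n : ℕ} {e : Fin n → U} {e' : Fin n → L.Dual}

lemma LeftBialgebroid.RHom.ext {f g : L.RHom M} (h : ∀ u, f.1 u = g.1 u) : f = g :=
  Subtype.ext (AddMonoidHom.ext h)

lemma LeftBialgebroid.RHom.ofDual_apply (m : M) (φ : L.Dual) (u : U) :
    (RHom.ofDual m φ).1 u = M.r (op (L.ev φ u)) m := rfl

lemma LeftBialgebroid.RHom.ofDual_add (m : M) (φ ψ : L.Dual) :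
    RHom.ofDual m (φ + ψ) = RHom.ofDual m φ + RHom.ofDual m ψ := by
  refine RHom.ext fun u => ?_
  change M.r (op (L.ev (φ + ψ) u)) m = M.r (op (L.ev φ u)) m + M.r (op (L.ev ψ u)) m
  rw [map_add, AddMonoidHom.add_apply, MulOpposite.op_add, M.r_add]

lemma LeftBialgebroid.RHom.add_ofDual (m m' : M) (φ : L.Dual) :
    RHom.ofDual (m + m') φ = RHom.ofDual m φ + RHom.ofDual m' φ :=
  RHom.ext fun u => map_add (M.r (op (L.ev φ u))) m m'

/-- The shift precomposes with left multiplication by s(a), which in the dual is left multiplication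
by the target element of a. Right linearity of a contraaction thus concerns the target only. -/
lemma LeftBialgebroid.RHom.shift_ofDual (a : A) (m : M) (φ : L.Dual) :
    RHom.shift a (RHom.ofDual m φ) = RHom.ofDual m (L.dualT (op a) * φ) :=
  RHom.ext fun u => congrArg (fun b => M.r (op b) m) (L.ev_t_mul (op a) φ u).symm

lemma LeftBialgebroid.RHom.postcomp_ofDual (f : M ⟶ N) (m : M) (φ : L.Dual) :
    RHom.postcomp f (RHom.ofDual m φ) = RHom.ofDual (f.add m) φ :=
  RHom.ext fun _ => f.map_r _ _

/-- `f = ∑ f(eᵢ) eⁱ(-)` -/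
lemma LeftBialgebroid.IsDualBasis.rhom_expand (he : L.IsDualBasis e e') (f : L.RHom M) :
    f = ∑ i, RHom.ofDual (f.1 (e i)) (e' i) := by
  refine RHom.ext fun u => ?_
  conv_lhs => rw [he u, map_sum]
  rw [AddSubgroup.val_finsetSum, AddMonoidHom.finsetSum_apply]
  exact Finset.sum_congr rfl fun i _ => RHom.map_t f _ _

/-- Additive maps on `Hom_{Aᵒᵖ}(U_◃, M)` agree if they agree on all `m φ(-)`. -/
lemma LeftBialgebroid.RHom.hom_eq (h : L.FGProj) {P : Type*} [AddCommGroup P] {g g' : L.RHom M →+ P}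
    (hg : ∀ m φ, g (RHom.ofDual m φ) = g' (RHom.ofDual m φ)) (f : L.RHom M) : g f = g' f := by
  obtain ⟨n, e, e', he⟩ := h.exists_basis
  rw [IsDualBasis.rhom_expand he f, map_sum, map_sum]
  exact Finset.sum_congr rfl fun i _ => hg _ _

/-- The left module over the dual given by a contramodule, `φ m = γ(m φ(-))`. -/
def ContraStr.dualMod (c : ContraStr L M) : LModStr L.dualRing M where
  act := RingHom.mk' ⟨⟨fun φ => AddMonoidHom.mk' (fun m => c.contra (RHom.ofDual m φ))
        (fun m m' => by rw [RHom.add_ofDual, map_add]), AddMonoidHom.ext c.contra_unit⟩,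
      fun φ ψ => AddMonoidHom.ext fun m => by
        -- Contra-associativity is used for g(u ⊗ v) = m⟨ψ, ⟨φ, u⟩v⟩. Then g ∘ Δ is m⟨φψ, -⟩, while
        -- the iterated side is γ(m⟨ψ, -⟩)⟨φ, -⟩ by right linearity of γ.
        have hg : ∀ a (ξ : Bim.tens L.leftBim L.leftBim),
            (AddMonoidHom.comp (RHom.ofDual m ψ).1 (L.contr L.leftBim φ))
              ((Bim.tens L.leftBim L.leftBim).r a ξ) =
            M.r a ((AddMonoidHom.comp (RHom.ofDual m ψ).1 (L.contr L.leftBim φ)) ξ) := fun a ξ =>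
          (congrArg (RHom.ofDual m ψ).1 (L.contr_r L.leftBim φ a ξ)).trans
            (RHom.map_t (RHom.ofDual m ψ) a _)
        refine (c.contra_assoc _ hg).symm.trans (congrArg c.contra (RHom.ext fun u => ?_))
        exact c.contra_r (L.ev φ u) (RHom.ofDual m ψ)⟩
    (fun φ ψ => AddMonoidHom.ext fun m => by
      change c.contra (RHom.ofDual m (φ + ψ)) = _
      rw [RHom.ofDual_add, map_add]; rfl)
  act_s a m := c.left_eq a m
  act_t a m := by
    obtain ⟨a⟩ := a
    -- The target element of a is a ε(-), and m (a ε(u)) = (m a) ε(u), so the unit axiom applies to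
    -- m a.
    refine Eq.trans (congrArg c.contra (RHom.ext fun u => ?_)) (c.contra_unit (M.r (op a) m))
    exact M.r_mul a (L.ε u) m

lemma ContraStr.dualMod_act (c : ContraStr L M) (φ : L.Dual) (m : M) :
    c.dualMod.act φ m = c.contra (RHom.ofDual m φ) := rfl

variable (L) in
/-- The functor from contramodules to left modules over the dual. -/
def contraToModFun : StrOn.Fun (Contra L) (LMod L.dualRing) where
  str c := c.dualMod
  mem {X Y c c' f} h φ m := by
    rw [c.dualMod_act, c'.dualMod_act, h, RHom.postcomp_ofDual]

/-- The contraaction `f ↦ ∑ eⁱ f(eᵢ)`. -/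
def LModStr.basisContra (s : LModStr L.dualRing M) (e : Fin n → U) (e' : Fin n → L.Dual) :
    L.RHom M →+ M :=
  AddMonoidHom.mk' (fun f => ∑ i, s.act (e' i) (f.1 (e i)))
    (fun f g => by
      rw [← Finset.sum_add_distrib]
      exact Finset.sum_congr rfl fun i _ => map_add (s.act (e' i)) _ _)

lemma LModStr.basisContra_apply (s : LModStr L.dualRing M) (f : L.RHom M) :
    s.basisContra e e' f = ∑ i, (s.act (e' i) : M →+ M) (f.1 (e i)) := rfl

/-- The sum is Σ eⁱ (m⟨φ, eᵢ⟩). Right scalars act through the target of the dual, so φ is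
reassembled from its expansion in the eⁱ. All contramodule axioms are verified through this formula.
-/
lemma LModStr.basisContra_ofDual (s : LModStr L.dualRing M) (he : L.IsDualBasis e e')
    (m : M) (φ : L.Dual) : s.basisContra e e' (RHom.ofDual m φ) = s.act φ m := by
  conv_rhs => rw [he.dual_expand φ, s.act_sum]
  rw [s.basisContra_apply]
  refine Finset.sum_congr rfl fun i _ => ?_
  rw [s.mul]
  exact congrArg (s.act (e' i)) (s.act_t (op (L.ev φ (e i))) m).symm

/-- Expand Δu in the first leg, then each g(eᵢ ⊗ -) in the dual basis. The coefficient of g(eᵢ ⊗ eⱼ)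
is eʲ evaluated at ⟨eⁱ, u₍₁₎⟩u₍₂₎, which is the value at u of the product eⁱeʲ. -/
lemma LeftBialgebroid.IsDualBasis.compΔ_expand (he : L.IsDualBasis e e')
    (g : Bim.tens L.leftBim L.leftBim →+ M)
    (hg : ∀ a ξ, g ((Bim.tens L.leftBim L.leftBim).r a ξ) = M.r a (g ξ)) :
    RHom.compΔ g hg = ∑ i, ∑ j, RHom.ofDual
      (g (Bim.t (M := L.leftBim) (N := L.leftBim) (e i) (e j))) (e' i * e' j) := by
  refine RHom.ext fun u => ?_
  rw [AddSubgroup.val_finsetSum, AddMonoidHom.finsetSum_apply]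
  refine (congrArg g (he.comul_expand u)).trans ((map_sum g _ _).trans ?_)
  refine Finset.sum_congr rfl fun i _ => ?_
  rw [AddSubgroup.val_finsetSum, AddMonoidHom.finsetSum_apply]
  have h1 := congrArg (fun f : L.RHom M => f.1 (L.conv (e' i) u))
    (he.rhom_expand (RHom.slice g hg (e i)))
  refine h1.trans ?_
  rw [AddSubgroup.val_finsetSum, AddMonoidHom.finsetSum_apply]
  rfl

/-- The contramodule given by a left module over the dual, for a dual basis. -/
def LModStr.basisContraStr (s : LModStr L.dualRing M) (h : L.FGProj) (he : L.IsDualBasis e e') :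
    ContraStr L M where
  contra := s.basisContra e e'
  -- Both sides are additive in f, so only f = m⟨φ, -⟩ has to be considered.
  contra_r a := RHom.hom_eq h
    (g := AddMonoidHom.mk' (fun f => s.basisContra e e' (RHom.shift a f))
      (fun f g => map_add (s.basisContra e e') (RHom.shift a f) (RHom.shift a g)))
    (g' := AddMonoidHom.comp (M.r (op a)) (s.basisContra e e')) (fun m φ => by
      change s.basisContra e e' (RHom.shift a (RHom.ofDual m φ)) =
        M.r (op a) (s.basisContra e e' (RHom.ofDual m φ))
      rw [RHom.shift_ofDual, s.basisContra_ofDual he, s.basisContra_ofDual he, s.mul]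
      exact s.act_t (op a) _)
  contra_assoc g hg := by
    -- Both sides are reduced to the double sum of (eⁱeʲ) g(eᵢ ⊗ eⱼ): one by iterating the
    -- contraaction, the other by expanding g ∘ Δ.
    rw [he.compΔ_expand g hg, map_sum, s.basisContra_apply]
    refine Finset.sum_congr rfl fun i _ => ?_
    rw [map_sum]
    refine (congrArg (s.act (e' i)) (s.basisContra_apply (e := e) (e' := e') _)).trans ?_
    refine (map_sum (s.act (e' i) : M →+ M) _ _).trans (Finset.sum_congr rfl fun j _ => ?_)
    rw [s.basisContra_ofDual he, s.mul]; rfl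
  contra_unit m := (s.basisContra_ofDual he m 1).trans (s.one m)
  left_eq a m := (s.basisContra_ofDual he m _).trans (s.act_s a m)

lemma LModStr.dualMod_basisContraStr (s : LModStr L.dualRing M) (h : L.FGProj)
    (he : L.IsDualBasis e e') : (s.basisContraStr h he).dualMod = s :=
  LModStr.ext_act fun φ m => s.basisContra_ofDual he m φ

/-- Compatibility with contraactions is an equality of additive maps on Hom(U_◃, M); on m⟨φ, -⟩ it
is linearity with respect to φ. -/
lemma contraToModFun_reflects (h : L.FGProj) {c : ContraStr L M} {c' : ContraStr L N} {f : M ⟶ N}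
    (hf : (LMod L.dualRing).IsHom c.dualMod c'.dualMod f) : (Contra L).IsHom c c' f :=
  RHom.hom_eq h (g := f.add.comp c.contra)
    (g' := AddMonoidHom.mk' (fun k => c'.contra (RHom.postcomp f k)) (fun k k' => by
      rw [← map_add]
      exact congrArg c'.contra (RHom.ext fun u => map_add f.add _ _)))
    (fun m φ => by
      change f.add (c.contra (RHom.ofDual m φ)) = c'.contra (RHom.postcomp f (RHom.ofDual m φ))
      rw [RHom.postcomp_ofDual]
      exact hf φ m)

lemma contraToModFun_isEquivalence (h : L.FGProj) : (contraToModFun L).functor.IsEquivalence := by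
  refine StrOn.Fun.isEquivalence _ (fun {X} s => ?_) (contraToModFun_reflects h)
  obtain ⟨n, e, e', he⟩ := h.exists_basis
  exact ⟨LModStr.basisContraStr s h he, LModStr.dualMod_basisContraStr s h he⟩

/-- A contraaction is determined by its values on the maps m⟨φ, -⟩, and those values are the action.
-/
lemma ContraStr.dualMod_injective (h : L.FGProj) {c c' : ContraStr L M}
    (hc : c.dualMod = c'.dualMod) : c = c' :=
  ContraStr.ext_contra (RHom.hom_eq h fun m φ =>
    congrArg (fun s : LModStr L.dualRing M => s.act φ m) hc)

end ContramodulesModules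

/-! ## Yetter-Drinfel'd modules -/

section YetterDrinfeld

open LeftBialgebroid

variable {A U : Type u} [Ring A] [Ring U] {L : LeftBialgebroid A U} {X M N : Bim A}
  {n : ℕ} {e : Fin n → U} {e' : Fin n → L.Dual}

lemma LComodStr.coact_expand (c : LComodStr L M) (he : L.IsDualBasis e e') (m : M) : c.coact m =
    ∑ i, Bim.t (M := L.leftBim) (e i) (c.dualMod.act (op (e' i)) m) :=
  he.tens_expand (c.coact m)

/-- In the opposite of the dual, right multiplication by φ puts φ in front of ψ, and a left factor φ
acts on the argument through `conv`. -/
lemma pair_mulLast (h : L.FGProj) (φ : L.Dual) (u : U) (ξ : Bim.tens X L.dualBim) :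
    L.pair X u ((L.dual h).mulLast X (op φ) ξ) = L.pair X (L.conv φ u) ξ := by
  induction ξ using Bim.t_induction with
  | h0 => simp only [map_zero]
  | ha x y hx hy => simp only [map_add, hx, hy]
  | ht x ψ => rfl

/-- The left side of the Yetter-Drinfel'd condition over the dual, paired with `u`, is the right side
of the condition over `U`, contracted with `φ`. -/
lemma pair_ydR (h : L.FGProj) (c : LComodStr L M) (c' : RComodStr (L.dual h) M) (φ : L.Dual) (u : U)
    (m : M) : L.pair M u (ydR c.dualMod c' m ((L.dual h).Δ (op φ))) =
      L.contr M φ (L.diagAct L.reg c'.predualMod u (c.coact m)) := by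
  obtain ⟨n, e, e', he⟩ := h.exists_basis
  -- With Δφ = Σ (eᵢ ⇀ φ) ⊗ eⁱ and m₍₋₁₎ ⊗ m₍₀₎ = Σ eᵢ ⊗ m eⁱ, both sides are sums over the same
  -- index in which m enters only through m eⁱ.
  rw [IsDualBasis.dual_comul_expand he h φ, c.coact_expand he, map_sum, map_sum, map_sum, map_sum]
  refine Finset.sum_congr rfl fun i _ => ?_
  refine (pair_mulLast h (L.harp (e i) φ) u _).trans ?_
  rw [diagAct_t]
  -- Both terms are now ⟨φ, u₍₁₎eᵢ⟩ u₍₂₎ (m eⁱ), the scalar acting once inside U through s and once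
  -- on the bimodule. This is checked for an arbitrary tensor in place of Δu.
  change c'.predualMod.act (L.contr L.leftBim (L.harp (e i) φ) (L.Δ u)) _ = _
  generalize L.Δ u = ξ
  generalize c.dualMod.act (op (e' i)) m = m'
  induction ξ using Bim.t_induction with
  | h0 =>
    rw [map_zero, map_zero, map_zero, map_zero]; rfl
  | ha x y hx hy =>
    rw [map_add, map_add, map_add, map_add, ← hx, ← hy]; rfl
  | ht x y =>
    change c'.predualMod.act (L.s (L.ev φ (x * e i)) * y) m' =
      M.l (L.ev φ (x * e i)) (c'.predualMod.act y m')
    rw [c'.predualMod.mul, c'.predualMod.act_s]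

/-- The right side of the Yetter-Drinfel'd condition over the dual, paired with `u`, is the left side
of the condition over `U`, contracted with `φ`. -/
lemma pair_diagAct (h : L.FGProj) (c : LComodStr L M) (c' : RComodStr (L.dual h) M) (φ : L.Dual)
    (u : U) (m : M) :
    L.pair M u ((L.dual h).diagAct c.dualMod (L.dual h).reg (op φ) (c'.coact m)) =
      L.contr M φ (ydL c'.predualMod c m (L.Δ u)) := by
  obtain ⟨n, e, e', he⟩ := h.exists_basis
  -- Both Δu and the coaction on m are expanded with the same dual basis, so the comparison is made
  -- for each element eⱼ m separately.
  rw [IsDualBasis.comul_expand he u, c'.coact_expand he, map_sum, map_sum]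
  refine Eq.trans ?_ (congrArg (L.contr M φ) (map_sum (ydL c'.predualMod c m) _ _)).symm
  rw [map_sum]
  refine Finset.sum_congr rfl fun j _ => ?_
  rw [ydL_t, contr_mulFst]
  generalize c'.predualMod.act (e j) m = m'
  -- The second leg of Δφ multiplies eʲ, and pairing that product with u evaluates it at `conv (e'
  -- j) u`. The resulting scalar is absorbed into the first leg, leaving the action of `conv (e' j)
  -- u` ⇀ φ.
  have h1 : ∀ ζ : Bim.tens L.dualBim L.dualBim,
      L.pair M u (c.dualMod.diag (L.dual h).reg m' (op (e' j)) ζ) =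
        c.dualMod.act (L.pairD (L.conv (e' j) u) ζ) m' := fun ζ => by
    induction ζ using Bim.t_induction with
    | h0 =>
      rw [map_zero, map_zero, map_zero]
      exact (congrArg (fun k : AddMonoid.End M => k m') (map_zero c.dualMod.act)).symm
    | ha x y hx hy =>
      rw [map_add, map_add, map_add, hx, hy]
      exact (c.dualMod.add _ _ m').symm
    | ht ψ χ =>
      change M.r (op (L.ev χ.unop (L.conv (e' j) u))) (c.dualMod.act ψ m') =
        c.dualMod.act (L.dualRing.opp.t (op (L.ev χ.unop (L.conv (e' j) u))) * ψ) m'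
      rw [c.dualMod.mul, c.dualMod.act_t]
  refine (h1 _).trans ?_
  exact congrArg (fun ψ => c.dualMod.act ψ m') (L.pair_comul h φ (L.conv (e' j) u))

/-- The two conditions are transposes of each other with their sides exchanged. Each is equivalent
to the same family of identities in M, indexed by pairs (φ, u), because contractions separate U_◃ ⊗
M and pairings separate M ⊗ U*. -/
lemma yd_iff (h : L.FGProj) (c : LComodStr L M) (c' : RComodStr (L.dual h) M) :
    (∀ φ m, ydR c.dualMod c' m ((L.dual h).Δ φ) =
      (L.dual h).diagAct c.dualMod (L.dual h).reg φ (c'.coact m)) ↔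
    ∀ u m, ydL c'.predualMod c m (L.Δ u) = L.diagAct L.reg c'.predualMod u (c.coact m) := by
  obtain ⟨n, e, e', he⟩ := h.exists_basis
  constructor
  · intro H u m
    refine IsDualBasis.contr_ext he fun φ => ?_
    rw [← pair_diagAct h, ← pair_ydR h]
    exact congrArg (L.pair M u) (H (op φ) m).symm
  · intro H φ m
    obtain ⟨φ, rfl⟩ := op_surjective (α := L.Dual) φ
    refine L.pair_ext h fun u => ?_
    refine (pair_ydR h c c' φ u m).trans (Eq.trans ?_ (pair_diagAct h c c' φ u m).symm)
    rw [H]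

/-! ### Inverse correspondences and the category of Yetter–Drinfel'd modules -/

lemma LComodStr.exists_dualMod_eq (h : L.FGProj) (s : LModStr L.dualRing.opp M) :
    ∃ c : LComodStr L M, c.dualMod = s := by
  obtain ⟨n, e, e', he⟩ := h.exists_basis
  exact ⟨s.basisComod he, s.dualMod_basisComod he⟩

lemma RComodStr.exists_predualMod_eq (h : L.FGProj) (s : LModStr L.toAeRing M) :
    ∃ c : RComodStr (L.dual h) M, c.predualMod = s := by
  obtain ⟨n, e, e', he⟩ := h.exists_basis
  exact ⟨s.basisDualComod h he, s.predualMod_basisDualComod h he⟩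

lemma ContraStr.exists_dualMod_eq (h : L.FGProj) (s : LModStr L.dualRing M) :
    ∃ c : ContraStr L M, c.dualMod = s := by
  obtain ⟨n, e, e', he⟩ := h.exists_basis
  exact ⟨s.basisContraStr h he, s.dualMod_basisContraStr h he⟩

/-- The left comodule that corresponds to a right module over the dual. -/
noncomputable def LModStr.predualComod (h : L.FGProj) (s : LModStr L.dualRing.opp M) :
    LComodStr L M := (LComodStr.exists_dualMod_eq h s).choose

lemma LModStr.dualMod_predualComod (h : L.FGProj) (s : LModStr L.dualRing.opp M) :
    (s.predualComod h).dualMod = s := (LComodStr.exists_dualMod_eq h s).choose_spec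

/-- The inverse is a chosen preimage, but injectivity of `dualMod` leaves only one candidate. -/
lemma LComodStr.predualComod_dualMod (h : L.FGProj) (c : LComodStr L M) :
    c.dualMod.predualComod h = c := LComodStr.dualMod_injective h (LModStr.dualMod_predualComod h _)

lemma LYDStr.ext' {p q : LYDStr L M} (h1 : p.mod = q.mod) (h2 : p.comod = q.comod) : p = q := by
  cases p; cases q; cases h1; cases h2; rfl

/-- The Yetter-Drinfel'd module over `U` given by one over the dual. -/
noncomputable def RYDStr.predual {h : L.FGProj} (p : RYDStr (L.dual h) M) : LYDStr L M where
  mod := p.comod.predualMod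
  comod := p.mod.predualComod h
  yd := (yd_iff h (p.mod.predualComod h) p.comod).1 (by
    rw [LModStr.dualMod_predualComod]; exact p.yd)

/-- The functor from Yetter-Drinfel'd modules over the dual to those over `U`. -/
noncomputable def ydFun (h : L.FGProj) : StrOn.Fun (RYD (L.dual h)) (LYD L) where
  str p := p.predual
  mem {X Y p q f} hf := ⟨(dualComodToModFun h).mem hf.2, comodToModFun_reflects h (by
    have := hf.1
    rwa [← LModStr.dualMod_predualComod h p.mod, ← LModStr.dualMod_predualComod h q.mod] at this)⟩

lemma ydFun_isEquivalence (h : L.FGProj) : (ydFun h).functor.IsEquivalence := by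
  refine StrOn.Fun.isEquivalence _ (fun {X} q => ?_) (fun {X Y p q f} hf => ⟨?_, ?_⟩)
  -- The preimage keeps the underlying bimodule: its action comes from the coaction of q, its
  -- coaction from the action of q, and `yd_iff` transports the compatibility.
  · obtain ⟨c', hc'⟩ := RComodStr.exists_predualMod_eq h q.mod
    refine ⟨⟨q.comod.dualMod, c', (yd_iff h q.comod c').2 ?_⟩, LYDStr.ext' hc' ?_⟩
    · rw [hc']; exact q.yd
    · exact LComodStr.predualComod_dualMod h q.comod
  · have h1 := (comodToModFun L).mem hf.2
    change (RMod L.dualRing).IsHom (p.mod.predualComod h).dualMod (q.mod.predualComod h).dualMod f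
      at h1
    rwa [LModStr.dualMod_predualComod, LModStr.dualMod_predualComod] at h1
  · exact dualComodToModFun_reflects h hf.1

/-- The coactions over U are only characterized by the modules over the dual they induce, so they
are compared there, where the tensor product and unit are already known to agree. -/
lemma ydFun_isStrictMonoidal (h : L.FGProj) :
    (ydFun h).IsStrictMonoidal (monRYD (L.dual h)) (monLYD L) where
  unit := LYDStr.ext' (RComodStr.predualMod_unit h) (LComodStr.dualMod_injective h
    ((LModStr.dualMod_predualComod h _).trans (LComodStr.dualMod_unit h).symm))
  tensor p q := LYDStr.ext' (p.comod.predualMod_tensor q.comod) (LComodStr.dualMod_injective h (by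
    refine (LModStr.dualMod_predualComod h _).trans (Eq.trans ?_
      (LComodStr.dualMod_tensor h (p.mod.predualComod h) (q.mod.predualComod h)).symm)
    rw [LModStr.dualMod_predualComod, LModStr.dualMod_predualComod]; rfl))

/-- Both braidings send m ⊗ n to Σ eᵢ n ⊗ m eⁱ: over the dual by expanding the coaction of n, over U
by expanding that of m. -/
lemma ydFun_braid (h : L.FGProj) (X Y : (RYD (L.dual h)).Obj) :
    (braidRYD X Y).base = (braidLYD ((ydFun h).functor.obj X) ((ydFun h).functor.obj Y)).base := by
  obtain ⟨n, e, e', he⟩ := h.exists_basis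
  refine Bim.tens_ext fun m n => ?_
  change RYDStr.ev X.str.mod Y.base m (Y.str.comod.coact n) =
    LYDStr.ev Y.str.comod.predualMod X.base n ((X.str.mod.predualComod h).coact m)
  rw [LComodStr.coact_expand _ he, LModStr.dualMod_predualComod, RComodStr.coact_expand _ he]
  refine (map_sum (RYDStr.ev X.str.mod Y.base m) _ _).trans
    (Eq.trans ?_ (map_sum (LYDStr.ev Y.str.comod.predualMod X.base n) _ _).symm)
  rfl

end YetterDrinfeld

/-! ## The dual of a left Hopf algebroid -/

section DualHopf

open LeftBialgebroid

variable {A U : Type u} [Ring A] [Ring U] {L : LeftBialgebroid A U} {X M N : Bim A}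
  {n : ℕ} {e : Fin n → U} {e' : Fin n → L.Dual}

namespace LeftBialgebroid

lemma contr_mul_t (a : A) (φ : L.Dual) (ξ : Bim.tens L.leftBim X) :
    L.contr X (φ * L.dualT (op a)) ξ = X.l a (L.contr X φ ξ) := by
  induction ξ using Bim.t_induction with
  | h0 => simp only [map_zero]
  | ha x y hx hy => simp only [map_add, hx, hy]
  | ht u x => rw [contr_t, L.ev_mul_t, contr_t, X.l_mul]; rfl

lemma contr_mulLast (φ : L.Dual) (v : U) (ξ : Bim.tens L.leftBim L.leftBim) :
    L.contr L.leftBim φ (L.mulLast L.leftBim v ξ) = (L.contr L.leftBim φ ξ : U) * v := by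
  induction ξ using Bim.t_induction with
  | h0 => simp only [map_zero]; exact (zero_mul v).symm
  | ha x y hx hy => simp only [map_add, hx, hy]; exact (add_mul _ _ v).symm
  | ht x y => exact (mul_assoc (L.s (L.ev φ x)) y v).symm

/-- Right A-linearity of functionals, seen through the pairing; it is what makes the pairing with
the domain of the Hopf–Galois map of U well defined. -/
lemma pair_t_mul (a : A) (v : U) (y : Bim.tens X L.dualBim) :
    L.pair X (L.t (op a) * v) y = X.r (op a) (L.pair X v y) := by
  induction y using Bim.t_induction with
  | h0 => simp only [map_zero]
  | ha x y hx hy => simp only [map_add, hx, hy]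
  | ht x ψ => rw [pair_t, L.ev_t, pair_t, X.r_mul]

lemma pairD_mulFst (h : L.FGProj) (v : U) (z : L.Dualᵐᵒᵖ) (y : Bim.tens L.dualBim L.dualBim) :
    L.pairD v ((L.dual h).mulFst L.dualBim z y) = L.pairD v y * z := by
  induction y using Bim.t_induction with
  | h0 => simp only [map_zero, zero_mul]
  | ha x y hx hy => simp only [map_add, hx, hy, add_mul]
  | ht ψ χ => exact (mul_assoc (L.dualRing.opp.t (op (L.ev χ.unop v))) ψ z).symm

/-! ### The Hopf–Galois domain of the dual as functionals on U ⊗ U -/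

/-- The pairing of `φ' ⊗ φ` in the domain of the Hopf-Galois map of the dual with
`u ⊗ v` in `U_◃ ⊗_A ▹U`, with value `φ(s(φ'(u)) v)`. -/
noncomputable def coHopfPair (h : L.FGProj) :
    (L.dual h).CoHopfDom →+ (Bim.tens L.leftBim L.leftBim →+ A) :=
  Bal.lift (biHom (M := L.Dualᵐᵒᵖ) (N := L.Dualᵐᵒᵖ)
      (fun φ' φ => (L.ev φ.unop).comp (L.contr L.leftBim φ'.unop))
      (fun φ' φ ψ => by ext ξ; rfl)
      (fun φ' ψ' φ => by
        ext ξ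
        change L.ev φ.unop (L.contr L.leftBim (φ'.unop + ψ'.unop) ξ) =
          L.ev φ.unop (L.contr L.leftBim φ'.unop ξ) + L.ev φ.unop (L.contr L.leftBim ψ'.unop ξ)
        rw [contr_add]; exact map_add (L.ev φ.unop) _ _))
    (fun a φ' φ => by
      ext ξ
      change L.ev φ.unop (L.contr L.leftBim (φ'.unop * L.dualT (op a)) ξ) =
        L.ev (L.dualT (op a) * φ.unop) (L.contr L.leftBim φ'.unop ξ)
      -- The element a crosses the balanced tensor as a target factor: on the right of φ' it
      -- multiplies values by a, on the left of φ it inserts s(a) in the argument. The two give the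
      -- same value of φ.
      rw [contr_mul_t]
      exact (L.ev_t_mul (op a) φ.unop _).symm)

lemma coHopfPair_tmul (h : L.FGProj) (φ' φ : L.Dualᵐᵒᵖ) (ξ : Bim.tens L.leftBim L.leftBim) :
    L.coHopfPair h (Bal.tmul φ' φ) ξ = L.ev φ.unop (L.contr L.leftBim φ'.unop ξ) := rfl

/-- Every functional obtained from the pairing is right A-linear; `exists_coHopfPair_eq` shows that
nothing else is required of a functional to arise in this way. -/
lemma coHopfPair_r (h : L.FGProj) (x : (L.dual h).CoHopfDom) (a : A)
    (ξ : Bim.tens L.leftBim L.leftBim) :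
    L.coHopfPair h x ((Bim.tens L.leftBim L.leftBim).r (op a) ξ) = L.coHopfPair h x ξ * a := by
  induction x using Bal.induction with
  | h0 => simp only [map_zero, AddMonoidHom.zero_apply, zero_mul]
  | ha x y hx hy => simp only [map_add, AddMonoidHom.add_apply, hx, hy, add_mul]
  | ht φ' φ =>
    rw [coHopfPair_tmul, coHopfPair_tmul, contr_r]
    exact L.ev_t φ.unop a _

/-- The element `g(u ⊗ -)` of the dual, for a right `A`-linear map `g` on `U_◃ ⊗_A ▹U`. -/
def sliceDual (g : Bim.tens L.leftBim L.leftBim →+ A)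
    (hg : ∀ a ξ, g ((Bim.tens L.leftBim L.leftBim).r (op a) ξ) = g ξ * a) (u : U) : L.Dual :=
  L.mkDual (g.comp (Bal.tmulHom u : U →+ Bim.tens L.leftBim L.leftBim))
    (fun a v => hg a (Bim.t (M := L.leftBim) (N := L.leftBim) u v))

/-- The element `φ(s(φ'(u)) -)` of the dual, for `φ' ⊗ φ` in the domain of the Hopf-Galois map of
the dual. -/
noncomputable def coHopfSlice (h : L.FGProj) (x : (L.dual h).CoHopfDom) (u : U) : L.Dual :=
  L.sliceDual (L.coHopfPair h x) (coHopfPair_r h x) u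

lemma coHopfSlice_add (h : L.FGProj) (x y : (L.dual h).CoHopfDom) (u : U) :
    L.coHopfSlice h (x + y) u = L.coHopfSlice h x u + L.coHopfSlice h y u :=
  dual_ext fun v => by
    change L.coHopfPair h (x + y) _ = L.coHopfPair h x _ + L.coHopfPair h y _
    rw [map_add]; rfl

lemma coHopfSlice_zero (h : L.FGProj) (u : U) : L.coHopfSlice h 0 u = 0 := by
  have := L.coHopfSlice_add h 0 0 u
  rwa [add_zero, left_eq_add] at this

lemma coHopfSlice_tmul (h : L.FGProj) (φ' φ : L.Dualᵐᵒᵖ) (u : U) :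
    L.coHopfSlice h (Bal.tmul φ' φ) u = L.dualT (op (L.ev φ'.unop u)) * φ.unop :=
  dual_ext fun v => (L.ev_t_mul (op (L.ev φ'.unop u)) φ.unop v).symm

/-- Expand φ' = Σ ⟨φ', eᵢ⟩ ▸ eⁱ and move the coefficients across the balanced tensor; what
accumulates in the second factor is the slice at eᵢ. -/
lemma IsDualBasis.coHopf_expand (he : L.IsDualBasis e e') (h : L.FGProj)
    (x : (L.dual h).CoHopfDom) :
    x = ∑ i, Bal.tmul (op (e' i)) (op (L.coHopfSlice h x (e i))) := by
  induction x using Bal.induction with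
  | h0 => simp only [coHopfSlice_zero, MulOpposite.op_zero, Bal.tmul_zero, Finset.sum_const_zero]
  | ha x y hx hy =>
    simp only [coHopfSlice_add, MulOpposite.op_add, Bal.tmul_add, Finset.sum_add_distrib, ← hx, ← hy]
  | ht φ' φ =>
    obtain ⟨φ', rfl⟩ := op_surjective (α := L.Dual) φ'
    refine (congrArg (Bal.tmul · φ) (L.dual_expand he φ')).trans ?_
    refine (Bal.sum_tmul _ _ _).trans (Finset.sum_congr rfl fun i _ => ?_)
    rw [coHopfSlice_tmul]
    exact Bal.bal (r := fun a : A => lm ((L.dual h).s a)) (l := fun a : A => rm ((L.dual h).s a))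
      (L.ev φ' (e i)) (op (e' i)) φ

/-- An element is rebuilt from its slices at the eᵢ, and the slices are values of the associated
functional. -/
lemma coHopfPair_injective (h : L.FGProj) : Function.Injective (L.coHopfPair h) := fun x y hxy => by
  obtain ⟨n, e, e', he⟩ := h.exists_basis
  rw [IsDualBasis.coHopf_expand he h x, IsDualBasis.coHopf_expand he h y]
  refine Finset.sum_congr rfl fun i _ => congrArg
    (fun φ : L.Dual => (Bal.tmul (op (e' i)) (op φ) : (L.dual h).CoHopfDom)) ?_
  exact dual_ext fun v => DFunLike.congr_fun hxy _

/-- The preimage is Σ eⁱ ⊗ g(eᵢ ⊗ -). Right linearity of g is needed for g(eᵢ ⊗ -) to lie in the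
dual, and expanding the argument along the dual basis recovers g. -/
lemma exists_coHopfPair_eq (h : L.FGProj) (g : Bim.tens L.leftBim L.leftBim →+ A)
    (hg : ∀ a ξ, g ((Bim.tens L.leftBim L.leftBim).r (op a) ξ) = g ξ * a) :
    ∃ x, L.coHopfPair h x = g := by
  obtain ⟨n, e, e', he⟩ := h.exists_basis
  refine ⟨∑ i, Bal.tmul (op (e' i)) (op (L.sliceDual g hg (e i))), AddMonoidHom.ext fun ξ => ?_⟩
  conv_rhs => rw [IsDualBasis.tens_expand he ξ, map_sum]
  rw [map_sum, AddMonoidHom.finsetSum_apply]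
  rfl

/-! ### The Hopf–Galois map of the dual as a transpose -/

/-- The pairing of `ψ ⊗ χ` in `U*_◂ ⊗_A ▸U*` with `u ⊗ v` in the domain of the Hopf-Galois map of
`U`, with value `ψ(u t(χ(v)))`. -/
def hopfPair (y : Bim.tens L.dualBim L.dualBim) : L.HopfDom →+ A :=
  Bal.lift (biHom (fun u v => L.ev (L.pairD v y).unop u)
      (fun u v v' => by
        have h1 : L.pairD (v + v') y = L.pairD v y + L.pairD v' y := L.pair_add L.dualBim v v' y
        rw [h1, MulOpposite.unop_add, map_add]; rfl)
      (fun u u' v => map_add _ _ _))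
    (fun a u v => by
      have h1 : L.pairD (L.t (op a) * v) y = L.dualBim.r (op a) (L.pairD v y) :=
        pair_t_mul a v y
      rw [biHom_apply, biHom_apply]
      change L.ev (L.pairD v y).unop (u * L.t (op a)) = L.ev (L.pairD (L.t (op a) * v) y).unop u
      rw [h1]
      exact (L.dualBim_r (op a) (L.pairD v y).unop u).symm)

lemma hopfPair_tmul (y : Bim.tens L.dualBim L.dualBim) (u v : U) :
    L.hopfPair y (Bal.tmul u v) = L.ev (L.pairD v y).unop u := rfl

/-- Together with `galois_hopfL` this makes the functional right A-linear once it is transported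
along the inverse of the Hopf–Galois map. -/
lemma hopfPair_hopfL (y : Bim.tens L.dualBim L.dualBim) (a : A) (ξ : L.HopfDom) :
    L.hopfPair y (L.hopfL (op a) ξ) = L.hopfPair y ξ * a := by
  induction ξ using Bal.induction with
  | h0 => simp only [map_zero, zero_mul]
  | ha x y hx hy => simp only [map_add, hx, hy, add_mul]
  | ht u v => exact L.ev_t _ a u

lemma hopfPair_add (y y' : Bim.tens L.dualBim L.dualBim) (ξ : L.HopfDom) :
    L.hopfPair (y + y') ξ = L.hopfPair y ξ + L.hopfPair y' ξ := by
  induction ξ using Bal.induction with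
  | h0 => simp only [map_zero, add_zero]
  | ha x y hx hy => simp only [map_add, hx, hy]; abel
  | ht u v => rw [hopfPair_tmul, map_add, MulOpposite.unop_add, map_add]; rfl

lemma hopfPair_zero (ξ : L.HopfDom) : L.hopfPair 0 ξ = 0 := by
  have := hopfPair_add (0 : Bim.tens L.dualBim L.dualBim) 0 ξ
  rwa [add_zero, left_eq_add] at this

/-- The Hopf-Galois map of the dual is the transpose of that of `U`. -/
lemma hopfPair_cogalois (h : L.FGProj) (x : (L.dual h).CoHopfDom) (ξ : L.HopfDom) :
    L.hopfPair ((L.dual h).cogalois x) ξ = L.coHopfPair h x (L.galois ξ) := by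
  induction x using Bal.induction with
  | h0 => rw [map_zero, map_zero, hopfPair_zero]; rfl
  | ha x y hx hy => rw [map_add, map_add, hopfPair_add, hx, hy]; rfl
  | ht φ' φ =>
    obtain ⟨φ, rfl⟩ := op_surjective (α := L.Dual) φ
    induction ξ using Bal.induction with
    | h0 => rw [map_zero, map_zero, map_zero]
    | ha x y hx hy => rw [map_add, map_add, map_add, hx, hy]
    | ht u v =>
      -- Pairing the second leg of φ'φ⁽¹⁾ ⊗ φ⁽²⁾ with v leaves φ'(v ⇀ φ). Evaluated at u this is
      -- φ(⟨φ', u₍₁₎⟩u₍₂₎v), which is the pairing of φ' ⊗ φ with u₍₁₎ ⊗ u₍₂₎v.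
      have h1 : L.pairD v ((L.dual h).cogalois (Bal.tmul φ' (op φ))) = op (L.harp v φ) * φ' := by
        rw [cogalois_tmul]
        exact (pairD_mulFst h v φ' _).trans (congrArg (· * φ') (L.pair_comul h φ v))
      rw [hopfPair_tmul, h1, coHopfPair_tmul, galois_tmul, contr_mulLast]
      rfl

end LeftBialgebroid

/-- The dual of a left Hopf algebroid is a right Hopf algebroid. -/
lemma LeftBialgebroid.IsLeftHopf.dual (hL : L.IsLeftHopf) (h : L.FGProj) :
    RightBialgebroid.IsRightHopf (L.dual h) := by
  -- Injectivity: every tensor in U ⊗ U is a value of the Hopf–Galois map of U, so the functionals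
  -- of x and y agree by transposition.
  refine ⟨fun x y hxy => coHopfPair_injective h (AddMonoidHom.ext fun ξ => ?_), fun y => ?_⟩
  · obtain ⟨ξ, rfl⟩ := hL.2 ξ
    rw [← hopfPair_cogalois, ← hopfPair_cogalois, hxy]
  · set β := AddEquiv.ofBijective L.galois hL
    -- Surjectivity: the functional of y, transported along the inverse of the Hopf–Galois map of U,
    -- is right A-linear and therefore comes from some x.
    obtain ⟨x, hx⟩ := exists_coHopfPair_eq h ((L.hopfPair y).comp β.symm.toAddMonoidHom)
      (fun a ξ => by
        obtain ⟨ξ, rfl⟩ := β.surjective ξ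
        have h1 : (Bim.tens L.leftBim L.leftBim).r (op a) (β ξ) = β (L.hopfL (op a) ξ) :=
          (L.galois_hopfL (op a) ξ).symm
        rw [h1]
        change L.hopfPair y (β.symm (β _)) = L.hopfPair y (β.symm (β _)) * a
        rw [β.symm_apply_apply, β.symm_apply_apply, hopfPair_hopfL])
    -- Equality with y is tested by pairing the second leg with v and evaluating the first at u,
    -- that is, by the functional on u ⊗ v.
    refine ⟨x, L.pair_ext h fun v => unop_injective (dual_ext fun u => ?_)⟩
    refine (hopfPair_cogalois h x (Bal.tmul u v)).trans ?_
    rw [hx]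
    exact congrArg (L.hopfPair y) (β.symm_apply_apply (Bal.tmul u v))

end DualHopf

/-! ## Anti Yetter-Drinfel'd modules and contramodules -/

section AntiYetterDrinfeld

open LeftBialgebroid

variable {A U : Type u} [Ring A] [Ring U] {L : LeftBialgebroid A U} {M N : Bim A}
  {n : ℕ} {e : Fin n → U} {e' : Fin n → L.Dual}

namespace LeftBialgebroid

variable (L) in
/-- `u ⊗ v ↦ s(a) u ⊗ v` -/
def hopfS (a : A) : L.HopfDom →+ L.HopfDom :=
  Bal.map (lm (L.s a)) (AddMonoidHom.id U) (fun _ x => (mul_assoc (L.s a) x _).symm)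
    (fun _ _ => rfl)

variable (L) in
/-- `u ⊗ v ↦ u ⊗ v w` -/
def hopfMul (w : U) : L.HopfDom →+ L.HopfDom :=
  Bal.map (AddMonoidHom.id U) (rm w) (fun _ _ => rfl) (fun _ x => mul_assoc _ x w)

lemma galois_hopfS (a : A) (ξ : L.HopfDom) :
    L.galois (L.hopfS a ξ) = (Bim.tens L.leftBim L.leftBim).l a (L.galois ξ) := by
  induction ξ using Bal.induction with
  | h0 => simp only [map_zero]
  | ha x y hx hy => simp only [map_add, hx, hy]
  | ht x y =>
    change L.galois (Bal.tmul (L.s a * x) y) = _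
    rw [galois_tmul, galois_tmul, L.Δ_s, L.mulLast_l]

lemma galois_hopfMul (w : U) (ξ : L.HopfDom) :
    L.galois (L.hopfMul w ξ) = L.mulLast L.leftBim w (L.galois ξ) := by
  induction ξ using Bal.induction with
  | h0 => simp only [map_zero]
  | ha x y hx hy => simp only [map_add, hx, hy]
  | ht x y =>
    change L.galois (Bal.tmul x (y * w)) = _
    rw [galois_tmul, galois_tmul, L.mulLast_mul]

/-- `(s(a) u)₊ ⊗ (s(a) u)₋ = s(a) u₊ ⊗ u₋` -/
lemma IsLeftHopf.trans_s (hL : L.IsLeftHopf) (a : A) (u : U) :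
    hL.trans (L.s a * u) = L.hopfS a (hL.trans u) := by
  refine hL.1 ?_
  rw [galois_hopfS, hL.galois_trans, hL.galois_trans]; rfl

variable (hL : L.IsLeftHopf)

namespace RHom

/-- The map `a f(-)`. -/
def lsmul (a : A) (f : L.RHom M) : L.RHom M :=
  ⟨(M.l a : M →+ M).comp f.1, fun b u => (congrArg (M.l a) (map_t f b u)).trans (M.comm a b _)⟩

/-- The translation map carries a left factor s(a) onto y₊, which acts last, and s(a) acts as the
left scalar a. -/
lemma act_s_mul (s : LModStr L.toAeRing M) (a : A) (y : U) (f : L.RHom M) :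
    RHom.act hL s (L.s a * y) f = lsmul a (RHom.act hL s y f) := by
  refine RHom.ext fun w => ?_
  change RHom.conj s f w (hL.trans (L.s a * y)) = M.l a (RHom.conj s f w (hL.trans y))
  rw [hL.trans_s]
  generalize hL.trans y = ξ
  induction ξ using Bal.induction with
  | h0 => simp only [map_zero]
  | ha x y hx hy => simp only [map_add, hx, hy]
  | ht x y =>
    change s.act (L.s a * x) (f.1 (y * w)) = M.l a (s.act x (f.1 (y * w)))
    rw [s.mul, s.act_s]

lemma adj_tmul (s : LModStr L.toAeRing M) (f : L.RHom M) (x y : U) :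
    RHom.adj hL s f (x ⊗ₜ y) = RHom.rshift x (RHom.act hL s y f) := rfl

/-- `f ↦ (y ⇀ f)(- x)` as an additive map -/
lemma adj_add (s : LModStr L.toAeRing M) (f g : L.RHom M) (z : U ⊗[ℤ] U) :
    RHom.adj hL s (f + g) z = RHom.adj hL s f z + RHom.adj hL s g z := by
  induction z with
  | zero => simp only [map_zero, add_zero]
  | add x y hx hy => simp only [map_add, hx, hy]; abel
  | tmul x y =>
    refine RHom.ext fun w => ?_
    change RHom.conj s (f + g) (w * x) (hL.trans y) =
      RHom.conj s f (w * x) (hL.trans y) + RHom.conj s g (w * x) (hL.trans y)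
    generalize hL.trans y = ξ
    induction ξ using Bal.induction with
    | h0 => simp only [map_zero, add_zero]
    | ha x y hx hy => simp only [map_add, hx, hy]; abel
    | ht x y => exact map_add (s.act x) _ _

end RHom

/-- Over a contramodule, `γ(f(- t(a))) = γ(a f(-))`. -/
lemma contra_rshift_t (h : L.FGProj) (c : ContraStr L M) (a : A) (f : L.RHom M) :
    c.contra (RHom.rshift (L.t (op a)) f) = c.contra (RHom.lsmul a f) := by
  refine RHom.hom_eq h (g := c.contra.comp (RHom.rshift (L.t (op a))))
    (g' := AddMonoidHom.mk' (fun f => c.contra (RHom.lsmul a f)) (fun f g => by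
      rw [← map_add]
      exact congrArg c.contra (RHom.ext fun u => map_add (M.l a) _ _))) (fun m φ => ?_) f
  -- For f = m⟨φ, -⟩, right translation by t(a) replaces φ by its product with the source element of
  -- a on the right, while a f(-) replaces m by a m. The source acts on M as the left scalar, so the
  -- two values of γ agree.
  have h1 : RHom.rshift (L.t (op a)) (RHom.ofDual m φ) = RHom.ofDual m (φ * L.dualS a) :=
    RHom.ext fun u => congrArg (fun b => M.r (op b) m) (L.ev_mul_s a φ u).symm
  have h2 : RHom.lsmul a (RHom.ofDual m φ) = RHom.ofDual (M.l a m) φ :=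
    RHom.ext fun u => M.comm a _ m
  change c.contra (RHom.rshift (L.t (op a)) (RHom.ofDual m φ)) =
    c.contra (RHom.lsmul a (RHom.ofDual m φ))
  rw [h1, h2, ← c.dualMod_act, ← c.dualMod_act, c.dualMod.mul]
  exact congrArg (c.dualMod.act φ) (c.dualMod.act_s a m)

/-- The map `x ⊗ y ↦ γ((y ⇀ f)(- x))`. -/
noncomputable def contraAdj (h : L.FGProj) (s : LModStr L.toAeRing M) (c : ContraStr L M)
    (f : L.RHom M) : Bim.tens L.leftBim L.leftBim →+ M :=
  Bim.tlift (M := L.leftBim) (N := L.leftBim)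
    (biHom (M := U) (N := U) (fun x y => c.contra (RHom.adj hL s f (x ⊗ₜ y)))
      (fun x y y' => by rw [TensorProduct.tmul_add, map_add, map_add])
      (fun x x' y => by rw [TensorProduct.add_tmul, map_add, map_add]))
    (fun a x y => by
      change c.contra (RHom.adj hL s f ((L.t (op a) * x) ⊗ₜ y)) =
        c.contra (RHom.adj hL s f (x ⊗ₜ (L.s a * y)))
      -- Balancedness: s(a) on the second leg gives a left scalar on the map, t(a) on the first leg
      -- gives a right translation, and γ does not distinguish them.
      rw [RHom.adj_tmul, RHom.adj_tmul, RHom.act_s_mul]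
      refine Eq.trans (congrArg c.contra (RHom.ext fun w => ?_))
        (contra_rshift_t h c a (RHom.rshift x (RHom.act hL s y f)))
      change (RHom.act hL s y f).1 (w * (L.t (op a) * x)) =
        (RHom.act hL s y f).1 (w * L.t (op a) * x)
      rw [mul_assoc])

/-- The right side of the contramodule condition therefore depends only on Δu and not on the formal
tensor representing it, so the dual basis expansion of Δu may be inserted. -/
lemma contraAdj_mkL (h : L.FGProj) (s : LModStr L.toAeRing M) (c : ContraStr L M)
    (f : L.RHom M) (z : U ⊗[ℤ] U) :
    contraAdj hL h s c f (L.mkL z) = c.contra (RHom.adj hL s f z) := by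
  induction z with
  | zero => simp only [map_zero]
  | add x y hx hy => simp only [map_add, hx, hy]
  | tmul x y => rfl

variable {h : L.FGProj} (hV : RightBialgebroid.IsRightHopf (L.dual h))

/-! ### The functionals θ and the two translation maps -/

/-- The element `w ↦ ψ(y₊ t(φ(y₋ w)))` of the dual. -/
noncomputable def theta (ψ φ : L.Dualᵐᵒᵖ) (y : U) : L.Dual :=
  L.coHopfSlice h (hV.trans φ) (L.conv ψ.unop y)

/-- The definition of `theta` uses the translation map of the dual: its value at w is φ⁺(s(⟨φ⁻, ⟨ψ,
y₍₁₎⟩y₍₂₎⟩) w). The right side uses that of U instead. The transpose relation between the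
Hopf–Galois maps exchanges one for the other. -/
lemma ev_theta (ψ φ : L.Dualᵐᵒᵖ) (y w : U) :
    L.ev (theta hV ψ φ y) w =
      L.hopfPair (Bim.t (M := L.dualBim) (N := L.dualBim) ψ φ) (L.hopfMul w (hL.trans y)) := by
  -- The map multiplies the first factor by ψ. This multiplies the first leg of the Hopf–Galois
  -- image by ψ, and in the pairing it replaces y by ⟨ψ, y₍₁₎⟩y₍₂₎.
  let ρ : (L.dual h).CoHopfDom →+ (L.dual h).CoHopfDom :=
    Bal.map (rm ψ) (AddMonoidHom.id L.Dualᵐᵒᵖ) (fun a x => mul_assoc _ x ψ) (fun _ _ => rfl)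
  have h1 : ∀ x, (L.dual h).cogalois (ρ x) =
      (L.dual h).mulFst L.dualBim ψ ((L.dual h).cogalois x) := fun x => by
    induction x using Bal.induction with
    | h0 => simp only [map_zero]
    | ha x y hx hy => simp only [map_add, hx, hy]
    | ht φ' φ =>
      change (L.dual h).cogalois (Bal.tmul (φ' * ψ) φ) = _
      rw [cogalois_tmul, cogalois_tmul]
      exact (L.dual h).mulFst_mul L.dualBim φ' ψ _
  have h2 : ∀ x, L.coHopfPair h (ρ x) (Bim.t (M := L.leftBim) (N := L.leftBim) y w) =
      L.coHopfPair h x (Bim.t (M := L.leftBim) (N := L.leftBim) (L.conv ψ.unop y) w) := fun x => by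
    induction x using Bal.induction with
    | h0 => simp only [map_zero, AddMonoidHom.zero_apply]
    | ha x y hx hy => simp only [map_add, AddMonoidHom.add_apply, hx, hy]
    | ht φ' φ => rfl
  have h3 : L.galois (L.hopfMul w (hL.trans y)) =
      Bim.t (M := L.leftBim) (N := L.leftBim) y w := by
    rw [galois_hopfMul, hL.galois_trans]
    exact congrArg (Bim.t (M := L.leftBim) (N := L.leftBim) y) (one_mul w)
  refine (h2 (hV.trans φ)).symm.trans ?_
  -- As y ⊗ w is the Hopf–Galois image of y₊ ⊗ y₋w, transposition applies. The Hopf–Galois map of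
  -- the dual then cancels its translation map, leaving ψ ⊗ φ.
  rw [← h3, ← hopfPair_cogalois, h1, hV.cogalois_trans]
  exact congrArg (fun z => L.hopfPair (Bim.t (M := L.dualBim) (N := L.dualBim) z φ) _) (one_mul ψ)

include hL in
-- In the formula over U, the scalar a only multiplies the value from the left, and in the dual this
-- is right multiplication by the target element of a. It is the balancedness needed to let θ act on
-- tensors m ⊗ ψ.
lemma theta_l (a : A) (ψ φ : L.Dualᵐᵒᵖ) (y : U) :
    theta hV (L.dualBim.l a ψ) φ y = theta hV ψ φ y * L.dualT (op a) := by
  refine dual_ext fun w => ?_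
  rw [L.ev_mul_t, ev_theta hL, ev_theta hL]
  generalize L.hopfMul w (hL.trans y) = ξ
  induction ξ using Bal.induction with
  | h0 => simp only [map_zero, mul_zero]
  | ha x y hx hy => simp only [map_add, hx, hy, mul_add]
  | ht u v =>
    have h1 : L.pairD v (Bim.t (M := L.dualBim) (N := L.dualBim) (L.dualBim.l a ψ) φ) =
        L.dualBim.l a (L.pairD v (Bim.t (M := L.dualBim) (N := L.dualBim) ψ φ)) :=
      (L.dualBim.comm _ _ _).symm
    rw [hopfPair_tmul, h1, hopfPair_tmul]
    exact L.dualBim_l a _ u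

include hL in
lemma theta_add (ψ ψ' φ : L.Dualᵐᵒᵖ) (y : U) :
    theta hV (ψ + ψ') φ y = theta hV ψ φ y + theta hV ψ' φ y := by
  refine dual_ext fun w => ?_
  rw [map_add, AddMonoidHom.add_apply, ev_theta hL, ev_theta hL, ev_theta hL, ← hopfPair_add]
  exact congrArg (fun z => L.hopfPair z _) (Bim.add_t (M := L.dualBim) (N := L.dualBim) _ _ _)

lemma theta_add' (ψ φ φ' : L.Dualᵐᵒᵖ) (y : U) :
    theta hV ψ (φ + φ') y = theta hV ψ φ y + theta hV ψ φ' y := by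
  unfold theta
  rw [map_add, coHopfSlice_add]

/-- The map `m ⊗ ψ ↦ θ m`, where `θ` is `w ↦ ψ(y₊ t(φ(y₋ w)))`. -/
noncomputable def thetaAct (s : LModStr L.dualRing M) (φ : L.Dualᵐᵒᵖ) (y : U) :
    Bim.tens M L.dualBim →+ M :=
  Bim.tlift (N := L.dualBim) (biHom (N := L.Dualᵐᵒᵖ) (fun m ψ => s.act (theta hV ψ φ y) m)
      (fun m ψ ψ' => by rw [theta_add hL, s.add]) (fun m m' ψ => map_add _ _ _))
    (fun a m ψ => by
      -- The target element that a leaves on the right of θ acts on m as the right scalar a.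
      refine Eq.trans ?_ (congrArg (fun χ => s.act χ m) (theta_l hL hV a ψ φ y)).symm
      dsimp only
      rw [s.mul]
      exact congrArg (s.act (theta hV ψ φ y)) (s.act_t (op a) m).symm)

lemma thetaAct_add (s : LModStr L.dualRing M) (φ φ' : L.Dualᵐᵒᵖ) (y : U)
    (ξ : Bim.tens M L.dualBim) :
    thetaAct hL hV s (φ + φ') y ξ = thetaAct hL hV s φ y ξ + thetaAct hL hV s φ' y ξ := by
  induction ξ using Bim.t_induction with
  | h0 => simp only [map_zero, add_zero]
  | ha x y hx hy => simp only [map_add, hx, hy]; abel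
  | ht m ψ =>
    change s.act (theta hV ψ (φ + φ') y) m = s.act (theta hV ψ φ y) m + s.act (theta hV ψ φ' y) m
    rw [theta_add', s.add]

lemma thetaAct_zero (s : LModStr L.dualRing M) (y : U) (ξ : Bim.tens M L.dualBim) :
    thetaAct hL hV s 0 y ξ = 0 := by
  have := thetaAct_add hL hV s 0 0 y ξ
  rwa [add_zero, left_eq_add] at this

/-! ### Both right-hand sides as actions of θ -/

/-- In the product χψφ' paired with u, the left factors χ and ψ are moved onto the argument one
after the other. The scalar that remains after evaluating φ' acts on φm through the target, giving
the slice. -/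
lemma pair_conj (s : LModStr L.dualRing M) (m : M) (ψ χ : L.Dualᵐᵒᵖ) (u : U)
    (x : (L.dual h).CoHopfDom) :
    L.pair M u (RightBialgebroid.conj (R := L.dual h) s m ψ χ x) =
      s.act (L.coHopfSlice h x (L.conv ψ.unop (L.conv χ.unop u))) m := by
  induction x using Bal.induction with
  | h0 => rw [map_zero, map_zero, coHopfSlice_zero, map_zero]; rfl
  | ha x y hx hy => rw [map_add, map_add, hx, hy, coHopfSlice_add, s.add]
  | ht φ' φ =>
    rw [coHopfSlice_tmul, s.mul]
    exact (s.act_t _ _).symm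

/-- At the translation map of φ the slice from `pair_conj` is θ by definition. So the right side of
the module condition, paired with u, is an action of θ that sees ζ only through its class. -/
lemma pair_adj_tmul (s : LModStr L.dualRing M) (φ χ : L.Dualᵐᵒᵖ) (u : U) (ζ : M ⊗[ℤ] L.Dualᵐᵒᵖ) :
    L.pair M u (RightBialgebroid.adj hV s (φ ⊗ₜ χ) ζ) =
      thetaAct hL hV s φ (L.conv χ.unop u) (Bal.mk ζ : Bim.tens M L.dualBim) := by
  induction ζ with
  | zero =>
    simp only [map_zero]
    exact (map_zero (thetaAct hL hV s φ _)).symm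
  | add x y hx hy =>
    simp only [map_add, hx, hy]
    exact (map_add (thetaAct hL hV s φ _) _ _).symm
  | tmul m ψ =>
    refine (congrArg (L.pair M u) (RightBialgebroid.adj_tmul hV s φ χ ψ m)).trans ?_
    exact pair_conj s m ψ χ u (hV.trans φ)

variable {c : RComodStr (L.dual h) M} {c' : ContraStr L M}

/-- The map is w ↦ y₊(m⟨φ, y₋wx⟩). The scalar enters as t(⟨x ⇀ φ, y₋w⟩), and with m⁽⁰⁾ ⊗ m⁽¹⁾ = Σ eᵢ
m ⊗ eⁱ the map becomes Σ (eᵢ m)θᵢ(-), where θᵢ is built from eⁱ and x ⇀ φ. The contraaction then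
gives Σ θᵢ(eᵢ m), the same kind of expression as on the module side. -/
lemma contra_adj_ofDual (m : M) (φ : L.Dual) (x y : U) :
    c'.contra (RHom.adj hL c.predualMod (RHom.ofDual m φ) (x ⊗ₜ y)) =
      thetaAct hL hV c'.dualMod (op (L.harp x φ)) y (c.coact m) := by
  obtain ⟨n, e, e', he⟩ := h.exists_basis
  have h1 : RHom.adj hL c.predualMod (RHom.ofDual m φ) (x ⊗ₜ y) =
      ∑ i, RHom.ofDual (c.predualMod.act (e i) m) (theta hV (op (e' i)) (op (L.harp x φ)) y) := by
    refine RHom.ext fun w => ?_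
    rw [AddSubgroup.val_finsetSum, AddMonoidHom.finsetSum_apply]
    simp only [RHom.ofDual_apply, ev_theta hL]
    change RHom.conj c.predualMod (RHom.ofDual m φ) (w * x) (hL.trans y) = _
    generalize hL.trans y = ξ
    induction ξ using Bal.induction with
    | h0 =>
      simp only [map_zero, op_zero]
      refine (Finset.sum_eq_zero fun i _ => ?_).symm
      rfl
    | ha x y hx hy =>
      simp only [map_add, MulOpposite.op_add, hx, hy]
      rw [← Finset.sum_add_distrib]; rfl
    | ht u v =>
      -- The right scalar is absorbed as a factor t on the right of u. The action of the resulting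
      -- element is the pairing with the coaction of m, which is then expanded.
      change c.predualMod.act u (M.r (op (L.ev φ (v * (w * x)))) m) = _
      rw [← c.predualMod.act_t, ← c.predualMod.mul, c.predualMod_act, c.coact_expand he, map_sum]
      refine Finset.sum_congr rfl fun i _ => ?_
      refine congrArg (fun b => M.r (op b) _) ?_
      change _ = L.ev (L.dualBim.r (op (L.ev (L.harp x φ) (v * w))) (op (e' i)) : L.Dualᵐᵒᵖ).unop u
      rw [L.dualBim_r, L.ev_harp, mul_assoc]; rfl
  rw [h1, map_sum, c.coact_expand he, map_sum]
  rfl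

/-- The two sides of the compatibility conditions agree. -/
lemma pair_adj (u : U) (m : M) (φ : L.Dual) (z : L.Dualᵐᵒᵖ ⊗[ℤ] L.Dualᵐᵒᵖ)
    (ζ : M ⊗[ℤ] L.Dualᵐᵒᵖ) (z' : U ⊗[ℤ] U) (hz : L.mkD z = (L.dual h).Δ (op φ))
    (hζ : (Bal.mk ζ : Bim.tens M L.dualBim) = c.coact m) (hz' : L.mkL z' = L.Δ u) :
    L.pair M u (RightBialgebroid.adj hV c'.dualMod z ζ) =
      c'.contra (RHom.adj hL c.predualMod (RHom.ofDual m φ) z') := by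
  obtain ⟨n, e, e', he⟩ := h.exists_basis
  -- The pairing is rewritten with the coproduct of u expanded along the dual basis. Then z enters
  -- only through pairings of its second leg, which are known for a representative of Δφ.
  have h1 : ∀ z, L.pair M u (RightBialgebroid.adj hV c'.dualMod z ζ) =
      ∑ i, thetaAct hL hV c'.dualMod (L.pairD (e i) (L.mkD z)) (L.conv (e' i) u) (c.coact m) :=
    fun z => by
      induction z with
      | zero =>
        simp only [map_zero, thetaAct_zero, Finset.sum_const_zero, AddMonoidHom.zero_apply]
      | add x y hx hy =>
        simp only [map_add, thetaAct_add, Finset.sum_add_distrib, AddMonoidHom.add_apply, hx, hy]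
      | tmul φ χ =>
        rw [pair_adj_tmul hL, hζ]
        -- Writing φ as 1 ⇀ φ brings the term into the form x ⇀ φ with x = 1, so it becomes a value
        -- at 1 ⊗ y of a map defined on U_◃ ⊗ U.
        have h2 : φ = op (L.harp 1 φ.unop) :=
          unop_injective (dual_ext fun v => congrArg (L.ev φ.unop) (mul_one v).symm)
        conv_lhs => rw [h2]
        rw [← contra_adj_ofDual (c := c) (c' := c') hL hV, ← contraAdj_mkL hL h]
        -- Expanding ⟨χ, u₍₁₎⟩u₍₂₎ gives Σ s(⟨χ, eᵢ⟩)⟨eⁱ, u₍₁₎⟩u₍₂₎. The scalars cross to the first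
        -- leg as t(⟨χ, eᵢ⟩), and translating φ by t(a) is the right action of a on the dual.
        have h3 : (L.mkL (1 ⊗ₜ L.conv χ.unop u)) =
            ∑ i, L.mkL (L.t (op (L.ev χ.unop (e i))) ⊗ₜ L.conv (e' i) u) := by
          rw [conv_apply, IsDualBasis.comul_expand he, map_sum]
          refine (Bal.tmul_sum _ _ _).trans (Finset.sum_congr rfl fun i _ => ?_)
          refine (Bim.t_bal (M := L.leftBim) (N := L.leftBim) _ (1 : U) _).symm.trans ?_
          exact congrArg (Bim.t (M := L.leftBim) (N := L.leftBim) · (L.conv (e' i) u))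
            (mul_one (L.t (op (L.ev χ.unop (e i)))))
        rw [h3, map_sum]
        refine Finset.sum_congr rfl fun i _ => ?_
        rw [contraAdj_mkL, contra_adj_ofDual hL hV]
        refine congrArg (fun ψ => thetaAct hL hV c'.dualMod ψ (L.conv (e' i) u) (c.coact m)) ?_
        refine unop_injective (dual_ext fun v => ?_)
        exact (L.dualBim_r (op (L.ev χ.unop (e i))) φ.unop v).symm
  -- The expansion of Δu is now inserted on the contramodule side as well. The two sums agree term
  -- by term, since pairing the second leg of Δφ with eᵢ gives eᵢ ⇀ φ.
  rw [h1, ← contraAdj_mkL hL h, hz', IsDualBasis.comul_expand he, map_sum]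
  refine Finset.sum_congr rfl fun i _ => ?_
  refine Eq.trans ?_ (contra_adj_ofDual hL hV m φ (e i) (L.conv (e' i) u)).symm
  refine congrArg (fun ψ => thetaAct hL hV c'.dualMod ψ (L.conv (e' i) u) (c.coact m)) ?_
  exact (congrArg (L.pairD (e i)) hz).trans (L.pair_comul h φ (e i))

/-- For f = m⟨φ, -⟩ the left side of the contramodule condition is u(φ m), which is also the pairing
with u of the left side of the module condition; the right sides agree by `pair_adj`. Maps of this
form suffice by additivity, and pairings separate, so each condition is the same family of
identities in u, φ and m. -/
lemma isAYD_iff (c : RComodStr (L.dual h) M) (c' : ContraStr L M) :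
    IsAYD hV c'.dualMod c ↔ IsAYDContra hL c.predualMod c' := by
  constructor
  · intro H u f z' hz'
    refine RHom.hom_eq h (g := (c.predualMod.act u : M →+ M).comp c'.contra)
      (g' := AddMonoidHom.mk' (fun f => c'.contra (RHom.adj hL c.predualMod f z'))
        (fun f g => by rw [RHom.adj_add, map_add])) (fun m φ => ?_) f
    -- Each condition quantifies over all formal representatives, so to use the one for modules it
    -- is enough to pick some.
    obtain ⟨z, hz⟩ := Bal.mk_surjective ((L.dual h).Δ (op φ))
    obtain ⟨ζ, hζ⟩ := Bal.mk_surjective (c.coact m)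
    change L.pair M u (c.coact (c'.dualMod.act φ m)) = c'.contra _
    rw [← pair_adj hL hV u m φ z ζ z' hz hζ hz']
    exact congrArg (L.pair M u) (H φ m z ζ hz hζ)
  · intro H φ m z ζ hz hζ
    refine L.pair_ext h fun u => ?_
    obtain ⟨z', hz'⟩ := Bal.mk_surjective (L.Δ u)
    refine Eq.trans ?_ (pair_adj hL hV u m φ z ζ z' hz hζ hz').symm
    exact H u (RHom.ofDual m φ) z' hz'

/-- Expanding the coaction on one side and the orbit map on the other yields the same sum Σ eⁱ(eᵢ
m). -/
lemma evR_coact (c : RComodStr (L.dual h) M) (c' : ContraStr L M) (m : M) :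
    LModStr.evR (R := L.dual h) c'.dualMod (c.coact m) =
      c'.contra (RHom.orbit c.predualMod m) := by
  obtain ⟨n, e, e', he⟩ := h.exists_basis
  rw [IsDualBasis.rhom_expand he (RHom.orbit c.predualMod m), c.coact_expand he, map_sum,
    map_sum]
  rfl

end LeftBialgebroid

/-! ### Categories of anti Yetter–Drinfel'd objects and their stable objects -/

/-- The action of the dual for a contramodule is determined by the defining formula. -/
lemma ContraToMod.eq {c : ContraStr L M} {s : LModStr L.dualRing M} (hs : ContraToMod c s) :
    s = c.dualMod := LModStr.ext_act hs

lemma DualComodToMod.eq {h : L.FGProj} {c : RComodStr (L.dual h) M} {s : LModStr L.toAeRing M}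
    (hs : DualComodToMod c s) : s = c.predualMod := LModStr.ext_act hs

/-- The contramodule that corresponds to a left module over the dual. -/
noncomputable def LModStr.predualContra (h : L.FGProj) (s : LModStr L.dualRing M) :
    ContraStr L M := (ContraStr.exists_dualMod_eq h s).choose

lemma LModStr.dualMod_predualContra (h : L.FGProj) (s : LModStr L.dualRing M) :
    (s.predualContra h).dualMod = s := (ContraStr.exists_dualMod_eq h s).choose_spec

lemma AYDContraStr.ext' {hL : L.IsLeftHopf} {p q : AYDContraStr hL M} (h1 : p.mod = q.mod)
    (h2 : p.contramod = q.contramod) : p = q := by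
  cases p; cases q; cases h1; cases h2; rfl

variable {h : L.FGProj} (hL : L.IsLeftHopf) (hV : RightBialgebroid.IsRightHopf (L.dual h))

/-- The anti Yetter-Drinfel'd contramodule given by an anti Yetter-Drinfel'd module over the dual. -/
noncomputable def AYDStr.predual (p : AYDStr hV M) : AYDContraStr hL M where
  mod := p.comod.predualMod
  contramod := LModStr.predualContra h p.mod
  ayd := (isAYD_iff hL hV p.comod _).1
    -- The chosen contramodule induces the action of p only up to a propositional equality, along
    -- which the compatibility is transported.
    (Eq.mpr (congrArg (IsAYD hV · p.comod) (LModStr.dualMod_predualContra h p.mod)) p.ayd)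

/-- Passing to modules preserves and reflects morphisms, and the chosen contramodules return the
given modules. -/
lemma isHom_predualContra (h : L.FGProj) (s : LModStr L.dualRing M) (s' : LModStr L.dualRing N)
    (f : M ⟶ N) : (LMod L.dualRing).IsHom s s' f ↔
      (Contra L).IsHom (s.predualContra h) (s'.predualContra h) f := by
  refine Iff.trans ?_ ⟨contraToModFun_reflects h, (contraToModFun L).mem⟩
  rw [s.dualMod_predualContra, s'.dualMod_predualContra]

/-- The functor from anti Yetter-Drinfel'd modules over the dual to anti Yetter-Drinfel'd
contramodules. -/
noncomputable def aydFun : StrOn.Fun (AYD hV) (AYDContra hL) where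
  str p := p.predual hL hV
  mem hf := ⟨(dualComodToModFun h).mem hf.2, (isHom_predualContra h _ _ _).1 hf.1⟩

lemma aydFun_reflects {p : AYDStr hV M} {q : AYDStr hV N} {f : M ⟶ N}
    (hf : (AYDContra hL).IsHom (p.predual hL hV) (q.predual hL hV) f) : (AYD hV).IsHom p q f :=
  ⟨(isHom_predualContra h _ _ _).2 hf.2, dualComodToModFun_reflects h hf.1⟩

/-- The preimage takes its action from the contraaction of q and its coaction from the action of q.
Uniqueness of the contramodule inducing a given module shows that the chosen one is that of q. -/
lemma AYDStr.exists_predual_eq (q : AYDContraStr hL M) : ∃ p : AYDStr hV M, p.predual hL hV = q := by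
  obtain ⟨c, hc⟩ := RComodStr.exists_predualMod_eq h q.mod
  refine ⟨⟨q.contramod.dualMod, c, (isAYD_iff hL hV c q.contramod).2 ?_⟩, AYDContraStr.ext' hc ?_⟩
  · rw [hc]; exact q.ayd
  · exact ContraStr.dualMod_injective h (LModStr.dualMod_predualContra h _)

lemma aydFun_isEquivalence : (aydFun hL hV).functor.IsEquivalence :=
  StrOn.Fun.isEquivalence _ (AYDStr.exists_predual_eq hL hV) (aydFun_reflects hL hV)

lemma isStable_iff_of_dual (c : RComodStr (L.dual h) M) (c' : ContraStr L M) :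
    IsStable (R := L.dual h) c'.dualMod c ↔ IsStableContra c.predualMod c' :=
  forall_congr' fun m => Eq.congr_left (evR_coact c c' m)

lemma AYDStr.isStable_iff (p : AYDStr hV M) : IsStable (R := L.dual h) p.mod p.comod ↔
    IsStableContra (p.predual hL hV).mod (p.predual hL hV).contramod :=
  Iff.trans (iff_of_eq (congrArg (IsStable (R := L.dual h) · p.comod)
    (LModStr.dualMod_predualContra h p.mod).symm)) (isStable_iff_of_dual p.comod _)

/-- The functor from stable anti Yetter-Drinfel'd modules over the dual to stable anti
Yetter-Drinfel'd contramodules. -/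
noncomputable def saydFun : StrOn.Fun (SAYD hV) (SAYDContra hL) where
  str p := ⟨p.1.predual hL hV, (AYDStr.isStable_iff hL hV p.1).1 p.2⟩
  mem hf := (aydFun hL hV).mem hf

lemma saydFun_isEquivalence : (saydFun hL hV).functor.IsEquivalence := by
  -- Stable objects form full subcategories, so reflection of morphisms is inherited; only stability
  -- of the preimage has to be added.
  refine StrOn.Fun.isEquivalence _ (fun {X} q => ?_) (aydFun_reflects hL hV)
  obtain ⟨p, hp⟩ := AYDStr.exists_predual_eq hL hV q.1
  refine ⟨⟨p, (AYDStr.isStable_iff hL hV p).2 ?_⟩, Subtype.ext hp⟩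
  rw [hp]; exact q.2

end AntiYetterDrinfeld

/-! ### The main theorem -/

/-- Functors and equivalences between structures over a left bialgebroid `U` and over its right dual `U*`:
left comodules and right modules; right comodules and left modules; Yetter-Drinfel'd modules;
contramodules and left modules; (stable) anti Yetter-Drinfel'd modules and contramodules. All functors
are the identity on underlying bimodules and maps. -/
theorem lemma4p3 {A U : Type u} [Ring A] [Ring U] (L : LeftBialgebroid A U) :
    (∃ F : StrOn.Fun (LComod L) (RMod L.dualRing),
      (∀ (M : Bim A) (c : LComodStr L M), ComodToMod c (F.str c)) ∧
      ∀ h : L.FGProj, F.functor.IsEquivalence ∧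
        F.IsStrictMonoidal (monLComod L) (L.dual h).monLMod) ∧
    (∀ h : L.FGProj, ∃ F : StrOn.Fun (RComod (L.dual h)) (LMod L.toAeRing),
      (∀ (M : Bim A) (c : RComodStr (L.dual h) M), DualComodToMod c (F.str c)) ∧
      F.functor.IsEquivalence ∧ F.IsStrictMonoidal (monRComod (L.dual h)) L.monLMod) ∧
    (∀ h : L.FGProj, ∃ F : StrOn.Fun (RYD (L.dual h)) (LYD L),
      (∀ (M : Bim A) (p : RYDStr (L.dual h) M), DualComodToMod p.comod (F.str p).mod ∧
        ComodToMod (F.str p).comod p.mod) ∧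
      F.functor.IsEquivalence ∧ F.IsStrictMonoidal (monRYD (L.dual h)) (monLYD L) ∧
      ∀ X Y : (RYD (L.dual h)).Obj,
        (braidRYD X Y).base = (braidLYD (F.functor.obj X) (F.functor.obj Y)).base) ∧
    (∃ F : StrOn.Fun (Contra L) (LMod L.dualRing),
      (∀ (M : Bim A) (c : ContraStr L M), ContraToMod c (F.str c)) ∧
      (L.FGProj → F.functor.IsEquivalence)) ∧
    (∀ (hL : L.IsLeftHopf) (h : L.FGProj), ∃ hV : RightBialgebroid.IsRightHopf (L.dual h),
      (∀ (M : Bim A) (s : LModStr L.dualRing M) (c : RComodStr (L.dual h) M)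
        (s' : LModStr L.toAeRing M) (c' : ContraStr L M), DualComodToMod c s' → ContraToMod c' s →
        (IsAYD hV s c ↔ IsAYDContra hL s' c') ∧
        (IsStable (R := L.dual h) s c ↔ IsStableContra s' c')) ∧
      ∃ F : StrOn.Fun (AYD hV) (AYDContra hL),
        (∀ (M : Bim A) (p : AYDStr hV M), DualComodToMod p.comod (F.str p).mod ∧
          ContraToMod (F.str p).contramod p.mod) ∧
        F.functor.IsEquivalence ∧
        ∃ F' : StrOn.Fun (SAYD hV) (SAYDContra hL),
          (∀ (M : Bim A) (p : (SAYD hV).Str M), (F'.str p).1 = F.str p.1) ∧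
          F'.functor.IsEquivalence) := by
  refine ⟨⟨comodToModFun L, fun M c φ m => rfl, fun h =>
      ⟨comodToModFun_isEquivalence h, comodToModFun_isStrictMonoidal h⟩⟩,
    fun h => ⟨dualComodToModFun h, fun M c u m => rfl, dualComodToModFun_isEquivalence h,
      dualComodToModFun_isStrictMonoidal h⟩,
    fun h => ⟨ydFun h, fun M p => ⟨fun u m => rfl, fun φ m => ?_⟩, ydFun_isEquivalence h,
      ydFun_isStrictMonoidal h, ydFun_braid h⟩,
    ⟨contraToModFun L, fun M c φ m => rfl, contraToModFun_isEquivalence⟩,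
    fun hL h => ⟨hL.dual h, fun M s c s' c' hs' hs => ?_, aydFun hL (hL.dual h),
      fun M p => ⟨fun u m => rfl, fun φ m => ?_⟩, aydFun_isEquivalence hL _,
      saydFun hL (hL.dual h), fun M p => rfl, saydFun_isEquivalence hL _⟩⟩
  -- The coaction over U is a chosen preimage, so this correspondence follows from the property
  -- defining the choice and not by unfolding.
  · exact (congrArg (fun s : LModStr L.dualRing.opp M => s.act (op φ) m)
      (LModStr.dualMod_predualComod h p.mod)).symm
  -- The defining formulas force the given actions to be the ones induced by c' and c, to which the
  -- equivalences of conditions apply.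
  · rw [hs.eq, hs'.eq]
    exact ⟨LeftBialgebroid.isAYD_iff hL _ c c', isStable_iff_of_dual c c'⟩
  · exact (congrArg (fun s : LModStr L.dualRing M => s.act φ m)
      (LModStr.dualMod_predualContra h p.mod)).symm
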